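/- **Proposition.** Let $P\colon E\to B$ be a fibration of bicategories: a homomorphism (pseudofunctor) such that every $f\colon b\to Pe$ is $Ph$ for some cartesian 1-cell $h\colon a\to e$, every functor $E(x,y)\to B(Px,Py)$ is a Grothendieck fibration, and horizontal composites of cartesian 2-cells (arrows cartesian for these functors) are cartesian. Here a 1-cell $f\colon x\to y$ of $E$ is cartesian if * for all $g\colon z\to y$, $h\colon Pz\to Px$ and $\alpha\colon Pf\cdot h\cong Pg$ there are $\hat h\colon z\to x$, $\hat\alpha\colon f\hat h\cong g$ and $\hat\beta\colon P\hat h\cong h$ compatible with $\alpha$, and * for $\sigma\colon g\Rightarrow g'$ and such lifts $(\hat h,\hat\alpha,\hat\beta)$, $(\hat h',\hat\alpha',\hat\beta')$ of $(h,\alpha)$ and $(h',\alpha')$, every $\delta\colon h\Rightarrow h'$ with $\alpha'\cdot(Pf\,\delta)=P\sigma\cdot\alpha$ lifts to a unique $\hat\delta\colon\hat h\Rightarrow\hat h'$ with $\hat\alpha'\cdot(f\hat\delta)=\sigma\cdot\hat\alpha$ and $\delta\cdot\hat\beta=\hat\beta'\cdot P\hat\delta$. Cartesian lifts of 2-cells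 (at each 1-cell of $E$) and of 1-cells (at each object of $E$) can be chosen; fix any such choices. Write $E_b$ for the fibre over $b$ (objects, 1-cells and 2-cells of $E$ lying strictly over $b$, $1_b$, $1_{1_b}$), a bicategory whose composition is the domain of the chosen cartesian lift of the canonical $1_b\cong 1_b1_b$ at the composite in $E$. Write $c(f,e)\colon f^*e\to e$ for the chosen cartesian 1-cell over $f$. 1. There is a trihomomorphism $F_P\colon B^{\mathrm{coop}}\to\mathbf{Bicat}$, $b\mapsto E_b$, obtained by factoring through chosen cartesian cells. It sends $f$ to $f^*$, equal to the chosen lifts on objects and such that the $c(f,-)$ are pseudo-natural, and it sends $\alpha\colon f\Rightarrow g$ to $\alpha^*\colon g^*\Rightarrow f^*$, where the domain of the chosen lift of $\alpha$ at $c(g,e)$ is isomorphic to $c(f,e)\cdot\alpha^*_e$. Its comparisons $\chi\colon f^*g^*\to (gf)^*$ and $\iota\colon 1\to 1^*$ come with isomorphisms $c(gf,e)\cdot\chi_e\cong c(g,e)\cdot c(f,g^*e)$ and $c(1,e)\cdot\iota_e\cong 1_e$. All these 2-cells lie over the canonical isomorphisms of $B$ (and $\alpha$), are natural, and are compatible with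 the structural modifications of $F_P$. Let $F_P$ be any trihomomorphism obtained in this way. 2. Its Grothendieck construction $\mathrm{el}\,F_P$ is a bicategory. Its objects are pairs $(x,e_x)$ with $e_x\in E_x$. Its 1-cells $(x,e_x)\to(y,e_y)$ are pairs $(f,\hat f)$ with $f\colon x\to y$ in $B$ and $\hat f\colon e_x\to f^*e_y$ in $E_x$. Its 2-cells $(f,\hat f)\Rightarrow(g,\hat g)$ are pairs $(\alpha,\hat\alpha)$ with $\alpha\colon f\Rightarrow g$ in $B$ and $\hat\alpha\colon\hat f\Rightarrow\alpha^*_{e_y}\hat g$ in $E_x$. Composition uses the structure of $F_P$; for instance $(g,\hat g)(f,\hat f)=(gf,\ \chi\cdot f^*(\hat g)\cdot\hat f)$. The first projection $\pi\colon\mathrm{el}\,F_P\to B$ is a fibration. 3. Define $H\colon\mathrm{el}\,F_P\to E$ on objects by $H(x,e_x)=e_x$. On 1-cells, $H(f,\hat f)$ is the domain of the chosen cartesian lift $\hat r\colon H(f,\hat f)\cong c(f,e_y)\cdot\hat f$ of the canonical isomorphism $f\cong f1_x$. On 2-cells, $H(\alpha,\hat\alpha)$ is the composite, conjugated by the $\hat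 r$, of $c(f,e_y)\,\hat\alpha$ with $\bar\alpha\,\hat g$, where $\bar\alpha\colon c(f,e_y)\cdot\alpha^*_{e_y}\Rightarrow c(g,e_y)$ is the cell induced by the chosen lift of $\alpha$. Its coherence isomorphisms $H(1_{(x,e_x)})\cong 1$ and $H((g,\hat g)(f,\hat f))\cong H(g,\hat g)\,H(f,\hat f)$ are the composites of the $\hat r$ with $c(1,e)\cdot\iota_e\cong 1_e$, respectively with $c(gf,-)\cdot\chi\cong c(g,-)\cdot c(f,-)$ and the naturality of $c(f,-)$ at $\hat g$. Then $H$ is a homomorphism of bicategories and a cartesian biequivalence over $B$: $PH=\pi$, $H$ preserves cartesian 1-cells and cartesian 2-cells, it is surjective on objects up to equivalence, and it is an equivalence on each hom-category. So every fibration is biequivalent, over $B$, to the Grothendieck construction of its associated trihomomorphism. -/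

import Mathlib

open CategoryTheory Bicategory

universe w₁ v₁ u₁ w₂ v₂ u₂ w₃ v₃ u₃

namespace FibredBicat

noncomputable section

/-! ### Cartesian cells and fibrations -/

section Fibrations

variable {E : Type u₂} [Bicategory.{w₂, v₂} E] {B : Type u₁} [Bicategory.{w₁, v₁} B]

/-- A lift of `(h, α)` along the 1-cell `f`, where `α : Pf . h ≅ Pg`: a 1-cell `hom : z ⟶ x` with
isomorphisms `fac : f . hom ≅ g` and `base : P hom ≅ h` that are compatible with `α`. -/
structure Lift₁ (P : E ⥤ᵖ B) {x y z : E} (f : x ⟶ y) (g : z ⟶ y) (h : P.obj z ⟶ P.obj x)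
    (α : h ≫ P.map f ≅ P.map g) where
  hom : z ⟶ x
  fac : hom ≫ f ≅ g
  base : P.map hom ≅ h
  comm : base.hom ▷ P.map f ≫ α.hom = (P.mapComp hom f).inv ≫ P.map₂ fac.hom

/-- Cartesian 1-cells of a homomorphism of bicategories. -/
structure IsCartesian₁ (P : E ⥤ᵖ B) {x y : E} (f : x ⟶ y) : Prop where
  exists_lift : ∀ {z : E} (g : z ⟶ y) (h : P.obj z ⟶ P.obj x) (α : h ≫ P.map f ≅ P.map g),
    Nonempty (Lift₁ P f g h α)
  exists_unique : ∀ {z : E} {g g' : z ⟶ y} (σ : g ⟶ g') {h h' : P.obj z ⟶ P.obj x}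
    {α : h ≫ P.map f ≅ P.map g} {α' : h' ≫ P.map f ≅ P.map g'}
    (L : Lift₁ P f g h α) (L' : Lift₁ P f g' h' α') (δ : h ⟶ h'),
    δ ▷ P.map f ≫ α'.hom = α.hom ≫ P.map₂ σ →
    ∃! d : L.hom ⟶ L'.hom,
      d ▷ f ≫ L'.fac.hom = L.fac.hom ≫ σ ∧ L.base.hom ≫ δ = P.map₂ d ≫ L'.base.hom

/-- A 2-cell is cartesian when it is cartesian as an arrow for the functor
`E(x, y) ⥤ B(Px, Py)`. -/
def IsCartesian₂ (P : E ⥤ᵖ B) {x y : E} {f g : x ⟶ y} (α : f ⟶ g) : Prop :=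
  (P.mapFunctor x y).IsStronglyCartesian (P.map₂ α) α

/-- A 1-cell `x' ⟶ y'` regarded as a 1-cell `x ⟶ y` along equalities of objects. -/
def castHom {x x' y y' : B} (hx : x = x') (hy : y = y') (u : x' ⟶ y') : x ⟶ y := by
  subst hx; subst hy; exact u

/-- Fibrations of bicategories. -/
structure IsFibration (P : E ⥤ᵖ B) : Prop where
  exists_cartesian : ∀ (e : E) {b : B} (f : b ⟶ P.obj e),
    ∃ (a : E) (ha : P.obj a = b) (h : a ⟶ e), P.map h = castHom ha rfl f ∧ IsCartesian₁ P h
  locally_fibred : ∀ x y : E, (P.mapFunctor x y).IsFibered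
  hcomp_cartesian : ∀ {x y z : E} {f f' : x ⟶ y} {g g' : y ⟶ z} (α : f ⟶ f') (β : g ⟶ g'),
    IsCartesian₂ P α → IsCartesian₂ P β → IsCartesian₂ P (α ▷ g ≫ f' ◁ β)

/-- A cartesian homomorphism from `P` to `Q`: one that lies over the base and preserves cartesian
1-cells and 2-cells. -/
structure IsCartesianHom {D : Type u₃} [Bicategory.{w₃, v₃} D] (P : E ⥤ᵖ B) (Q : D ⥤ᵖ B)
    (H : E ⥤ᵖ D) : Prop where
  comp_eq : H.comp Q = P
  map_cartesian : ∀ {x y : E} (f : x ⟶ y), IsCartesian₁ P f → IsCartesian₁ Q (H.map f)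
  map₂_cartesian : ∀ {x y : E} {f g : x ⟶ y} (α : f ⟶ g),
    IsCartesian₂ P α → IsCartesian₂ Q (H.map₂ α)

/-- A biequivalence: a homomorphism that is surjective on objects up to equivalence and is an
equivalence on all hom-categories. -/
structure IsBiequivalence {D : Type u₃} [Bicategory.{w₃, v₃} D] (H : E ⥤ᵖ D) : Prop where
  surj : ∀ d : D, ∃ e : E, Nonempty (H.obj e ≌ d)
  local_equiv : ∀ x y : E, (H.mapFunctor x y).IsEquivalence

end Fibrations

/-! ### Choices of cartesian 2-cells, and the fibres -/

section Fibres

variable {E : Type u₂} [Bicategory.{w₂, v₂} E] {B : Type u₁} [Bicategory.{w₁, v₁} B]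

/-- A 2-cell between casts of 1-cells. -/
def castHom₂ {x x' y y' : B} (hx : x = x') (hy : y = y') {u v : x' ⟶ y'} (σ : u ⟶ v) :
    castHom hx hy u ⟶ castHom hx hy v := by
  subst hx; subst hy; exact σ

/-- An isomorphism with an identity 1-cell, seen over a cast of the identity. -/
def castId {x b : B} (hx : x = b) {f : x ⟶ x} (φ : f ≅ 𝟙 x) : f ≅ castHom hx hx (𝟙 b) := by
  subst hx; exact φ

/-- An isomorphism with a composite of casts, seen as one with the cast of the composite. -/
def castComp {x x' y y' z z' : B} (hx : x = x') (hy : y = y') (hz : z = z') {u : x' ⟶ y'}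
    {v : y' ⟶ z'} {f : x ⟶ z} (φ : f ≅ castHom hx hy u ≫ castHom hy hz v) :
    f ≅ castHom hx hz (u ≫ v) := by
  subst hx; subst hy; subst hz; exact φ

/-- A cartesian lift of `σ : w ⟶ P g` at `g`. -/
structure CartLift₂ (P : E ⥤ᵖ B) {x y : E} (g : x ⟶ y) {w : P.obj x ⟶ P.obj y}
    (σ : w ⟶ P.map g) where
  dom : x ⟶ y
  hom : dom ⟶ g
  cart : (P.mapFunctor x y).IsStronglyCartesian σ hom

theorem CartLift₂.domain_eq {P : E ⥤ᵖ B} {x y : E} {g : x ⟶ y} {w : P.obj x ⟶ P.obj y}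
    {σ : w ⟶ P.map g} (L : CartLift₂ P g σ) : P.map L.dom = w :=
  have := L.cart
  IsHomLift.domain_eq (P.mapFunctor x y) σ L.hom

theorem CartLift₂.map₂_eq {P : E ⥤ᵖ B} {x y : E} {g : x ⟶ y} {w : P.obj x ⟶ P.obj y}
    {σ : w ⟶ P.map g} (L : CartLift₂ P g σ) : P.map₂ L.hom = eqToHom L.domain_eq ≫ σ := by
  have := L.cart
  have h := IsHomLift.fac' (P.mapFunctor x y) σ L.hom
  have h' : P.map₂ L.hom = eqToHom L.domain_eq ≫ σ ≫ 𝟙 _ := h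
  rwa [Category.comp_id] at h'

theorem CartLift₂.isIso {P : E ⥤ᵖ B} {x y : E} {g : x ⟶ y} {w : P.obj x ⟶ P.obj y}
    {σ : w ⟶ P.map g} (L : CartLift₂ P g σ) (h : IsIso σ) : IsIso L.hom :=
  have := L.cart
  have : IsIso (C := P.obj x ⟶ P.obj y) (Y := (P.mapFunctor x y).obj g) σ := h
  Functor.IsStronglyCartesian.isIso_of_base_isIso (P.mapFunctor x y) σ L.hom

/-- A choice of cartesian lifts of 2-cells. -/
structure LocalCleavage (P : E ⥤ᵖ B) where
  lift : ∀ {x y : E} (g : x ⟶ y) {w : P.obj x ⟶ P.obj y} (σ : w ⟶ P.map g), CartLift₂ P g σ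

variable {P : E ⥤ᵖ B}

/-- Objects of the fibre over `b`. -/
@[ext]
structure Fibre (κ : LocalCleavage P) (b : B) where
  obj : E
  proj_eq : P.obj obj = b

variable {κ : LocalCleavage P}

/-- The 1-cell `u` of the base, seen between the images under `P` of objects of the fibres. -/
abbrev base₁ {b b' : B} (e : Fibre κ b) (e' : Fibre κ b') (u : b ⟶ b') :
    P.obj e.obj ⟶ P.obj e'.obj :=
  castHom e.proj_eq e'.proj_eq u

/-- The 2-cell `σ` of the base, seen between the images under `P` of objects of the fibres. -/
abbrev base₂ {b b' : B} (e : Fibre κ b) (e' : Fibre κ b') {u v : b ⟶ b'} (σ : u ⟶ v) :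
    base₁ e e' u ⟶ base₁ e e' v :=
  castHom₂ e.proj_eq e'.proj_eq σ

@[simp] theorem base₂_id {b b' : B} (e : Fibre κ b) (e' : Fibre κ b') (u : b ⟶ b') :
    base₂ e e' (𝟙 u) = 𝟙 _ := by
  obtain ⟨e, rfl⟩ := e; obtain ⟨e', rfl⟩ := e'; rfl

theorem base₂_comp {b b' : B} (e : Fibre κ b) (e' : Fibre κ b') {u v w : b ⟶ b'}
    (σ : u ⟶ v) (τ : v ⟶ w) : base₂ e e' (σ ≫ τ) = base₂ e e' σ ≫ base₂ e e' τ := by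
  obtain ⟨e, rfl⟩ := e; obtain ⟨e', rfl⟩ := e'; rfl

section

variable {x y z t : E} {f f' : x ⟶ y} {g g' : y ⟶ z} {h : z ⟶ t} {u u' : P.obj x ⟶ P.obj y}
  {v v' : P.obj y ⟶ P.obj z} {w : P.obj z ⟶ P.obj t}

/-- The composite of isomorphisms `Pf ≅ u` and `Pg ≅ v`. -/
def compIso (φ : P.map f ≅ u) (ψ : P.map g ≅ v) : P.map (f ≫ g) ≅ u ≫ v :=
  P.mapComp f g ≪≫ whiskerRightIso φ _ ≪≫ whiskerLeftIso _ ψ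

theorem compIso_whiskerLeft (φ : P.map f ≅ u) (ψ : P.map g ≅ v) (ψ' : P.map g' ≅ v')
    (θ : g ⟶ g') (σ : v ⟶ v') (hθ : P.map₂ θ ≫ ψ'.hom = ψ.hom ≫ σ) :
    P.map₂ (f ◁ θ) ≫ (compIso φ ψ').hom = (compIso φ ψ).hom ≫ u ◁ σ := by
  have h' := congrArg (fun x => u ◁ x) hθ
  simp only [Bicategory.whiskerLeft_comp] at h'
  simp [compIso, whisker_exchange_assoc, h']

theorem compIso_whiskerRight (φ : P.map f ≅ u) (φ' : P.map f' ≅ u') (ψ : P.map g ≅ v)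
    (θ : f ⟶ f') (σ : u ⟶ u') (hθ : P.map₂ θ ≫ φ'.hom = φ.hom ≫ σ) :
    P.map₂ (θ ▷ g) ≫ (compIso φ' ψ).hom = (compIso φ ψ).hom ≫ σ ▷ v := by
  have h' := congrArg (fun x => x ▷ P.map g) hθ
  simp only [Bicategory.comp_whiskerRight] at h'
  simp [compIso, whisker_exchange, reassoc_of% h']

theorem compIso_associator (φ : P.map f ≅ u) (ψ : P.map g ≅ v) (χ : P.map h ≅ w) :
    P.map₂ (α_ f g h).hom ≫ (compIso φ (compIso ψ χ)).hom =
      (compIso (compIso φ ψ) χ).hom ≫ (α_ u v w).hom := by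
  simp [compIso, whisker_exchange_assoc]

theorem compIso_leftUnitor (φ : P.map f ≅ u) :
    P.map₂ (λ_ f).hom ≫ φ.hom = (compIso (P.mapId x) φ).hom ≫ (λ_ u).hom := by
  simp [compIso]

theorem compIso_rightUnitor (φ : P.map f ≅ u) :
    P.map₂ (ρ_ f).hom ≫ φ.hom = (compIso φ (P.mapId y)).hom ≫ (ρ_ u).hom := by
  simp [compIso, ← whisker_exchange_assoc]

end

theorem base₂_isIso {b b' : B} (e : Fibre κ b) (e' : Fibre κ b') {u v : b ⟶ b'} (w : u ≅ v) :
    IsIso (base₂ e e' w.hom) :=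
  ⟨base₂ e e' w.inv, by simp [← base₂_comp], by simp [← base₂_comp]⟩

/-- A 1-cell of `E` between objects of the fibres lying over `u` up to a given isomorphism. -/
structure Disp {b b' : B} (e : Fibre κ b) (e' : Fibre κ b') (u : b ⟶ b') where
  hom : e.obj ⟶ e'.obj
  iso : P.map hom ≅ base₁ e e' u

namespace Disp

/-- A 1-cell lying strictly over `u`. -/
@[simps] def ofEq {b b' : B} {e : Fibre κ b} {e' : Fibre κ b'} {u : b ⟶ b'}
    (f : e.obj ⟶ e'.obj) (h : P.map f = base₁ e e' u) : Disp e e' u where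
  hom := f
  iso := eqToIso h

/-- The identity of `e`, over the identity of `b`. -/
def id {b : B} (e : Fibre κ b) : Disp e e (𝟙 b) where
  hom := 𝟙 e.obj
  iso := castId e.proj_eq (P.mapId e.obj)

/-- The composite of 1-cells over `u` and over `v`, over the composite of `u` and `v`. -/
def comp {b b' b'' : B} {e : Fibre κ b} {e' : Fibre κ b'} {e'' : Fibre κ b''}
    {u : b ⟶ b'} {v : b' ⟶ b''} (f : Disp e e' u) (g : Disp e' e'' v) : Disp e e'' (u ≫ v) where
  hom := f.hom ≫ g.hom
  iso := castComp e.proj_eq e'.proj_eq e''.proj_eq (compIso f.iso g.iso)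

/-- The 2-cell `θ` of `E` lies over the 2-cell `σ` of `B`. -/
def Over {b b' : B} {e : Fibre κ b} {e' : Fibre κ b'} {u v : b ⟶ b'} (f : Disp e e' u)
    (g : Disp e e' v) (θ : f.hom ⟶ g.hom) (σ : u ⟶ v) : Prop :=
  P.map₂ θ ≫ g.iso.hom = f.iso.hom ≫ base₂ e e' σ

section

variable {b b' b'' b₃ : B} {e : Fibre κ b} {e' : Fibre κ b'} {e'' : Fibre κ b''} {e₃ : Fibre κ b₃}

theorem Over.id {u : b ⟶ b'} (f : Disp e e' u) : Over f f (𝟙 _) (𝟙 _) := by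
  simp [Over]

theorem Over.comp {u v w : b ⟶ b'} {f : Disp e e' u} {g : Disp e e' v} {h : Disp e e' w}
    {θ : f.hom ⟶ g.hom} {ζ : g.hom ⟶ h.hom} {σ : u ⟶ v} {τ : v ⟶ w} (hθ : Over f g θ σ)
    (hζ : Over g h ζ τ) : Over f h (θ ≫ ζ) (σ ≫ τ) := by
  simp only [Over] at *
  rw [base₂_comp, P.map₂_comp, Category.assoc, hζ, reassoc_of% hθ]

theorem Over.inv {u v : b ⟶ b'} {f : Disp e e' u} {g : Disp e e' v} {θ : f.hom ≅ g.hom}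
    {σ : u ≅ v} (hθ : Over f g θ.hom σ.hom) : Over g f θ.inv σ.inv := by
  simp only [Over] at *
  rw [← cancel_epi (P.map₂ θ.hom), ← Category.assoc, ← P.map₂_comp, Iso.hom_inv_id, P.map₂_id,
    Category.id_comp, reassoc_of% hθ, ← base₂_comp, Iso.hom_inv_id, base₂_id, Category.comp_id]

theorem Over.whiskerLeft {u : b ⟶ b'} {v w : b' ⟶ b''} (f : Disp e e' u) {g : Disp e' e'' v}
    {h : Disp e' e'' w} {θ : g.hom ⟶ h.hom} {σ : v ⟶ w} (hθ : Over g h θ σ) :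
    (f.comp g).Over (f.comp h) (f.hom ◁ θ) (u ◁ σ) := by
  obtain ⟨e, rfl⟩ := e; obtain ⟨e', rfl⟩ := e'; obtain ⟨e'', rfl⟩ := e''
  exact compIso_whiskerLeft (P := P) f.iso g.iso h.iso θ σ hθ

theorem Over.whiskerRight {u v : b ⟶ b'} {w : b' ⟶ b''} {f : Disp e e' u}
    {g : Disp e e' v} {θ : f.hom ⟶ g.hom} {σ : u ⟶ v} (hθ : Over f g θ σ) (h : Disp e' e'' w) :
    Over (f.comp h) (g.comp h) (θ ▷ h.hom) (σ ▷ w) := by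
  obtain ⟨e, rfl⟩ := e; obtain ⟨e', rfl⟩ := e'; obtain ⟨e'', rfl⟩ := e''
  exact compIso_whiskerRight (P := P) f.iso g.iso h.iso θ σ hθ

theorem Over.associator {u : b ⟶ b'} {v : b' ⟶ b''} {w : b'' ⟶ b₃} (f : Disp e e' u)
    (g : Disp e' e'' v) (h : Disp e'' e₃ w) :
    Over ((f.comp g).comp h) (f.comp (g.comp h)) (α_ f.hom g.hom h.hom).hom (α_ u v w).hom := by
  obtain ⟨e, rfl⟩ := e; obtain ⟨e', rfl⟩ := e'; obtain ⟨e'', rfl⟩ := e''; obtain ⟨e₃, rfl⟩ := e₃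
  exact compIso_associator (P := P) f.iso g.iso h.iso

theorem Over.leftUnitor {u : b ⟶ b'} (f : Disp e e' u) :
    Over ((Disp.id e).comp f) f (λ_ f.hom).hom (λ_ u).hom := by
  obtain ⟨e, rfl⟩ := e; obtain ⟨e', rfl⟩ := e'
  exact compIso_leftUnitor (P := P) f.iso

theorem Over.rightUnitor {u : b ⟶ b'} (f : Disp e e' u) :
    Over (f.comp (Disp.id e')) f (ρ_ f.hom).hom (ρ_ u).hom := by
  obtain ⟨e, rfl⟩ := e; obtain ⟨e', rfl⟩ := e'
  exact compIso_rightUnitor (P := P) f.iso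

end

section

variable {b b' : B} {e : Fibre κ b} {e' : Fibre κ b'} {u u' : b ⟶ b'}

/-- The chosen cartesian 2-cell over `σ : u ⟶ u'` with codomain a 1-cell over `u'`. -/
def lift (D : Disp e e' u') (σ : u ⟶ u') : CartLift₂ P D.hom (base₂ e e' σ ≫ D.iso.inv) :=
  κ.lift D.hom (base₂ e e' σ ≫ D.iso.inv)

/-- The domain of the chosen cartesian 2-cell over `σ : u ⟶ u'`: a 1-cell strictly over `u`. -/
def pull (D : Disp e e' u') (σ : u ⟶ u') : Disp e e' u :=
  ofEq (D.lift σ).dom (D.lift σ).domain_eq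

/-- The chosen cartesian 2-cell over `σ : u ⟶ u'`. -/
def pullHom (D : Disp e e' u') (σ : u ⟶ u') : (D.pull σ).hom ⟶ D.hom :=
  (D.lift σ).hom

/-- The chosen cartesian 2-cell over an isomorphism `w`, which is an isomorphism. -/
def pullIso (D : Disp e e' u') (w : u ≅ u') : (D.pull w.hom).hom ≅ D.hom :=
  have := base₂_isIso e e' w
  have : IsIso (D.lift w.hom).hom := (D.lift w.hom).isIso inferInstance
  let i : (D.lift w.hom).dom ≅ D.hom := asIso (D.lift w.hom).hom
  i

theorem pullIso_over (D : Disp e e' u') (w : u ≅ u') :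
    (D.pull w.hom).Over D (D.pullIso w).hom w.hom := by
  have h := (D.lift w.hom).map₂_eq
  change P.map₂ (D.lift w.hom).hom ≫ D.iso.hom =
    eqToHom (D.lift w.hom).domain_eq ≫ base₂ e e' w.hom
  rw [h]
  simp

end

end Disp

namespace Fibre

variable {b : B}

/-- A 1-cell of the fibre over `b`: a 1-cell of `E` that maps to `𝟙 b`. -/
structure Hom (e e' : Fibre κ b) where
  hom : e.obj ⟶ e'.obj
  map_eq : P.map hom = base₁ e e' (𝟙 b)

/-- A 1-cell of the fibre as a 1-cell of `E` over the identity. -/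
def Hom.disp {e e' : Fibre κ b} (f : Hom e e') : Disp e e' (𝟙 b) :=
  Disp.ofEq f.hom f.map_eq

/-- A 2-cell of the fibre over `b`: a 2-cell of `E` that maps to the identity of `𝟙 b`. -/
@[ext]
structure Hom₂ {e e' : Fibre κ b} (f g : Hom e e') where
  hom : f.hom ⟶ g.hom
  map₂_eq : P.map₂ hom = eqToHom (f.map_eq.trans g.map_eq.symm)

theorem Hom₂.over {e e' : Fibre κ b} {f g : Hom e e'} (θ : Hom₂ f g) :
    f.disp.Over g.disp θ.hom (𝟙 _) := by
  have h := θ.map₂_eq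
  simp [Disp.Over, Hom.disp, Disp.ofEq, h]

/-- A 2-cell of `E` over the identity of `𝟙 b` as a 2-cell of the fibre. -/
def Hom₂.mk' {e e' : Fibre κ b} {f g : Hom e e'} (θ : f.hom ⟶ g.hom) {σ : 𝟙 b ⟶ 𝟙 b}
    (h : f.disp.Over g.disp θ σ) (hσ : σ = 𝟙 _) : Hom₂ f g where
  hom := θ
  map₂_eq := by
    subst hσ
    simp only [Disp.Over, Hom.disp, Disp.ofEq, base₂_id, Category.comp_id, eqToIso.hom] at h
    rw [← cancel_mono (eqToHom g.map_eq), h]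
    simp

instance homCategory (e e' : Fibre κ b) : Category (Hom e e') where
  Hom f g := Hom₂ f g
  id f := ⟨𝟙 _, by simp⟩
  comp θ ζ := ⟨θ.hom ≫ ζ.hom, by simp [θ.map₂_eq, ζ.map₂_eq]⟩
  id_comp θ := Hom₂.ext (Category.id_comp _)
  comp_id θ := Hom₂.ext (Category.comp_id _)
  assoc θ ζ ξ := Hom₂.ext (Category.assoc _ _ _)

variable {e e' e'' e₃ : Fibre κ b}

/-- Composition in the fibre: the domain of the chosen cartesian lift of `𝟙 b ≅ 𝟙 b ≫ 𝟙 b` at the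
composite in `E`. -/
def Hom.comp (f : Hom e e') (g : Hom e' e'') : Hom e e'' where
  hom := ((f.disp.comp g.disp).pull (λ_ (𝟙 b)).inv).hom
  map_eq := ((f.disp.comp g.disp).lift (λ_ (𝟙 b)).inv).domain_eq

/-- The chosen cartesian 2-cell from the composite in the fibre to the composite in `E`. -/
def compIso (f : Hom e e') (g : Hom e' e'') : (f.comp g).hom ≅ f.hom ≫ g.hom :=
  (f.disp.comp g.disp).pullIso (λ_ (𝟙 b)).symm

theorem compIso_over (f : Hom e e') (g : Hom e' e'') :
    (f.comp g).disp.Over (f.disp.comp g.disp) (compIso f g).hom (λ_ (𝟙 b)).inv :=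
  (f.disp.comp g.disp).pullIso_over (λ_ (𝟙 b)).symm

/-- Identities in the fibre: the domain of the chosen cartesian lift of `𝟙 b ≅ P (𝟙 e)` at the
identity in `E`. -/
def Hom.id (e : Fibre κ b) : Hom e e where
  hom := ((Disp.id e).pull (𝟙 _)).hom
  map_eq := ((Disp.id e).lift (𝟙 _)).domain_eq

/-- The chosen cartesian 2-cell from the identity in the fibre to the identity in `E`. -/
def idIso (e : Fibre κ b) : (Hom.id e).hom ≅ 𝟙 e.obj :=
  (Disp.id e).pullIso (Iso.refl _)

theorem idIso_over (e : Fibre κ b) :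
    (Hom.id e).disp.Over (Disp.id e) (idIso e).hom (𝟙 _) :=
  (Disp.id e).pullIso_over (Iso.refl _)

theorem compIso_inv_over (f : Hom e e') (g : Hom e' e'') :
    (f.disp.comp g.disp).Over (f.comp g).disp (compIso f g).inv (λ_ (𝟙 b)).hom :=
  Disp.Over.inv (f := (f.comp g).disp) (g := f.disp.comp g.disp) (σ := (λ_ (𝟙 b)).symm)
    (compIso_over f g)

/-- An isomorphism of `E` over the identity of `𝟙 b` as an isomorphism of the fibre. -/
def isoMk {f g : Hom e e'} (θ : f.hom ≅ g.hom) {σ : 𝟙 b ⟶ 𝟙 b}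
    (h : f.disp.Over g.disp θ.hom σ) (hσ : σ = 𝟙 _) : f ≅ g where
  hom := Hom₂.mk' θ.hom h hσ
  inv := Hom₂.mk' θ.inv
    (Disp.Over.inv (f := f.disp) (g := g.disp) (σ := Iso.refl (𝟙 b))
      (by subst hσ; exact h)) rfl
  hom_inv_id := Hom₂.ext θ.hom_inv_id
  inv_hom_id := Hom₂.ext θ.inv_hom_id

theorem hom₂_ext {f g : Hom e e'} {θ ζ : f ⟶ g} (h : Hom₂.hom θ = Hom₂.hom ζ) : θ = ζ :=
  Hom₂.ext h

theorem comp_hom₂ {f g h : Hom e e'} (θ : f ⟶ g) (ζ : g ⟶ h) :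
    Hom₂.hom (θ ≫ ζ) = Hom₂.hom θ ≫ Hom₂.hom ζ := rfl

theorem id_hom₂ (f : Hom e e') : Hom₂.hom (𝟙 f) = 𝟙 f.hom := rfl

open Disp

/-- Whiskering in the fibre. -/
def whiskerL (f : Hom e e') {g h : Hom e' e''} (η : g ⟶ h) : f.comp g ⟶ f.comp h :=
  Hom₂.mk' ((compIso f g).hom ≫ f.hom ◁ Hom₂.hom η ≫ (compIso f h).inv)
    ((compIso_over f g).comp ((Over.whiskerLeft f.disp (Hom₂.over η)).comp (compIso_inv_over f h)))
    (by simp)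

/-- Whiskering in the fibre. -/
def whiskerR {f g : Hom e e'} (η : f ⟶ g) (h : Hom e' e'') : f.comp h ⟶ g.comp h :=
  Hom₂.mk' ((compIso f h).hom ≫ Hom₂.hom η ▷ h.hom ≫ (compIso g h).inv)
    ((compIso_over f h).comp ((Over.whiskerRight (Hom₂.over η) h.disp).comp
      (compIso_inv_over g h)))
    (by simp)

/-- The associativity isomorphism of the fibre. -/
def assocIso (f : Hom e e') (g : Hom e' e'') (h : Hom e'' e₃) :
    (f.comp g).comp h ≅ f.comp (g.comp h) :=
  isoMk
    (compIso (f.comp g) h ≪≫ whiskerRightIso (compIso f g) h.hom ≪≫ α_ _ _ _ ≪≫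
      whiskerLeftIso f.hom (compIso g h).symm ≪≫ (compIso f (g.comp h)).symm)
    ((compIso_over _ _).comp <| (Over.whiskerRight (compIso_over f g) h.disp).comp <|
      (Over.associator f.disp g.disp h.disp).comp <|
      (Over.whiskerLeft f.disp (compIso_inv_over g h)).comp (compIso_inv_over _ _))
    (by simp)

/-- The left unit isomorphism of the fibre. -/
def leftUnitorIso (f : Hom e e') : (Hom.id e).comp f ≅ f :=
  isoMk (compIso (Hom.id e) f ≪≫ whiskerRightIso (idIso e) f.hom ≪≫ λ_ _)
    ((compIso_over _ _).comp <| (Over.whiskerRight (idIso_over _) f.disp).comp <|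
      Over.leftUnitor f.disp)
    (by simp)

/-- The right unit isomorphism of the fibre. -/
def rightUnitorIso (f : Hom e e') : f.comp (Hom.id e') ≅ f :=
  isoMk (compIso f (Hom.id e') ≪≫ whiskerLeftIso f.hom (idIso e') ≪≫ ρ_ _)
    ((compIso_over _ _).comp <| (Over.whiskerLeft f.disp (idIso_over _)).comp <|
      Over.rightUnitor f.disp)
    (by simp)

theorem whiskerL_hom (f : Hom e e') {g h : Hom e' e''} (η : g ⟶ h) :
    Hom₂.hom (whiskerL f η) = (compIso f g).hom ≫ f.hom ◁ Hom₂.hom η ≫ (compIso f h).inv := rfl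

theorem whiskerR_hom {f g : Hom e e'} (η : f ⟶ g) (h : Hom e' e'') :
    Hom₂.hom (whiskerR η h) = (compIso f h).hom ≫ Hom₂.hom η ▷ h.hom ≫ (compIso g h).inv := rfl

theorem assocIso_hom (f : Hom e e') (g : Hom e' e'') (h : Hom e'' e₃) :
    Hom₂.hom (assocIso f g h).hom = (compIso (f.comp g) h).hom ≫ (compIso f g).hom ▷ h.hom ≫
      (α_ f.hom g.hom h.hom).hom ≫ f.hom ◁ (compIso g h).inv ≫ (compIso f (g.comp h)).inv := rfl

theorem assocIso_inv (f : Hom e e') (g : Hom e' e'') (h : Hom e'' e₃) :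
    Hom₂.hom (assocIso f g h).inv = (compIso f (g.comp h)).hom ≫ f.hom ◁ (compIso g h).hom ≫
      (α_ f.hom g.hom h.hom).inv ≫ (compIso f g).inv ▷ h.hom ≫ (compIso (f.comp g) h).inv := by
  change (compIso (f.comp g) h ≪≫ whiskerRightIso (compIso f g) h.hom ≪≫ α_ _ _ _ ≪≫
      whiskerLeftIso f.hom (compIso g h).symm ≪≫ (compIso f (g.comp h)).symm).inv = _
  simp

theorem leftUnitorIso_hom (f : Hom e e') : Hom₂.hom (leftUnitorIso f).hom =
    (compIso (Hom.id e) f).hom ≫ (idIso e).hom ▷ f.hom ≫ (λ_ f.hom).hom := rfl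

theorem leftUnitorIso_inv (f : Hom e e') : Hom₂.hom (leftUnitorIso f).inv =
    (λ_ f.hom).inv ≫ (idIso e).inv ▷ f.hom ≫ (compIso (Hom.id e) f).inv := by
  change (compIso (Hom.id e) f ≪≫ whiskerRightIso (idIso e) f.hom ≪≫ λ_ _).inv = _
  simp

theorem rightUnitorIso_hom (f : Hom e e') : Hom₂.hom (rightUnitorIso f).hom =
    (compIso f (Hom.id e')).hom ≫ f.hom ◁ (idIso e').hom ≫ (ρ_ f.hom).hom := rfl

theorem rightUnitorIso_inv (f : Hom e e') : Hom₂.hom (rightUnitorIso f).inv =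
    (ρ_ f.hom).inv ≫ f.hom ◁ (idIso e').inv ≫ (compIso f (Hom.id e')).inv := by
  change (compIso f (Hom.id e') ≪≫ whiskerLeftIso f.hom (idIso e') ≪≫ ρ_ _).inv = _
  simp

/-- The fibre over `b` as a bicategory. -/
instance bicategory (κ : LocalCleavage P) (b : B) : Bicategory (Fibre κ b) where
  Hom := Hom
  id := Hom.id
  comp := Hom.comp
  homCategory := homCategory
  whiskerLeft f _ _ η := whiskerL f η
  whiskerRight η h := whiskerR η h
  associator := assocIso
  leftUnitor := leftUnitorIso
  rightUnitor := rightUnitorIso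
  whiskerLeft_id f g := hom₂_ext (by simp [whiskerL_hom, id_hom₂])
  whiskerLeft_comp f _ _ _ η θ := hom₂_ext (by simp [whiskerL_hom, comp_hom₂])
  id_whiskerLeft η := hom₂_ext (by
    simp only [whiskerL_hom, comp_hom₂, leftUnitorIso_hom, leftUnitorIso_inv, Category.assoc]
    rw [← id_whiskerLeft_assoc, ← whisker_exchange_assoc]
    simp)
  comp_whiskerLeft f g _ _ η := hom₂_ext (by
    simp only [whiskerL_hom, comp_hom₂, assocIso_hom, assocIso_inv]
    simp
    rw [← comp_whiskerLeft_assoc, ← whisker_exchange_assoc]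
    simp)
  id_whiskerRight f g := hom₂_ext (by simp [whiskerR_hom, id_hom₂])
  comp_whiskerRight η θ h := hom₂_ext (by simp [whiskerR_hom, comp_hom₂])
  whiskerRight_id η := hom₂_ext (by
    simp only [whiskerR_hom, comp_hom₂, rightUnitorIso_hom, rightUnitorIso_inv, Category.assoc]
    rw [← whiskerRight_id_assoc, whisker_exchange_assoc]
    simp)
  whiskerRight_comp η g h := hom₂_ext (by
    simp only [whiskerR_hom, comp_hom₂, assocIso_hom, assocIso_inv]
    simp
    rw [← whiskerRight_comp_assoc, whisker_exchange_assoc]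
    simp)
  whisker_assoc f _ _ η h := hom₂_ext (by
    simp [whiskerL_hom, whiskerR_hom, comp_hom₂, assocIso_hom, assocIso_inv])
  whisker_exchange η θ := hom₂_ext (by
    simp [whiskerL_hom, whiskerR_hom, comp_hom₂, whisker_exchange_assoc])
  pentagon f g h k := hom₂_ext (by
    simp [whiskerL_hom, whiskerR_hom, comp_hom₂, assocIso_hom]
    rw [whisker_exchange_assoc]
    simp)
  triangle f g := hom₂_ext (by
    simp [whiskerL_hom, whiskerR_hom, comp_hom₂, assocIso_hom, leftUnitorIso_hom,
      rightUnitorIso_hom])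

/-- The inclusion of the fibre over `b` into `E`. -/
def incl (κ : LocalCleavage P) (b : B) : Fibre κ b ⥤ᵖ E where
  obj e := e.obj
  map f := Hom.hom f
  map₂ θ := Hom₂.hom θ
  map₂_id _ := rfl
  map₂_comp _ _ := rfl
  mapId e := idIso e
  mapComp f g := compIso f g
  map₂_whisker_left _ _ _ _ := rfl
  map₂_whisker_right _ _ := rfl
  map₂_associator _ _ _ := rfl
  map₂_left_unitor _ := rfl
  map₂_right_unitor _ := rfl

/-- The 1-cell of `E` underlying a 1-cell of the fibre. -/
def J {e e' : Fibre κ b} (k : e ⟶ e') : e.obj ⟶ e'.obj := Hom.hom k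

/-- The 2-cell of `E` underlying a 2-cell of the fibre. -/
def J₂ {e e' : Fibre κ b} {k l : e ⟶ e'} (θ : k ⟶ l) : J k ⟶ J l := Hom₂.hom θ

/-- An isomorphism of `E` underlying an isomorphism of the fibre. -/
def JIso {e e' : Fibre κ b} {k l : e ⟶ e'} (θ : k ≅ l) : J k ≅ J l :=
  (incl κ b).map₂Iso θ

/-- The isomorphism from the composite in the fibre to the composite in `E`. -/
def JComp {e e' e'' : Fibre κ b} (k : e ⟶ e') (l : e' ⟶ e'') : J (k ≫ l) ≅ J k ≫ J l :=
  compIso k l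

/-- The isomorphism from a composite of three 1-cells in the fibre to the composite in `E`. -/
def JComp₃ {e e' e'' e₃ : Fibre κ b} (k : e ⟶ e') (l : e' ⟶ e'') (m : e'' ⟶ e₃) :
    J (k ≫ l ≫ m) ≅ J k ≫ J l ≫ J m :=
  JComp k (l ≫ m) ≪≫ whiskerLeftIso (J k) (JComp l m)

/-- The isomorphism from the identity in the fibre to the identity in `E`. -/
def JId (e : Fibre κ b) : J (𝟙 e) ≅ 𝟙 e.obj := idIso e

/-- A 1-cell of the fibre as a 1-cell of `E` over the identity. -/
def JDisp {e e' : Fibre κ b} (k : e ⟶ e') : Disp e e' (𝟙 b) := Hom.disp k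

end Fibre

end Fibres

/-! ### Trihomomorphisms into the tricategory of bicategories -/

section Transformations

variable {X : Type u₁} [Bicategory.{w₁, v₁} X] {Y : Type u₂} [Bicategory.{w₂, v₂} Y]
  {Z : Type u₃} [Bicategory.{w₃, v₃} Z]

/-- The components of a pseudo-natural transformation, without the axioms. -/
structure TransData (G K : PrelaxFunctorStruct X Y) where
  app (x : X) : G.obj x ⟶ K.obj x
  nat {x y : X} (k : x ⟶ y) : G.map k ≫ app y ≅ app x ≫ K.map k

namespace TransData

/-- The components of a pseudo-natural transformation. -/
def of {G K : X ⥤ᵖ Y} (θ : G.StrongTrans K) :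
    TransData G.toPrelaxFunctorStruct K.toPrelaxFunctorStruct where
  app x := θ.app x
  nat k := θ.naturality k

/-- The components of the identity transformation. -/
def id (G : X ⥤ᵖ Y) : TransData G.toPrelaxFunctorStruct G.toPrelaxFunctorStruct where
  app x := 𝟙 (G.obj x)
  nat k := ρ_ (G.map k) ≪≫ (λ_ (G.map k)).symm

/-- The components of a composite of transformations. -/
def comp {G K L : PrelaxFunctorStruct X Y} (θ : TransData G K) (ζ : TransData K L) :
    TransData G L where
  app x := θ.app x ≫ ζ.app x
  nat {x y} k := (α_ _ _ _).symm ≪≫ whiskerRightIso (θ.nat k) (ζ.app y) ≪≫ α_ _ _ _ ≪≫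
    whiskerLeftIso (θ.app x) (ζ.nat k) ≪≫ (α_ _ _ _).symm

/-- The components of the composite of a homomorphism with a transformation. -/
def pre (L : X ⥤ᵖ Y) {G K : PrelaxFunctorStruct Y Z} (θ : TransData G K) :
    TransData (L.toPrelaxFunctorStruct.comp G) (L.toPrelaxFunctorStruct.comp K) where
  app x := θ.app (L.obj x)
  nat k := θ.nat (L.map k)

/-- The components of the composite of a transformation with a homomorphism. -/
def post {G K : PrelaxFunctorStruct X Y} (θ : TransData G K) (L : Y ⥤ᵖ Z) :
    TransData (G.comp L.toPrelaxFunctorStruct) (K.comp L.toPrelaxFunctorStruct) where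
  app x := L.map (θ.app x)
  nat {x y} k := (L.mapComp (G.map k) (θ.app y)).symm ≪≫ L.map₂Iso (θ.nat k) ≪≫
    L.mapComp (θ.app x) (K.map k)

/-- A family of 2-cells is a modification. -/
def IsModification {G K : PrelaxFunctorStruct X Y} (θ ζ : TransData G K)
    (m : ∀ x, θ.app x ⟶ ζ.app x) : Prop :=
  ∀ {x y : X} (k : x ⟶ y), G.map k ◁ m y ≫ (ζ.nat k).hom = (θ.nat k).hom ≫ m x ▷ K.map k

end TransData

end Transformations

/-- A 1-cell of a bicategory is an equivalence. -/
def IsEquiv₁ {X : Type u₁} [Bicategory.{w₁, v₁} X] {x y : X} (f : x ⟶ y) : Prop :=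
  ∃ e : x ≌ y, e.hom = f

section Trihomomorphisms

/-- The horizontal composite of 2-cells. -/
def hc {B : Type u₁} [Bicategory.{w₁, v₁} B] {a b c : B} {f f' : a ⟶ b} {g g' : b ⟶ c}
    (α : f ⟶ f') (β : g ⟶ g') : f ≫ g ⟶ f' ≫ g' :=
  α ▷ g ≫ f' ◁ β

/-- The action of a trihomomorphism on cells, and its comparison transformations. -/
structure TrihomCore (B : Type u₁) [Bicategory.{w₁, v₁} B] (X : B → Type u₂)
    [∀ b, Bicategory.{w₂, v₂} (X b)] where
  /-- The action on 1-cells. -/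
  map {a b : B} (u : a ⟶ b) : X b ⥤ᵖ X a
  /-- The action on 2-cells. -/
  map₂ {a b : B} {u v : a ⟶ b} (σ : u ⟶ v) : (map v).StrongTrans (map u)
  /-- The comparison for composites of 1-cells. -/
  χ {a b c : B} (f : a ⟶ b) (g : b ⟶ c) : ((map g).comp (map f)).StrongTrans (map (f ≫ g))
  /-- The comparison for identity 1-cells. -/
  ι (a : B) : (Pseudofunctor.id (X a)).StrongTrans (map (𝟙 a))

namespace TrihomCore

variable {B : Type u₁} [Bicategory.{w₁, v₁} B] {X : B → Type u₂}
    [∀ b, Bicategory.{w₂, v₂} (X b)] (F : TrihomCore B X)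

/-- The component of the action on a 2-cell at an object. -/
def app₂ {a b : B} {u v : a ⟶ b} (σ : u ⟶ v) (x : X b) : (F.map v).obj x ⟶ (F.map u).obj x :=
  (F.map₂ σ).app x

/-- The component of the action on a 2-cell at a 1-cell. -/
def nat₂ {a b : B} {u v : a ⟶ b} (σ : u ⟶ v) {x y : X b} (k : x ⟶ y) :
    (F.map v).map k ≫ F.app₂ σ y ≅ F.app₂ σ x ≫ (F.map u).map k :=
  (F.map₂ σ).naturality k

/-- The component of `χ` at an object. -/
def χApp {a b c : B} (f : a ⟶ b) (g : b ⟶ c) (x : X c) :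
    (F.map f).obj ((F.map g).obj x) ⟶ (F.map (f ≫ g)).obj x :=
  (F.χ f g).app x

/-- The component of `χ` at a 1-cell. -/
def χNat {a b c : B} (f : a ⟶ b) (g : b ⟶ c) {x y : X c} (k : x ⟶ y) :
    (F.map f).map ((F.map g).map k) ≫ F.χApp f g y ≅ F.χApp f g x ≫ (F.map (f ≫ g)).map k :=
  (F.χ f g).naturality k

/-- The component of `ι` at an object. -/
def ιApp (a : B) (x : X a) : x ⟶ (F.map (𝟙 a)).obj x :=
  (F.ι a).app x

/-- The component of `ι` at a 1-cell. -/
def ιNat (a : B) {x y : X a} (k : x ⟶ y) :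
    k ≫ F.ιApp a y ≅ F.ιApp a x ≫ (F.map (𝟙 a)).map k :=
  (F.ι a).naturality k

end TrihomCore

/-- The data of a trihomomorphism from `B`, with 1-cells and 2-cells reversed, to bicategories,
given by `X` on objects. All cells of the target are unpacked into components. -/
structure TrihomData (B : Type u₁) [Bicategory.{w₁, v₁} B] (X : B → Type u₂)
    [∀ b, Bicategory.{w₂, v₂} (X b)] extends TrihomCore B X where
  /-- The comparison for vertical composites of 2-cells. -/
  map₂Comp {a b : B} {u v w : a ⟶ b} (σ : u ⟶ v) (τ : v ⟶ w) (x : X b) :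
    toTrihomCore.app₂ (σ ≫ τ) x ≅ toTrihomCore.app₂ τ x ≫ toTrihomCore.app₂ σ x
  /-- The comparison for identity 2-cells. -/
  map₂Id {a b : B} (u : a ⟶ b) (x : X b) : toTrihomCore.app₂ (𝟙 u) x ≅ 𝟙 ((map u).obj x)
  /-- The naturality of `χ` in 2-cells. -/
  χ₂ {a b c : B} {f f' : a ⟶ b} {g g' : b ⟶ c} (α : f ⟶ f') (β : g ⟶ g') (x : X c) :
    toTrihomCore.app₂ α ((map g').obj x) ≫ (map f).map (toTrihomCore.app₂ β x) ≫
        toTrihomCore.χApp f g x ≅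
      toTrihomCore.χApp f' g' x ≫ toTrihomCore.app₂ (hc α β) x
  /-- The modification for associativity. -/
  ω {a b c d : B} (f : a ⟶ b) (g : b ⟶ c) (h : c ⟶ d) (x : X d) :
    (map f).map (toTrihomCore.χApp g h x) ≫ toTrihomCore.χApp f (g ≫ h) x ≫
        toTrihomCore.app₂ (α_ f g h).hom x ≅
      toTrihomCore.χApp f g ((map h).obj x) ≫ toTrihomCore.χApp (f ≫ g) h x
  /-- The modification for units on one side. -/
  γ {a b : B} (f : a ⟶ b) (x : X b) :
    (map f).map (toTrihomCore.ιApp b x) ≫ toTrihomCore.χApp f (𝟙 b) x ≫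
        toTrihomCore.app₂ (ρ_ f).inv x ≅
      𝟙 ((map f).obj x)
  /-- The modification for units on the other side. -/
  δ {a b : B} (f : a ⟶ b) (x : X b) :
    toTrihomCore.app₂ (λ_ f).hom x ≅
      toTrihomCore.ιApp a ((map f).obj x) ≫ toTrihomCore.χApp (𝟙 a) f x

namespace TrihomData

variable {B : Type u₁} [Bicategory.{w₁, v₁} B] {X : B → Type u₂}
    [∀ b, Bicategory.{w₂, v₂} (X b)] (F : TrihomData B X)

/-- The components of the action on equal 2-cells agree. -/
def eq₂ {a b : B} {u v : a ⟶ b} {σ τ : u ⟶ v} (h : σ = τ) (x : X b) : F.app₂ σ x ≅ F.app₂ τ x :=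
  eqToIso (by rw [h])

/-- The comparison `map₂Comp` between two factorisations of the same 2-cell. -/
def swap {a b : B} {u v v' w : a ⟶ b} (σ : u ⟶ v) (τ : v ⟶ w) (σ' : u ⟶ v') (τ' : v' ⟶ w)
    (h : σ ≫ τ = σ' ≫ τ') (x : X b) :
    F.app₂ τ x ≫ F.app₂ σ x ⟶ F.app₂ τ' x ≫ F.app₂ σ' x :=
  (F.map₂Comp σ τ x).inv ≫ (F.eq₂ h x).hom ≫ (F.map₂Comp σ' τ' x).hom

/-- The naturality of `χ` in its second variable. -/
def χL {a b c : B} (f : a ⟶ b) {g g' : b ⟶ c} (β : g ⟶ g') (x : X c) :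
    (F.map f).map (F.app₂ β x) ≫ F.χApp f g x ≅
      F.χApp f g' x ≫ F.app₂ (f ◁ β) x :=
  (λ_ _).symm ≪≫ whiskerRightIso (F.map₂Id f _).symm _ ≪≫ F.χ₂ (𝟙 f) β x ≪≫
    whiskerLeftIso _ (F.eq₂ (by simp [hc]) x)

/-- The naturality of `χ` in its first variable. -/
def χR {a b c : B} {f f' : a ⟶ b} (α : f ⟶ f') (g : b ⟶ c) (x : X c) :
    F.app₂ α ((F.map g).obj x) ≫ F.χApp f g x ≅
      F.χApp f' g x ≫ F.app₂ (α ▷ g) x :=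
  whiskerLeftIso _ ((λ_ _).symm ≪≫ whiskerRightIso (((F.map f).mapId _).symm ≪≫
    (F.map f).map₂Iso (F.map₂Id g x).symm) _) ≪≫ F.χ₂ α (𝟙 g) x ≪≫
    whiskerLeftIso _ (F.eq₂ (by simp [hc]) x)

/-- One side of the naturality of `ω` in 2-cells. -/
def ωNat₁ {a b c d : B} {f f' : a ⟶ b} {g g' : b ⟶ c} {h h' : c ⟶ d} (α : f ⟶ f')
    (β : g ⟶ g') (γ : h ⟶ h') (x : X d) :
    (F.map f').map (F.χApp g' h' x) ≫ F.χApp f' (g' ≫ h') x ≫ F.app₂ (α_ f' g' h').hom x ≫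
        F.app₂ (hc (hc α β) γ) x ⟶
      F.app₂ α ((F.map g').obj ((F.map h').obj x)) ≫
        (F.map f).map (F.app₂ β ((F.map h').obj x)) ≫
        (F.map f).map ((F.map g).map (F.app₂ γ x)) ≫
        F.χApp f g ((F.map h).obj x) ≫ F.χApp (f ≫ g) h x :=
  𝟙 _ ⊗≫ (F.ω f' g' h' x).hom ▷ F.app₂ (hc (hc α β) γ) x ⊗≫
    F.χApp f' g' _ ◁ (F.χ₂ (hc α β) γ x).inv ⊗≫
    (F.χ₂ α β ((F.map h').obj x)).inv ▷
      ((F.map (f ≫ g)).map (F.app₂ γ x) ≫ F.χApp (f ≫ g) h x) ⊗≫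
    F.app₂ α _ ◁ (F.map f).map (F.app₂ β _) ◁
      (F.χNat f g (F.app₂ γ x)).inv ▷ F.χApp (f ≫ g) h x ⊗≫ 𝟙 _

/-- The other side of the naturality of `ω` in 2-cells. -/
def ωNat₂ {a b c d : B} {f f' : a ⟶ b} {g g' : b ⟶ c} {h h' : c ⟶ d} (α : f ⟶ f')
    (β : g ⟶ g') (γ : h ⟶ h') (x : X d) :
    (F.map f').map (F.χApp g' h' x) ≫ F.χApp f' (g' ≫ h') x ≫ F.app₂ (α_ f' g' h').hom x ≫
        F.app₂ (hc (hc α β) γ) x ⟶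
      F.app₂ α ((F.map g').obj ((F.map h').obj x)) ≫
        (F.map f).map (F.app₂ β ((F.map h').obj x)) ≫
        (F.map f).map ((F.map g).map (F.app₂ γ x)) ≫
        F.χApp f g ((F.map h).obj x) ≫ F.χApp (f ≫ g) h x :=
  (F.map f').map (F.χApp g' h' x) ◁ F.χApp f' (g' ≫ h') x ◁
      F.swap (hc (hc α β) γ) (α_ f' g' h').hom (α_ f g h).hom (hc α (hc β γ)) (by simp [hc]) x ⊗≫
    (F.map f').map (F.χApp g' h' x) ◁ (F.χ₂ α (hc β γ) x).inv ▷
      F.app₂ (α_ f g h).hom x ⊗≫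
    (F.nat₂ α (F.χApp g' h' x)).hom ▷
      ((F.map f).map (F.app₂ (hc β γ) x) ≫ F.χApp f (g ≫ h) x ≫
        F.app₂ (α_ f g h).hom x) ⊗≫
    F.app₂ α _ ◁ (((F.map f).mapComp _ _).inv ≫ (F.map f).map₂ (F.χ₂ β γ x).inv ≫
      ((F.map f).mapComp _ _).hom ≫ (F.map f).map _ ◁ ((F.map f).mapComp _ _).hom) ▷
      (F.χApp f (g ≫ h) x ≫ F.app₂ (α_ f g h).hom x) ⊗≫
    F.app₂ α _ ◁ (F.map f).map (F.app₂ β _) ◁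
      (F.map f).map ((F.map g).map (F.app₂ γ x)) ◁ (F.ω f g h x).hom ⊗≫ 𝟙 _

/-- One side of the associativity axiom. -/
def assoc₁ {a b c d e : B} (f : a ⟶ b) (g : b ⟶ c) (h : c ⟶ d) (k : d ⟶ e) (x : X e) :
    (F.map f).map ((F.map g).map (F.χApp h k x)) ≫ (F.map f).map (F.χApp g (h ≫ k) x) ≫
        F.χApp f (g ≫ h ≫ k) x ≫ F.app₂ (α_ f g (h ≫ k)).hom x ≫
        F.app₂ (α_ (f ≫ g) h k).hom x ⟶
      F.χApp f g _ ≫ F.χApp (f ≫ g) h _ ≫ F.χApp ((f ≫ g) ≫ h) k x :=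
  𝟙 _ ⊗≫ (F.map f).map ((F.map g).map (F.χApp h k x)) ◁ (F.ω f g (h ≫ k) x).hom ▷
      F.app₂ (α_ (f ≫ g) h k).hom x ⊗≫
    (F.χNat f g (F.χApp h k x)).hom ▷
      (F.χApp (f ≫ g) (h ≫ k) x ≫ F.app₂ (α_ (f ≫ g) h k).hom x) ⊗≫
    F.χApp f g _ ◁ (F.ω (f ≫ g) h k x).hom ⊗≫ 𝟙 _

/-- The other side of the associativity axiom. -/
def assoc₂ {a b c d e : B} (f : a ⟶ b) (g : b ⟶ c) (h : c ⟶ d) (k : d ⟶ e) (x : X e) :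
    (F.map f).map ((F.map g).map (F.χApp h k x)) ≫ (F.map f).map (F.χApp g (h ≫ k) x) ≫
        F.χApp f (g ≫ h ≫ k) x ≫ F.app₂ (α_ f g (h ≫ k)).hom x ≫
        F.app₂ (α_ (f ≫ g) h k).hom x ⟶
      F.χApp f g _ ≫ F.χApp (f ≫ g) h _ ≫ F.χApp ((f ≫ g) ≫ h) k x :=
  (F.map f).map ((F.map g).map (F.χApp h k x)) ◁ (F.map f).map (F.χApp g (h ≫ k) x) ◁
      F.χApp f (g ≫ h ≫ k) x ◁
      (F.swap (α_ (f ≫ g) h k).hom (α_ f g (h ≫ k)).hom ((α_ f g h).hom ▷ k)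
        ((α_ f (g ≫ h) k).hom ≫ f ◁ (α_ g h k).hom) (by simp) x ≫
      (F.map₂Comp (α_ f (g ≫ h) k).hom (f ◁ (α_ g h k).hom) x).hom ▷ _) ⊗≫
    (F.map f).map ((F.map g).map (F.χApp h k x)) ◁ (F.map f).map (F.χApp g (h ≫ k) x) ◁
      (F.χL f (α_ g h k).hom x).inv ▷
      (F.app₂ (α_ f (g ≫ h) k).hom x ≫ F.app₂ ((α_ f g h).hom ▷ k) x) ⊗≫
    ((F.map f).map ((F.map g).map (F.χApp h k x)) ◁ ((F.map f).mapComp _ _).inv ≫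
      ((F.map f).mapComp _ _).inv ≫ (F.map f).map₂ (F.ω g h k x).hom ≫
      ((F.map f).mapComp _ _).hom) ▷
      (F.χApp f ((g ≫ h) ≫ k) x ≫ F.app₂ (α_ f (g ≫ h) k).hom x ≫
        F.app₂ ((α_ f g h).hom ▷ k) x) ⊗≫
    (F.map f).map (F.χApp g h _) ◁ (F.ω f (g ≫ h) k x).hom ▷
      F.app₂ ((α_ f g h).hom ▷ k) x ⊗≫
    (F.map f).map (F.χApp g h _) ◁ F.χApp f (g ≫ h) _ ◁ (F.χR (α_ f g h).hom k x).inv ⊗≫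
    (F.ω f g h ((F.map k).obj x)).hom ▷ F.χApp ((f ≫ g) ≫ h) k x ⊗≫ 𝟙 _

/-- One side of the unit axiom. -/
def unit₁ {a b c : B} (f : a ⟶ b) (g : b ⟶ c) (x : X c) :
    (F.map f).map (F.ιApp b ((F.map g).obj x)) ≫ F.χApp f (𝟙 b) ((F.map g).obj x) ≫
      F.χApp (f ≫ 𝟙 b) g x ≫ F.app₂ ((ρ_ f).inv ▷ g) x ⟶ F.χApp f g x :=
  (F.map f).map (F.ιApp b ((F.map g).obj x)) ◁ F.χApp f (𝟙 b) ((F.map g).obj x) ◁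
      (F.χR (ρ_ f).inv g x).inv ⊗≫
    (F.γ f ((F.map g).obj x)).hom ▷ F.χApp f g x ⊗≫ 𝟙 _

/-- The other side of the unit axiom. -/
def unit₂ {a b c : B} (f : a ⟶ b) (g : b ⟶ c) (x : X c) :
    (F.map f).map (F.ιApp b ((F.map g).obj x)) ≫ F.χApp f (𝟙 b) ((F.map g).obj x) ≫
      F.χApp (f ≫ 𝟙 b) g x ≫ F.app₂ ((ρ_ f).inv ▷ g) x ⟶ F.χApp f g x :=
  𝟙 _ ⊗≫ (F.map f).map (F.ιApp b ((F.map g).obj x)) ◁ (F.ω f (𝟙 b) g x).inv ▷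
      F.app₂ ((ρ_ f).inv ▷ g) x ⊗≫
    (((F.map f).mapComp _ _).inv ≫ (F.map f).map₂ (F.δ g x).inv) ▷
      (F.χApp f (𝟙 b ≫ g) x ≫ F.app₂ (α_ f (𝟙 b) g).hom x ≫
        F.app₂ ((ρ_ f).inv ▷ g) x) ⊗≫
    (F.χL f (λ_ g).hom x).hom ▷
      (F.app₂ (α_ f (𝟙 b) g).hom x ≫ F.app₂ ((ρ_ f).inv ▷ g) x) ⊗≫
    F.χApp f g x ◁ ((F.map₂Comp (α_ f (𝟙 b) g).hom (f ◁ (λ_ g).hom) x).inv ▷ _ ≫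
      (F.map₂Comp ((ρ_ f).inv ▷ g) ((α_ f (𝟙 b) g).hom ≫ f ◁ (λ_ g).hom) x).inv ≫
      (F.eq₂ (τ := 𝟙 (f ≫ g)) (by simp) x).hom ≫
      (F.map₂Id (f ≫ g) x).hom) ⊗≫ 𝟙 _

/-- The axioms of a trihomomorphism. -/
structure IsTrihom (F : TrihomData B X) : Prop where
  -- `map₂Comp` and `map₂Id` are modifications, and make `B(a, b) → Bicat(X b, X a)` a homomorphism
  map₂Comp_mod : ∀ {a b : B} {u v w : a ⟶ b} (σ : u ⟶ v) (τ : v ⟶ w),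
    (TransData.of (F.map₂ (σ ≫ τ))).IsModification
      ((TransData.of (F.map₂ τ)).comp (.of (F.map₂ σ))) fun x => (F.map₂Comp σ τ x).hom
  map₂Id_mod : ∀ {a b : B} (u : a ⟶ b),
    (TransData.of (F.map₂ (𝟙 u))).IsModification (.id (F.map u)) fun x => (F.map₂Id u x).hom
  map₂_assoc : ∀ {a b : B} {u v w z : a ⟶ b} (σ : u ⟶ v) (τ : v ⟶ w) (υ : w ⟶ z) (x : X b),
    (F.map₂Comp (σ ≫ τ) υ x).hom ≫ F.app₂ υ x ◁ (F.map₂Comp σ τ x).hom =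
      (F.eq₂ (Category.assoc σ τ υ) x).hom ≫ (F.map₂Comp σ (τ ≫ υ) x).hom ≫
        (F.map₂Comp τ υ x).hom ▷ F.app₂ σ x ≫ (α_ _ _ _).hom
  map₂_id_comp : ∀ {a b : B} {u v : a ⟶ b} (σ : u ⟶ v) (x : X b),
    (F.map₂Comp (𝟙 u) σ x).hom ≫ F.app₂ σ x ◁ (F.map₂Id u x).hom ≫ (ρ_ _).hom =
      (F.eq₂ (Category.id_comp σ) x).hom
  map₂_comp_id : ∀ {a b : B} {u v : a ⟶ b} (σ : u ⟶ v) (x : X b),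
    (F.map₂Comp σ (𝟙 v) x).hom ≫ (F.map₂Id v x).hom ▷ F.app₂ σ x ≫ (λ_ _).hom =
      (F.eq₂ (Category.comp_id σ) x).hom
  -- `χ` and `ι` are pseudo-natural equivalences
  χ_equiv : ∀ {a b c : B} (f : a ⟶ b) (g : b ⟶ c) (x : X c), IsEquiv₁ (F.χApp f g x)
  ι_equiv : ∀ (a : B) (x : X a), IsEquiv₁ (F.ιApp a x)
  χ₂_mod : ∀ {a b c : B} {f f' : a ⟶ b} {g g' : b ⟶ c} (α : f ⟶ f') (β : g ⟶ g'),
    ((TransData.of (F.map₂ α)).pre (F.map g') |>.comp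
      (((TransData.of (F.map₂ β)).post (F.map f)).comp (.of (F.χ f g)))).IsModification
      ((TransData.of (F.χ f' g')).comp (.of (F.map₂ (hc α β)))) fun x => (F.χ₂ α β x).hom
  χ₂_id : ∀ {a b c : B} (f : a ⟶ b) (g : b ⟶ c) (x : X c),
    (F.χ₂ (𝟙 f) (𝟙 g) x).hom ≫ F.χApp f g x ◁ ((F.eq₂ (τ := 𝟙 (f ≫ g)) (by simp [hc]) x).hom ≫
        (F.map₂Id (f ≫ g) x).hom) ≫
        (ρ_ _).hom =
      (F.map₂Id f _).hom ▷ _ ≫ (λ_ _).hom ≫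
        ((F.map f).map₂ (F.map₂Id g x).hom ≫ ((F.map f).mapId _).hom) ▷ F.χApp f g x ≫ (λ_ _).hom
  χ₂_comp : ∀ {a b c : B} {f f' f'' : a ⟶ b} {g g' g'' : b ⟶ c} (α : f ⟶ f') (α' : f' ⟶ f'')
    (β : g ⟶ g') (β' : g' ⟶ g'') (x : X c),
    (F.χ₂ (α ≫ α') (β ≫ β') x).hom ≫ F.χApp f'' g'' x ◁ ((F.eq₂ (by simp [hc, whisker_exchange_assoc]) x).hom
        ≫ (F.map₂Comp (hc α β) (hc α' β') x).hom) =
      (F.map₂Comp α α' _).hom ▷ _ ≫ _ ◁ ((F.map f).map₂ (F.map₂Comp β β' x).hom ≫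
          ((F.map f).mapComp _ _).hom) ▷ F.χApp f g x ⊗≫
        F.app₂ α' ((F.map g'').obj x) ◁ (F.nat₂ α (F.app₂ β' x)).inv ▷
          ((F.map f).map (F.app₂ β x) ≫ F.χApp f g x) ⊗≫
        F.app₂ α' ((F.map g'').obj x) ◁ (F.map f').map (F.app₂ β' x) ◁
          (F.χ₂ α β x).hom ⊗≫
        (F.χ₂ α' β' x).hom ▷ F.app₂ (hc α β) x ≫ (α_ _ _ _).hom
  -- `ω`, `γ` and `δ` are modifications, natural in 2-cells
  ω_mod : ∀ {a b c d : B} (f : a ⟶ b) (g : b ⟶ c) (h : c ⟶ d),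
    (((TransData.of (F.χ g h)).post (F.map f)).comp
      ((TransData.of (F.χ f (g ≫ h))).comp (.of (F.map₂ (α_ f g h).hom)))).IsModification
      (((TransData.of (F.χ f g)).pre (F.map h)).comp (.of (F.χ (f ≫ g) h)))
      fun x => (F.ω f g h x).hom
  ω_nat : ∀ {a b c d : B} {f f' : a ⟶ b} {g g' : b ⟶ c} {h h' : c ⟶ d} (α : f ⟶ f')
    (β : g ⟶ g') (γ : h ⟶ h') (x : X d), F.ωNat₁ α β γ x = F.ωNat₂ α β γ x
  γ_mod : ∀ {a b : B} (f : a ⟶ b),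
    (((TransData.of (F.ι b)).post (F.map f)).comp
      ((TransData.of (F.χ f (𝟙 b))).comp (.of (F.map₂ (ρ_ f).inv)))).IsModification
      (.id (F.map f)) fun x => (F.γ f x).hom
  γ_nat : ∀ {a b : B} {f f' : a ⟶ b} (α : f ⟶ f') (x : X b),
    (F.γ f' x).hom ▷ F.app₂ α x ⊗≫ 𝟙 (F.app₂ α x) =
      𝟙 _ ⊗≫ (F.map f').map (F.ιApp b x) ◁ F.χApp f' (𝟙 b) x ◁
          F.swap α (ρ_ f').inv (ρ_ f).inv (α ▷ 𝟙 b) (by simp) x ⊗≫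
        (F.map f').map (F.ιApp b x) ◁ (F.χR α (𝟙 b) x).inv ▷ F.app₂ (ρ_ f).inv x ⊗≫
        (F.nat₂ α (F.ιApp b x)).hom ▷
          (F.χApp f (𝟙 b) x ≫ F.app₂ (ρ_ f).inv x) ⊗≫
        F.app₂ α x ◁ (F.γ f x).hom ⊗≫ 𝟙 (F.app₂ α x)
  δ_mod : ∀ {a b : B} (f : a ⟶ b),
    (TransData.of (F.map₂ (λ_ f).hom)).IsModification
      (((TransData.of (F.ι a)).pre (F.map f)).comp (.of (F.χ (𝟙 a) f))) fun x => (F.δ f x).hom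
  δ_nat : ∀ {a b : B} {f f' : a ⟶ b} (α : f ⟶ f') (x : X b),
    (F.δ f' x).hom ▷ F.app₂ (𝟙 a ◁ α) x ⊗≫
        F.ιApp a ((F.map f').obj x) ◁ (F.χL (𝟙 a) α x).inv ⊗≫
        (F.ιNat a (F.app₂ α x)).inv ▷ F.χApp (𝟙 a) f x ⊗≫
        𝟙 (F.app₂ α x ≫ F.ιApp a ((F.map f).obj x) ≫ F.χApp (𝟙 a) f x) =
      F.swap (𝟙 a ◁ α) (λ_ f').hom (λ_ f).hom α (by simp) x ≫ F.app₂ α x ◁ (F.δ f x).hom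
  -- the two axioms relating `ω`, `γ` and `δ`
  assoc : ∀ {a b c d e : B} (f : a ⟶ b) (g : b ⟶ c) (h : c ⟶ d) (k : d ⟶ e) (x : X e),
    F.assoc₁ f g h k x = F.assoc₂ f g h k x
  unit : ∀ {a b c : B} (f : a ⟶ b) (g : b ⟶ c) (x : X c), F.unit₁ f g x = F.unit₂ f g x

end TrihomData

end Trihomomorphisms

/-! ### Bicategories from raw data -/

section Raw

/-- The data of a bicategory with horizontal composition as an operation on 2-cells, without the
axioms. -/
structure RawBicategory (C : Type u₁) where
  Hom : C → C → Type v₁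
  Hom₂ {x y : C} : Hom x y → Hom x y → Type w₁
  id (x : C) : Hom x x
  comp {x y z : C} : Hom x y → Hom y z → Hom x z
  id₂ {x y : C} (f : Hom x y) : Hom₂ f f
  comp₂ {x y : C} {f g h : Hom x y} : Hom₂ f g → Hom₂ g h → Hom₂ f h
  hcomp {x y z : C} {f f' : Hom x y} {g g' : Hom y z} :
    Hom₂ f f' → Hom₂ g g' → Hom₂ (comp f g) (comp f' g')
  assoc {x y z t : C} (f : Hom x y) (g : Hom y z) (h : Hom z t) :
    Hom₂ (comp (comp f g) h) (comp f (comp g h))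
  leftUnitor {x y : C} (f : Hom x y) : Hom₂ (comp (id x) f) f
  rightUnitorInv {x y : C} (f : Hom x y) : Hom₂ f (comp f (id y))

namespace RawBicategory

/-- A 2-cell is invertible. -/
def IsInvertible {C : Type u₁} (R : RawBicategory.{w₁, v₁} C) {x y : C} {f g : R.Hom x y}
    (θ : R.Hom₂ f g) : Prop :=
  ∃ ζ : R.Hom₂ g f, R.comp₂ θ ζ = R.id₂ f ∧ R.comp₂ ζ θ = R.id₂ g

/-- The axioms of a bicategory. -/
structure IsLawful {C : Type u₁} (R : RawBicategory.{w₁, v₁} C) : Prop where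
  id₂_comp₂ : ∀ {x y : C} {f g : R.Hom x y} (θ : R.Hom₂ f g), R.comp₂ (R.id₂ f) θ = θ
  comp₂_id₂ : ∀ {x y : C} {f g : R.Hom x y} (θ : R.Hom₂ f g), R.comp₂ θ (R.id₂ g) = θ
  comp₂_assoc : ∀ {x y : C} {f g h k : R.Hom x y} (θ : R.Hom₂ f g) (ζ : R.Hom₂ g h)
    (ξ : R.Hom₂ h k), R.comp₂ (R.comp₂ θ ζ) ξ = R.comp₂ θ (R.comp₂ ζ ξ)
  hcomp_id₂ : ∀ {x y z : C} (f : R.Hom x y) (g : R.Hom y z),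
    R.hcomp (R.id₂ f) (R.id₂ g) = R.id₂ (R.comp f g)
  interchange : ∀ {x y z : C} {f f' f'' : R.Hom x y} {g g' g'' : R.Hom y z} (θ : R.Hom₂ f f')
    (θ' : R.Hom₂ f' f'') (ζ : R.Hom₂ g g') (ζ' : R.Hom₂ g' g''),
    R.hcomp (R.comp₂ θ θ') (R.comp₂ ζ ζ') = R.comp₂ (R.hcomp θ ζ) (R.hcomp θ' ζ')
  assoc_nat : ∀ {x y z t : C} {f f' : R.Hom x y} {g g' : R.Hom y z} {h h' : R.Hom z t}
    (θ : R.Hom₂ f f') (ζ : R.Hom₂ g g') (ξ : R.Hom₂ h h'),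
    R.comp₂ (R.hcomp (R.hcomp θ ζ) ξ) (R.assoc f' g' h') =
      R.comp₂ (R.assoc f g h) (R.hcomp θ (R.hcomp ζ ξ))
  leftUnitor_nat : ∀ {x y : C} {f f' : R.Hom x y} (θ : R.Hom₂ f f'),
    R.comp₂ (R.hcomp (R.id₂ (R.id x)) θ) (R.leftUnitor f') = R.comp₂ (R.leftUnitor f) θ
  rightUnitorInv_nat : ∀ {x y : C} {f f' : R.Hom x y} (θ : R.Hom₂ f f'),
    R.comp₂ θ (R.rightUnitorInv f') = R.comp₂ (R.rightUnitorInv f) (R.hcomp θ (R.id₂ (R.id y)))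
  assoc_inv : ∀ {x y z t : C} (f : R.Hom x y) (g : R.Hom y z) (h : R.Hom z t),
    R.IsInvertible (R.assoc f g h)
  leftUnitor_inv : ∀ {x y : C} (f : R.Hom x y), R.IsInvertible (R.leftUnitor f)
  rightUnitorInv_inv : ∀ {x y : C} (f : R.Hom x y), R.IsInvertible (R.rightUnitorInv f)
  pentagon : ∀ {x y z t s : C} (f : R.Hom x y) (g : R.Hom y z) (h : R.Hom z t) (k : R.Hom t s),
    R.comp₂ (R.hcomp (R.assoc f g h) (R.id₂ k))
        (R.comp₂ (R.assoc f (R.comp g h) k) (R.hcomp (R.id₂ f) (R.assoc g h k))) =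
      R.comp₂ (R.assoc (R.comp f g) h k) (R.assoc f g (R.comp h k))
  triangle : ∀ {x y z : C} (f : R.Hom x y) (g : R.Hom y z),
    R.comp₂ (R.hcomp (R.rightUnitorInv f) (R.id₂ g))
        (R.comp₂ (R.assoc f (R.id y) g) (R.hcomp (R.id₂ f) (R.leftUnitor g))) =
      R.id₂ (R.comp f g)

/-- The type of objects of a raw bicategory that satisfies the axioms. -/
def Total {C : Type u₁} (R : RawBicategory.{w₁, v₁} C) (_ : R.IsLawful) : Type u₁ := C

variable {C : Type u₁} {R : RawBicategory.{w₁, v₁} C}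

instance categoryStruct (hR : R.IsLawful) : CategoryStruct (R.Total hR) where
  Hom := R.Hom
  id := R.id
  comp := R.comp

instance homCategory (hR : R.IsLawful) (x y : R.Total hR) : Category (x ⟶ y) where
  Hom f g := R.Hom₂ f g
  id f := R.id₂ f
  comp θ ζ := R.comp₂ θ ζ
  id_comp := hR.id₂_comp₂
  comp_id := hR.comp₂_id₂
  assoc := hR.comp₂_assoc

/-- An invertible 2-cell as an isomorphism. -/
def IsInvertible.iso {hR : R.IsLawful} {x y : R.Total hR} {f g : x ⟶ y} {θ : f ⟶ g}
    (h : R.IsInvertible θ) : f ≅ g where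
  hom := θ
  inv := h.choose
  hom_inv_id := h.choose_spec.1
  inv_hom_id := h.choose_spec.2

section

variable (hR : R.IsLawful) {x y z t s : R.Total hR}

/-- Horizontal composition in the notation of bicategories. -/
def hcomp' {f f' : x ⟶ y} {g g' : y ⟶ z} (θ : f ⟶ f') (ζ : g ⟶ g') : f ≫ g ⟶ f' ≫ g' :=
  R.hcomp θ ζ

theorem hcomp'_id (f : x ⟶ y) (g : y ⟶ z) : hcomp' hR (𝟙 f) (𝟙 g) = 𝟙 (f ≫ g) :=
  hR.hcomp_id₂ f g

theorem hcomp'_comp {f f' f'' : x ⟶ y} {g g' g'' : y ⟶ z} (θ : f ⟶ f') (θ' : f' ⟶ f'')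
    (ζ : g ⟶ g') (ζ' : g' ⟶ g'') :
    hcomp' hR (θ ≫ θ') (ζ ≫ ζ') = hcomp' hR θ ζ ≫ hcomp' hR θ' ζ' :=
  hR.interchange θ θ' ζ ζ'

/-- The associator as an isomorphism. -/
def assocIso (f : x ⟶ y) (g : y ⟶ z) (h : z ⟶ t) : (f ≫ g) ≫ h ≅ f ≫ g ≫ h :=
  (hR.assoc_inv f g h).iso

/-- The left unitor as an isomorphism. -/
def leftUnitorIso (f : x ⟶ y) : 𝟙 x ≫ f ≅ f := (hR.leftUnitor_inv f).iso

/-- The right unitor as an isomorphism. -/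
def rightUnitorIso (f : x ⟶ y) : f ≫ 𝟙 y ≅ f :=
  Iso.symm (IsInvertible.iso (hR := hR) (f := f) (g := f ≫ 𝟙 y) (hR.rightUnitorInv_inv f))

theorem assocIso_nat {f f' : x ⟶ y} {g g' : y ⟶ z} {h h' : z ⟶ t}
    (θ : f ⟶ f') (ζ : g ⟶ g') (ξ : h ⟶ h') :
    hcomp' hR (hcomp' hR θ ζ) ξ ≫ (assocIso hR f' g' h').hom =
      (assocIso hR f g h).hom ≫ hcomp' hR θ (hcomp' hR ζ ξ) :=
  hR.assoc_nat θ ζ ξ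

theorem leftUnitorIso_nat {f f' : x ⟶ y} (θ : f ⟶ f') :
    hcomp' hR (𝟙 (𝟙 x)) θ ≫ (leftUnitorIso hR f').hom = (leftUnitorIso hR f).hom ≫ θ :=
  hR.leftUnitor_nat θ

theorem rightUnitorIso_nat {f f' : x ⟶ y} (θ : f ⟶ f') :
    θ ≫ (rightUnitorIso hR f').inv = (rightUnitorIso hR f).inv ≫ hcomp' hR θ (𝟙 (𝟙 y)) :=
  hR.rightUnitorInv_nat θ

end

instance bicategory (hR : R.IsLawful) : Bicategory (R.Total hR) where
  whiskerLeft f _ _ η := hcomp' hR (𝟙 f) η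
  whiskerRight η h := hcomp' hR η (𝟙 h)
  associator := assocIso hR
  leftUnitor := leftUnitorIso hR
  rightUnitor := rightUnitorIso hR
  whiskerLeft_id f g := hcomp'_id hR f g
  whiskerLeft_comp f _ _ _ η θ := by rw [← hcomp'_comp, Category.comp_id]
  id_whiskerLeft η := by rw [← Category.assoc, ← leftUnitorIso_nat]; simp
  comp_whiskerLeft f g _ _ η := by
    rw [← Category.assoc, ← assocIso_nat, hcomp'_id]; simp
  id_whiskerRight f g := hcomp'_id hR f g
  comp_whiskerRight η θ h := by rw [← hcomp'_comp, Category.comp_id]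
  whiskerRight_id η := by rw [rightUnitorIso_nat]; simp
  whiskerRight_comp η g h := by
    rw [assocIso_nat, hcomp'_id]; simp
  whisker_assoc f _ _ η h := by
    rw [← Category.assoc, ← assocIso_nat]; simp
  whisker_exchange η θ := by
    rw [← hcomp'_comp, ← hcomp'_comp]; simp
  pentagon f g h k := hR.pentagon f g h k
  triangle {x y z} f g := by
    have h : hcomp' hR (rightUnitorIso hR f).inv (𝟙 g) ≫ (assocIso hR f (𝟙 y) g).hom ≫
      hcomp' hR (𝟙 f) (leftUnitorIso hR g).hom = 𝟙 _ := hR.triangle f g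
    have h' : hcomp' hR (rightUnitorIso hR f).hom (𝟙 g) ≫
        hcomp' hR (rightUnitorIso hR f).inv (𝟙 g) = 𝟙 _ := by
      rw [← hcomp'_comp, Iso.hom_inv_id, Category.comp_id, hcomp'_id]
    calc _ = (hcomp' hR (rightUnitorIso hR f).hom (𝟙 g) ≫
          hcomp' hR (rightUnitorIso hR f).inv (𝟙 g)) ≫ (assocIso hR f (𝟙 y) g).hom ≫
            hcomp' hR (𝟙 f) (leftUnitorIso hR g).hom := by rw [h', Category.id_comp]
      _ = _ := by rw [Category.assoc, h, Category.comp_id]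

end RawBicategory

end Raw

/-! ### The Grothendieck construction -/

/-- Objects of the Grothendieck construction. -/
structure El {B : Type u₁} [Bicategory.{w₁, v₁} B] {X : B → Type u₂}
    [∀ b, Bicategory.{w₂, v₂} (X b)] (F : TrihomData B X) where
  base : B
  fib : X base

namespace El

variable {B : Type u₁} [Bicategory.{w₁, v₁} B] {X : B → Type u₂}
    [∀ b, Bicategory.{w₂, v₂} (X b)] {F : TrihomData B X}

/-- 1-cells of the Grothendieck construction. -/
structure Hom (p q : El F) where
  base : p.base ⟶ q.base
  fib : p.fib ⟶ (F.map base).obj q.fib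

/-- 2-cells of the Grothendieck construction. -/
structure Hom₂ {p q : El F} (f g : Hom p q) where
  base : f.base ⟶ g.base
  fib : f.fib ⟶ g.fib ≫ F.app₂ base q.fib

/-- Identity 1-cells. -/
def Hom.id (p : El F) : Hom p p where
  base := 𝟙 p.base
  fib := F.ιApp p.base p.fib

/-- Composition of 1-cells. -/
def Hom.comp {p q r : El F} (f : Hom p q) (g : Hom q r) : Hom p r where
  base := f.base ≫ g.base
  fib := f.fib ≫ (F.map f.base).map g.fib ≫ F.χApp f.base g.base r.fib

/-- Identity 2-cells. -/
def Hom₂.id {p q : El F} (f : Hom p q) : Hom₂ f f where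
  base := 𝟙 f.base
  fib := (ρ_ f.fib).inv ≫ f.fib ◁ (F.map₂Id f.base q.fib).inv

/-- Vertical composition of 2-cells. -/
def Hom₂.comp {p q : El F} {f g h : Hom p q} (θ : Hom₂ f g) (ζ : Hom₂ g h) : Hom₂ f h where
  base := θ.base ≫ ζ.base
  fib := θ.fib ≫ ζ.fib ▷ F.app₂ θ.base q.fib ≫ (α_ _ _ _).hom ≫
    h.fib ◁ (F.map₂Comp θ.base ζ.base q.fib).inv

/-- The fibre component of the horizontal composite of 2-cells. -/
def hcompFib {p q r : El F} {f f' : Hom p q} {g g' : Hom q r} (θ : Hom₂ f f') (ζ : Hom₂ g g') :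
    f.fib ≫ (F.map f.base).map g.fib ≫ F.χApp f.base g.base r.fib ⟶
      (f'.fib ≫ (F.map f'.base).map g'.fib ≫ F.χApp f'.base g'.base r.fib) ≫
        F.app₂ (hc θ.base ζ.base) r.fib :=
  θ.fib ▷ ((F.map f.base).map g.fib ≫ F.χApp f.base g.base r.fib) ⊗≫
    f'.fib ◁ F.app₂ θ.base q.fib ◁ ((F.map f.base).map₂ ζ.fib ≫ ((F.map f.base).mapComp _ _).hom) ▷
      F.χApp f.base g.base r.fib ⊗≫
    f'.fib ◁ (F.nat₂ θ.base g'.fib).inv ▷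
      ((F.map f.base).map (F.app₂ ζ.base r.fib) ≫ F.χApp f.base g.base r.fib) ⊗≫
    f'.fib ◁ (F.map f'.base).map g'.fib ◁ (F.χ₂ θ.base ζ.base r.fib).hom ⊗≫ 𝟙 _

/-- Horizontal composition of 2-cells. -/
def Hom₂.hcomp {p q r : El F} {f f' : Hom p q} {g g' : Hom q r} (θ : Hom₂ f f')
    (ζ : Hom₂ g g') : Hom₂ (f.comp g) (f'.comp g') where
  base := hc θ.base ζ.base
  fib := hcompFib θ ζ

/-- The fibre component of the associator. -/
def assocFib {p q r s : El F} (f : Hom p q) (g : Hom q r) (h : Hom r s) :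
    (f.fib ≫ (F.map f.base).map g.fib ≫ F.χApp f.base g.base r.fib) ≫
        (F.map (f.base ≫ g.base)).map h.fib ≫ F.χApp (f.base ≫ g.base) h.base s.fib ⟶
      (f.fib ≫ (F.map f.base).map (g.fib ≫ (F.map g.base).map h.fib ≫
          F.χApp g.base h.base s.fib) ≫ F.χApp f.base (g.base ≫ h.base) s.fib) ≫
        F.app₂ (α_ f.base g.base h.base).hom s.fib :=
  𝟙 _ ⊗≫ f.fib ◁ (F.map f.base).map g.fib ◁ (F.χNat f.base g.base h.fib).inv ▷
      F.χApp (f.base ≫ g.base) h.base s.fib ⊗≫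
    f.fib ◁ (F.map f.base).map g.fib ◁ (F.map f.base).map ((F.map g.base).map h.fib) ◁
      (F.ω f.base g.base h.base s.fib).inv ⊗≫
    f.fib ◁ ((F.map f.base).map g.fib ◁ ((F.map f.base).mapComp _ _).inv ≫
        ((F.map f.base).mapComp g.fib
          ((F.map g.base).map h.fib ≫ F.χApp g.base h.base s.fib)).inv) ▷
      (F.χApp f.base (g.base ≫ h.base) s.fib ≫ F.app₂ (α_ f.base g.base h.base).hom s.fib) ⊗≫ 𝟙 _

/-- The associator. -/
def Hom₂.assoc {p q r s : El F} (f : Hom p q) (g : Hom q r) (h : Hom r s) :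
    Hom₂ ((f.comp g).comp h) (f.comp (g.comp h)) where
  base := (α_ f.base g.base h.base).hom
  fib := assocFib f g h

/-- The fibre component of the left unitor. -/
def leftUnitorFib {p q : El F} (f : Hom p q) :
    F.ιApp p.base p.fib ≫ (F.map (𝟙 p.base)).map f.fib ≫ F.χApp (𝟙 p.base) f.base q.fib ⟶
      f.fib ≫ F.app₂ (λ_ f.base).hom q.fib :=
  𝟙 _ ⊗≫ (F.ιNat p.base f.fib).inv ▷ F.χApp (𝟙 p.base) f.base q.fib ⊗≫
    f.fib ◁ (F.δ f.base q.fib).inv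

/-- The left unitor. -/
def Hom₂.leftUnitor {p q : El F} (f : Hom p q) : Hom₂ ((Hom.id p).comp f) f where
  base := (λ_ f.base).hom
  fib := leftUnitorFib f

/-- The fibre component of the inverse of the right unitor. -/
def rightUnitorInvFib {p q : El F} (f : Hom p q) :
    f.fib ⟶ (f.fib ≫ (F.map f.base).map (F.ιApp q.base q.fib) ≫
      F.χApp f.base (𝟙 q.base) q.fib) ≫ F.app₂ (ρ_ f.base).inv q.fib :=
  (ρ_ f.fib).inv ≫ f.fib ◁ (F.γ f.base q.fib).inv ⊗≫ 𝟙 _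

/-- The inverse of the right unitor. -/
def Hom₂.rightUnitorInv {p q : El F} (f : Hom p q) : Hom₂ f (f.comp (Hom.id q)) where
  base := (ρ_ f.base).inv
  fib := rightUnitorInvFib f

variable (F) in
/-- The cells and operations of the Grothendieck construction. -/
def raw : RawBicategory (El F) where
  Hom := Hom
  Hom₂ := Hom₂
  id := Hom.id
  comp := Hom.comp
  id₂ := Hom₂.id
  comp₂ := Hom₂.comp
  hcomp := Hom₂.hcomp
  assoc := Hom₂.assoc
  leftUnitor := Hom₂.leftUnitor
  rightUnitorInv := Hom₂.rightUnitorInv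

variable (F) in
/-- The Grothendieck construction. -/
abbrev Groth (h : (raw F).IsLawful) : Type _ := (raw F).Total h

/-- The projection of the Grothendieck construction to the base. -/
def proj (h : (raw F).IsLawful) : Groth F h ⥤ᵖ B where
  obj p := El.base p
  map f := Hom.base f
  map₂ θ := Hom₂.base θ
  map₂_id _ := rfl
  map₂_comp _ _ := rfl
  mapId _ := Iso.refl _
  mapComp _ _ := Iso.refl _
  map₂_whisker_left f g h η := by
    change hc (𝟙 (Hom.base f)) (Hom₂.base η) = 𝟙 (Hom.base f ≫ Hom.base g) ≫
      Hom.base f ◁ Hom₂.base η ≫ 𝟙 (Hom.base f ≫ Hom.base h)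
    simp [hc]
  map₂_whisker_right {x y z f g} η h := by
    change hc (Hom₂.base η) (𝟙 (Hom.base h)) = 𝟙 (Hom.base f ≫ Hom.base h) ≫
      Hom₂.base η ▷ Hom.base h ≫ 𝟙 (Hom.base g ≫ Hom.base h)
    simp [hc]
  map₂_associator f g k := by
    change (α_ (Hom.base f) (Hom.base g) (Hom.base k)).hom =
      𝟙 ((Hom.base f ≫ Hom.base g) ≫ Hom.base k) ≫ 𝟙 (Hom.base f ≫ Hom.base g) ▷ Hom.base k ≫
        (α_ (Hom.base f) (Hom.base g) (Hom.base k)).hom ≫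
        Hom.base f ◁ 𝟙 (Hom.base g ≫ Hom.base k) ≫ 𝟙 (Hom.base f ≫ Hom.base g ≫ Hom.base k)
    simp
  map₂_left_unitor {p q} f := by
    change (λ_ (Hom.base f)).hom = 𝟙 (𝟙 (El.base p) ≫ Hom.base f) ≫
      𝟙 (𝟙 (El.base p)) ▷ Hom.base f ≫ (λ_ (Hom.base f)).hom
    simp
  map₂_right_unitor {p q} f := by
    change Hom₂.base (ρ_ f).hom = 𝟙 (Hom.base f ≫ 𝟙 (El.base q)) ≫
      Hom.base f ◁ 𝟙 (𝟙 (El.base q)) ≫ (ρ_ (Hom.base f)).hom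
    have h₁ : Hom₂.base (ρ_ f).hom ≫ (ρ_ (Hom.base f)).inv = 𝟙 (Hom.base f ≫ 𝟙 (El.base q)) :=
      congrArg Hom₂.base (ρ_ f).hom_inv_id
    have h₂ : Hom₂.base (ρ_ f).hom = (ρ_ (Hom.base f)).hom :=
      ((Iso.comp_inv_eq (ρ_ (Hom.base f))).1 h₁).trans (Category.id_comp _)
    simpa using h₂

end El

/-! ### The trihomomorphism associated to a fibration -/

section Associated

variable {E : Type u₂} [Bicategory.{w₂, v₂} E] {B : Type u₁} [Bicategory.{w₁, v₁} B]
  {P : E ⥤ᵖ B}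

open Fibre

/-- A cartesian 1-cell strictly over `u` with codomain `e`. -/
structure CartLift₁ (κ : LocalCleavage P) {a b : B} (u : a ⟶ b) (e : Fibre κ b) where
  dom : Fibre κ a
  hom : dom.obj ⟶ e.obj
  map_eq : P.map hom = base₁ dom e u
  cart : IsCartesian₁ P hom

/-- A choice of cartesian 1-cells with given codomain over every 1-cell of the base. -/
def Cleavage (κ : LocalCleavage P) : Type _ :=
  ∀ ⦃a b : B⦄ (u : a ⟶ b) (e : Fibre κ b), CartLift₁ κ u e

/-- Homomorphisms `u^*` between fibres, together with cartesian 1-cells from `u^* e` to `e`, and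
operations on 2-cells and comparison transformations. The cartesian 1-cells are the chosen ones,
and they are pseudo-natural in `e`, by 2-cells over the canonical isomorphisms of `B`. -/
structure AssociatedCore (κ : LocalCleavage P) (κ₁ : Cleavage κ) where
  F : TrihomData B (Fibre κ)
  c {a b : B} (u : a ⟶ b) : ((F.map u).comp (incl κ a)).StrongTrans (incl κ b)
  map_eq {a b : B} (u : a ⟶ b) (e : Fibre κ b) :
    P.map ((c u).app e) = base₁ ((F.map u).obj e) e u
  cart {a b : B} (u : a ⟶ b) (e : Fibre κ b) : IsCartesian₁ P ((c u).app e)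
  chosen {a b : B} (u : a ⟶ b) (e : Fibre κ b) :
    (⟨(F.map u).obj e, (c u).app e, map_eq u e, cart u e⟩ : CartLift₁ κ u e) = κ₁ u e

namespace AssociatedCore

variable {κ : LocalCleavage P} {κ₁ : Cleavage κ} (T : AssociatedCore κ κ₁)

/-- The cartesian 1-cell over `u` at `e`. -/
def cApp {a b : B} (u : a ⟶ b) (e : Fibre κ b) : ((T.F.map u).obj e).obj ⟶ e.obj :=
  (T.c u).app e

/-- The naturality of the cartesian 1-cells over `u`. -/
def cNat {a b : B} (u : a ⟶ b) {e e' : Fibre κ b} (k : e ⟶ e') :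
    J ((T.F.map u).map k) ≫ T.cApp u e' ≅ T.cApp u e ≫ J k :=
  (T.c u).naturality k

/-- The cartesian 1-cell over `u` at `e`, with the 1-cell that it lies over. -/
def cDisp {a b : B} (u : a ⟶ b) (e : Fibre κ b) : Disp ((T.F.map u).obj e) e u :=
  Disp.ofEq (T.cApp u e) (T.map_eq u e)

end AssociatedCore

/-- The cells of `E` that relate the action on 2-cells and the comparison transformations of `F` to
the cartesian cells. -/
structure AssociatedData (κ : LocalCleavage P) (κ₁ : Cleavage κ) extends
    AssociatedCore κ κ₁ where
  /-- The domain of the chosen lift of `σ` at `c v e` factors through `c u e` by `σ^*`. -/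
  fac {a b : B} {u v : a ⟶ b} (σ : u ⟶ v) (e : Fibre κ b) :
    J (F.app₂ σ e) ≫ toAssociatedCore.cApp u e ≅ ((toAssociatedCore.cDisp v e).pull σ).hom
  /-- The composite of `c f` and `c g` factors through `c (f ≫ g)` by `χ`. -/
  x {a b d : B} (f : a ⟶ b) (g : b ⟶ d) (e : Fibre κ d) :
    J (F.χApp f g e) ≫ toAssociatedCore.cApp (f ≫ g) e ≅
      toAssociatedCore.cApp f ((F.map g).obj e) ≫ toAssociatedCore.cApp g e
  /-- The identity factors through `c (𝟙 a)` by `ι`. -/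
  i (a : B) (e : Fibre κ a) : J (F.ιApp a e) ≫ toAssociatedCore.cApp (𝟙 a) e ≅ 𝟙 e.obj

namespace AssociatedData

variable {κ : LocalCleavage P} {κ₁ : Cleavage κ} (T : AssociatedData κ κ₁)

/-- The 2-cell over `σ` from `σ^*` followed by `c u e` to `c v e`. -/
def s {a b : B} {u v : a ⟶ b} (σ : u ⟶ v) (e : Fibre κ b) :
    J (T.F.app₂ σ e) ≫ T.cApp u e ⟶ T.cApp v e :=
  (T.fac σ e).hom ≫ (T.cDisp v e).pullHom σ

end AssociatedData

/-- The trihomomorphism associated to `P`, with the factorisations through cartesian cells that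
define it. -/
structure AssociatedTrihom (κ : LocalCleavage P) (κ₁ : Cleavage κ) extends
    AssociatedData κ κ₁ where
  isTrihom : F.IsTrihom
  -- the factorisations lie over the canonical isomorphisms of `B`
  cNat_base : ∀ {a b : B} (u : a ⟶ b) {e e' : Fibre κ b} (k : e ⟶ e'),
    Disp.Over ((JDisp ((F.map u).map k)).comp (toAssociatedCore.cDisp u e'))
      ((toAssociatedCore.cDisp u e).comp (JDisp k)) (toAssociatedCore.cNat u k).hom
      ((λ_ u).hom ≫ (ρ_ u).inv)
  fac_base : ∀ {a b : B} {u v : a ⟶ b} (σ : u ⟶ v) (e : Fibre κ b),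
    Disp.Over ((JDisp (F.app₂ σ e)).comp (toAssociatedCore.cDisp u e))
      ((toAssociatedCore.cDisp v e).pull σ) (fac σ e).hom (λ_ u).hom
  x_base : ∀ {a b d : B} (f : a ⟶ b) (g : b ⟶ d) (e : Fibre κ d),
    Disp.Over ((JDisp (F.χApp f g e)).comp (toAssociatedCore.cDisp (f ≫ g) e))
      ((toAssociatedCore.cDisp f ((F.map g).obj e)).comp (toAssociatedCore.cDisp g e))
      (x f g e).hom (λ_ (f ≫ g)).hom
  i_base : ∀ (a : B) (e : Fibre κ a),
    Disp.Over ((JDisp (F.ιApp a e)).comp (toAssociatedCore.cDisp (𝟙 a) e)) (Disp.id e)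
      (i a e).hom (λ_ (𝟙 a)).hom
  -- they are natural, which determines the 2-cell components of the transformations
  s_mod : ∀ {a b : B} {u v : a ⟶ b} (σ : u ⟶ v),
    (((TransData.of (F.map₂ σ)).post (incl κ a)).comp (.of (c u))).IsModification
      (.of (c v)) fun e => toAssociatedData.s σ e
  x_mod : ∀ {a b d : B} (f : a ⟶ b) (g : b ⟶ d),
    (((TransData.of (F.χ f g)).post (incl κ a)).comp (.of (c (f ≫ g)))).IsModification
      (((TransData.of (c f)).pre (F.map g)).comp (.of (c g))) fun e => (x f g e).hom
  i_mod : ∀ a : B,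
    (((TransData.of (F.ι a)).post (incl κ a)).comp (.of (c (𝟙 a)))).IsModification
      (.id (incl κ a)) fun e => (i a e).hom
  -- they are compatible with the modifications of `F`, which determines these
  s_comp : ∀ {a b : B} {u v w : a ⟶ b} (σ : u ⟶ v) (τ : v ⟶ w) (e : Fibre κ b),
    toAssociatedData.s (σ ≫ τ) e =
      (J₂ (F.map₂Comp σ τ e).hom ≫ (JComp _ _).hom) ▷ toAssociatedCore.cApp u e ≫
        (α_ _ _ _).hom ≫ J (F.app₂ τ e) ◁ toAssociatedData.s σ e ≫ toAssociatedData.s τ e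
  s_id : ∀ {a b : B} (u : a ⟶ b) (e : Fibre κ b),
    toAssociatedData.s (𝟙 u) e =
      (J₂ (F.map₂Id u e).hom ≫ (JId _).hom) ▷ toAssociatedCore.cApp u e ≫ (λ_ _).hom
  χ₂_eq : ∀ {a b d : B} {f f' : a ⟶ b} {g g' : b ⟶ d} (α : f ⟶ f') (β : g ⟶ g')
    (e : Fibre κ d),
    ((JComp₃ _ _ _).inv ≫ J₂ (F.χ₂ α β e).hom ≫ (JComp _ _).hom) ▷
          toAssociatedCore.cApp (f ≫ g) e ⊗≫
        J (F.χApp f' g' e) ◁ toAssociatedData.s (hc α β) e ≫ (x f' g' e).hom =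
      𝟙 _ ⊗≫ J (F.app₂ α ((F.map g').obj e)) ◁ J ((F.map f).map (F.app₂ β e)) ◁
          (x f g e).hom ⊗≫
        J (F.app₂ α ((F.map g').obj e)) ◁ (toAssociatedCore.cNat f (F.app₂ β e)).hom ▷
          toAssociatedCore.cApp g e ⊗≫
        toAssociatedData.s α ((F.map g').obj e) ▷
          (J (F.app₂ β e) ≫ toAssociatedCore.cApp g e) ≫
        toAssociatedCore.cApp f' ((F.map g').obj e) ◁ toAssociatedData.s β e
  ω_eq : ∀ {a b d d' : B} (f : a ⟶ b) (g : b ⟶ d) (h : d ⟶ d') (e : Fibre κ d'),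
    ((JComp₃ _ _ _).inv ≫ J₂ (F.ω f g h e).hom ≫ (JComp _ _).hom) ▷
          toAssociatedCore.cApp ((f ≫ g) ≫ h) e ⊗≫
        J (F.χApp f g ((F.map h).obj e)) ◁ (x (f ≫ g) h e).hom ⊗≫
        (x f g ((F.map h).obj e)).hom ▷ toAssociatedCore.cApp h e ⊗≫ 𝟙 _ =
      𝟙 _ ⊗≫ J ((F.map f).map (F.χApp g h e)) ◁ J (F.χApp f (g ≫ h) e) ◁
          toAssociatedData.s (α_ f g h).hom e ⊗≫
        J ((F.map f).map (F.χApp g h e)) ◁ (x f (g ≫ h) e).hom ⊗≫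
        (toAssociatedCore.cNat f (F.χApp g h e)).hom ▷ toAssociatedCore.cApp (g ≫ h) e ⊗≫
        toAssociatedCore.cApp f ((F.map g).obj ((F.map h).obj e)) ◁ (x g h e).hom
  γ_eq : ∀ {a b : B} (f : a ⟶ b) (e : Fibre κ b),
    ((JComp₃ _ _ _).inv ≫ J₂ (F.γ f e).hom ≫ (JId _).hom) ▷ toAssociatedCore.cApp f e ≫
        (λ_ _).hom =
      𝟙 _ ⊗≫ J ((F.map f).map (F.ιApp b e)) ◁ J (F.χApp f (𝟙 b) e) ◁
          toAssociatedData.s (ρ_ f).inv e ≫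
        J ((F.map f).map (F.ιApp b e)) ◁ (x f (𝟙 b) e).hom ⊗≫
        (toAssociatedCore.cNat f (F.ιApp b e)).hom ▷ toAssociatedCore.cApp (𝟙 b) e ⊗≫
        toAssociatedCore.cApp f e ◁ (i b e).hom ≫ (ρ_ _).hom
  δ_eq : ∀ {a b : B} (f : a ⟶ b) (e : Fibre κ b),
    (J₂ (F.δ f e).hom ≫ (JComp _ _).hom) ▷ toAssociatedCore.cApp (𝟙 a ≫ f) e ⊗≫
        J (F.ιApp a ((F.map f).obj e)) ◁ (x (𝟙 a) f e).hom ⊗≫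
        (i a ((F.map f).obj e)).hom ▷ toAssociatedCore.cApp f e ≫ (λ_ _).hom =
      toAssociatedData.s (λ_ f).hom e

end Associated

/-! ### The comparison homomorphism -/

section Comparison

/-- The data of a homomorphism of bicategories, without the axioms. -/
structure PseudofunctorData (C : Type u₁) [Bicategory.{w₁, v₁} C] (D : Type u₂)
    [Bicategory.{w₂, v₂} D] extends PrelaxFunctorStruct C D where
  mapId (x : C) : map (𝟙 x) ≅ 𝟙 (obj x)
  mapComp {x y z : C} (f : x ⟶ y) (g : y ⟶ z) : map (f ≫ g) ≅ map f ≫ map g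

namespace PseudofunctorData

variable {C : Type u₁} [Bicategory.{w₁, v₁} C] {D : Type u₂} [Bicategory.{w₂, v₂} D]

/-- The axioms of a homomorphism of bicategories. -/
structure IsLawful (H : PseudofunctorData C D) : Prop where
  map₂_id : ∀ {x y : C} (f : x ⟶ y), H.map₂ (𝟙 f) = 𝟙 (H.map f)
  map₂_comp : ∀ {x y : C} {f g h : x ⟶ y} (θ : f ⟶ g) (ζ : g ⟶ h),
    H.map₂ (θ ≫ ζ) = H.map₂ θ ≫ H.map₂ ζ
  map₂_whisker_left : ∀ {x y z : C} (f : x ⟶ y) {g h : y ⟶ z} (θ : g ⟶ h),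
    H.map₂ (f ◁ θ) = (H.mapComp f g).hom ≫ H.map f ◁ H.map₂ θ ≫ (H.mapComp f h).inv
  map₂_whisker_right : ∀ {x y z : C} {f g : x ⟶ y} (θ : f ⟶ g) (h : y ⟶ z),
    H.map₂ (θ ▷ h) = (H.mapComp f h).hom ≫ H.map₂ θ ▷ H.map h ≫ (H.mapComp g h).inv
  map₂_associator : ∀ {x y z t : C} (f : x ⟶ y) (g : y ⟶ z) (h : z ⟶ t),
    H.map₂ (α_ f g h).hom = (H.mapComp (f ≫ g) h).hom ≫ (H.mapComp f g).hom ▷ H.map h ≫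
      (α_ (H.map f) (H.map g) (H.map h)).hom ≫ H.map f ◁ (H.mapComp g h).inv ≫
      (H.mapComp f (g ≫ h)).inv
  map₂_left_unitor : ∀ {x y : C} (f : x ⟶ y),
    H.map₂ (λ_ f).hom = (H.mapComp (𝟙 x) f).hom ≫ (H.mapId x).hom ▷ H.map f ≫
      (λ_ (H.map f)).hom
  map₂_right_unitor : ∀ {x y : C} (f : x ⟶ y),
    H.map₂ (ρ_ f).hom = (H.mapComp f (𝟙 y)).hom ≫ H.map f ◁ (H.mapId y).hom ≫
      (ρ_ (H.map f)).hom

/-- Data that satisfies the axioms as a homomorphism. -/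
def IsLawful.toPseudofunctor {H : PseudofunctorData C D} (hH : H.IsLawful) : C ⥤ᵖ D where
  toPrelaxFunctorStruct := H.toPrelaxFunctorStruct
  map₂_id := hH.map₂_id
  map₂_comp := hH.map₂_comp
  mapId := H.mapId
  mapComp := H.mapComp
  map₂_whisker_left := hH.map₂_whisker_left
  map₂_whisker_right := hH.map₂_whisker_right
  map₂_associator f g h := by simp [hH.map₂_associator f g h]
  map₂_left_unitor := hH.map₂_left_unitor
  map₂_right_unitor := hH.map₂_right_unitor

end PseudofunctorData

namespace AssociatedTrihom

variable {E : Type u₂} [Bicategory.{w₂, v₂} E] {B : Type u₁} [Bicategory.{w₁, v₁} B]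
  {P : E ⥤ᵖ B} {κ : LocalCleavage P} {κ₁ : Cleavage κ} (T : AssociatedTrihom κ κ₁)

open Fibre

/-- The composite in `E` of the fibre component of a 1-cell and a chosen cartesian 1-cell. -/
def compDisp {p q : El T.F} (f : El.Hom p q) : Disp p.fib q.fib (𝟙 p.base ≫ f.base) :=
  (JDisp f.fib).comp (T.cDisp f.base q.fib)

/-- The comparison on 1-cells: the domain of the chosen cartesian lift of `f.base ≅ 𝟙 ≫ f.base` at
the composite of the fibre component and a chosen cartesian 1-cell. -/
def compMap {p q : El T.F} (f : El.Hom p q) : p.fib.obj ⟶ q.fib.obj :=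
  ((T.compDisp f).pull (λ_ f.base).inv).hom

/-- The chosen cartesian lift. -/
def r {p q : El T.F} (f : El.Hom p q) : T.compMap f ≅ J f.fib ≫ T.cApp f.base q.fib :=
  (T.compDisp f).pullIso (λ_ f.base).symm

/-- The comparison on 2-cells. -/
def compMap₂ {p q : El T.F} {f g : El.Hom p q} (θ : El.Hom₂ f g) : T.compMap f ⟶ T.compMap g :=
  (T.r f).hom ≫ (J₂ θ.fib ≫ (JComp _ _).hom) ▷ T.cApp f.base q.fib ≫ (α_ _ _ _).hom ≫
    J g.fib ◁ T.s θ.base q.fib ≫ (T.r g).inv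

/-- The comparison preserves identities. -/
def compMapId (p : El T.F) : T.compMap (El.Hom.id p) ≅ 𝟙 p.fib.obj :=
  T.r (El.Hom.id p) ≪≫ T.i p.base p.fib

/-- The comparison preserves composition. -/
def compMapComp {p q q' : El T.F} (f : El.Hom p q) (g : El.Hom q q') :
    T.compMap (f.comp g) ≅ T.compMap f ≫ T.compMap g :=
  T.r (f.comp g) ≪≫
    whiskerRightIso (JComp₃ f.fib ((T.F.map f.base).map g.fib) (T.F.χApp f.base g.base q'.fib))
      (T.cApp (f.base ≫ g.base) q'.fib) ≪⊗≫
    whiskerLeftIso (J f.fib) (whiskerLeftIso (J ((T.F.map f.base).map g.fib))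
      (T.x f.base g.base q'.fib)) ≪⊗≫
    whiskerLeftIso (J f.fib) (whiskerRightIso (T.cNat f.base g.fib) (T.cApp g.base q'.fib)) ≪⊗≫
    whiskerRightIso (T.r f).symm (J g.fib ≫ T.cApp g.base q'.fib) ≪≫
    whiskerLeftIso (T.compMap f) (T.r g).symm

/-- The data of the comparison from the Grothendieck construction to `E`. -/
def comparison (h : (El.raw T.F).IsLawful) : PseudofunctorData (El.Groth T.F h) E where
  obj p := (El.fib p).obj
  map f := T.compMap f
  map₂ θ := T.compMap₂ θ
  mapId p := T.compMapId p
  mapComp f g := T.compMapComp f g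

end AssociatedTrihom

end Comparison

end

end FibredBicat

/-! A cartesian 1-cell `c` followed by a cartesian 2-cell `R` detects 2-cells. A 2-cell `d : k ⟶ l`
is determined by its image in `B` together with `d ▷ c ≫ R`, and it exists as soon as a prescribed
image and a prescribed composite are compatible (`IsCartesian₁.existsUnique_fac`). Between 1-cells
of a fibre the image in `B` is forced, so 2-cells of a fibre amount to 2-cells of `E` over a given
2-cell of `B`. Everything rests on this principle.

Its existence half produces the trihomomorphism. The homomorphisms `u^*` with their constraints, the
transformations `σ^*`, `χ`, `ι` and all structural modifications arise by factoring cells of `E`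
through chosen cartesian cells, two cells over the same 2-cell of `B` giving comparable
factorisations (`exists_lift_hom`, `exists_lift_hom₂`, `exists_lift_iso`). Its uniqueness half
proves the axioms. Each of them equates two 2-cells of a fibre, and after composition with cartesian
cells both sides become the same pasting in `E` (`fibre_hom_ext`). The 1-cells `χ` and `ι` are
equivalences because source and target are domains of 1-cells with the same weak universal property
(`Disp.IsTerminal`).

To make these verifications mechanical, 2-cells act by postcomposition on a variable 1-cell `m`, and
composites are bracketed to the left. Associators then disappear, and two kinds of rules suffice:
interchange laws (`Slide`), and rules that eliminate a structural cell of `F` standing in front of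
cartesian cells.

A 2-cell of the Grothendieck construction is interpreted in `E` by `cell`. By the same principle
this is a bijection (`cell_injective`, `cell_surjective`), and it carries the operations of the
Grothendieck construction to those of `E`. Hence the axioms of a bicategory need not be verified by
hand: they are reflected from `E` (`RawBicategory.Interpretation.isLawful`), and the same formulas
say that `H` is a homomorphism. Finally `H` reaches every object, is bijective on 2-cells, and
reaches every 1-cell up to an isomorphism over an identity of `B`. Cartesian cells therefore
correspond under `H` (`IsStrictBiequivalence`). As `PH` equals the projection strictly, the
projection is a fibration and `H` is a cartesian biequivalence. -/

namespace FibredBicat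

noncomputable section

section

/-! ### Cartesian 1-cells and 2-cells, and the existence of cleavages. -/

section CartesianCells

variable {E : Type u₂} [Bicategory.{w₂, v₂} E] {B : Type u₁} [Bicategory.{w₁, v₁} B]
  {P : E ⥤ᵖ B}

theorem isHomLift_iff {x y : E} {f g : x ⟶ y} {φ : f ⟶ g} {τ : P.map f ⟶ P.map g} :
    (P.mapFunctor x y).IsHomLift τ φ ↔ P.map₂ φ = τ := by
  constructor
  · intro h
    have e : τ = 𝟙 _ ≫ P.map₂ φ ≫ 𝟙 _ := IsHomLift.fac (P.mapFunctor x y) τ φ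
    simpa using e.symm
  · rintro rfl
    exact IsHomLift.map (P.mapFunctor x y) φ

/-- The conditions `IsHomLift` in the universal property become plain equations between 2-cells of
`B`, which can be used for rewriting. -/
theorem isCartesian₂_iff {x y : E} {f g : x ⟶ y} {α : f ⟶ g} :
    IsCartesian₂ P α ↔ ∀ {h : x ⟶ y} (φ : h ⟶ g) (τ : P.map h ⟶ P.map f),
      P.map₂ φ = τ ≫ P.map₂ α → ∃! χ : h ⟶ f, P.map₂ χ = τ ∧ χ ≫ α = φ := by
  constructor
  · intro hα h φ τ e
    obtain ⟨χ, ⟨h₁, h₂⟩, h₃⟩ := @Functor.IsStronglyCartesian.universal_property' _ _ _ _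
      (P.mapFunctor x y) _ _ _ _ _ _ hα h τ φ (isHomLift_iff.2 e)
    exact ⟨χ, ⟨isHomLift_iff.1 h₁, h₂⟩, fun ξ hξ => h₃ ξ ⟨isHomLift_iff.2 hξ.1, hξ.2⟩⟩
  · intro H
    refine { toIsHomLift := isHomLift_iff.2 rfl, universal_property' := ?_ }
    intro h τ φ hφ
    obtain ⟨χ, ⟨h₁, h₂⟩, h₃⟩ := H φ τ (isHomLift_iff.1 hφ)
    exact ⟨χ, ⟨isHomLift_iff.2 h₁, h₂⟩, fun ξ hξ => h₃ ξ ⟨isHomLift_iff.1 hξ.1, hξ.2⟩⟩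

namespace IsCartesian₂

variable {x y z : E} {f g h : x ⟶ y}

theorem ext {α : f ⟶ g} (hα : IsCartesian₂ P α) {θ ζ : h ⟶ f} (hb : P.map₂ θ = P.map₂ ζ)
    (e : θ ≫ α = ζ ≫ α) : θ = ζ :=
  (isCartesian₂_iff.1 hα (ζ ≫ α) (P.map₂ ζ) (by simp)).unique ⟨hb, e⟩ ⟨rfl, rfl⟩

theorem of_isIso (α : f ⟶ g) [IsIso α] : IsCartesian₂ P α := by
  rw [isCartesian₂_iff]
  intro h φ τ e
  refine ⟨φ ≫ inv α, ⟨?_, by simp⟩, ?_⟩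
  · have : P.map₂ α ≫ P.map₂ (inv α) = 𝟙 _ := by simp
    rw [P.map₂_comp, e, Category.assoc, this, Category.comp_id]
  · rintro χ ⟨-, rfl⟩
    simp

theorem comp {α : f ⟶ g} {β : g ⟶ h} (hα : IsCartesian₂ P α) (hβ : IsCartesian₂ P β) :
    IsCartesian₂ P (α ≫ β) := by
  rw [isCartesian₂_iff]
  intro k φ τ e
  obtain ⟨χ, ⟨h₁, h₂⟩, -⟩ := isCartesian₂_iff.1 hβ φ (τ ≫ P.map₂ α) (by simpa using e)
  obtain ⟨ξ, ⟨h₃, h₄⟩, -⟩ := isCartesian₂_iff.1 hα χ τ h₁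
  refine ⟨ξ, ⟨h₃, by rw [← Category.assoc, h₄, h₂]⟩, ?_⟩
  rintro ξ' ⟨h₅, h₆⟩
  refine hα.ext (h₅.trans h₃.symm) (hβ.ext (by simp [h₅, h₃]) ?_)
  rw [Category.assoc, h₆, h₄, h₂]

/-- Whiskering is horizontal composition with an identity 2-cell, which is cartesian because it is
invertible. -/
theorem whiskerLeft (hP : IsFibration P) (k : z ⟶ x) {α : f ⟶ g} (hα : IsCartesian₂ P α) :
    IsCartesian₂ P (k ◁ α) := by
  simpa using hP.hcomp_cartesian (𝟙 k) α (of_isIso _) hα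

theorem whiskerRight (hP : IsFibration P) {α : f ⟶ g} (hα : IsCartesian₂ P α) (k : y ⟶ z) :
    IsCartesian₂ P (α ▷ k) := by
  simpa using hP.hcomp_cartesian α (𝟙 k) hα (of_isIso _)

end IsCartesian₂

/-- The source of `σ` agrees with the image of the domain of the lift only propositionally. Once
that equality is substituted, `σ` is the image of the lift itself. -/
theorem CartLift₂.isCartesian₂ {x y : E} {g : x ⟶ y} {w : P.obj x ⟶ P.obj y}
    {σ : w ⟶ P.map g} (L : CartLift₂ P g σ) : IsCartesian₂ P L.hom := by
  have := L.cart
  have h := L.domain_eq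
  have h' := L.map₂_eq
  obtain ⟨dom, hom, cart⟩ := L
  dsimp only at *
  subst h
  simp only [eqToHom_refl, Category.id_comp] at h'
  subst h'
  exact cart

namespace IsCartesian₁

variable {x y z : E} {c : x ⟶ y}

/-- A 2-cell between composites with a cartesian 1-cell is whiskered from a unique 2-cell over a
given 2-cell of the base. -/
theorem existsUnique_whiskerRight (hc : IsCartesian₁ P c) {k l : z ⟶ x} (θ : k ≫ c ⟶ l ≫ c)
    (δ : P.map k ⟶ P.map l)
    (hδ : P.map₂ θ = (P.mapComp k c).hom ≫ δ ▷ P.map c ≫ (P.mapComp l c).inv) :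
    ∃! d : k ⟶ l, d ▷ c = θ ∧ P.map₂ d = δ := by
  -- The composites `k ≫ c` and `l ≫ c` are regarded as lifts of themselves, with identity
  -- comparisons, along the inverse compositors of `P`.
  have := hc.exists_unique θ
    (L := ⟨k, Iso.refl _, Iso.refl _, by simp⟩) (L' := ⟨l, Iso.refl _, Iso.refl _, by simp⟩)
    (α := (P.mapComp k c).symm) (α' := (P.mapComp l c).symm) δ (by simp [hδ])
  simpa [eq_comm] using this

/-- Factorisation through a cartesian 1-cell and a cartesian 2-cell. -/
theorem existsUnique_fac (hc : IsCartesian₁ P c) {k l : z ⟶ x} {n : z ⟶ y} {R : l ≫ c ⟶ n}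
    (hR : IsCartesian₂ P R) (W : k ≫ c ⟶ n) (δ : P.map k ⟶ P.map l)
    (hδ : P.map₂ W = (P.mapComp k c).hom ≫ δ ▷ P.map c ≫ (P.mapComp l c).inv ≫ P.map₂ R) :
    ∃! d : k ⟶ l, d ▷ c ≫ R = W ∧ P.map₂ d = δ := by
  -- `W` is first factored through `R`. The resulting 2-cell `θ : k ≫ c ⟶ l ≫ c` lies over a
  -- whiskering of `δ`, so it is itself a whiskering.
  obtain ⟨θ, ⟨h₁, h₂⟩, -⟩ := isCartesian₂_iff.1 hR W
    ((P.mapComp k c).hom ≫ δ ▷ P.map c ≫ (P.mapComp l c).inv) (by simpa using hδ)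
  obtain ⟨d, ⟨h₃, h₄⟩, h₅⟩ := hc.existsUnique_whiskerRight θ δ h₁
  refine ⟨d, ⟨by rw [h₃, h₂], h₄⟩, ?_⟩
  rintro d' ⟨h₆, h₇⟩
  refine h₅ _ ⟨hR.ext ?_ (h₆.trans h₂.symm), h₇⟩
  rw [h₁]
  simp [h₇]

/-- The uniqueness half of `existsUnique_fac`. It matters that `R` is only required to be cartesian:
later tests involve the cells over arbitrary 2-cells `σ` of `B`, which need not be invertible. -/
theorem hom_ext (hc : IsCartesian₁ P c) {k l : z ⟶ x} {n : z ⟶ y} {R : l ≫ c ⟶ n}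
    (hR : IsCartesian₂ P R) {d d' : k ⟶ l} (hb : P.map₂ d = P.map₂ d')
    (h : d ▷ c ≫ R = d' ▷ c ≫ R) : d = d' :=
  (hc.existsUnique_fac hR (d' ▷ c ≫ R) (P.map₂ d') (by simp)).unique ⟨h, hb⟩ ⟨rfl, rfl⟩

end IsCartesian₁

theorem IsFibration.nonempty_localCleavage (hP : IsFibration P) : Nonempty (LocalCleavage P) := by
  refine ⟨⟨fun {x y} g {w} σ => Classical.choice ?_⟩⟩
  have := hP.locally_fibred x y
  obtain ⟨d, φ, h⟩ := IsPreFibered.exists_isCartesian (P.mapFunctor x y) (a := g) rfl σ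
  -- In a Grothendieck fibration cartesian arrows are strongly cartesian, so the lift provided by
  -- the prefibration is good enough.
  exact ⟨⟨d, φ, @Functor.IsFibered.isStronglyCartesian_of_isCartesian _ _ _ _
    (P.mapFunctor x y) this _ _ σ _ _ φ h⟩⟩

theorem IsFibration.nonempty_cleavage (hP : IsFibration P) (κ : LocalCleavage P) :
    Nonempty (Cleavage κ) := by
  refine ⟨fun a b u e => Classical.choice ?_⟩
  obtain ⟨e, rfl⟩ := e
  obtain ⟨d, rfl, h, h₁, h₂⟩ := hP.exists_cartesian e u
  exact ⟨⟨⟨d, rfl⟩, h, h₁, h₂⟩⟩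

end CartesianCells

end

/-! ### Cartesian 2-cells by instance search, and a calculus of 2-cells acting by postcomposition.
-/

section

/-- Cartesian 2-cells, as a type class. -/
class CartesianCell {E : Type u₂} [Bicategory.{w₂, v₂} E] {B : Type u₁} [Bicategory.{w₁, v₁} B]
    (P : E ⥤ᵖ B) {x y : E} {f g : x ⟶ y} (α : f ⟶ g) : Prop where
  cart : IsCartesian₂ P α

section

variable {E : Type u₂} [Bicategory.{w₂, v₂} E] {B : Type u₁} [Bicategory.{w₁, v₁} B]
  (P : E ⥤ᵖ B) {x y z : E} {f g h : x ⟶ y}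

/-- With these four instances, a pasting of invertible cells and cartesian lifts is recognised as
cartesian automatically. This discharges the side condition of `fibre_hom_ext` for every test cell;
invertibility is tried last. -/
instance (priority := low) CartesianCell.of_isIso (α : f ⟶ g) [IsIso α] : CartesianCell P α :=
  ⟨.of_isIso α⟩

instance CartesianCell.comp (α : f ⟶ g) (β : g ⟶ h) [hα : CartesianCell P α]
    [hβ : CartesianCell P β] : CartesianCell P (α ≫ β) := ⟨hα.cart.comp hβ.cart⟩

instance CartesianCell.whiskerRight [hP : Fact (IsFibration P)] (α : f ⟶ g)
    [hα : CartesianCell P α] (k : y ⟶ z) : CartesianCell P (α ▷ k) := ⟨hα.cart.whiskerRight hP.out k⟩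

instance CartesianCell.whiskerLeft [hP : Fact (IsFibration P)] (k : z ⟶ x) (α : f ⟶ g)
    [hα : CartesianCell P α] : CartesianCell P (k ◁ α) := ⟨hα.cart.whiskerLeft hP.out k⟩

end

/-! ### 2-cells acting by postcomposition -/

section Act

variable {E : Type u₂} [Bicategory.{w₂, v₂} E] {z x y y' w w' : E}

/-- The equation `a ≫ b = d` together with its whiskered and reassociated forms. -/
abbrev Slide {f g h : x ⟶ y} (a : f ⟶ g) (b : g ⟶ h) (d : f ⟶ h) : Prop :=
  (a ≫ b = d ∧ ∀ {k : x ⟶ y} (r : h ⟶ k), a ≫ b ≫ r = d ≫ r) ∧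
  (∀ {t : E} (c : y ⟶ t), a ▷ c ≫ b ▷ c = d ▷ c ∧
    ∀ {k : x ⟶ t} (r : h ≫ c ⟶ k), a ▷ c ≫ b ▷ c ≫ r = d ▷ c ≫ r) ∧
  (∀ {t t' : E} (c : y ⟶ t) (c' : t ⟶ t'), a ▷ c ▷ c' ≫ b ▷ c ▷ c' = d ▷ c ▷ c' ∧
    ∀ {k : x ⟶ t'} (r : (h ≫ c) ≫ c' ⟶ k),
      a ▷ c ▷ c' ≫ b ▷ c ▷ c' ≫ r = d ▷ c ▷ c' ≫ r) ∧
  (∀ {t t' t'' : E} (c : y ⟶ t) (c' : t ⟶ t') (c'' : t' ⟶ t''),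
    a ▷ c ▷ c' ▷ c'' ≫ b ▷ c ▷ c' ▷ c'' = d ▷ c ▷ c' ▷ c'' ∧
    ∀ {k : x ⟶ t''} (r : ((h ≫ c) ≫ c') ≫ c'' ⟶ k),
      a ▷ c ▷ c' ▷ c'' ≫ b ▷ c ▷ c' ▷ c'' ≫ r = d ▷ c ▷ c' ▷ c'' ≫ r)

/-- All forms follow from the one equation. They are listed separately because `simp` matches
syntactically and would not find the pair inside a longer or whiskered composite. -/
theorem Slide.mk {f g h : x ⟶ y} {a : f ⟶ g} {b : g ⟶ h} {d : f ⟶ h} (e : a ≫ b = d) :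
    Slide a b d := by
  subst e
  refine ⟨⟨?_, ?_⟩, ?_, ?_, ?_⟩ <;> simp

/-- The equation `a = d` together with its whiskered forms. -/
abbrev Expand {f g : x ⟶ y} (a d : f ⟶ g) : Prop :=
  a = d ∧ (∀ {t : E} (c : y ⟶ t), a ▷ c = d ▷ c) ∧
  (∀ {t t' : E} (c : y ⟶ t) (c' : t ⟶ t'), a ▷ c ▷ c' = d ▷ c ▷ c') ∧
  (∀ {t t' t'' : E} (c : y ⟶ t) (c' : t ⟶ t') (c'' : t' ⟶ t''),
    a ▷ c ▷ c' ▷ c'' = d ▷ c ▷ c' ▷ c'')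

theorem Expand.mk {f g : x ⟶ y} {a d : f ⟶ g} (e : a = d) : Expand a d := by
  subst e
  refine ⟨?_, ?_, ?_, ?_⟩ <;> simp

/-- A 2-cell acting on a 1-cell by postcomposition. -/
def act₁₁ (m : z ⟶ x) {f g : x ⟶ y} (θ : f ⟶ g) : m ≫ f ⟶ m ≫ g := m ◁ θ

/-- A 2-cell from a composite acting on a 1-cell by postcomposition. -/
def act₂₁ (m : z ⟶ x) {f : x ⟶ y} {g : y ⟶ w} {h : x ⟶ w} (θ : f ≫ g ⟶ h) :
    (m ≫ f) ≫ g ⟶ m ≫ h := (α_ _ _ _).hom ≫ m ◁ θ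

/-- An isomorphism to an identity acting on a 1-cell by postcomposition. -/
def act₁₀ (m : z ⟶ x) {f : x ⟶ x} (θ : f ≅ 𝟙 x) : m ≫ f ≅ m :=
  whiskerLeftIso m θ ≪≫ ρ_ m

/-- An isomorphism to a composite acting on a 1-cell by postcomposition. -/
def act₁₂ (m : z ⟶ x) {f : x ⟶ w} {g : x ⟶ y} {h : y ⟶ w} (θ : f ≅ g ≫ h) :
    m ≫ f ≅ (m ≫ g) ≫ h := whiskerLeftIso m θ ≪≫ (α_ _ _ _).symm

/-- An isomorphism from a composite to an identity acting on a 1-cell by postcomposition. -/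
def act₂₀ (m : z ⟶ x) {f : x ⟶ y} {g : y ⟶ x} (θ : f ≫ g ≅ 𝟙 x) : (m ≫ f) ≫ g ≅ m :=
  α_ _ _ _ ≪≫ whiskerLeftIso m θ ≪≫ ρ_ m

/-- An isomorphism of composites acting on a 1-cell by postcomposition. -/
def act₂₂ (m : z ⟶ x) {f : x ⟶ y} {g : y ⟶ w} {h : x ⟶ y'} {k : y' ⟶ w} (θ : f ≫ g ≅ h ≫ k) :
    (m ≫ f) ≫ g ≅ (m ≫ h) ≫ k := α_ _ _ _ ≪≫ whiskerLeftIso m θ ≪≫ (α_ _ _ _).symm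

variable {m m' : z ⟶ x} (μ : m ⟶ m')

/-- This and its variants are the interchange law. With composites bracketed to the left, a 2-cell
on the initial factor slides past an action on later factors without any associator appearing. -/
theorem act₁₁_slide {f g : x ⟶ y} (θ : f ⟶ g) :
    Slide (μ ▷ f) (act₁₁ m' θ) (act₁₁ m θ ≫ μ ▷ g) := .mk (by
  simp [act₁₁, whisker_exchange])

theorem act₂₁_slide {f : x ⟶ y} {g : y ⟶ w} {h : x ⟶ w} (θ : f ≫ g ⟶ h) :
    Slide (μ ▷ f ▷ g) (act₂₁ m' θ) (act₂₁ m θ ≫ μ ▷ h) := .mk (by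
  simp [act₂₁, whisker_exchange])

theorem act₁₀_slide {f : x ⟶ x} (θ : f ≅ 𝟙 x) :
    Slide (μ ▷ f) (act₁₀ m' θ).hom ((act₁₀ m θ).hom ≫ μ) := .mk (by
  simp [act₁₀, ← whisker_exchange_assoc])

theorem act₁₂_slide {f : x ⟶ w} {g : x ⟶ y} {h : y ⟶ w} (θ : f ≅ g ≫ h) :
    Slide (μ ▷ f) (act₁₂ m' θ).hom ((act₁₂ m θ).hom ≫ μ ▷ g ▷ h) := .mk (by
  simp [act₁₂, ← whisker_exchange_assoc])

theorem act₂₀_slide {f : x ⟶ y} {g : y ⟶ x} (θ : f ≫ g ≅ 𝟙 x) :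
    Slide (μ ▷ f ▷ g) (act₂₀ m' θ).hom ((act₂₀ m θ).hom ≫ μ) := .mk (by
  have h := whisker_exchange μ θ.hom
  -- The associator turns the double whiskering of `μ` into a whiskering by `f ≫ g`, to which the
  -- exchange law with `θ` as a whole applies.
  rw [← cancel_epi (α_ m f g).inv]
  simp [act₂₀, -whiskerRight_comp, ← whiskerRight_comp_assoc, ← reassoc_of% h])

theorem act₂₂_slide {f : x ⟶ y} {g : y ⟶ w} {h : x ⟶ y'} {k : y' ⟶ w} (θ : f ≫ g ≅ h ≫ k) :
    Slide (μ ▷ f ▷ g) (act₂₂ m' θ).hom ((act₂₂ m θ).hom ≫ μ ▷ h ▷ k) := .mk (by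
  have h := whisker_exchange μ θ.hom
  rw [← cancel_epi (α_ m f g).inv]
  simp [act₂₂, -whiskerRight_comp, ← whiskerRight_comp_assoc, ← reassoc_of% h]
  simp)

theorem act₁₂_inv_slide {f : x ⟶ w} {g : x ⟶ y} {h : y ⟶ w} (θ : f ≅ g ≫ h) :
    Slide (act₁₂ m θ).inv (μ ▷ f) (μ ▷ g ▷ h ≫ (act₁₂ m' θ).inv) := .mk (by
  rw [Iso.inv_comp_eq, ← Category.assoc, Iso.eq_comp_inv]; exact (act₁₂_slide μ θ).1.1)

theorem act₂₂_inv_slide {f : x ⟶ y} {g : y ⟶ w} {h : x ⟶ y'} {k : y' ⟶ w} (θ : f ≫ g ≅ h ≫ k) :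
    Slide (act₂₂ m θ).inv (μ ▷ f ▷ g) (μ ▷ h ▷ k ≫ (act₂₂ m' θ).inv) := .mk (by
  rw [Iso.inv_comp_eq, ← Category.assoc, Iso.eq_comp_inv]; exact (act₂₂_slide μ θ).1.1)

@[simp] theorem iso_inv_hom_slide {f g : x ⟶ y} (φ : f ≅ g) : Slide φ.inv φ.hom (𝟙 g) :=
  .mk φ.inv_hom_id

theorem act₁₁_comp {f g h : x ⟶ y} (m : z ⟶ x) (θ : f ⟶ g) (ζ : g ⟶ h) :
    act₁₁ m (θ ≫ ζ) = act₁₁ m θ ≫ act₁₁ m ζ := by simp [act₁₁]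

theorem act₁₁_id (m : z ⟶ x) (f : x ⟶ y) : act₁₁ m (𝟙 f) = 𝟙 _ := by simp [act₁₁]

theorem eq_of_act₁₁_eq {f g : x ⟶ y} {θ ζ : f ⟶ g} (h : act₁₁ (𝟙 x) θ = act₁₁ (𝟙 x) ζ) :
    θ = ζ := by
  simpa [act₁₁] using h

end Act

/-! ### 2-cells of the fibres acting by postcomposition -/

section FibreAct

variable {E : Type u₂} [Bicategory.{w₂, v₂} E] {B : Type u₁} [Bicategory.{w₁, v₁} B]
  {P : E ⥤ᵖ B} {κ : LocalCleavage P} {b : B} {e e' e'' e₃ : Fibre κ b} {z : E}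

open Fibre

/-- A 2-cell of a fibre acting by postcomposition. -/
def fact (m : z ⟶ e.obj) {k l : e ⟶ e'} (θ : k ⟶ l) : m ≫ J k ⟶ m ≫ J l := act₁₁ m (J₂ θ)

/-- The comparison of composites in a fibre acting by postcomposition. -/
def jc (m : z ⟶ e.obj) (k : e ⟶ e') (l : e' ⟶ e'') : m ≫ J (k ≫ l) ≅ (m ≫ J k) ≫ J l :=
  act₁₂ m (JComp k l)

/-- The comparison of identities in a fibre acting by postcomposition. -/
def ju (m : z ⟶ e.obj) : m ≫ J (𝟙 e) ≅ m := act₁₀ m (JId e)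

variable {m m' : z ⟶ e.obj} (μ : m ⟶ m')

@[simp] theorem fact_slide {k l : e ⟶ e'} (θ : k ⟶ l) :
    Slide (μ ▷ J k) (fact m' θ) (fact m θ ≫ μ ▷ J l) := act₁₁_slide μ _

@[simp] theorem jc_slide (k : e ⟶ e') (l : e' ⟶ e'') :
    Slide (μ ▷ J (k ≫ l)) (jc m' k l).hom ((jc m k l).hom ≫ μ ▷ J k ▷ J l) := act₁₂_slide μ _

@[simp] theorem jc_inv_slide (k : e ⟶ e') (l : e' ⟶ e'') :
    Slide (jc m k l).inv (μ ▷ J (k ≫ l)) (μ ▷ J k ▷ J l ≫ (jc m' k l).inv) :=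
  act₁₂_inv_slide μ _

@[simp] theorem ju_slide : Slide (μ ▷ J (𝟙 e)) (ju m').hom ((ju m).hom ≫ μ) := act₁₀_slide μ _

variable (m)

@[simp] theorem fact_comp {k l n : e ⟶ e'} (θ : k ⟶ l) (ζ : l ⟶ n) :
    fact m (θ ≫ ζ) = fact m θ ≫ fact m ζ := act₁₁_comp _ _ _

@[simp] theorem fact_id (k : e ⟶ e') : fact m (𝟙 k) = 𝟙 _ := act₁₁_id _ _

-- Whiskering in the fibre is, by definition, whiskering in `E` conjugated by chosen lifts. A left
-- whiskering by `k` is absorbed into the 1-cell acted upon, which becomes `m ≫ J k`; this is the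
-- reason for letting `m` vary.
@[simp] theorem fact_whiskerLeft (k : e ⟶ e') {l n : e' ⟶ e''} (θ : l ⟶ n) :
    fact m (k ◁ θ) = (jc m k l).hom ≫ fact (m ≫ J k) θ ≫ (jc m k n).inv := by
  have h : J₂ (k ◁ θ) = (JComp k l).hom ≫ J k ◁ J₂ θ ≫ (JComp k n).inv := rfl
  simp [fact, act₁₁, jc, act₁₂, h]

@[simp] theorem fact_whiskerRight {k l : e ⟶ e'} (θ : k ⟶ l) (n : e' ⟶ e'') :
    fact m (θ ▷ n) = (jc m k n).hom ≫ fact m θ ▷ J n ≫ (jc m l n).inv := by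
  have h : J₂ (θ ▷ n) = (JComp k n).hom ≫ J₂ θ ▷ J n ≫ (JComp l n).inv := rfl
  simp [fact, act₁₁, jc, act₁₂, h]

-- The associators of `E` are cancelled by those built into `jc`, so that only comparisons of
-- composites remain.
@[simp] theorem fact_associator (k : e ⟶ e') (l : e' ⟶ e'') (n : e'' ⟶ e₃) :
    fact m (α_ k l n).hom = (jc m (k ≫ l) n).hom ≫ (jc m k l).hom ▷ J n ≫
      (jc (m ≫ J k) l n).inv ≫ (jc m k (l ≫ n)).inv := by
  have h : J₂ (α_ k l n).hom = (JComp (k ≫ l) n).hom ≫ (JComp k l).hom ▷ J n ≫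
    (α_ (J k) (J l) (J n)).hom ≫ J k ◁ (JComp l n).inv ≫ (JComp k (l ≫ n)).inv := rfl
  simp [fact, act₁₁, jc, act₁₂, h]

@[simp] theorem fact_leftUnitor (k : e ⟶ e') :
    fact m (λ_ k).hom = (jc m (𝟙 e) k).hom ≫ (ju m).hom ▷ J k := by
  have h : J₂ (λ_ k).hom = (JComp (𝟙 e) k).hom ≫ (JId e).hom ▷ J k ≫ (λ_ (J k)).hom := rfl
  simp [fact, act₁₁, jc, act₁₂, ju, act₁₀, h]

@[simp] theorem fact_rightUnitor (k : e ⟶ e') :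
    fact m (ρ_ k).hom = (jc m k (𝟙 e')).hom ≫ (ju (m ≫ J k)).hom := by
  have h : J₂ (ρ_ k).hom = (JComp k (𝟙 e')).hom ≫ J k ◁ (JId e').hom ≫ (ρ_ (J k)).hom := rfl
  simp [fact, act₁₁, jc, act₁₂, ju, act₁₀, h]

/-- The action of an isomorphism is invertible by functoriality, so its inverse can be computed from
any right inverse. -/
theorem fact_inv {k l : e ⟶ e'} (θ : k ≅ l) {d : m ≫ J k ⟶ m ≫ J l} {d' : m ≫ J l ⟶ m ≫ J k}
    (h : fact m θ.hom = d) (h' : d ≫ d' = 𝟙 _) : fact m θ.inv = d' := by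
  subst h
  calc _ = fact m θ.inv ≫ fact m θ.hom ≫ d' := by rw [h', Category.comp_id]
    _ = _ := by rw [← Category.assoc, ← fact_comp, Iso.inv_hom_id, fact_id, Category.id_comp]

@[simp] theorem fact_associator_inv (k : e ⟶ e') (l : e' ⟶ e'') (n : e'' ⟶ e₃) :
    fact m (α_ k l n).inv = (jc m k (l ≫ n)).hom ≫ (jc (m ≫ J k) l n).hom ≫
      (jc m k l).inv ▷ J n ≫ (jc m (k ≫ l) n).inv :=
  fact_inv m _ (fact_associator m k l n) (by simp)

@[simp] theorem fact_leftUnitor_inv (k : e ⟶ e') :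
    fact m (λ_ k).inv = (ju m).inv ▷ J k ≫ (jc m (𝟙 e) k).inv :=
  fact_inv m _ (fact_leftUnitor m k) (by simp)

@[simp] theorem fact_rightUnitor_inv (k : e ⟶ e') :
    fact m (ρ_ k).inv = (ju (m ≫ J k)).inv ≫ (jc m k (𝟙 e')).inv :=
  fact_inv m _ (fact_rightUnitor m k) (by simp)

@[simp] theorem fact_inv_hom_slide {k l : e ⟶ e'} (θ : k ≅ l) :
    Slide (fact m θ.inv) (fact m θ.hom) (𝟙 _) := .mk (by simp [← fact_comp, fact_id])

/-- Equality of 2-cells of a fibre can be checked after composition with a cartesian 1-cell and a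
cartesian 2-cell. -/
theorem fibre_hom_ext {y : E} {c : e'.obj ⟶ y} (hc : IsCartesian₁ P c) {k l : e ⟶ e'}
    {n : e.obj ⟶ y} (R : (𝟙 e.obj ≫ J l) ≫ c ⟶ n) [hR : CartesianCell P R] {θ ζ : k ⟶ l}
    (h : fact (𝟙 e.obj) θ ▷ c ≫ R = fact (𝟙 e.obj) ζ ▷ c ≫ R) : θ = ζ := by
  apply hom₂_ext
  -- Parallel 2-cells of a fibre have the same image in `B`, namely a transport along an equality of
  -- 1-cells.
  have hb : P.map₂ (J₂ θ) = P.map₂ (J₂ ζ) := θ.map₂_eq.trans ζ.map₂_eq.symm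
  refine hc.hom_ext (R := (λ_ (J l)).inv ▷ c ≫ R) ((IsCartesian₂.of_isIso _).comp hR.cart) hb ?_
  have h' (ξ : k ⟶ l) : J₂ ξ ▷ c ≫ (λ_ (J l)).inv ▷ c ≫ R =
      (λ_ (J k)).inv ▷ c ≫ fact (𝟙 e.obj) ξ ▷ c ≫ R := by
    simp [fact, act₁₁]
  exact (h' θ).trans ((congrArg _ h).trans (h' ζ).symm)

end FibreAct

end

/-! ### Compatibility of the trihomomorphism with cartesian cells, in acting form. -/

section

section

variable {E : Type u₂} [Bicategory.{w₂, v₂} E] {x y : E}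

/-- The equation `a ≫ a' ≫ b = d` together with its whiskered and reassociated forms. -/
abbrev Slide₃ {f f' g h : x ⟶ y} (a : f ⟶ f') (a' : f' ⟶ g) (b : g ⟶ h) (d : f ⟶ h) : Prop :=
  (a ≫ a' ≫ b = d ∧ ∀ {k : x ⟶ y} (r : h ⟶ k), a ≫ a' ≫ b ≫ r = d ≫ r) ∧
  (∀ {t : E} (c : y ⟶ t), a ▷ c ≫ a' ▷ c ≫ b ▷ c = d ▷ c ∧
    ∀ {k : x ⟶ t} (r : h ≫ c ⟶ k), a ▷ c ≫ a' ▷ c ≫ b ▷ c ≫ r = d ▷ c ≫ r) ∧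
  (∀ {t t' : E} (c : y ⟶ t) (c' : t ⟶ t'),
    a ▷ c ▷ c' ≫ a' ▷ c ▷ c' ≫ b ▷ c ▷ c' = d ▷ c ▷ c' ∧
    ∀ {k : x ⟶ t'} (r : (h ≫ c) ≫ c' ⟶ k),
      a ▷ c ▷ c' ≫ a' ▷ c ▷ c' ≫ b ▷ c ▷ c' ≫ r = d ▷ c ▷ c' ≫ r)

theorem Slide₃.mk {f f' g h : x ⟶ y} {a : f ⟶ f'} {a' : f' ⟶ g} {b : g ⟶ h} {d : f ⟶ h}
    (e : a ≫ a' ≫ b = d) : Slide₃ a a' b d := by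
  subst e
  refine ⟨⟨?_, ?_⟩, ?_, ?_⟩ <;> simp

/-- The equation `a ≫ a' ≫ a'' ≫ b = d` together with its whiskered and reassociated forms. -/
abbrev Slide₄ {f f' f'' g h : x ⟶ y} (a : f ⟶ f') (a' : f' ⟶ f'') (a'' : f'' ⟶ g) (b : g ⟶ h)
    (d : f ⟶ h) : Prop :=
  (a ≫ a' ≫ a'' ≫ b = d ∧ ∀ {k : x ⟶ y} (r : h ⟶ k), a ≫ a' ≫ a'' ≫ b ≫ r = d ≫ r) ∧
  (∀ {t : E} (c : y ⟶ t), a ▷ c ≫ a' ▷ c ≫ a'' ▷ c ≫ b ▷ c = d ▷ c ∧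
    ∀ {k : x ⟶ t} (r : h ≫ c ⟶ k),
      a ▷ c ≫ a' ▷ c ≫ a'' ▷ c ≫ b ▷ c ≫ r = d ▷ c ≫ r) ∧
  (∀ {t t' : E} (c : y ⟶ t) (c' : t ⟶ t'),
    a ▷ c ▷ c' ≫ a' ▷ c ▷ c' ≫ a'' ▷ c ▷ c' ≫ b ▷ c ▷ c' = d ▷ c ▷ c' ∧
    ∀ {k : x ⟶ t'} (r : (h ≫ c) ≫ c' ⟶ k),
      a ▷ c ▷ c' ≫ a' ▷ c ▷ c' ≫ a'' ▷ c ▷ c' ≫ b ▷ c ▷ c' ≫ r = d ▷ c ▷ c' ≫ r)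

theorem Slide₄.mk {f f' f'' g h : x ⟶ y} {a : f ⟶ f'} {a' : f' ⟶ f''} {a'' : f'' ⟶ g} {b : g ⟶ h}
    {d : f ⟶ h} (e : a ≫ a' ≫ a'' ≫ b = d) : Slide₄ a a' a'' b d := by
  subst e
  refine ⟨⟨?_, ?_⟩, ?_, ?_⟩ <;> simp

end

variable {E : Type u₂} [Bicategory.{w₂, v₂} E] {B : Type u₁} [Bicategory.{w₁, v₁} B]
  {P : E ⥤ᵖ B} {κ : LocalCleavage P} {κ₁ : Cleavage κ}

open Fibre

/-- The conditions on the data of an associated trihomomorphism, apart from the axioms of a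
trihomomorphism. -/
class AssociatedData.IsCoherent (T : AssociatedData κ κ₁) : Prop where
  cNat_base : ∀ {a b : B} (u : a ⟶ b) {e e' : Fibre κ b} (k : e ⟶ e'),
    Disp.Over ((JDisp ((T.F.map u).map k)).comp (T.cDisp u e'))
      ((T.cDisp u e).comp (JDisp k)) (T.cNat u k).hom
      ((λ_ u).hom ≫ (ρ_ u).inv)
  fac_base : ∀ {a b : B} {u v : a ⟶ b} (σ : u ⟶ v) (e : Fibre κ b),
    Disp.Over ((JDisp (T.F.app₂ σ e)).comp (T.cDisp u e))
      ((T.cDisp v e).pull σ) (T.fac σ e).hom (λ_ u).hom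
  x_base : ∀ {a b d : B} (f : a ⟶ b) (g : b ⟶ d) (e : Fibre κ d),
    Disp.Over ((JDisp (T.F.χApp f g e)).comp (T.cDisp (f ≫ g) e))
      ((T.cDisp f ((T.F.map g).obj e)).comp (T.cDisp g e))
      (T.x f g e).hom (λ_ (f ≫ g)).hom
  i_base : ∀ (a : B) (e : Fibre κ a),
    Disp.Over ((JDisp (T.F.ιApp a e)).comp (T.cDisp (𝟙 a) e)) (Disp.id e)
      (T.i a e).hom (λ_ (𝟙 a)).hom
  s_mod : ∀ {a b : B} {u v : a ⟶ b} (σ : u ⟶ v),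
    (((TransData.of (T.F.map₂ σ)).post (incl κ a)).comp (.of (T.c u))).IsModification
      (.of (T.c v)) fun e => T.s σ e
  x_mod : ∀ {a b d : B} (f : a ⟶ b) (g : b ⟶ d),
    (((TransData.of (T.F.χ f g)).post (incl κ a)).comp (.of (T.c (f ≫ g)))).IsModification
      (((TransData.of (T.c f)).pre (T.F.map g)).comp (.of (T.c g))) fun e => (T.x f g e).hom
  i_mod : ∀ a : B,
    (((TransData.of (T.F.ι a)).post (incl κ a)).comp (.of (T.c (𝟙 a)))).IsModification
      (.id (incl κ a)) fun e => (T.i a e).hom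
  s_comp : ∀ {a b : B} {u v w : a ⟶ b} (σ : u ⟶ v) (τ : v ⟶ w) (e : Fibre κ b),
    T.s (σ ≫ τ) e =
      (J₂ (T.F.map₂Comp σ τ e).hom ≫ (JComp _ _).hom) ▷ T.cApp u e ≫
        (α_ _ _ _).hom ≫ J (T.F.app₂ τ e) ◁ T.s σ e ≫ T.s τ e
  s_id : ∀ {a b : B} (u : a ⟶ b) (e : Fibre κ b),
    T.s (𝟙 u) e =
      (J₂ (T.F.map₂Id u e).hom ≫ (JId _).hom) ▷ T.cApp u e ≫ (λ_ _).hom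
  χ₂_eq : ∀ {a b d : B} {f f' : a ⟶ b} {g g' : b ⟶ d} (α : f ⟶ f') (β : g ⟶ g')
    (e : Fibre κ d),
    ((JComp₃ _ _ _).inv ≫ J₂ (T.F.χ₂ α β e).hom ≫ (JComp _ _).hom) ▷
          T.cApp (f ≫ g) e ⊗≫
        J (T.F.χApp f' g' e) ◁ T.s (hc α β) e ≫ (T.x f' g' e).hom =
      𝟙 _ ⊗≫ J (T.F.app₂ α ((T.F.map g').obj e)) ◁ J ((T.F.map f).map (T.F.app₂ β e)) ◁
          (T.x f g e).hom ⊗≫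
        J (T.F.app₂ α ((T.F.map g').obj e)) ◁ (T.cNat f (T.F.app₂ β e)).hom ▷
          T.cApp g e ⊗≫
        T.s α ((T.F.map g').obj e) ▷
          (J (T.F.app₂ β e) ≫ T.cApp g e) ≫
        T.cApp f' ((T.F.map g').obj e) ◁ T.s β e
  ω_eq : ∀ {a b d d' : B} (f : a ⟶ b) (g : b ⟶ d) (h : d ⟶ d') (e : Fibre κ d'),
    ((JComp₃ _ _ _).inv ≫ J₂ (T.F.ω f g h e).hom ≫ (JComp _ _).hom) ▷
          T.cApp ((f ≫ g) ≫ h) e ⊗≫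
        J (T.F.χApp f g ((T.F.map h).obj e)) ◁ (T.x (f ≫ g) h e).hom ⊗≫
        (T.x f g ((T.F.map h).obj e)).hom ▷ T.cApp h e ⊗≫ 𝟙 _ =
      𝟙 _ ⊗≫ J ((T.F.map f).map (T.F.χApp g h e)) ◁ J (T.F.χApp f (g ≫ h) e) ◁
          T.s (α_ f g h).hom e ⊗≫
        J ((T.F.map f).map (T.F.χApp g h e)) ◁ (T.x f (g ≫ h) e).hom ⊗≫
        (T.cNat f (T.F.χApp g h e)).hom ▷ T.cApp (g ≫ h) e ⊗≫
        T.cApp f ((T.F.map g).obj ((T.F.map h).obj e)) ◁ (T.x g h e).hom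
  γ_eq : ∀ {a b : B} (f : a ⟶ b) (e : Fibre κ b),
    ((JComp₃ _ _ _).inv ≫ J₂ (T.F.γ f e).hom ≫ (JId _).hom) ▷ T.cApp f e ≫
        (λ_ _).hom =
      𝟙 _ ⊗≫ J ((T.F.map f).map (T.F.ιApp b e)) ◁ J (T.F.χApp f (𝟙 b) e) ◁
          T.s (ρ_ f).inv e ≫
        J ((T.F.map f).map (T.F.ιApp b e)) ◁ (T.x f (𝟙 b) e).hom ⊗≫
        (T.cNat f (T.F.ιApp b e)).hom ▷ T.cApp (𝟙 b) e ⊗≫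
        T.cApp f e ◁ (T.i b e).hom ≫ (ρ_ _).hom
  δ_eq : ∀ {a b : B} (f : a ⟶ b) (e : Fibre κ b),
    (J₂ (T.F.δ f e).hom ≫ (JComp _ _).hom) ▷ T.cApp (𝟙 a ≫ f) e ⊗≫
        J (T.F.ιApp a ((T.F.map f).obj e)) ◁ (T.x (𝟙 a) f e).hom ⊗≫
        (T.i a ((T.F.map f).obj e)).hom ▷ T.cApp f e ≫ (λ_ _).hom =
      T.s (λ_ f).hom e

/-- The axioms of a trihomomorphism are kept apart from `IsCoherent` because they will be deduced
from it. Results on coherent data apply to every associated trihomomorphism through this instance.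
-/
instance AssociatedTrihom.isCoherent (T : AssociatedTrihom κ κ₁) : T.toAssociatedData.IsCoherent where
  cNat_base := T.cNat_base
  fac_base := T.fac_base
  x_base := T.x_base
  i_base := T.i_base
  s_mod := T.s_mod
  x_mod := T.x_mod
  i_mod := T.i_mod
  s_comp := T.s_comp
  s_id := T.s_id
  χ₂_eq := T.χ₂_eq
  ω_eq := T.ω_eq
  γ_eq := T.γ_eq
  δ_eq := T.δ_eq

namespace AssociatedData

variable (T : AssociatedData κ κ₁) {z : E} {a b d d' : B}

/-- The naturality of the cartesian 1-cells acting by postcomposition. -/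
def cA {u : a ⟶ b} {e e' : Fibre κ b} (m : z ⟶ ((T.F.map u).obj e).obj) (k : e ⟶ e') :
    (m ≫ J ((T.F.map u).map k)) ≫ T.cApp u e' ≅ (m ≫ T.cApp u e) ≫ J k :=
  act₂₂ m (T.cNat u k)

/-- The 2-cell `s` acting by postcomposition. -/
def sA {u v : a ⟶ b} {e : Fibre κ b} (m : z ⟶ ((T.F.map v).obj e).obj) (σ : u ⟶ v) :
    (m ≫ J (T.F.app₂ σ e)) ≫ T.cApp u e ⟶ m ≫ T.cApp v e :=
  act₂₁ m (T.s σ e)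

/-- The isomorphism `x` acting by postcomposition. -/
def xA {f : a ⟶ b} {g : b ⟶ d} {e : Fibre κ d}
    (m : z ⟶ ((T.F.map f).obj ((T.F.map g).obj e)).obj) :
    (m ≫ J (T.F.χApp f g e)) ≫ T.cApp (f ≫ g) e ≅
      (m ≫ T.cApp f ((T.F.map g).obj e)) ≫ T.cApp g e :=
  act₂₂ m (T.x f g e)

/-- The isomorphism `i` acting by postcomposition. -/
def iA {e : Fibre κ a} (m : z ⟶ e.obj) : (m ≫ J (T.F.ιApp a e)) ≫ T.cApp (𝟙 a) e ≅ m :=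
  act₂₀ m (T.i a e)

section Slide

variable {e e' : Fibre κ b}

@[simp] theorem cA_slide {u : a ⟶ b} {m m' : z ⟶ ((T.F.map u).obj e).obj} (μ : m ⟶ m') (k : e ⟶ e') :
    Slide (μ ▷ J ((T.F.map u).map k) ▷ T.cApp u e') (T.cA m' k).hom
      ((T.cA m k).hom ≫ μ ▷ T.cApp u e ▷ J k) := act₂₂_slide μ _

@[simp] theorem cA_inv_slide {u : a ⟶ b} {m m' : z ⟶ ((T.F.map u).obj e).obj} (μ : m ⟶ m') (k : e ⟶ e') :
    Slide (T.cA m k).inv (μ ▷ J ((T.F.map u).map k) ▷ T.cApp u e')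
      (μ ▷ T.cApp u e ▷ J k ≫ (T.cA m' k).inv) := act₂₂_inv_slide μ _

@[simp] theorem sA_slide {u v : a ⟶ b} {m m' : z ⟶ ((T.F.map v).obj e).obj} (μ : m ⟶ m') (σ : u ⟶ v) :
    Slide (μ ▷ J (T.F.app₂ σ e) ▷ T.cApp u e) (T.sA m' σ) (T.sA m σ ≫ μ ▷ T.cApp v e) :=
  act₂₁_slide μ _

@[simp] theorem xA_slide {f : a ⟶ d} {g : d ⟶ b}
    {m m' : z ⟶ ((T.F.map f).obj ((T.F.map g).obj e)).obj} (μ : m ⟶ m') :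
    Slide (μ ▷ J (T.F.χApp f g e) ▷ T.cApp (f ≫ g) e) (T.xA m').hom
      ((T.xA m).hom ≫ μ ▷ T.cApp f ((T.F.map g).obj e) ▷ T.cApp g e) := act₂₂_slide μ _

@[simp] theorem xA_inv_slide {f : a ⟶ d} {g : d ⟶ b}
    {m m' : z ⟶ ((T.F.map f).obj ((T.F.map g).obj e)).obj} (μ : m ⟶ m') :
    Slide (T.xA m).inv (μ ▷ J (T.F.χApp f g e) ▷ T.cApp (f ≫ g) e)
      (μ ▷ T.cApp f ((T.F.map g).obj e) ▷ T.cApp g e ≫ (T.xA m').inv) := act₂₂_inv_slide μ _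

@[simp] theorem iA_slide {m m' : z ⟶ e.obj} (μ : m ⟶ m') :
    Slide (μ ▷ J (T.F.ιApp b e) ▷ T.cApp (𝟙 b) e) (T.iA m').hom ((T.iA m).hom ≫ μ) :=
  act₂₀_slide μ _

end Slide

section Structure

variable {u v w : a ⟶ b} {e e' e'' : Fibre κ b}

-- Naturality of `c(u, -)` in 2-cells: in front of a cartesian 1-cell over `u`, the reindexed 2-cell
-- amounts to the original one acting after that 1-cell.
@[simp] theorem fact_map₂ (m : z ⟶ ((T.F.map u).obj e).obj) {k l : e ⟶ e'} (θ : k ⟶ l) :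
    Expand (fact m ((T.F.map u).map₂ θ) ▷ T.cApp u e')
      ((T.cA m k).hom ≫ fact (m ≫ T.cApp u e) θ ≫ (T.cA m l).inv) := .mk (by
  have h : J₂ ((T.F.map u).map₂ θ) ▷ T.cApp u e' ≫ (T.cNat u l).hom =
    (T.cNat u k).hom ≫ T.cApp u e ◁ J₂ θ := (T.c u).naturality_naturality θ
  have h' := congrArg (m ◁ ·) h
  simp only [whiskerLeft_comp] at h'
  rw [← Category.assoc, Iso.eq_comp_inv]
  simp [fact, act₁₁, cA, act₂₂, h'])

/-- In the `push` lemmas a structural cell of `F`, followed by the cartesian cells leading out of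
its target, is rewritten as a pasting of cells leading out of its source in which the structural
cell no longer occurs. Here the reason is the compatibility of `c(u, -)` with composition. -/
theorem fact_mapComp_push (m : z ⟶ ((T.F.map u).obj e).obj) (k : e ⟶ e') (l : e' ⟶ e'') :
    fact m ((T.F.map u).mapComp k l).hom ▷ T.cApp u e'' ≫ (jc m _ _).hom ▷ T.cApp u e'' ≫
        (T.cA (m ≫ J ((T.F.map u).map k)) l).hom ≫ (T.cA m k).hom ▷ J l =
      (T.cA m (k ≫ l)).hom ≫ (jc (m ≫ T.cApp u e) k l).hom := by
  have h : (T.cNat u (k ≫ l)).hom ≫ T.cApp u e ◁ (JComp k l).hom =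
    (J₂ ((T.F.map u).mapComp k l).hom ≫ (JComp _ _).hom) ▷ T.cApp u e'' ≫ (α_ _ _ _).hom ≫
      J ((T.F.map u).map k) ◁ (T.cNat u l).hom ≫ (α_ _ _ _).inv ≫ (T.cNat u k).hom ▷ J l ≫
      (α_ _ _ _).hom := (T.c u).naturality_comp k l
  have h' := congrArg (m ◁ ·) h
  simp only [whiskerLeft_comp, comp_whiskerRight, Category.assoc] at h'
  simp [fact, act₁₁, cA, act₂₂, jc, act₁₂, reassoc_of% h']

theorem fact_mapId_push (m : z ⟶ ((T.F.map u).obj e).obj) :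
    fact m ((T.F.map u).mapId e).hom ▷ T.cApp u e ≫ (ju m).hom ▷ T.cApp u e =
      (T.cA m (𝟙 e)).hom ≫ (ju (m ≫ T.cApp u e)).hom := by
  have h : (T.cNat u (𝟙 e)).hom ≫ T.cApp u e ◁ (JId e).hom =
    (J₂ ((T.F.map u).mapId e).hom ≫ (JId _).hom) ▷ T.cApp u e ≫ (λ_ _).hom ≫ (ρ_ _).inv :=
      (T.c u).naturality_id e
  have h' := congrArg (m ◁ ·) h
  simp only [whiskerLeft_comp, comp_whiskerRight, Category.assoc] at h'
  simp [fact, act₁₁, cA, act₂₂, ju, act₁₀, reassoc_of% h']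

@[simp] theorem fact_eq₂ (m : z ⟶ ((T.F.map v).obj e).obj) {σ τ : u ⟶ v} (h : σ = τ) :
    Slide (fact m (T.F.eq₂ h e).hom ▷ T.cApp u e) (T.sA m τ) (T.sA m σ) := .mk (by
  subst h
  simp [TrihomData.eq₂, fact_id])

variable {T}

variable [hT : T.IsCoherent]
include hT

theorem IsCoherent.nat₂_push (m : z ⟶ ((T.F.map v).obj e).obj) (σ : u ⟶ v) (k : e ⟶ e') :
    fact m (T.F.nat₂ σ k).hom ▷ T.cApp u e' ≫ (jc m _ _).hom ▷ T.cApp u e' ≫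
        (T.cA (m ≫ J (T.F.app₂ σ e)) k).hom ≫ T.sA m σ ▷ J k =
      (jc m _ _).hom ▷ T.cApp u e' ≫ T.sA (m ≫ J ((T.F.map v).map k)) σ ≫ (T.cA m k).hom := by
  have h : J ((T.F.map v).map k) ◁ T.s σ e' ≫ (T.cNat v k).hom =
    ((α_ _ _ _).inv ≫ ((JComp _ _).inv ≫ J₂ (T.F.nat₂ σ k).hom ≫ (JComp _ _).hom) ▷ T.cApp u e' ≫
      (α_ _ _ _).hom ≫ J (T.F.app₂ σ e) ◁ (T.cNat u k).hom ≫ (α_ _ _ _).inv) ≫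
      T.s σ e ▷ J k := hT.s_mod σ k
  have h' := congrArg (m ◁ ·) h
  simp only [whiskerLeft_comp, comp_whiskerRight, Category.assoc] at h'
  simp [fact, act₁₁, cA, act₂₂, jc, act₁₂, sA, act₂₁, reassoc_of% h']

theorem IsCoherent.map₂Comp_push (m : z ⟶ ((T.F.map w).obj e).obj) (σ : u ⟶ v) (τ : v ⟶ w) :
    fact m (T.F.map₂Comp σ τ e).hom ▷ T.cApp u e ≫ (jc m _ _).hom ▷ T.cApp u e ≫
      T.sA (m ≫ J (T.F.app₂ τ e)) σ ≫ T.sA m τ = T.sA m (σ ≫ τ) := by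
  have h' := congrArg (m ◁ ·) (hT.s_comp σ τ e)
  simp only [whiskerLeft_comp, comp_whiskerRight, Category.assoc] at h'
  simp [fact, act₁₁, jc, act₁₂, sA, act₂₁, h']

theorem IsCoherent.map₂Id_push (m : z ⟶ ((T.F.map u).obj e).obj) :
    fact m (T.F.map₂Id u e).hom ▷ T.cApp u e ≫ (ju m).hom ▷ T.cApp u e = T.sA m (𝟙 u) := by
  have h' := congrArg (m ◁ ·) (hT.s_id u e)
  simp only [whiskerLeft_comp, comp_whiskerRight, Category.assoc] at h'
  simp [fact, act₁₁, ju, act₁₀, sA, act₂₁, h']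

theorem IsCoherent.χNat_push {f : a ⟶ d} {g : d ⟶ b}
    (m : z ⟶ ((T.F.map f).obj ((T.F.map g).obj e)).obj) (k : e ⟶ e') :
    fact m (T.F.χNat f g k).hom ▷ T.cApp (f ≫ g) e' ≫ (jc m _ _).hom ▷ T.cApp (f ≫ g) e' ≫
        (T.cA (m ≫ J (T.F.χApp f g e)) k).hom ≫ (T.xA m).hom ▷ J k =
      (jc m _ _).hom ▷ T.cApp (f ≫ g) e' ≫
        (T.xA (m ≫ J ((T.F.map f).map ((T.F.map g).map k)))).hom ≫
        (T.cA m ((T.F.map g).map k)).hom ▷ T.cApp g e' ≫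
        (T.cA (m ≫ T.cApp f ((T.F.map g).obj e)) k).hom := by
  have h : J ((T.F.map f).map ((T.F.map g).map k)) ◁ (T.x f g e').hom ≫
    (α_ _ _ _).inv ≫ (T.cNat f ((T.F.map g).map k)).hom ▷ T.cApp g e' ≫ (α_ _ _ _).hom ≫
      T.cApp f ((T.F.map g).obj e) ◁ (T.cNat g k).hom ≫ (α_ _ _ _).inv =
    ((α_ _ _ _).inv ≫ ((JComp _ _).inv ≫ J₂ (T.F.χNat f g k).hom ≫ (JComp _ _).hom) ▷
        T.cApp (f ≫ g) e' ≫
      (α_ _ _ _).hom ≫ J (T.F.χApp f g e) ◁ (T.cNat (f ≫ g) k).hom ≫ (α_ _ _ _).inv) ≫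
      (T.x f g e).hom ▷ J k := hT.x_mod f g k
  -- Precomposition with the comparison of composites cancels its inverse in the modification axiom,
  -- and whiskering by `m` puts the equation into acting form.
  have h' := congrArg (fun t => m ◁ ((JComp _ _).hom ▷ T.cApp (f ≫ g) e' ≫ (α_ _ _ _).hom ≫ t)) h.symm
  simp at h'
  simp [fact, act₁₁, cA, act₂₂, jc, act₁₂, xA]
  simp [reassoc_of% h']

theorem IsCoherent.ιNat_push (m : z ⟶ e.obj) (k : e ⟶ e') :
    fact m (T.F.ιNat b k).hom ▷ T.cApp (𝟙 b) e' ≫ (jc m _ _).hom ▷ T.cApp (𝟙 b) e' ≫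
        (T.cA (m ≫ J (T.F.ιApp b e)) k).hom ≫ (T.iA m).hom ▷ J k =
      (jc m _ _).hom ▷ T.cApp (𝟙 b) e' ≫ (T.iA (m ≫ J k)).hom := by
  have h : J k ◁ (T.i b e').hom ≫ (ρ_ _).hom ≫ (λ_ _).inv =
    ((α_ _ _ _).inv ≫ ((JComp _ _).inv ≫ J₂ (T.F.ιNat b k).hom ≫ (JComp _ _).hom) ▷
        T.cApp (𝟙 b) e' ≫
      (α_ _ _ _).hom ≫ J (T.F.ιApp b e) ◁ (T.cNat (𝟙 b) k).hom ≫ (α_ _ _ _).inv) ≫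
      (T.i b e).hom ▷ J k := hT.i_mod b k
  have h' := congrArg (fun t => m ◁ ((JComp _ _).hom ▷ T.cApp (𝟙 b) e' ≫ (α_ _ _ _).hom ≫ t)) h.symm
  simp at h'
  simp [fact, act₁₁, cA, act₂₂, jc, act₁₂, iA, act₂₀]
  simp [reassoc_of% h']

theorem IsCoherent.χ₂_push {f f' : a ⟶ d} {g g' : d ⟶ b} (α : f ⟶ f') (β : g ⟶ g')
    (m : z ⟶ ((T.F.map f').obj ((T.F.map g').obj e)).obj) :
    fact m (T.F.χ₂ α β e).hom ▷ T.cApp (f ≫ g) e ≫ (jc m _ _).hom ▷ T.cApp (f ≫ g) e ≫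
        T.sA (m ≫ J (T.F.χApp f' g' e)) (hc α β) ≫ (T.xA m).hom =
      (jc m _ _).hom ▷ T.cApp (f ≫ g) e ≫
        (jc (m ≫ J (T.F.app₂ α ((T.F.map g').obj e))) _ _).hom ▷ T.cApp (f ≫ g) e ≫
        (T.xA ((m ≫ J (T.F.app₂ α ((T.F.map g').obj e))) ≫
          J ((T.F.map f).map (T.F.app₂ β e)))).hom ≫
        (T.cA (m ≫ J (T.F.app₂ α ((T.F.map g').obj e))) (T.F.app₂ β e)).hom ▷ T.cApp g e ≫
        T.sA ((m ≫ J (T.F.app₂ α ((T.F.map g').obj e))) ≫ T.cApp f ((T.F.map g').obj e)) β ≫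
        T.sA m α ▷ T.cApp g' e := by
  have h := congrArg ((JComp₃ _ _ _).hom ▷ T.cApp (f ≫ g) e ≫ ·) (hT.χ₂_eq α β e)
  simp [JComp₃, bicategoricalComp] at h
  -- `χ₂_eq` applies the cell over `α` before the one over `β`, while the normal form used here has
  -- the opposite order. Interchange reconciles the two.
  rw [← (T.sA_slide (T.sA m α) β).1.1]
  simp [fact, act₁₁, cA, act₂₂, jc, act₁₂, xA, sA, act₂₁]
  have h' := congrArg (m ◁ ·) h
  simp only [whiskerLeft_comp] at h'
  simp only [reassoc_of% h']
  bicategory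

theorem IsCoherent.ω_push {f : a ⟶ d} {g : d ⟶ d'} {h : d' ⟶ b}
    (m : z ⟶ ((T.F.map f).obj ((T.F.map g).obj ((T.F.map h).obj e))).obj) :
    fact m (T.F.ω f g h e).hom ▷ T.cApp ((f ≫ g) ≫ h) e ≫
        (jc m _ _).hom ▷ T.cApp ((f ≫ g) ≫ h) e ≫
        (T.xA (m ≫ J (T.F.χApp f g ((T.F.map h).obj e)))).hom ≫
        (T.xA m).hom ▷ T.cApp h e =
      (jc m _ _).hom ▷ T.cApp ((f ≫ g) ≫ h) e ≫
        (jc (m ≫ J ((T.F.map f).map (T.F.χApp g h e))) _ _).hom ▷ T.cApp ((f ≫ g) ≫ h) e ≫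
        T.sA ((m ≫ J ((T.F.map f).map (T.F.χApp g h e))) ≫ J (T.F.χApp f (g ≫ h) e))
          (α_ f g h).hom ≫
        (T.xA (m ≫ J ((T.F.map f).map (T.F.χApp g h e)))).hom ≫
        (T.cA m (T.F.χApp g h e)).hom ▷ T.cApp (g ≫ h) e ≫
        (T.xA (m ≫ T.cApp f ((T.F.map g).obj ((T.F.map h).obj e)))).hom := by
  have h := congrArg ((JComp₃ _ _ _).hom ▷ T.cApp ((f ≫ g) ≫ h) e ≫ · ≫
    (α_ _ _ _).inv) (hT.ω_eq f g h e)
  simp [JComp₃, bicategoricalComp] at h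
  simp [fact, act₁₁, cA, act₂₂, jc, act₁₂, xA, sA, act₂₁]
  have h' := congrArg (m ◁ ·) h
  simp only [whiskerLeft_comp] at h'
  simp [reassoc_of% h']

theorem IsCoherent.γ_push {f : a ⟶ b} (m : z ⟶ ((T.F.map f).obj e).obj) :
    fact m (T.F.γ f e).hom ▷ T.cApp f e ≫ (ju m).hom ▷ T.cApp f e =
      (jc m _ _).hom ▷ T.cApp f e ≫
        (jc (m ≫ J ((T.F.map f).map (T.F.ιApp b e))) _ _).hom ▷ T.cApp f e ≫
        T.sA ((m ≫ J ((T.F.map f).map (T.F.ιApp b e))) ≫ J (T.F.χApp f (𝟙 b) e)) (ρ_ f).inv ≫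
        (T.xA (m ≫ J ((T.F.map f).map (T.F.ιApp b e)))).hom ≫
        (T.cA m (T.F.ιApp b e)).hom ▷ T.cApp (𝟙 b) e ≫
        (T.iA (m ≫ T.cApp f e)).hom := by
  have h := congrArg ((JComp₃ _ _ _).hom ▷ T.cApp f e ≫ ·) (hT.γ_eq f e)
  simp [JComp₃, bicategoricalComp] at h
  simp [fact, act₁₁, cA, act₂₂, jc, act₁₂, xA, sA, act₂₁, iA, act₂₀, ju, act₁₀]
  have h' := congrArg (m ◁ ·) h
  simp only [whiskerLeft_comp] at h'
  simp [h']

theorem IsCoherent.δ_push {f : a ⟶ b} (m : z ⟶ ((T.F.map f).obj e).obj) :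
    fact m (T.F.δ f e).hom ▷ T.cApp (𝟙 a ≫ f) e ≫ (jc m _ _).hom ▷ T.cApp (𝟙 a ≫ f) e ≫
      (T.xA (m ≫ J (T.F.ιApp a ((T.F.map f).obj e)))).hom ≫ (T.iA m).hom ▷ T.cApp f e =
    T.sA m (λ_ f).hom := by
  have h := hT.δ_eq f e
  simp [bicategoricalComp] at h
  simp [fact, act₁₁, act₂₂, jc, act₁₂, xA, sA, act₂₁, iA, act₂₀]
  have h' := congrArg (m ◁ ·) h
  simp only [whiskerLeft_comp] at h'
  simp [← h']

end Structure

end AssociatedData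

end

/-! ### Rewriting rules for structural cells in front of cartesian cells. -/

section

section

variable {E : Type u₂} [Bicategory.{w₂, v₂} E] {x y : E}

/-- The equation `a ≫ a' ≫ a'' ≫ a₃ ≫ b = d` together with its whiskered and reassociated
forms. -/
abbrev Slide₅ {f f' f'' f₃ g h : x ⟶ y} (a : f ⟶ f') (a' : f' ⟶ f'') (a'' : f'' ⟶ f₃)
    (a₃ : f₃ ⟶ g) (b : g ⟶ h) (d : f ⟶ h) : Prop :=
  (a ≫ a' ≫ a'' ≫ a₃ ≫ b = d ∧
    ∀ {k : x ⟶ y} (r : h ⟶ k), a ≫ a' ≫ a'' ≫ a₃ ≫ b ≫ r = d ≫ r) ∧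
  (∀ {t : E} (c : y ⟶ t), a ▷ c ≫ a' ▷ c ≫ a'' ▷ c ≫ a₃ ▷ c ≫ b ▷ c = d ▷ c ∧
    ∀ {k : x ⟶ t} (r : h ≫ c ⟶ k),
      a ▷ c ≫ a' ▷ c ≫ a'' ▷ c ≫ a₃ ▷ c ≫ b ▷ c ≫ r = d ▷ c ≫ r)

theorem Slide₅.mk {f f' f'' f₃ g h : x ⟶ y} {a : f ⟶ f'} {a' : f' ⟶ f''} {a'' : f'' ⟶ f₃}
    {a₃ : f₃ ⟶ g} {b : g ⟶ h} {d : f ⟶ h} (e : a ≫ a' ≫ a'' ≫ a₃ ≫ b = d) :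
    Slide₅ a a' a'' a₃ b d := by
  subst e
  refine ⟨⟨?_, ?_⟩, ?_⟩ <;> simp

/-- The equation `a ≫ a₁ ≫ a₂ ≫ a₃ ≫ a₄ ≫ a₅ ≫ b = d` together with its whiskered and reassociated
forms. -/
abbrev Slide₇ {f f₁ f₂ f₃ f₄ f₅ g h : x ⟶ y} (a : f ⟶ f₁) (a₁ : f₁ ⟶ f₂) (a₂ : f₂ ⟶ f₃)
    (a₃ : f₃ ⟶ f₄) (a₄ : f₄ ⟶ f₅) (a₅ : f₅ ⟶ g) (b : g ⟶ h) (d : f ⟶ h) : Prop :=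
  (a ≫ a₁ ≫ a₂ ≫ a₃ ≫ a₄ ≫ a₅ ≫ b = d ∧
    ∀ {k : x ⟶ y} (r : h ⟶ k), a ≫ a₁ ≫ a₂ ≫ a₃ ≫ a₄ ≫ a₅ ≫ b ≫ r = d ≫ r) ∧
  (∀ {t : E} (c : y ⟶ t),
    a ▷ c ≫ a₁ ▷ c ≫ a₂ ▷ c ≫ a₃ ▷ c ≫ a₄ ▷ c ≫ a₅ ▷ c ≫ b ▷ c = d ▷ c ∧
    ∀ {k : x ⟶ t} (r : h ≫ c ⟶ k),
      a ▷ c ≫ a₁ ▷ c ≫ a₂ ▷ c ≫ a₃ ▷ c ≫ a₄ ▷ c ≫ a₅ ▷ c ≫ b ▷ c ≫ r = d ▷ c ≫ r)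

theorem Slide₇.mk {f f₁ f₂ f₃ f₄ f₅ g h : x ⟶ y} {a : f ⟶ f₁} {a₁ : f₁ ⟶ f₂} {a₂ : f₂ ⟶ f₃}
    {a₃ : f₃ ⟶ f₄} {a₄ : f₄ ⟶ f₅} {a₅ : f₅ ⟶ g} {b : g ⟶ h} {d : f ⟶ h}
    (e : a ≫ a₁ ≫ a₂ ≫ a₃ ≫ a₄ ≫ a₅ ≫ b = d) : Slide₇ a a₁ a₂ a₃ a₄ a₅ b d := by
  subst e
  refine ⟨⟨?_, ?_⟩, ?_⟩ <;> simp

/-- If the cells following `a` in a `push` equation have a right inverse, the equation is solved for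
`a` and gives a rule for `a` alone. If they involve some `sA`, which is not invertible in general,
the rule has to match a whole string ending there; hence the longer variants of `Slide`. -/
theorem Expand.of_push {f g h : x ⟶ y} {a : f ⟶ g} {R : g ⟶ h} {W : f ⟶ h} (R' : h ⟶ g)
    (e : a ≫ R = W) (hR : R ≫ R' = 𝟙 g) : Expand a (W ≫ R') := .mk (by
  rw [← e, Category.assoc, hR, Category.comp_id])

end

variable {E : Type u₂} [Bicategory.{w₂, v₂} E] {B : Type u₁} [Bicategory.{w₁, v₁} B]
  {P : E ⥤ᵖ B} {κ : LocalCleavage P} {κ₁ : Cleavage κ}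

open Fibre

/-- A `push` equation for an isomorphism, read backwards, is one for its inverse, with the roles of
the two pastings exchanged. -/
theorem fact_inv_push {b : B} {e e' : Fibre κ b} {z y : E} {m : z ⟶ e.obj} {k l : e ⟶ e'}
    {θ : k ≅ l} {c : e'.obj ⟶ y} {n : z ⟶ y} {R : (m ≫ J l) ≫ c ⟶ n} {W : (m ≫ J k) ≫ c ⟶ n}
    (h : fact m θ.hom ▷ c ≫ R = W) : fact m θ.inv ▷ c ≫ W = R := by
  subst h
  simp [((fact_inv_hom_slide m θ).2.1 c).2]

theorem fact_inv_expand {b : B} {e e' : Fibre κ b} {z y : E} {m : z ⟶ e.obj} {k l : e ⟶ e'}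
    {θ : k ≅ l} {c : e'.obj ⟶ y} {n : z ⟶ y} {R : (m ≫ J l) ≫ c ⟶ n} {W : (m ≫ J k) ≫ c ⟶ n}
    (W' : n ⟶ (m ≫ J k) ≫ c) (h : fact m θ.hom ▷ c ≫ R = W) (hW : W ≫ W' = 𝟙 _) :
    Expand (fact m θ.inv ▷ c) (R ≫ W') :=
  .of_push W' (fact_inv_push h) hW

namespace AssociatedData

variable {T : AssociatedData κ κ₁} {z : E} {a b d d' : B} {u v w : a ⟶ b} {e e' e'' : Fibre κ b}

@[simp] theorem fact_mapComp (m : z ⟶ ((T.F.map u).obj e).obj) (k : e ⟶ e') (l : e' ⟶ e'') :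
    Expand (fact m ((T.F.map u).mapComp k l).hom ▷ T.cApp u e'')
      (((T.cA m (k ≫ l)).hom ≫ (jc (m ≫ T.cApp u e) k l).hom) ≫
        (T.cA m k).inv ▷ J l ≫ (T.cA (m ≫ J ((T.F.map u).map k)) l).inv ≫
        (jc m _ _).inv ▷ T.cApp u e'') :=
  .of_push _ (T.fact_mapComp_push m k l) (by simp)

@[simp] theorem fact_mapComp_inv (m : z ⟶ ((T.F.map u).obj e).obj) (k : e ⟶ e') (l : e' ⟶ e'') :
    Expand (fact m ((T.F.map u).mapComp k l).inv ▷ T.cApp u e'')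
      (((jc m _ _).hom ▷ T.cApp u e'' ≫ (T.cA (m ≫ J ((T.F.map u).map k)) l).hom ≫
        (T.cA m k).hom ▷ J l) ≫ (jc (m ≫ T.cApp u e) k l).inv ≫ (T.cA m (k ≫ l)).inv) :=
  fact_inv_expand _ (T.fact_mapComp_push m k l) (by simp)

@[simp] theorem fact_mapId (m : z ⟶ ((T.F.map u).obj e).obj) :
    Expand (fact m ((T.F.map u).mapId e).hom ▷ T.cApp u e)
      (((T.cA m (𝟙 e)).hom ≫ (ju (m ≫ T.cApp u e)).hom) ≫ (ju m).inv ▷ T.cApp u e) :=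
  .of_push _ (T.fact_mapId_push m) (by simp)

@[simp] theorem fact_mapId_inv (m : z ⟶ ((T.F.map u).obj e).obj) :
    Expand (fact m ((T.F.map u).mapId e).inv ▷ T.cApp u e)
      ((ju m).hom ▷ T.cApp u e ≫ (ju (m ≫ T.cApp u e)).inv ≫ (T.cA m (𝟙 e)).inv) :=
  fact_inv_expand _ (T.fact_mapId_push m) (by simp)

namespace IsCoherent

variable [hT : T.IsCoherent]
include hT

@[simp] theorem fact_nat₂ (m : z ⟶ ((T.F.map v).obj e).obj) (σ : u ⟶ v) (k : e ⟶ e') :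
    Slide₄ (fact m (T.F.nat₂ σ k).hom ▷ T.cApp u e') ((jc m _ _).hom ▷ T.cApp u e')
      (T.cA (m ≫ J (T.F.app₂ σ e)) k).hom (T.sA m σ ▷ J k)
      ((jc m _ _).hom ▷ T.cApp u e' ≫ T.sA (m ≫ J ((T.F.map v).map k)) σ ≫ (T.cA m k).hom) :=
  .mk (hT.nat₂_push m σ k)

@[simp] theorem fact_nat₂_inv (m : z ⟶ ((T.F.map v).obj e).obj) (σ : u ⟶ v) (k : e ⟶ e') :
    Slide₃ (fact m (T.F.nat₂ σ k).inv ▷ T.cApp u e') ((jc m _ _).hom ▷ T.cApp u e')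
        (T.sA (m ≫ J ((T.F.map v).map k)) σ)
      ((jc m _ _).hom ▷ T.cApp u e' ≫ (T.cA (m ≫ J (T.F.app₂ σ e)) k).hom ≫ T.sA m σ ▷ J k ≫
        (T.cA m k).inv) := .mk (by
  -- The trailing `cA` is invertible and belongs on the right-hand side, so that the pattern to be
  -- matched ends at the possibly noninvertible `sA`.
  rw [← cancel_mono (T.cA m k).hom]
  simpa using fact_inv_push (hT.nat₂_push m σ k))

@[simp] theorem fact_map₂Comp (m : z ⟶ ((T.F.map w).obj e).obj) (σ : u ⟶ v) (τ : v ⟶ w) :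
    Slide₄ (fact m (T.F.map₂Comp σ τ e).hom ▷ T.cApp u e) ((jc m _ _).hom ▷ T.cApp u e)
      (T.sA (m ≫ J (T.F.app₂ τ e)) σ) (T.sA m τ) (T.sA m (σ ≫ τ)) :=
  .mk (hT.map₂Comp_push m σ τ)

@[simp] theorem fact_map₂Comp_inv (m : z ⟶ ((T.F.map w).obj e).obj) (σ : u ⟶ v) (τ : v ⟶ w) :
    Slide (fact m (T.F.map₂Comp σ τ e).inv ▷ T.cApp u e) (T.sA m (σ ≫ τ))
      ((jc m _ _).hom ▷ T.cApp u e ≫ T.sA (m ≫ J (T.F.app₂ τ e)) σ ≫ T.sA m τ) :=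
  .mk (fact_inv_push (hT.map₂Comp_push m σ τ))

@[simp] theorem fact_map₂Id (m : z ⟶ ((T.F.map u).obj e).obj) :
    Expand (fact m (T.F.map₂Id u e).hom ▷ T.cApp u e)
      (T.sA m (𝟙 u) ≫ (ju m).inv ▷ T.cApp u e) :=
  .of_push _ (hT.map₂Id_push m) (by simp)

@[simp] theorem fact_map₂Id_inv (m : z ⟶ ((T.F.map u).obj e).obj) :
    Slide (fact m (T.F.map₂Id u e).inv ▷ T.cApp u e) (T.sA m (𝟙 u)) ((ju m).hom ▷ T.cApp u e) :=
  .mk (fact_inv_push (hT.map₂Id_push m))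

-- Either factorisation acts as the common composite does, so `swap` merely exchanges the two
-- actions.
@[simp] theorem fact_swap (m : z ⟶ ((T.F.map w).obj e).obj) {v' : a ⟶ b} (σ : u ⟶ v) (τ : v ⟶ w)
    (σ' : u ⟶ v') (τ' : v' ⟶ w) (h : σ ≫ τ = σ' ≫ τ') :
    Slide₄ (fact m (T.F.swap σ τ σ' τ' h e) ▷ T.cApp u e) ((jc m _ _).hom ▷ T.cApp u e)
      (T.sA (m ≫ J (T.F.app₂ τ' e)) σ') (T.sA m τ')
      ((jc m _ _).hom ▷ T.cApp u e ≫ T.sA (m ≫ J (T.F.app₂ τ e)) σ ≫ T.sA m τ) := .mk (by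
  simp only [TrihomData.swap, fact_comp, comp_whiskerRight, Category.assoc, hT.fact_map₂Comp,
    T.fact_eq₂, hT.fact_map₂Comp_inv])

@[simp] theorem fact_χNat {f : a ⟶ d} {g : d ⟶ b}
    (m : z ⟶ ((T.F.map f).obj ((T.F.map g).obj e)).obj) (k : e ⟶ e') :
    Expand (fact m (T.F.χNat f g k).hom ▷ T.cApp (f ≫ g) e')
      (((jc m _ _).hom ▷ T.cApp (f ≫ g) e' ≫
        (T.xA (m ≫ J ((T.F.map f).map ((T.F.map g).map k)))).hom ≫
        (T.cA m ((T.F.map g).map k)).hom ▷ T.cApp g e' ≫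
        (T.cA (m ≫ T.cApp f ((T.F.map g).obj e)) k).hom) ≫
        (T.xA m).inv ▷ J k ≫ (T.cA (m ≫ J (T.F.χApp f g e)) k).inv ≫
        (jc m _ _).inv ▷ T.cApp (f ≫ g) e') :=
  .of_push _ (hT.χNat_push m k) (by simp)

@[simp] theorem fact_χNat_inv {f : a ⟶ d} {g : d ⟶ b}
    (m : z ⟶ ((T.F.map f).obj ((T.F.map g).obj e)).obj) (k : e ⟶ e') :
    Expand (fact m (T.F.χNat f g k).inv ▷ T.cApp (f ≫ g) e')
      (((jc m _ _).hom ▷ T.cApp (f ≫ g) e' ≫ (T.cA (m ≫ J (T.F.χApp f g e)) k).hom ≫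
        (T.xA m).hom ▷ J k) ≫
        (T.cA (m ≫ T.cApp f ((T.F.map g).obj e)) k).inv ≫
        (T.cA m ((T.F.map g).map k)).inv ▷ T.cApp g e' ≫
        (T.xA (m ≫ J ((T.F.map f).map ((T.F.map g).map k)))).inv ≫
        (jc m _ _).inv ▷ T.cApp (f ≫ g) e') :=
  fact_inv_expand _ (hT.χNat_push m k) (by simp)

@[simp] theorem fact_ιNat (m : z ⟶ e.obj) (k : e ⟶ e') :
    Expand (fact m (T.F.ιNat b k).hom ▷ T.cApp (𝟙 b) e')
      (((jc m _ _).hom ▷ T.cApp (𝟙 b) e' ≫ (T.iA (m ≫ J k)).hom) ≫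
        (T.iA m).inv ▷ J k ≫ (T.cA (m ≫ J (T.F.ιApp b e)) k).inv ≫
        (jc m _ _).inv ▷ T.cApp (𝟙 b) e') :=
  .of_push _ (hT.ιNat_push m k) (by simp)

@[simp] theorem fact_ιNat_inv (m : z ⟶ e.obj) (k : e ⟶ e') :
    Expand (fact m (T.F.ιNat b k).inv ▷ T.cApp (𝟙 b) e')
      (((jc m _ _).hom ▷ T.cApp (𝟙 b) e' ≫
        (T.cA (m ≫ J (T.F.ιApp b e)) k).hom ≫ (T.iA m).hom ▷ J k) ≫
        (T.iA (m ≫ J k)).inv ≫ (jc m _ _).inv ▷ T.cApp (𝟙 b) e') :=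
  fact_inv_expand _ (hT.ιNat_push m k) (by simp)

@[simp] theorem fact_χ₂ {f f' : a ⟶ d} {g g' : d ⟶ b} (α : f ⟶ f') (β : g ⟶ g')
    (m : z ⟶ ((T.F.map f').obj ((T.F.map g').obj e)).obj) :
    Slide₃ (fact m (T.F.χ₂ α β e).hom ▷ T.cApp (f ≫ g) e) ((jc m _ _).hom ▷ T.cApp (f ≫ g) e)
        (T.sA (m ≫ J (T.F.χApp f' g' e)) (hc α β))
      (((jc m _ _).hom ▷ T.cApp (f ≫ g) e ≫
        (jc (m ≫ J (T.F.app₂ α ((T.F.map g').obj e))) _ _).hom ▷ T.cApp (f ≫ g) e ≫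
        (T.xA ((m ≫ J (T.F.app₂ α ((T.F.map g').obj e))) ≫
          J ((T.F.map f).map (T.F.app₂ β e)))).hom ≫
        (T.cA (m ≫ J (T.F.app₂ α ((T.F.map g').obj e))) (T.F.app₂ β e)).hom ▷ T.cApp g e ≫
        T.sA ((m ≫ J (T.F.app₂ α ((T.F.map g').obj e))) ≫ T.cApp f ((T.F.map g').obj e)) β ≫
        T.sA m α ▷ T.cApp g' e) ≫ (T.xA m).inv) := .mk (by
  rw [← cancel_mono (T.xA m).hom]
  simpa using hT.χ₂_push α β m)

@[simp] theorem fact_χ₂_inv {f f' : a ⟶ d} {g g' : d ⟶ b} (α : f ⟶ f') (β : g ⟶ g')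
    (m : z ⟶ ((T.F.map f').obj ((T.F.map g').obj e)).obj) :
    Slide₇ (fact m (T.F.χ₂ α β e).inv ▷ T.cApp (f ≫ g) e)
      ((jc m _ _).hom ▷ T.cApp (f ≫ g) e)
      ((jc (m ≫ J (T.F.app₂ α ((T.F.map g').obj e))) _ _).hom ▷ T.cApp (f ≫ g) e)
      (T.xA ((m ≫ J (T.F.app₂ α ((T.F.map g').obj e))) ≫
          J ((T.F.map f).map (T.F.app₂ β e)))).hom
      ((T.cA (m ≫ J (T.F.app₂ α ((T.F.map g').obj e))) (T.F.app₂ β e)).hom ▷ T.cApp g e)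
      (T.sA ((m ≫ J (T.F.app₂ α ((T.F.map g').obj e))) ≫ T.cApp f ((T.F.map g').obj e)) β)
      (T.sA m α ▷ T.cApp g' e)
      ((jc m _ _).hom ▷ T.cApp (f ≫ g) e ≫
        T.sA (m ≫ J (T.F.χApp f' g' e)) (hc α β) ≫ (T.xA m).hom) :=
  .mk (fact_inv_push (hT.χ₂_push α β m))

-- `χL` comes from `χ₂` with an identity in the first variable, and the action of that identity is
-- removed by the rules for `map₂Id`.
@[simp] theorem fact_χL {f : a ⟶ d} {g g' : d ⟶ b} (β : g ⟶ g')
    (m : z ⟶ ((T.F.map f).obj ((T.F.map g').obj e)).obj) :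
    Slide₃ (fact m (T.F.χL f β e).hom ▷ T.cApp (f ≫ g) e) ((jc m _ _).hom ▷ T.cApp (f ≫ g) e)
        (T.sA (m ≫ J (T.F.χApp f g' e)) (f ◁ β))
      (((jc m _ _).hom ▷ T.cApp (f ≫ g) e ≫
        (T.xA (m ≫ J ((T.F.map f).map (T.F.app₂ β e)))).hom ≫
        (T.cA m (T.F.app₂ β e)).hom ▷ T.cApp g e ≫
        T.sA (m ≫ T.cApp f ((T.F.map g').obj e)) β) ≫ (T.xA m).inv) := .mk (by
  simp [TrihomData.χL])

theorem χL_push {f : a ⟶ d} {g g' : d ⟶ b} (β : g ⟶ g')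
    (m : z ⟶ ((T.F.map f).obj ((T.F.map g').obj e)).obj) :
    fact m (T.F.χL f β e).hom ▷ T.cApp (f ≫ g) e ≫ (jc m _ _).hom ▷ T.cApp (f ≫ g) e ≫
        T.sA (m ≫ J (T.F.χApp f g' e)) (f ◁ β) ≫ (T.xA m).hom =
      (jc m _ _).hom ▷ T.cApp (f ≫ g) e ≫
        (T.xA (m ≫ J ((T.F.map f).map (T.F.app₂ β e)))).hom ≫
        (T.cA m (T.F.app₂ β e)).hom ▷ T.cApp g e ≫
        T.sA (m ≫ T.cApp f ((T.F.map g').obj e)) β := by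
  simp

@[simp] theorem fact_χL_inv {f : a ⟶ d} {g g' : d ⟶ b} (β : g ⟶ g')
    (m : z ⟶ ((T.F.map f).obj ((T.F.map g').obj e)).obj) :
    Slide₅ (fact m (T.F.χL f β e).inv ▷ T.cApp (f ≫ g) e) ((jc m _ _).hom ▷ T.cApp (f ≫ g) e)
      (T.xA (m ≫ J ((T.F.map f).map (T.F.app₂ β e)))).hom
      ((T.cA m (T.F.app₂ β e)).hom ▷ T.cApp g e) (T.sA (m ≫ T.cApp f ((T.F.map g').obj e)) β)
      ((jc m _ _).hom ▷ T.cApp (f ≫ g) e ≫ T.sA (m ≫ J (T.F.χApp f g' e)) (f ◁ β) ≫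
        (T.xA m).hom) :=
  .mk (fact_inv_push (χL_push β m))

theorem χR_push {f f' : a ⟶ d} {g : d ⟶ b} (α : f ⟶ f')
    (m : z ⟶ ((T.F.map f').obj ((T.F.map g).obj e)).obj) :
    fact m (T.F.χR α g e).hom ▷ T.cApp (f ≫ g) e ≫ (jc m _ _).hom ▷ T.cApp (f ≫ g) e ≫
        T.sA (m ≫ J (T.F.χApp f' g e)) (α ▷ g) ≫ (T.xA m).hom =
      (jc m _ _).hom ▷ T.cApp (f ≫ g) e ≫
        (T.xA (m ≫ J (T.F.app₂ α ((T.F.map g).obj e)))).hom ≫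
        T.sA m α ▷ T.cApp g e := by
  have h : (T.F.χR α g e).hom = T.F.app₂ α ((T.F.map g).obj e) ◁ ((λ_ _).inv ≫
      (((T.F.map f).mapId _).inv ≫ (T.F.map f).map₂ (T.F.map₂Id g e).inv) ▷ _) ≫
      (T.F.χ₂ α (𝟙 g) e).hom ≫ T.F.χApp f' g e ◁ (T.F.eq₂ (by simp [hc]) e).hom := rfl
  simp [h]

@[simp] theorem fact_χR_inv {f f' : a ⟶ d} {g : d ⟶ b} (α : f ⟶ f')
    (m : z ⟶ ((T.F.map f').obj ((T.F.map g).obj e)).obj) :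
    Slide₄ (fact m (T.F.χR α g e).inv ▷ T.cApp (f ≫ g) e) ((jc m _ _).hom ▷ T.cApp (f ≫ g) e)
      (T.xA (m ≫ J (T.F.app₂ α ((T.F.map g).obj e)))).hom (T.sA m α ▷ T.cApp g e)
      ((jc m _ _).hom ▷ T.cApp (f ≫ g) e ≫ T.sA (m ≫ J (T.F.χApp f' g e)) (α ▷ g) ≫
        (T.xA m).hom) :=
  .mk (fact_inv_push (χR_push α m))

@[simp] theorem fact_ω {f : a ⟶ d} {g : d ⟶ d'} {h : d' ⟶ b}
    (m : z ⟶ ((T.F.map f).obj ((T.F.map g).obj ((T.F.map h).obj e))).obj) :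
    Expand (fact m (T.F.ω f g h e).hom ▷ T.cApp ((f ≫ g) ≫ h) e)
      (((jc m _ _).hom ▷ T.cApp ((f ≫ g) ≫ h) e ≫
        (jc (m ≫ J ((T.F.map f).map (T.F.χApp g h e))) _ _).hom ▷ T.cApp ((f ≫ g) ≫ h) e ≫
        T.sA ((m ≫ J ((T.F.map f).map (T.F.χApp g h e))) ≫ J (T.F.χApp f (g ≫ h) e))
          (α_ f g h).hom ≫
        (T.xA (m ≫ J ((T.F.map f).map (T.F.χApp g h e)))).hom ≫
        (T.cA m (T.F.χApp g h e)).hom ▷ T.cApp (g ≫ h) e ≫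
        (T.xA (m ≫ T.cApp f ((T.F.map g).obj ((T.F.map h).obj e)))).hom) ≫
        (T.xA m).inv ▷ T.cApp h e ≫
        (T.xA (m ≫ J (T.F.χApp f g ((T.F.map h).obj e)))).inv ≫
        (jc m _ _).inv ▷ T.cApp ((f ≫ g) ≫ h) e) :=
  .of_push _ (hT.ω_push m) (by simp)

@[simp] theorem fact_ω_inv {f : a ⟶ d} {g : d ⟶ d'} {h : d' ⟶ b}
    (m : z ⟶ ((T.F.map f).obj ((T.F.map g).obj ((T.F.map h).obj e))).obj) :
    Slide₄ (fact m (T.F.ω f g h e).inv ▷ T.cApp ((f ≫ g) ≫ h) e)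
      ((jc m _ _).hom ▷ T.cApp ((f ≫ g) ≫ h) e)
      ((jc (m ≫ J ((T.F.map f).map (T.F.χApp g h e))) _ _).hom ▷ T.cApp ((f ≫ g) ≫ h) e)
      (T.sA ((m ≫ J ((T.F.map f).map (T.F.χApp g h e))) ≫ J (T.F.χApp f (g ≫ h) e))
          (α_ f g h).hom)
      (((jc m _ _).hom ▷ T.cApp ((f ≫ g) ≫ h) e ≫
        (T.xA (m ≫ J (T.F.χApp f g ((T.F.map h).obj e)))).hom ≫
        (T.xA m).hom ▷ T.cApp h e) ≫
        (T.xA (m ≫ T.cApp f ((T.F.map g).obj ((T.F.map h).obj e)))).inv ≫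
        (T.cA m (T.F.χApp g h e)).inv ▷ T.cApp (g ≫ h) e ≫
        (T.xA (m ≫ J ((T.F.map f).map (T.F.χApp g h e)))).inv) := .mk (by
  -- The cells after `sA` are invertible. Inserting the full `push` equation on the right-hand side
  -- allows them to cancel against their inverses.
  rw [← fact_inv_push (hT.ω_push m)]
  simp)

@[simp] theorem fact_γ {f : a ⟶ b} (m : z ⟶ ((T.F.map f).obj e).obj) :
    Expand (fact m (T.F.γ f e).hom ▷ T.cApp f e)
      (((jc m _ _).hom ▷ T.cApp f e ≫
        (jc (m ≫ J ((T.F.map f).map (T.F.ιApp b e))) _ _).hom ▷ T.cApp f e ≫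
        T.sA ((m ≫ J ((T.F.map f).map (T.F.ιApp b e))) ≫ J (T.F.χApp f (𝟙 b) e)) (ρ_ f).inv ≫
        (T.xA (m ≫ J ((T.F.map f).map (T.F.ιApp b e)))).hom ≫
        (T.cA m (T.F.ιApp b e)).hom ▷ T.cApp (𝟙 b) e ≫
        (T.iA (m ≫ T.cApp f e)).hom) ≫ (ju m).inv ▷ T.cApp f e) :=
  .of_push _ (hT.γ_push m) (by simp)

@[simp] theorem fact_γ_inv {f : a ⟶ b} (m : z ⟶ ((T.F.map f).obj e).obj) :
    Slide₄ (fact m (T.F.γ f e).inv ▷ T.cApp f e)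
      ((jc m _ _).hom ▷ T.cApp f e)
      ((jc (m ≫ J ((T.F.map f).map (T.F.ιApp b e))) _ _).hom ▷ T.cApp f e)
      (T.sA ((m ≫ J ((T.F.map f).map (T.F.ιApp b e))) ≫ J (T.F.χApp f (𝟙 b) e)) (ρ_ f).inv)
      ((ju m).hom ▷ T.cApp f e ≫ (T.iA (m ≫ T.cApp f e)).inv ≫
        (T.cA m (T.F.ιApp b e)).inv ▷ T.cApp (𝟙 b) e ≫
        (T.xA (m ≫ J ((T.F.map f).map (T.F.ιApp b e)))).inv) := .mk (by
  rw [← reassoc_of% fact_inv_push (hT.γ_push m)]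
  simp)

@[simp] theorem fact_δ {f : a ⟶ b} (m : z ⟶ ((T.F.map f).obj e).obj) :
    Expand (fact m (T.F.δ f e).hom ▷ T.cApp (𝟙 a ≫ f) e)
      (T.sA m (λ_ f).hom ≫ (T.iA m).inv ▷ T.cApp f e ≫
        (T.xA (m ≫ J (T.F.ιApp a ((T.F.map f).obj e)))).inv ≫
        (jc m _ _).inv ▷ T.cApp (𝟙 a ≫ f) e) :=
  .of_push _ (hT.δ_push m) (by simp)

@[simp] theorem fact_δ_inv {f : a ⟶ b} (m : z ⟶ ((T.F.map f).obj e).obj) :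
    Slide (fact m (T.F.δ f e).inv ▷ T.cApp (𝟙 a ≫ f) e) (T.sA m (λ_ f).hom)
      ((jc m _ _).hom ▷ T.cApp (𝟙 a ≫ f) e ≫
        (T.xA (m ≫ J (T.F.ιApp a ((T.F.map f).obj e)))).hom ≫ (T.iA m).hom ▷ T.cApp f e) :=
  .mk (fact_inv_push (hT.δ_push m))

end IsCoherent

end AssociatedData

end

/-! ### Trihomomorphism axioms: functoriality on 2-cells, and the modification axioms. -/

section

variable {E : Type u₂} [Bicategory.{w₂, v₂} E] {B : Type u₁} [Bicategory.{w₁, v₁} B]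
  {P : E ⥤ᵖ B} {κ : LocalCleavage P} {κ₁ : Cleavage κ}

open Fibre

namespace AssociatedData

variable (T : AssociatedData κ κ₁) {z : E} {a b d d' : B} {u v w w' : a ⟶ b} {e e' e'' : Fibre κ b}

theorem isCartesian_cApp (u : a ⟶ b) (e : Fibre κ b) : IsCartesian₁ P (T.cApp u e) := T.cart u e

/-- `s σ e` is an isomorphism followed by a chosen cartesian lift, and whiskering preserves
cartesian 2-cells in a fibration. In the test cells below, all other constituents are invertible. -/
instance cartesianCell_sA [hP : Fact (IsFibration P)] (m : z ⟶ ((T.F.map v).obj e).obj)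
    (σ : u ⟶ v) : CartesianCell P (T.sA m σ) := by
  have : CartesianCell P ((T.cDisp v e).pullHom σ) := ⟨CartLift₂.isCartesian₂ _⟩
  have : CartesianCell P (T.s σ e) := .comp P (T.fac σ e).hom ((T.cDisp v e).pullHom σ)
  exact .comp P (α_ _ _ _).hom (m ◁ T.s σ e)

variable {T}

namespace IsCoherent

variable [hP : Fact (IsFibration P)] [hT : T.IsCoherent]
include hT hP

/-- The pattern for all the axioms: the test cell `R` unpacks the target composite of the fibre with
`jc` and then applies the cartesian cells leading out of it. The rewriting rules reduce both sides
to the same pasting, here the action of the triple composite. -/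
theorem map₂_assoc (σ : u ⟶ v) (τ : v ⟶ w) (υ : w ⟶ w') (e : Fibre κ b) :
    (T.F.map₂Comp (σ ≫ τ) υ e).hom ≫ T.F.app₂ υ e ◁ (T.F.map₂Comp σ τ e).hom =
      (T.F.eq₂ (Category.assoc σ τ υ) e).hom ≫ (T.F.map₂Comp σ (τ ≫ υ) e).hom ≫
        (T.F.map₂Comp τ υ e).hom ▷ T.F.app₂ σ e ≫ (α_ _ _ _).hom := by
  refine fibre_hom_ext (T.isCartesian_cApp u e) (R := (jc _ _ _).hom ▷ T.cApp u e ≫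
    (jc _ _ _).hom ▷ T.cApp u e ≫ T.sA _ σ ≫ T.sA _ τ ≫ T.sA _ υ) ?_
  simp

theorem map₂_id_comp (σ : u ⟶ v) (e : Fibre κ b) :
    (T.F.map₂Comp (𝟙 u) σ e).hom ≫ T.F.app₂ σ e ◁ (T.F.map₂Id u e).hom ≫ (ρ_ _).hom =
      (T.F.eq₂ (Category.id_comp σ) e).hom := by
  refine fibre_hom_ext (T.isCartesian_cApp u e) (R := T.sA _ σ) ?_
  simp

theorem map₂_comp_id (σ : u ⟶ v) (e : Fibre κ b) :
    (T.F.map₂Comp σ (𝟙 v) e).hom ≫ (T.F.map₂Id v e).hom ▷ T.F.app₂ σ e ≫ (λ_ _).hom =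
      (T.F.eq₂ (Category.comp_id σ) e).hom := by
  refine fibre_hom_ext (T.isCartesian_cApp u e) (R := T.sA _ σ) ?_
  simp

theorem map₂Comp_mod (σ : u ⟶ v) (τ : v ⟶ w) :
    (TransData.of (T.F.map₂ (σ ≫ τ))).IsModification
      ((TransData.of (T.F.map₂ τ)).comp (.of (T.F.map₂ σ)))
      fun x => (T.F.map₂Comp σ τ x).hom := by
  intro e e' k
  -- The modification axiom with its components named through `nat₂`. It is definitionally the
  -- unfolded goal, in the form that the rewriting rules recognise.
  have h : (T.F.map w).map k ◁ (T.F.map₂Comp σ τ e').hom ≫ (α_ _ _ _).inv ≫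
      (T.F.nat₂ τ k).hom ▷ T.F.app₂ σ e' ≫ (α_ _ _ _).hom ≫
      T.F.app₂ τ e ◁ (T.F.nat₂ σ k).hom ≫ (α_ _ _ _).inv =
      (T.F.nat₂ (σ ≫ τ) k).hom ≫ (T.F.map₂Comp σ τ e).hom ▷ (T.F.map u).map k := by
    refine fibre_hom_ext (T.isCartesian_cApp u e') (R := (jc _ _ _).hom ▷ T.cApp u e' ≫
      (jc _ _ _).hom ▷ J ((T.F.map u).map k) ▷ T.cApp u e' ≫
      (T.cA _ k).hom ≫ T.sA _ σ ▷ J k ≫ T.sA _ τ ▷ J k) ?_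
    simp
  exact h

theorem map₂Id_mod (u : a ⟶ b) :
    (TransData.of (T.F.map₂ (𝟙 u))).IsModification (.id (T.F.map u))
      fun x => (T.F.map₂Id u x).hom := by
  intro e e' k
  have h : (T.F.map u).map k ◁ (T.F.map₂Id u e').hom ≫ (ρ_ _).hom ≫ (λ_ _).inv =
      (T.F.nat₂ (𝟙 u) k).hom ≫ (T.F.map₂Id u e).hom ▷ (T.F.map u).map k := by
    refine fibre_hom_ext (T.isCartesian_cApp u e') (R := (jc _ _ _).hom ▷ T.cApp u e' ≫
      (ju _).hom ▷ J ((T.F.map u).map k) ▷ T.cApp u e' ≫ (T.cA _ k).hom) ?_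
    simp
  exact h

theorem χ₂_mod {f f' : a ⟶ d} {g g' : d ⟶ b} (α : f ⟶ f') (β : g ⟶ g') :
    ((TransData.of (T.F.map₂ α)).pre (T.F.map g') |>.comp
      (((TransData.of (T.F.map₂ β)).post (T.F.map f)).comp (.of (T.F.χ f g)))).IsModification
      ((TransData.of (T.F.χ f' g')).comp (.of (T.F.map₂ (hc α β))))
      fun x => (T.F.χ₂ α β x).hom := by
  intro e e' k
  have h : (T.F.map f').map ((T.F.map g').map k) ◁ (T.F.χ₂ α β e').hom ≫ (α_ _ _ _).inv ≫
      (T.F.χNat f' g' k).hom ▷ T.F.app₂ (hc α β) e' ≫ (α_ _ _ _).hom ≫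
      T.F.χApp f' g' e ◁ (T.F.nat₂ (hc α β) k).hom ≫ (α_ _ _ _).inv =
      ((α_ _ _ _).inv ≫ (T.F.nat₂ α ((T.F.map g').map k)).hom ▷ _ ≫ (α_ _ _ _).hom ≫
      T.F.app₂ α ((T.F.map g').obj e) ◁ ((α_ _ _ _).inv ≫
        (((T.F.map f).mapComp _ _).inv ≫ (T.F.map f).map₂ (T.F.nat₂ β k).hom ≫
        ((T.F.map f).mapComp _ _).hom) ▷ T.F.χApp f g e' ≫ (α_ _ _ _).hom ≫
        (T.F.map f).map (T.F.app₂ β e) ◁ (T.F.χNat f g k).hom ≫ (α_ _ _ _).inv) ≫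
        (α_ _ _ _).inv) ≫ (T.F.χ₂ α β e).hom ▷ (T.F.map (f ≫ g)).map k := by
    refine fibre_hom_ext (T.isCartesian_cApp (f ≫ g) e') (R := (jc _ _ _).hom ▷ T.cApp _ e' ≫
      (jc _ _ _).hom ▷ J ((T.F.map (f ≫ g)).map k) ▷ T.cApp (f ≫ g) e' ≫
      (T.cA _ k).hom ≫ T.sA _ (hc α β) ▷ J k ≫ (T.xA _).hom ▷ J k) ?_
    simp
    -- Normalisation has slid the cell over `α` to the end. It is brought back in front of `cA`,
    -- where it completes the string that the rule for the naturality of `α` absorbs.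
    rw [← (T.cA_slide (T.sA (𝟙 _) α) k).1.1, ((hT.fact_nat₂ _ α _).2.1 _).2]
    simp
  exact h

theorem ω_mod (f : a ⟶ d) (g : d ⟶ d') (h : d' ⟶ b) :
    (((TransData.of (T.F.χ g h)).post (T.F.map f)).comp
      ((TransData.of (T.F.χ f (g ≫ h))).comp (.of (T.F.map₂ (α_ f g h).hom)))).IsModification
      (((TransData.of (T.F.χ f g)).pre (T.F.map h)).comp (.of (T.F.χ (f ≫ g) h)))
      fun x => (T.F.ω f g h x).hom := by
  intro e e' k
  have h : (T.F.map f).map ((T.F.map g).map ((T.F.map h).map k)) ◁ (T.F.ω f g h e').hom ≫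
      (α_ _ _ _).inv ≫
      (T.F.χNat f g ((T.F.map h).map k)).hom ▷ T.F.χApp (f ≫ g) h e' ≫ (α_ _ _ _).hom ≫
      T.F.χApp f g ((T.F.map h).obj e) ◁ (T.F.χNat (f ≫ g) h k).hom ≫ (α_ _ _ _).inv =
      ((α_ _ _ _).inv ≫
        (((T.F.map f).mapComp _ _).inv ≫ (T.F.map f).map₂ (T.F.χNat g h k).hom ≫
        ((T.F.map f).mapComp _ _).hom) ▷ _ ≫ (α_ _ _ _).hom ≫
        (T.F.map f).map (T.F.χApp g h e) ◁ ((α_ _ _ _).inv ≫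
          (T.F.χNat f (g ≫ h) k).hom ▷ _ ≫ (α_ _ _ _).hom ≫
          T.F.χApp f (g ≫ h) e ◁ (T.F.nat₂ (α_ f g h).hom k).hom ≫ (α_ _ _ _).inv) ≫
        (α_ _ _ _).inv) ≫ (T.F.ω f g h e).hom ▷ (T.F.map ((f ≫ g) ≫ h)).map k := by
    refine fibre_hom_ext (T.isCartesian_cApp ((f ≫ g) ≫ h) e')
      (R := (jc _ _ _).hom ▷ T.cApp _ e' ≫
      (jc _ _ _).hom ▷ J ((T.F.map ((f ≫ g) ≫ h)).map k) ▷ T.cApp ((f ≫ g) ≫ h) e' ≫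
      (T.cA _ k).hom ≫ (T.xA _).hom ▷ J k ≫ (T.xA _).hom ▷ T.cApp h e ▷ J k) ?_
    simp
  exact h

theorem γ_mod (f : a ⟶ b) :
    (((TransData.of (T.F.ι b)).post (T.F.map f)).comp
      ((TransData.of (T.F.χ f (𝟙 b))).comp (.of (T.F.map₂ (ρ_ f).inv)))).IsModification
      (.id (T.F.map f)) fun x => (T.F.γ f x).hom := by
  intro e e' k
  have h : (T.F.map f).map k ◁ (T.F.γ f e').hom ≫ (ρ_ _).hom ≫ (λ_ _).inv =
      ((α_ _ _ _).inv ≫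
        (((T.F.map f).mapComp _ _).inv ≫ (T.F.map f).map₂ (T.F.ιNat b k).hom ≫
        ((T.F.map f).mapComp _ _).hom) ▷ _ ≫ (α_ _ _ _).hom ≫
        (T.F.map f).map (T.F.ιApp b e) ◁ ((α_ _ _ _).inv ≫
          (T.F.χNat f (𝟙 b) k).hom ▷ _ ≫ (α_ _ _ _).hom ≫
          T.F.χApp f (𝟙 b) e ◁ (T.F.nat₂ (ρ_ f).inv k).hom ≫ (α_ _ _ _).inv) ≫
        (α_ _ _ _).inv) ≫ (T.F.γ f e).hom ▷ (T.F.map f).map k := by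
    refine fibre_hom_ext (T.isCartesian_cApp f e')
      (R := (jc _ _ _).hom ▷ T.cApp _ e' ≫
      (ju _).hom ▷ J ((T.F.map f).map k) ▷ T.cApp f e' ≫
      (T.cA _ k).hom) ?_
    simp
  exact h

theorem δ_mod (f : a ⟶ b) :
    (TransData.of (T.F.map₂ (λ_ f).hom)).IsModification
      (((TransData.of (T.F.ι a)).pre (T.F.map f)).comp (.of (T.F.χ (𝟙 a) f)))
      fun x => (T.F.δ f x).hom := by
  intro e e' k
  have h : (T.F.map f).map k ◁ (T.F.δ f e').hom ≫ (α_ _ _ _).inv ≫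
      (T.F.ιNat a ((T.F.map f).map k)).hom ▷ _ ≫ (α_ _ _ _).hom ≫
      T.F.ιApp a ((T.F.map f).obj e) ◁ (T.F.χNat (𝟙 a) f k).hom ≫ (α_ _ _ _).inv =
      (T.F.nat₂ (λ_ f).hom k).hom ≫ (T.F.δ f e).hom ▷ (T.F.map (𝟙 a ≫ f)).map k := by
    refine fibre_hom_ext (T.isCartesian_cApp (𝟙 a ≫ f) e')
      (R := (jc _ _ _).hom ▷ T.cApp _ e' ≫
      (jc _ _ _).hom ▷ J ((T.F.map (𝟙 a ≫ f)).map k) ▷ T.cApp (𝟙 a ≫ f) e' ≫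
      (T.cA _ k).hom ≫ (T.xA _).hom ▷ J k ≫ (T.iA _).hom ▷ T.cApp f e ▷ J k) ?_
    simp
  exact h

end IsCoherent

end AssociatedData

end

/-! ### Trihomomorphism axioms: naturality in 2-cells, and the associativity and unit axioms. -/

section

variable {E : Type u₂} [Bicategory.{w₂, v₂} E] {B : Type u₁} [Bicategory.{w₁, v₁} B]
  {P : E ⥤ᵖ B} {κ : LocalCleavage P} {κ₁ : Cleavage κ}

open Fibre

namespace AssociatedData.IsCoherent

variable {T : AssociatedData κ κ₁} {z : E} {a b d d' : B} {u v w w' : a ⟶ b} {e e' e'' : Fibre κ b}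
variable [hP : Fact (IsFibration P)] [hT : T.IsCoherent]
include hT hP

omit hP in
theorem χ₂_id (f : a ⟶ d) (g : d ⟶ b) (e : Fibre κ b) :
    (T.F.χ₂ (𝟙 f) (𝟙 g) e).hom ≫ T.F.χApp f g e ◁
        ((T.F.eq₂ (τ := 𝟙 (f ≫ g)) (by simp [hc]) e).hom ≫ (T.F.map₂Id (f ≫ g) e).hom) ≫
        (ρ_ _).hom =
      (T.F.map₂Id f _).hom ▷ _ ≫ (λ_ _).hom ≫
        ((T.F.map f).map₂ (T.F.map₂Id g e).hom ≫ ((T.F.map f).mapId _).hom) ▷ T.F.χApp f g e ≫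
        (λ_ _).hom := by
  refine fibre_hom_ext (T.isCartesian_cApp (f ≫ g) e) (R := (T.xA _).hom) ?_
  simp

theorem χ₂_comp {f f' f'' : a ⟶ d} {g g' g'' : d ⟶ b} (α : f ⟶ f') (α' : f' ⟶ f'')
    (β : g ⟶ g') (β' : g' ⟶ g'') (e : Fibre κ b) :
    (T.F.χ₂ (α ≫ α') (β ≫ β') e).hom ≫ T.F.χApp f'' g'' e ◁
        ((T.F.eq₂ (by simp [hc, whisker_exchange_assoc]) e).hom ≫
          (T.F.map₂Comp (hc α β) (hc α' β') e).hom) =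
      (T.F.map₂Comp α α' _).hom ▷ _ ≫ _ ◁ ((T.F.map f).map₂ (T.F.map₂Comp β β' e).hom ≫
          ((T.F.map f).mapComp _ _).hom) ▷ T.F.χApp f g e ⊗≫
        T.F.app₂ α' ((T.F.map g'').obj e) ◁ (T.F.nat₂ α (T.F.app₂ β' e)).inv ▷
          ((T.F.map f).map (T.F.app₂ β e) ≫ T.F.χApp f g e) ⊗≫
        T.F.app₂ α' ((T.F.map g'').obj e) ◁ (T.F.map f').map (T.F.app₂ β' e) ◁
          (T.F.χ₂ α β e).hom ⊗≫
        (T.F.χ₂ α' β' e).hom ▷ T.F.app₂ (hc α β) e ≫ (α_ _ _ _).hom := by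
  refine fibre_hom_ext (T.isCartesian_cApp (f ≫ g) e) (R := (jc _ _ _).hom ▷ T.cApp (f ≫ g) e ≫
    (jc _ _ _).hom ▷ T.cApp (f ≫ g) e ≫ T.sA _ (hc α β) ≫ T.sA _ (hc α' β') ≫ (T.xA _).hom) ?_
  simp [bicategoricalComp]

set_option maxHeartbeats 800000 in
theorem γ_nat {f f' : a ⟶ b} (α : f ⟶ f') (e : Fibre κ b) :
    (T.F.γ f' e).hom ▷ T.F.app₂ α e ⊗≫ 𝟙 (T.F.app₂ α e) =
      𝟙 _ ⊗≫ (T.F.map f').map (T.F.ιApp b e) ◁ T.F.χApp f' (𝟙 b) e ◁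
          T.F.swap α (ρ_ f').inv (ρ_ f).inv (α ▷ 𝟙 b) (by simp) e ⊗≫
        (T.F.map f').map (T.F.ιApp b e) ◁ (T.F.χR α (𝟙 b) e).inv ▷ T.F.app₂ (ρ_ f).inv e ⊗≫
        (T.F.nat₂ α (T.F.ιApp b e)).hom ▷
          (T.F.χApp f (𝟙 b) e ≫ T.F.app₂ (ρ_ f).inv e) ⊗≫
        T.F.app₂ α e ◁ (T.F.γ f e).hom ⊗≫ 𝟙 (T.F.app₂ α e) := by
  refine fibre_hom_ext (T.isCartesian_cApp f e) (R := T.sA _ α) ?_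
  simp [bicategoricalComp]
  -- The cell over `α` has been slid past `iA`; moving it back exposes the string that the
  -- naturality rule for `α` rewrites.
  rw [← (T.iA_slide (T.sA (𝟙 _) α)).1.1, ((hT.fact_nat₂ _ α _).2.1 _).2]
  simp

theorem δ_nat {f f' : a ⟶ b} (α : f ⟶ f') (e : Fibre κ b) :
    (T.F.δ f' e).hom ▷ T.F.app₂ (𝟙 a ◁ α) e ⊗≫
        T.F.ιApp a ((T.F.map f').obj e) ◁ (T.F.χL (𝟙 a) α e).inv ⊗≫
        (T.F.ιNat a (T.F.app₂ α e)).inv ▷ T.F.χApp (𝟙 a) f e ⊗≫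
        𝟙 (T.F.app₂ α e ≫ T.F.ιApp a ((T.F.map f).obj e) ≫ T.F.χApp (𝟙 a) f e) =
      T.F.swap (𝟙 a ◁ α) (λ_ f').hom (λ_ f).hom α (by simp) e ≫
        T.F.app₂ α e ◁ (T.F.δ f e).hom := by
  refine fibre_hom_ext (T.isCartesian_cApp (𝟙 a ≫ f) e)
    (R := (jc _ _ _).hom ▷ T.cApp (𝟙 a ≫ f) e ≫ (jc _ _ _).hom ▷ T.cApp (𝟙 a ≫ f) e ≫
      (T.xA _).hom ≫ (T.iA _).hom ▷ T.cApp f e ≫ T.sA _ α) ?_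
  simp [bicategoricalComp]

set_option maxHeartbeats 1600000 in
theorem ω_nat {f f' : a ⟶ d} {g g' : d ⟶ d'} {h h' : d' ⟶ b} (α : f ⟶ f')
    (β : g ⟶ g') (γ : h ⟶ h') (e : Fibre κ b) : T.F.ωNat₁ α β γ e = T.F.ωNat₂ α β γ e := by
  -- The comparisons `jc` separate the five factors of the target. Then `xA` splits the cartesian
  -- 1-cell over the triple composite, and each `cA` moves one of the pieces forward, until `γ`, `β`
  -- and `α` can act in this order.
  refine fibre_hom_ext (T.isCartesian_cApp ((f ≫ g) ≫ h) e)
    (R := (jc _ _ _).hom ▷ T.cApp _ e ≫ (jc _ _ _).hom ▷ T.cApp _ e ≫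
      (jc _ _ _).hom ▷ T.cApp _ e ≫ (jc _ _ _).hom ▷ T.cApp _ e ≫ (T.xA _).hom ≫
      (T.xA _).hom ▷ T.cApp h e ≫ (T.cA _ _).hom ▷ T.cApp g _ ▷ T.cApp h e ≫
      (T.cA _ _).hom ▷ T.cApp h e ≫ T.sA _ γ ≫
      (T.cA _ _).hom ▷ T.cApp g _ ▷ T.cApp h' e ≫ T.sA _ β ▷ T.cApp h' e ≫
      T.sA _ α ▷ T.cApp g' _ ▷ T.cApp h' e) ?_
  simp [bicategoricalComp, TrihomData.ωNat₁, TrihomData.ωNat₂]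
  rw [← (T.xA_slide (T.sA (𝟙 _) α)).1.1, ((hT.fact_nat₂ _ α _).2.1 _).2]
  simp

omit hP in
theorem unit (f : a ⟶ d) (g : d ⟶ b) (e : Fibre κ b) : T.F.unit₁ f g e = T.F.unit₂ f g e := by
  refine fibre_hom_ext (T.isCartesian_cApp (f ≫ g) e) (R := (T.xA _).hom) ?_
  simp [bicategoricalComp, TrihomData.unit₁, TrihomData.unit₂]

omit hP in
theorem assoc {d'' : B} (f : a ⟶ d) (g : d ⟶ d') (h : d' ⟶ d'') (k : d'' ⟶ b) (e : Fibre κ b) :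
    T.F.assoc₁ f g h k e = T.F.assoc₂ f g h k e := by
  refine fibre_hom_ext (T.isCartesian_cApp (((f ≫ g) ≫ h) ≫ k) e)
    (R := (jc _ _ _).hom ▷ T.cApp _ e ≫ (jc _ _ _).hom ▷ T.cApp _ e ≫
      (T.xA _).hom ≫ (T.xA _).hom ▷ T.cApp k e ≫ (T.xA _).hom ▷ T.cApp h _ ▷ T.cApp k e) ?_
  simp [bicategoricalComp, TrihomData.assoc₁, TrihomData.assoc₂]

end AssociatedData.IsCoherent

end

/-! ### Factoring cells over `B` through cartesian 1-cells. -/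

section

variable {E : Type u₂} [Bicategory.{w₂, v₂} E] {B : Type u₁} [Bicategory.{w₁, v₁} B]
  {P : E ⥤ᵖ B} {κ : LocalCleavage P}

open Fibre

section Base

variable {a b d : B} {e : Fibre κ a} {x : Fibre κ b} {y : Fibre κ d}

/-- The comparison of composites of 1-cells of the base, seen between objects of the fibres. -/
def base₁Comp (e : Fibre κ a) (x : Fibre κ b) (y : Fibre κ d) (u : a ⟶ b) (v : b ⟶ d) :
    base₁ e x u ≫ base₁ x y v ≅ base₁ e y (u ≫ v) :=
  castComp e.proj_eq x.proj_eq y.proj_eq (Iso.refl _)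

/-- All transport along equalities of objects is isolated in the single isomorphism `base₁Comp`, so
that later calculations involve no casts. -/
theorem Disp.comp_iso {u : a ⟶ b} {v : b ⟶ d} (f : Disp e x u) (g : Disp x y v) :
    (f.comp g).iso = compIso f.iso g.iso ≪≫ base₁Comp e x y u v := by
  obtain ⟨e, rfl⟩ := e; obtain ⟨x, rfl⟩ := x; obtain ⟨y, rfl⟩ := y
  ext
  exact (Category.comp_id _).symm

/-- An isomorphism of the base, seen between objects of the fibres. -/
@[simps] def base₂Iso (e : Fibre κ a) (x : Fibre κ b) {u v : a ⟶ b} (w : u ≅ v) :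
    base₁ e x u ≅ base₁ e x v where
  hom := base₂ e x w.hom
  inv := base₂ e x w.inv
  hom_inv_id := by simp [← base₂_comp]
  inv_hom_id := by simp [← base₂_comp]

end Base

section Lift

variable {a a' b : B} {e : Fibre κ a} {x : Fibre κ a'} {y : Fibre κ b} {u : a' ⟶ b}
  {c : Disp x y u}

theorem Disp.over_comp_iff {f : a ⟶ a'} {v : a ⟶ b}
    {k : Disp e x f} {n : Disp e y v} {R : k.hom ≫ c.hom ⟶ n.hom} {σ : f ≫ u ⟶ v} :
    (k.comp c).Over n R σ ↔ P.map₂ R ≫ n.iso.hom = (P.mapComp k.hom c.hom).hom ≫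
      k.iso.hom ▷ P.map c.hom ≫ base₁ e x f ◁ c.iso.hom ≫ (base₁Comp e x y f u).hom ≫
      base₂ e y σ := by
  simp only [Disp.Over, Disp.comp_iso]
  change _ = ((((P.mapComp k.hom c.hom).hom ≫ k.iso.hom ▷ P.map c.hom ≫ base₁ e x f ◁ c.iso.hom)) ≫
    (base₁Comp e x y f u).hom) ≫ base₂ e y σ ↔ _
  simp only [Category.assoc]
  rfl

/-- 1-cells over a composite factor through cartesian 1-cells. -/
theorem IsCartesian₁.exists_lift_disp (hc : IsCartesian₁ P c.hom)
    {f : a ⟶ a'} {v : a ⟶ b} (m : Disp e y v) (w : f ≫ u ≅ v) :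
    ∃ (k : Disp e x f) (φ : k.hom ≫ c.hom ≅ m.hom), (k.comp c).Over m φ.hom w.hom := by
  -- The isomorphism to be lifted is `w` combined with the canonical ones. The compatibility
  -- recorded in `Lift₁.comm` then says that `fac` lies over `w`.
  obtain ⟨L⟩ := hc.exists_lift m.hom (base₁ e x f)
    (whiskerLeftIso _ c.iso ≪≫ base₁Comp e x y f u ≪≫ base₂Iso e y w ≪≫ m.iso.symm)
  refine ⟨⟨L.hom, L.base⟩, L.fac, ?_⟩
  have hL := L.comm
  rw [Iso.eq_inv_comp] at hL
  rw [Disp.over_comp_iff, ← hL]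
  simp

/-- 1-cells over the same 1-cell as a cartesian 1-cell factor through it by 1-cells of the fibre. -/
theorem IsCartesian₁.exists_lift_hom {e x : Fibre κ a} {u : a ⟶ b} {c : Disp x y u}
    (hc : IsCartesian₁ P c.hom) {v : a ⟶ b} (m : Disp e y v)
    (w : 𝟙 a ≫ u ≅ v) :
    ∃ (k : e ⟶ x) (φ : J k ≫ c.hom ≅ m.hom),
      ((JDisp k).comp c).Over m φ.hom w.hom := by
  obtain ⟨k, φ, hφ⟩ := hc.exists_lift_disp m w
  -- `k` lies over the identity only up to isomorphism, whereas 1-cells of the fibre do so strictly.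
  -- The chosen lift of an identity at `k` corrects this.
  let l : e ⟶ x := ⟨(k.pull (𝟙 _)).hom, (k.lift (𝟙 _)).domain_eq⟩
  have hl : (JDisp l).Over k (k.pullIso (Iso.refl _)).hom (𝟙 _) := k.pullIso_over (Iso.refl _)
  refine ⟨l, whiskerRightIso (k.pullIso (Iso.refl _)) c.hom ≪≫ φ, ?_⟩
  have := (hl.whiskerRight c).comp hφ
  rw [id_whiskerRight, Category.id_comp] at this
  exact this

/-- When `R` and `W` lie over the same 2-cell, their images differ by the canonical isomorphism
between the images of `k` and `l`. This is the hypothesis of `existsUnique_fac`, with that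
isomorphism as `δ`. -/
theorem Disp.Over.map₂_eq {k l : Disp e x (f : a ⟶ a')} {v : a ⟶ b} {n : Disp e y v}
    {R : l.hom ≫ c.hom ⟶ n.hom} {W : k.hom ≫ c.hom ⟶ n.hom} {σ : f ≫ u ⟶ v}
    (hR : (l.comp c).Over n R σ) (hW : (k.comp c).Over n W σ) :
    P.map₂ W = (P.mapComp k.hom c.hom).hom ≫ (k.iso ≪≫ l.iso.symm).hom ▷ P.map c.hom ≫
      (P.mapComp l.hom c.hom).inv ≫ P.map₂ R := by
  rw [← cancel_mono n.iso.hom]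
  rw [Disp.over_comp_iff] at hR hW
  rw [hW]
  simp only [Category.assoc, hR]
  simp

/-- 2-cells over the same 2-cell factor through cartesian cells by 2-cells of the fibre. -/
theorem IsCartesian₁.exists_lift_hom₂ {e x : Fibre κ a} {u : a ⟶ b} {c : Disp x y u}
    (hc : IsCartesian₁ P c.hom) {v : a ⟶ b} {n : Disp e y v}
    {k l : e ⟶ x} {R : J l ≫ c.hom ⟶ n.hom} {W : J k ≫ c.hom ⟶ n.hom} {σ : 𝟙 a ≫ u ⟶ v}
    (hR : ((JDisp l).comp c).Over n R σ) (hW : ((JDisp k).comp c).Over n W σ)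
    (cR : IsCartesian₂ P R) : ∃ θ : k ⟶ l, J₂ θ ▷ c.hom ≫ R = W := by
  obtain ⟨d, ⟨h₁, h₂⟩, -⟩ := hc.existsUnique_fac cR W _ (hR.map₂_eq hW)
  -- For 1-cells strictly over an identity the prescribed image is a composite of transports along
  -- equalities, so the lifted 2-cell belongs to the fibre.
  exact ⟨⟨d, h₂.trans (by simp [JDisp, Hom.disp, Disp.ofEq]; rfl)⟩, h₁⟩

/-- Equality of 2-cells of a fibre can be checked after composition with a cartesian 1-cell and a
cartesian 2-cell. -/
theorem IsCartesian₁.hom₂_ext {e x : Fibre κ a} {y : E} {c : x.obj ⟶ y}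
    (hc : IsCartesian₁ P c) {k l : e ⟶ x} {n : e.obj ⟶ y} {R : J l ≫ c ⟶ n}
    (cR : IsCartesian₂ P R) {θ ζ : k ⟶ l} (h : J₂ θ ▷ c ≫ R = J₂ ζ ▷ c ≫ R) : θ = ζ :=
  Fibre.hom₂_ext (hc.hom_ext cR (θ.map₂_eq.trans ζ.map₂_eq.symm) h)

/-- Cartesian 2-cells over the same 2-cell factor through cartesian cells by isomorphisms of the
fibre. -/
theorem IsCartesian₁.exists_lift_iso {e x : Fibre κ a} {u : a ⟶ b} {c : Disp x y u}
    (hc : IsCartesian₁ P c.hom) {v : a ⟶ b} {n : Disp e y v}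
    {k l : e ⟶ x} {R : J l ≫ c.hom ⟶ n.hom} {W : J k ≫ c.hom ⟶ n.hom} {σ : 𝟙 a ≫ u ⟶ v}
    (hR : ((JDisp l).comp c).Over n R σ) (hW : ((JDisp k).comp c).Over n W σ)
    (cR : IsCartesian₂ P R) (cW : IsCartesian₂ P W) : ∃ θ : k ≅ l, J₂ θ.hom ▷ c.hom ≫ R = W := by
  -- Each of `R` and `W` factors through the other, and uniqueness of factorisations makes the two
  -- comparisons mutually inverse.
  obtain ⟨θ, hθ⟩ := hc.exists_lift_hom₂ hR hW cR
  obtain ⟨ζ, hζ⟩ := hc.exists_lift_hom₂ hW hR cW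
  refine ⟨⟨θ, ζ, hc.hom₂_ext cW ?_, hc.hom₂_ext cR ?_⟩, hθ⟩
  · have : J₂ (θ ≫ ζ) = J₂ θ ≫ J₂ ζ := rfl
    rw [this, comp_whiskerRight, Category.assoc, hζ, hθ]
    exact (by simp : W = 𝟙 _ ▷ c.hom ≫ W)
  · have : J₂ (ζ ≫ θ) = J₂ ζ ≫ J₂ θ := rfl
    rw [this, comp_whiskerRight, Category.assoc, hθ, hζ]
    exact (by simp : R = 𝟙 _ ▷ c.hom ≫ R)

end Lift

end

/-! ### Reindexing homomorphisms between fibres. -/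

section

variable {E : Type u₂} [Bicategory.{w₂, v₂} E] {B : Type u₁} [Bicategory.{w₁, v₁} B]
  {P : E ⥤ᵖ B} {κ : LocalCleavage P} {a b b' : B}

open Fibre

theorem Disp.Over.congr {b b' : B} {e : Fibre κ b} {e' : Fibre κ b'} {u v : b ⟶ b'}
    {f : Disp e e' u} {g : Disp e e' v} {θ : f.hom ⟶ g.hom} {σ τ : u ⟶ v} (h : f.Over g θ σ)
    (e : σ = τ) : f.Over g θ τ := e ▸ h

namespace Fibre

theorem JComp_over {e e' e'' : Fibre κ b} (k : e ⟶ e') (l : e' ⟶ e'') :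
    (JDisp (k ≫ l)).Over ((JDisp k).comp (JDisp l)) (JComp k l).hom (λ_ (𝟙 b)).inv :=
  compIso_over k l

theorem JId_over (e : Fibre κ b) : (JDisp (𝟙 e)).Over (Disp.id e) (JId e).hom (𝟙 _) :=
  idIso_over e

theorem J₂_over {e e' : Fibre κ b} {k l : e ⟶ e'} (θ : k ⟶ l) :
    (JDisp k).Over (JDisp l) (J₂ θ) (𝟙 _) := Hom₂.over θ

end Fibre

open Disp

section

variable {b₃ : B} {e : Fibre κ a} {e' : Fibre κ b} {e'' : Fibre κ b'} {e₃ : Fibre κ b₃}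

theorem Disp.Over.associator_inv {u : a ⟶ b} {v : b ⟶ b'} {w : b' ⟶ b₃} (f : Disp e e' u)
    (g : Disp e' e'' v) (h : Disp e'' e₃ w) :
    Over (f.comp (g.comp h)) ((f.comp g).comp h) (α_ f.hom g.hom h.hom).inv (α_ u v w).inv :=
  Over.inv (f := (f.comp g).comp h) (g := f.comp (g.comp h)) (Over.associator f g h)

theorem Disp.Over.leftUnitor_inv {u : a ⟶ b} (f : Disp e e' u) :
    Over f ((Disp.id e).comp f) (λ_ f.hom).inv (λ_ u).inv :=
  Over.inv (f := (Disp.id e).comp f) (g := f) (Over.leftUnitor f)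

theorem Disp.Over.rightUnitor_inv {u : a ⟶ b} (f : Disp e e' u) :
    Over f (f.comp (Disp.id e')) (ρ_ f.hom).inv (ρ_ u).inv :=
  Over.inv (f := f.comp (Disp.id e')) (g := f) (Over.rightUnitor f)

end

/-- Operations on 1-cells and 2-cells between fibres along `u`, with isomorphisms by which they
commute with given 1-cells over `u`. -/
structure PreCone {u : a ⟶ b} {obj : Fibre κ b → Fibre κ a} (disp : ∀ e, Disp (obj e) e u) where
  map {e e' : Fibre κ b} (k : e ⟶ e') : obj e ⟶ obj e'
  map₂ {e e' : Fibre κ b} {k l : e ⟶ e'} (θ : k ⟶ l) : map k ⟶ map l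
  mapId (e : Fibre κ b) : map (𝟙 e) ≅ 𝟙 (obj e)
  mapComp {e e' e'' : Fibre κ b} (k : e ⟶ e') (l : e' ⟶ e'') : map (k ≫ l) ≅ map k ≫ map l
  nat {e e' : Fibre κ b} (k : e ⟶ e') : J (map k) ≫ (disp e').hom ≅ (disp e).hom ≫ J k
  nat_over {e e' : Fibre κ b} (k : e ⟶ e') :
    ((JDisp (map k)).comp (disp e')).Over ((disp e).comp (JDisp k)) (nat k).hom
      ((λ_ u).hom ≫ (ρ_ u).inv)
  map₂_nat {e e' : Fibre κ b} {k l : e ⟶ e'} (θ : k ⟶ l) :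
    J₂ (map₂ θ) ▷ (disp e').hom ≫ (nat l).hom = (nat k).hom ≫ (disp e).hom ◁ J₂ θ
  mapId_nat (e : Fibre κ b) :
    J₂ (mapId e).hom ▷ (disp e).hom ≫ (JId _).hom ▷ (disp e).hom ≫ (λ_ _).hom =
      (nat (𝟙 e)).hom ≫ (disp e).hom ◁ (JId e).hom ≫ (ρ_ _).hom
  mapComp_nat {e e' e'' : Fibre κ b} (k : e ⟶ e') (l : e' ⟶ e'') :
    J₂ (mapComp k l).hom ▷ (disp e'').hom ≫ (JComp _ _).hom ▷ (disp e'').hom ≫ (α_ _ _ _).hom ≫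
      J (map k) ◁ (nat l).hom ≫ (α_ _ _ _).inv ≫ (nat k).hom ▷ J l ≫ (α_ _ _ _).hom =
    (nat (k ≫ l)).hom ≫ (disp e).hom ◁ (JComp k l).hom

namespace PreCone

variable {u v : a ⟶ b}

/-- Factoring through cartesian 1-cells. -/
theorem nonempty_of_cartesian {obj : Fibre κ b → Fibre κ a} (disp : ∀ e, Disp (obj e) e u)
    (hc : ∀ e, IsCartesian₁ P (disp e).hom) : Nonempty (PreCone disp) := by
  have h₁ {e e' : Fibre κ b} (k : e ⟶ e') : ∃ (m : obj e ⟶ obj e')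
      (φ : J m ≫ (disp e').hom ≅ (disp e).hom ≫ J k), ((JDisp m).comp (disp e')).Over ((disp e).comp (JDisp k)) φ.hom
        ((λ_ u).hom ≫ (ρ_ u).inv) :=
    (hc e').exists_lift_hom ((disp e).comp (JDisp k)) (λ_ u ≪≫ (ρ_ u).symm)
  choose map nat nat_over using @h₁
  -- From here on, each datum compares two cells of `E` that lie over the same 2-cell of `B`, by
  -- coherence in `B`. For the two constraints both cells are invertible, hence the comparison is an
  -- isomorphism.
  have h₂ {e e' : Fibre κ b} {k l : e ⟶ e'} (θ : k ⟶ l) :=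
    (hc e').exists_lift_hom₂ (n := (disp e).comp (JDisp l)) (W := (nat k).hom ≫ _)
      (nat_over l) (((nat_over k).comp (Over.whiskerLeft (disp e) (J₂_over θ))).congr (by simp))
      (.of_isIso (nat l).hom)
  choose map₂ map₂_nat using @h₂
  have h₃ (e : Fibre κ b) :=
    (hc e).exists_lift_iso (n := disp e) (R := _ ≫ _) (W := (nat (𝟙 e)).hom ≫ _ ≫ _)
      ((Over.whiskerRight (JId_over (obj e)) (disp e)).comp (Over.leftUnitor (disp e)))
      (((nat_over (𝟙 e)).comp ((Over.whiskerLeft (disp e) (JId_over e)).comp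
        (Over.rightUnitor (disp e)))).congr (by simp))
      (.of_isIso ((JId _).hom ▷ (disp e).hom ≫ (λ_ (disp e).hom).hom))
      (.of_isIso ((nat (𝟙 e)).hom ≫ (disp e).hom ◁ (JId e).hom ≫ (ρ_ (disp e).hom).hom))
  choose mapId mapId_nat using @h₃
  have h₄ {e e' e'' : Fibre κ b} (k : e ⟶ e') (l : e' ⟶ e'') :=
    (hc e'').exists_lift_iso (n := (disp e).comp ((JDisp k).comp (JDisp l)))
      (R := _ ≫ _ ≫ _ ≫ _ ≫ _ ≫ _) (W := (nat (k ≫ l)).hom ≫ _)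
      ((Over.whiskerRight (JComp_over (map k) (map l)) (disp e'')).comp
        ((Over.associator (JDisp (map k)) (JDisp (map l)) (disp e'')).comp
        ((Over.whiskerLeft (JDisp (map k)) (nat_over l)).comp
        ((Over.associator_inv (JDisp (map k)) (disp e') (JDisp l)).comp
        ((Over.whiskerRight (nat_over k) (JDisp l)).comp
        (Over.associator (disp e) (JDisp k) (JDisp l)))))))
      (((nat_over (k ≫ l)).comp (Over.whiskerLeft (disp e) (JComp_over k l))).congr
        (by bicategory))
      (.of_isIso ((JComp _ _).hom ▷ (disp e'').hom ≫ (α_ _ _ _).hom ≫ J (map k) ◁ (nat l).hom ≫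
        (α_ (J (map k)) ((disp e').hom) (J l)).inv ≫ (nat k).hom ▷ J l ≫ (α_ (disp e).hom (J k) (J l)).hom))
      (.of_isIso ((nat (k ≫ l)).hom ≫ (disp e).hom ◁ (JComp k l).hom))
  choose mapComp mapComp_nat using @h₄
  exact ⟨⟨map, map₂, mapId, mapComp, nat, nat_over, map₂_nat, mapId_nat, mapComp_nat⟩⟩

section Act

variable {obj : Fibre κ b → Fibre κ a} {disp : ∀ e, Disp (obj e) e u} (C : PreCone disp)
  {e e' e'' : Fibre κ b} {z : E}

/-- The isomorphisms `nat` acting by postcomposition. -/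
def cA (m : z ⟶ (obj e).obj) (k : e ⟶ e') :
    (m ≫ J (C.map k)) ≫ (disp e').hom ≅ (m ≫ (disp e).hom) ≫ J k :=
  act₂₂ m (C.nat k)

@[simp] theorem cA_slide {m m' : z ⟶ (obj e).obj} (μ : m ⟶ m') (k : e ⟶ e') :
    Slide (μ ▷ J (C.map k) ▷ (disp e').hom) (C.cA m' k).hom
      ((C.cA m k).hom ≫ μ ▷ (disp e).hom ▷ J k) := act₂₂_slide μ _

@[simp] theorem cA_inv_slide {m m' : z ⟶ (obj e).obj} (μ : m ⟶ m') (k : e ⟶ e') :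
    Slide (C.cA m k).inv (μ ▷ J (C.map k) ▷ (disp e').hom)
      (μ ▷ (disp e).hom ▷ J k ≫ (C.cA m' k).inv) := act₂₂_inv_slide μ _

@[simp] theorem fact_map₂ (m : z ⟶ (obj e).obj) {k l : e ⟶ e'} (θ : k ⟶ l) :
    Expand (fact m (C.map₂ θ) ▷ (disp e').hom)
      ((C.cA m k).hom ≫ fact (m ≫ (disp e).hom) θ ≫ (C.cA m l).inv) := .mk (by
  have h' := congrArg (m ◁ ·) (C.map₂_nat θ)
  simp only [whiskerLeft_comp] at h'
  rw [← Category.assoc, Iso.eq_comp_inv]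
  simp [fact, act₁₁, cA, act₂₂, h'])

theorem fact_mapComp_push (m : z ⟶ (obj e).obj) (k : e ⟶ e') (l : e' ⟶ e'') :
    fact m (C.mapComp k l).hom ▷ (disp e'').hom ≫ (jc m _ _).hom ▷ (disp e'').hom ≫
        (C.cA (m ≫ J (C.map k)) l).hom ≫ (C.cA m k).hom ▷ J l =
      (C.cA m (k ≫ l)).hom ≫ (jc (m ≫ (disp e).hom) k l).hom := by
  have h' := congrArg (m ◁ ·) (C.mapComp_nat k l)
  simp only [whiskerLeft_comp] at h'
  simp [fact, act₁₁, cA, act₂₂, jc, act₁₂, ← reassoc_of% h']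

theorem fact_mapId_push (m : z ⟶ (obj e).obj) :
    fact m (C.mapId e).hom ▷ (disp e).hom ≫ (ju m).hom ▷ (disp e).hom =
      (C.cA m (𝟙 e)).hom ≫ (ju (m ≫ (disp e).hom)).hom := by
  have h' := congrArg (m ◁ ·) (C.mapId_nat e)
  simp only [whiskerLeft_comp] at h'
  simp [fact, act₁₁, cA, act₂₂, ju, act₁₀, h']

@[simp] theorem fact_mapComp (m : z ⟶ (obj e).obj) (k : e ⟶ e') (l : e' ⟶ e'') :
    Expand (fact m (C.mapComp k l).hom ▷ (disp e'').hom)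
      (((C.cA m (k ≫ l)).hom ≫ (jc (m ≫ (disp e).hom) k l).hom) ≫
        (C.cA m k).inv ▷ J l ≫ (C.cA (m ≫ J (C.map k)) l).inv ≫
        (jc m _ _).inv ▷ (disp e'').hom) :=
  .of_push _ (C.fact_mapComp_push m k l) (by simp)

@[simp] theorem fact_mapComp_inv (m : z ⟶ (obj e).obj) (k : e ⟶ e') (l : e' ⟶ e'') :
    Expand (fact m (C.mapComp k l).inv ▷ (disp e'').hom)
      (((jc m _ _).hom ▷ (disp e'').hom ≫ (C.cA (m ≫ J (C.map k)) l).hom ≫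
        (C.cA m k).hom ▷ J l) ≫ (jc (m ≫ (disp e).hom) k l).inv ≫ (C.cA m (k ≫ l)).inv) :=
  fact_inv_expand _ (C.fact_mapComp_push m k l) (by simp)

@[simp] theorem fact_mapId (m : z ⟶ (obj e).obj) :
    Expand (fact m (C.mapId e).hom ▷ (disp e).hom)
      (((C.cA m (𝟙 e)).hom ≫ (ju (m ≫ (disp e).hom)).hom) ≫ (ju m).inv ▷ (disp e).hom) :=
  .of_push _ (C.fact_mapId_push m) (by simp)

/-- Factoring through cartesian 1-cells is a homomorphism. -/
def toPseudofunctor (hc : ∀ e, IsCartesian₁ P (disp e).hom) : Fibre κ b ⥤ᵖ Fibre κ a where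
  obj := obj
  map := C.map
  map₂ := C.map₂
  mapId := C.mapId
  mapComp := C.mapComp
  -- Each axiom is tested against the naturality isomorphism at the 1-cell concerned, where it
  -- reduces to the defining equations of the lifted cells.
  map₂_id k := fibre_hom_ext (hc _) (R := (C.cA _ k).hom) (by simp)
  map₂_comp θ ζ := fibre_hom_ext (hc _) (R := (C.cA _ _).hom) (by simp)
  map₂_whisker_left k _ _ θ := fibre_hom_ext (hc _) (R := (C.cA _ _).hom) (by simp)
  map₂_whisker_right θ k := fibre_hom_ext (hc _) (R := (C.cA _ _).hom) (by simp)
  map₂_associator k l n := fibre_hom_ext (hc _) (R := (C.cA _ _).hom) (by simp)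
  map₂_left_unitor k := fibre_hom_ext (hc _) (R := (C.cA _ _).hom) (by simp)
  map₂_right_unitor k := fibre_hom_ext (hc _) (R := (C.cA _ _).hom) (by simp)

/-- The given 1-cells are pseudo-natural. -/
def toStrongTrans (hc : ∀ e, IsCartesian₁ P (disp e).hom) :
    ((C.toPseudofunctor hc).comp (incl κ a)).StrongTrans (incl κ b) where
  app e := (disp e).hom
  naturality k := C.nat k
  naturality_naturality θ := C.map₂_nat θ
  naturality_id e := by
    have h := congrArg (· ≫ (ρ_ _).inv) (C.mapId_nat e)
    simp only [Category.assoc, Iso.hom_inv_id, Category.comp_id] at h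
    have h' : (J₂ (C.mapId e).hom ≫ (JId _).hom) ▷ (disp e).hom ≫ (λ_ _).hom ≫ (ρ_ _).inv =
      (C.nat (𝟙 e)).hom ≫ (disp e).hom ◁ (JId e).hom := by simpa using h
    exact h'.symm
  naturality_comp k l := by
    have h := C.mapComp_nat k l
    rw [← comp_whiskerRight_assoc] at h
    exact h.symm

end Act

end PreCone

end

/-! ### Pseudo-natural transformations obtained by factorisation. -/

section

variable {E : Type u₂} [Bicategory.{w₂, v₂} E] {B : Type u₁} [Bicategory.{w₁, v₁} B]
  {P : E ⥤ᵖ B} {κ : LocalCleavage P} {a b b' : B}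

open Fibre Disp

namespace PreCone

variable {u v : a ⟶ b} {objC objD : Fibre κ b → Fibre κ a} {c : ∀ e, Disp (objC e) e u} (C : PreCone c)
  {dispD : ∀ e, Disp (objD e) e v} (D : PreCone dispD) [hP : Fact (IsFibration P)]

include hP in
/-- Pseudo-natural families of 1-cells factor through cartesian 1-cells by pseudo-natural families
of 1-cells of the fibre. -/
theorem exists_trans (hc : ∀ e, IsCartesian₁ P (c e).hom) {σ : u ⟶ v} (t : ∀ e, objD e ⟶ objC e)
    (s : ∀ e, J (t e) ≫ (c e).hom ⟶ (dispD e).hom)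
    (hs : ∀ e, ((JDisp (t e)).comp (c e)).Over (dispD e) (s e) ((λ_ u).hom ≫ σ))
    (cs : ∀ e, IsCartesian₂ P (s e)) :
    ∃ n : ∀ {e e' : Fibre κ b} (k : e ⟶ e'), D.map k ≫ t e' ≅ t e ≫ C.map k,
      (∀ {e e' : Fibre κ b} (k : e ⟶ e'), J (D.map k) ◁ s e' ≫ (D.nat k).hom =
        ((α_ _ _ _).inv ≫ ((JComp _ _).inv ≫ J₂ (n k).hom ≫ (JComp _ _).hom) ▷ (c e').hom ≫
          (α_ _ _ _).hom ≫ J (t e) ◁ (C.nat k).hom ≫ (α_ _ _ _).inv) ≫ s e ▷ J k) ∧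
      (∀ {e e' : Fibre κ b} {k l : e ⟶ e'} (θ : k ⟶ l),
        D.map₂ θ ▷ t e' ≫ (n l).hom = (n k).hom ≫ t e ◁ C.map₂ θ) ∧
      (∀ e : Fibre κ b, (n (𝟙 e)).hom ≫ t e ◁ (C.mapId e).hom =
        (D.mapId e).hom ▷ t e ≫ (λ_ _).hom ≫ (ρ_ _).inv) ∧
      (∀ {e e' e'' : Fibre κ b} (k : e ⟶ e') (l : e' ⟶ e''),
        (n (k ≫ l)).hom ≫ t e ◁ (C.mapComp k l).hom =
          (D.mapComp k l).hom ▷ t e'' ≫ (α_ _ _ _).hom ≫ D.map k ◁ (n l).hom ≫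
            (α_ _ _ _).inv ≫ (n k).hom ▷ C.map l ≫ (α_ _ _ _).hom) := by
  -- `n k` compares two cartesian 2-cells over the same 2-cell of `B`: the naturality of `c` at `k`
  -- followed by `s e`, and `s e'` followed by the naturality of `dispD` at `k`.
  have h₁ {e e' : Fibre κ b} (k : e ⟶ e') : ∃ θ : D.map k ≫ t e' ≅ t e ≫ C.map k,
      J₂ θ.hom ▷ (c e').hom ≫ (JComp (t e) (C.map k)).hom ▷ (c e').hom ≫ (α_ _ _ _).hom ≫
        J (t e) ◁ (C.nat k).hom ≫ (α_ (J (t e)) (c e).hom (J k)).inv ≫ s e ▷ J k =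
      (JComp (D.map k) (t e')).hom ▷ (c e').hom ≫ (α_ _ _ _).hom ≫ J (D.map k) ◁ s e' ≫
        (D.nat k).hom := (hc e').exists_lift_iso
    (n := (dispD e).comp (JDisp k))
    (R := (JComp (t e) (C.map k)).hom ▷ (c e').hom ≫ (α_ _ _ _).hom ≫ J (t e) ◁ (C.nat k).hom ≫
      (α_ (J (t e)) (c e).hom (J k)).inv ≫ s e ▷ J k)
    (W := (JComp (D.map k) (t e')).hom ▷ (c e').hom ≫ (α_ _ _ _).hom ≫ J (D.map k) ◁ s e' ≫
      (D.nat k).hom)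
    ((Over.whiskerRight (JComp_over (t e) (C.map k)) (c e')).comp
      ((Over.associator (JDisp (t e)) (JDisp (C.map k)) (c e')).comp
      ((Over.whiskerLeft (JDisp (t e)) (C.nat_over k)).comp
      ((Over.associator_inv (JDisp (t e)) (c e) (JDisp k)).comp
      (Over.whiskerRight (hs e) (JDisp k))))))
    (((Over.whiskerRight (JComp_over (D.map k) (t e')) (c e')).comp
      ((Over.associator (JDisp (D.map k)) (JDisp (t e')) (c e')).comp
      ((Over.whiskerLeft (JDisp (D.map k)) (hs e')).comp (D.nat_over k)))).congr (by simp))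
    ((IsCartesian₂.of_isIso ((JComp (t e) (C.map k)).hom ▷ (c e').hom)).comp
      ((IsCartesian₂.of_isIso _).comp ((IsCartesian₂.of_isIso (J (t e) ◁ (C.nat k).hom)).comp
      ((IsCartesian₂.of_isIso _).comp ((cs e).whiskerRight hP.out _)))))
    ((IsCartesian₂.of_isIso ((JComp (D.map k) (t e')).hom ▷ (c e').hom)).comp
      ((IsCartesian₂.of_isIso _).comp (((cs e').whiskerLeft hP.out _).comp
      (IsCartesian₂.of_isIso (D.nat k).hom))))
  choose n hn using @h₁
  let sA {z : E} {e : Fibre κ b} (m : z ⟶ (objD e).obj) : (m ≫ J (t e)) ≫ (c e).hom ⟶ m ≫ (dispD e).hom :=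
    act₂₁ m (s e)
  have sA_slide {z : E} {e : Fibre κ b} {m m' : z ⟶ (objD e).obj} (μ : m ⟶ m') :
      Slide (μ ▷ J (t e) ▷ (c e).hom) (sA m') (sA m ≫ μ ▷ (dispD e).hom) := act₂₁_slide μ _
  have cartesianCell_sA {z : E} {e : Fibre κ b} (m : z ⟶ (objD e).obj) : CartesianCell P (sA m) :=
    ⟨(IsCartesian₂.of_isIso _).comp ((cs e).whiskerLeft hP.out _)⟩
  have n_push {z : E} {e e' : Fibre κ b} (m : z ⟶ (objD e).obj) (k : e ⟶ e') :
      Slide₄ (fact m (n k).hom ▷ (c e').hom) ((jc m _ _).hom ▷ (c e').hom) (C.cA (m ≫ J (t e)) k).hom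
          (sA m ▷ J k)
        ((jc m _ _).hom ▷ (c e').hom ≫ sA (m ≫ J (D.map k)) ≫ (D.cA m k).hom) := .mk (by
    have h' := congrArg (m ◁ ·) (hn k)
    simp only [whiskerLeft_comp] at h'
    simp [fact, act₁₁, cA, act₂₂, jc, act₁₂, sA, act₂₁, reassoc_of% h'])
  -- Only interchange, cartesianness and the equation for `n` are needed from here on. Making `sA`
  -- opaque prevents its unfolding.
  clear_value sA
  refine ⟨n, fun k => ?_, fun {e e' k l} θ => ?_, fun e => ?_, fun {e e' e''} k l => ?_⟩
  · have h' := hn k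
    rw [← cancel_epi ((JComp _ _).hom ▷ (c _).hom ≫ (α_ _ _ _).hom)]
    simpa using h'.symm
  · refine fibre_hom_ext (hc _) (R := (jc _ _ _).hom ▷ (c _).hom ≫ (C.cA _ _).hom ≫ sA _ ▷ J l) ?_
    simp
    -- The cell `sA` is moved in front of the action of `θ`, where it completes the string rewritten
    -- by `n_push`.
    rw [← (fact_slide (sA _) θ).1.1, (n_push _ k).1.2]
    simp [sA_slide, n_push]
  · refine fibre_hom_ext (hc _) (R := (jc _ _ _).hom ▷ (c _).hom ≫ (ju _).hom ▷ (c _).hom ≫ sA _) ?_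
    simp
    rw [← (ju_slide (sA _)).1.1, (n_push _ _).1.2]
    simp [sA_slide]
  · refine fibre_hom_ext (hc _) (R := (jc _ _ _).hom ▷ (c _).hom ≫ (jc _ _ _).hom ▷ (c _).hom ≫
      (C.cA _ _).hom ≫ (C.cA _ _).hom ▷ J l ≫ sA _ ▷ J k ▷ J l) ?_
    simp [sA_slide, n_push]
    rw [← (jc_slide (sA _) k l).1.1, (n_push _ _).1.2]
    simp

end PreCone

end

/-! ### Identity and composite cones. -/

section

variable {E : Type u₂} [Bicategory.{w₂, v₂} E] {B : Type u₁} [Bicategory.{w₁, v₁} B]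
  {P : E ⥤ᵖ B} {κ : LocalCleavage P} {a b b' : B}

open Fibre Disp

theorem Disp.pullHom_over {e : Fibre κ a} {e' : Fibre κ b} {u u' : a ⟶ b} (D : Disp e e' u')
    (σ : u ⟶ u') : (D.pull σ).Over D (D.pullHom σ) σ := by
  have h := (D.lift σ).map₂_eq
  change P.map₂ (D.lift σ).hom ≫ D.iso.hom = eqToHom (D.lift σ).domain_eq ≫ base₂ e e' σ
  rw [h]
  simp

namespace PreCone

/-- The identities, as 1-cells over the identity. -/
def id (κ : LocalCleavage P) (a : B) : PreCone (fun e : Fibre κ a => Disp.id e) where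
  map k := k
  map₂ θ := θ
  mapId _ := Iso.refl _
  mapComp _ _ := Iso.refl _
  nat k := ρ_ (J k) ≪≫ (λ_ (J k)).symm
  nat_over k := ((Over.rightUnitor (JDisp k)).comp (Over.leftUnitor_inv (JDisp k))).congr
    (by rw [unitors_equal, unitors_inv_equal])
  map₂_nat θ := by simp [Disp.id]
  mapId_nat e := by
    have : J₂ (Iso.refl (𝟙 e)).hom = 𝟙 (J (𝟙 e)) := rfl
    rw [this]
    simp [Disp.id, unitors_equal]
  mapComp_nat k l := by
    have : J₂ (Iso.refl (k ≫ l)).hom = 𝟙 (J (k ≫ l)) := rfl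
    rw [this]
    simp [Disp.id]

variable {u : a ⟶ b} {v : b ⟶ b'} {objC : Fibre κ b → Fibre κ a} {objD : Fibre κ b' → Fibre κ b}
  {c : ∀ e, Disp (objC e) e u} {d : ∀ e, Disp (objD e) e v}

/-- Composites of 1-cells over `u` and `v`. -/
def comp (C : PreCone c) (D : PreCone d) (hc : ∀ e, IsCartesian₁ P (c e).hom)
    (hd : ∀ e, IsCartesian₁ P (d e).hom) : PreCone (fun e => (c (objD e)).comp (d e)) where
  map k := C.map (D.map k)
  map₂ θ := C.map₂ (D.map₂ θ)
  -- Taking the constraints from the composite homomorphism makes this cone agree definitionally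
  -- with the source required of `χ` in `TrihomCore`.
  mapId e := ((D.toPseudofunctor hd).comp (C.toPseudofunctor hc)).mapId e
  mapComp k l := ((D.toPseudofunctor hd).comp (C.toPseudofunctor hc)).mapComp k l
  nat {e e'} k := (α_ (J (C.map (D.map k))) (c (objD e')).hom (d e').hom).symm ≪≫
    whiskerRightIso (C.nat (D.map k)) (d e').hom ≪≫ α_ (c (objD e)).hom (J (D.map k)) (d e').hom ≪≫
    whiskerLeftIso (c (objD e)).hom (D.nat k) ≪≫ (α_ (c (objD e)).hom (d e).hom (J k)).symm
  nat_over {e e'} k := ((Over.associator_inv (JDisp (C.map (D.map k))) (c (objD e')) (d e')).comp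
    ((Over.whiskerRight (C.nat_over (D.map k)) (d e')).comp
    ((Over.associator (c (objD e)) (JDisp (D.map k)) (d e')).comp
    ((Over.whiskerLeft (c (objD e)) (D.nat_over k)).comp
    (Over.associator_inv (c (objD e)) (d e) (JDisp k)))))).congr (by simp)
  map₂_nat {e e' k l} θ := by
    change J₂ (C.map₂ (D.map₂ θ)) ▷ ((c (objD e')).hom ≫ (d e').hom) ≫
      ((α_ (J (C.map (D.map l))) (c (objD e')).hom (d e').hom).inv ≫
        (C.nat (D.map l)).hom ▷ (d e').hom ≫ (α_ (c (objD e)).hom (J (D.map l)) (d e').hom).hom ≫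
        (c (objD e)).hom ◁ (D.nat l).hom ≫ (α_ (c (objD e)).hom (d e).hom (J l)).inv) =
      ((α_ (J (C.map (D.map k))) (c (objD e')).hom (d e').hom).inv ≫
        (C.nat (D.map k)).hom ▷ (d e').hom ≫ (α_ (c (objD e)).hom (J (D.map k)) (d e').hom).hom ≫
        (c (objD e)).hom ◁ (D.nat k).hom ≫ (α_ (c (objD e)).hom (d e).hom (J k)).inv) ≫
        ((c (objD e)).hom ≫ (d e).hom) ◁ J₂ θ
    have h₁ := congrArg (· ▷ (d e').hom) (C.map₂_nat (D.map₂ θ))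
    have h₂ := congrArg ((c (objD e)).hom ◁ ·) (D.map₂_nat θ)
    simp only [comp_whiskerRight, whiskerLeft_comp] at h₁ h₂
    simp [reassoc_of% h₁, reassoc_of% h₂]
  mapId_nat e := by
    change J₂ (C.map₂ (D.mapId e).hom ≫ (C.mapId (objD e)).hom) ▷ ((c (objD e)).hom ≫ (d e).hom) ≫
      (JId (objC (objD e))).hom ▷ ((c (objD e)).hom ≫ (d e).hom) ≫
      (λ_ ((c (objD e)).hom ≫ (d e).hom)).hom =
      ((α_ (J (C.map (D.map (𝟙 e)))) (c (objD e)).hom (d e).hom).inv ≫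
        (C.nat (D.map (𝟙 e))).hom ▷ (d e).hom ≫
        (α_ (c (objD e)).hom (J (D.map (𝟙 e))) (d e).hom).hom ≫
        (c (objD e)).hom ◁ (D.nat (𝟙 e)).hom ≫ (α_ (c (objD e)).hom (d e).hom (J (𝟙 e))).inv) ≫
        ((c (objD e)).hom ≫ (d e).hom) ◁ (JId e).hom ≫ (ρ_ ((c (objD e)).hom ≫ (d e).hom)).hom
    have h₁ := congrArg (· ▷ (d e).hom) (C.map₂_nat (D.mapId e).hom)
    have h₂ := congrArg (· ▷ (d e).hom) (C.mapId_nat (objD e))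
    have h₃ := congrArg ((c (objD e)).hom ◁ ·) (D.mapId_nat e)
    simp only [comp_whiskerRight, whiskerLeft_comp, ← triangle, whisker_assoc, Category.assoc,
      Iso.inv_hom_id_assoc] at h₁ h₂ h₃
    have h₄ : J₂ (C.map₂ (D.mapId e).hom ≫ (C.mapId (objD e)).hom) =
      J₂ (C.map₂ (D.mapId e).hom) ≫ J₂ (C.mapId (objD e)).hom := rfl
    rw [h₄, leftUnitor_comp, rightUnitor_comp]
    simp only [comp_whiskerRight, whiskerRight_comp, Category.assoc, Iso.hom_inv_id_assoc, h₂,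
      reassoc_of% h₁, comp_whiskerLeft, Iso.inv_hom_id_assoc, h₃]
  mapComp_nat {e e' e''} k l := by
    change J₂ (C.map₂ (D.mapComp k l).hom ≫ (C.mapComp (D.map k) (D.map l)).hom) ▷
      ((c (objD e'')).hom ≫ (d e'').hom) ≫
      (JComp (C.map (D.map k)) (C.map (D.map l))).hom ▷ ((c (objD e'')).hom ≫ (d e'').hom) ≫
      (α_ _ _ ((c (objD e'')).hom ≫ (d e'').hom)).hom ≫ J (C.map (D.map k)) ◁
      ((α_ (J (C.map (D.map l))) (c (objD e'')).hom (d e'').hom).inv ≫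
        (C.nat (D.map l)).hom ▷ (d e'').hom ≫
        (α_ (c (objD e')).hom (J (D.map l)) (d e'').hom).hom ≫
        (c (objD e')).hom ◁ (D.nat l).hom ≫ (α_ (c (objD e')).hom (d e').hom (J l)).inv) ≫
      (α_ _ ((c (objD e')).hom ≫ (d e').hom) _).inv ≫
      ((α_ (J (C.map (D.map k))) (c (objD e')).hom (d e').hom).inv ≫
        (C.nat (D.map k)).hom ▷ (d e').hom ≫
        (α_ (c (objD e)).hom (J (D.map k)) (d e').hom).hom ≫
        (c (objD e)).hom ◁ (D.nat k).hom ≫ (α_ (c (objD e)).hom (d e).hom (J k)).inv) ▷ J l ≫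
      (α_ ((c (objD e)).hom ≫ (d e).hom) _ _).hom =
      ((α_ (J (C.map (D.map (k ≫ l)))) (c (objD e'')).hom (d e'').hom).inv ≫
        (C.nat (D.map (k ≫ l))).hom ▷ (d e'').hom ≫
        (α_ (c (objD e)).hom (J (D.map (k ≫ l))) (d e'').hom).hom ≫
        (c (objD e)).hom ◁ (D.nat (k ≫ l)).hom ≫ (α_ (c (objD e)).hom (d e).hom (J (k ≫ l))).inv) ≫
        ((c (objD e)).hom ≫ (d e).hom) ◁ (JComp k l).hom
    have h₁ := congrArg (· ▷ (d e'').hom) (C.map₂_nat (D.mapComp k l).hom)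
    have h₂ := congrArg (· ▷ (d e'').hom) (C.mapComp_nat (D.map k) (D.map l))
    have h₃ := congrArg ((c (objD e)).hom ◁ ·) (D.mapComp_nat k l)
    simp only [comp_whiskerRight, whiskerLeft_comp, whisker_assoc, Category.assoc] at h₁ h₂ h₃
    have h₄ : J₂ (C.map₂ (D.mapComp k l).hom ≫ (C.mapComp (D.map k) (D.map l)).hom) =
      J₂ (C.map₂ (D.mapComp k l).hom) ≫ J₂ (C.mapComp (D.map k) (D.map l)).hom := rfl
    rw [h₄]
    simp only [comp_whiskerRight, whiskerRight_comp, Category.assoc, Iso.hom_inv_id_assoc,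
      comp_whiskerLeft, Iso.inv_hom_id_assoc, whiskerLeft_comp, whisker_assoc]
    rw [← reassoc_of% h₃]
    have h₆ := h₁ =≫ (α_ _ _ _).hom
    simp only [Category.assoc, Iso.inv_hom_id, Category.comp_id] at h₆
    rw [← reassoc_of% h₆]
    have h₅ := h₂ =≫ (α_ _ _ _).hom
    simp only [Category.assoc, Iso.inv_hom_id, Category.comp_id] at h₅
    rw [← reassoc_of% h₅]
    -- The naturality cells for `C` at `D.map k` and for `D` at `l` act on different factors and
    -- occur in opposite orders on the two sides.
    have h₇ := (α_ _ _ _).inv ≫= whisker_exchange (C.nat (D.map k)).hom (D.nat l).hom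
    simp only [comp_whiskerLeft, whiskerRight_comp, Category.assoc, Iso.inv_hom_id_assoc] at h₇
    simp [← pentagon_hom_hom_inv_hom_hom_assoc, reassoc_of% h₇]

end PreCone

end

/-! ### Factorisations defining the action on 2-cells and the comparison transformations. -/

section

variable {E : Type u₂} [Bicategory.{w₂, v₂} E] {B : Type u₁} [Bicategory.{w₁, v₁} B]
  {P : E ⥤ᵖ B} {κ : LocalCleavage P} {a b b' : B}

open Fibre Disp

/-- Pseudo-natural factorisations of the domains of cartesian 2-cells through the 1-cells `c`. -/
structure Factorisation {u v : a ⟶ b} {objC objD : Fibre κ b → Fibre κ a}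
    {c : ∀ e, Disp (objC e) e u} (C : PreCone c) {d : ∀ e, Disp (objD e) e v} (D : PreCone d)
    (m : ∀ e, Disp (objD e) e u) (μ : ∀ e, (m e).hom ⟶ (d e).hom) where
  app (e : Fibre κ b) : objD e ⟶ objC e
  fac (e : Fibre κ b) : J (app e) ≫ (c e).hom ≅ (m e).hom
  fac_over (e : Fibre κ b) : ((JDisp (app e)).comp (c e)).Over (m e) (fac e).hom (λ_ u).hom
  nat {e e' : Fibre κ b} (k : e ⟶ e') : D.map k ≫ app e' ≅ app e ≫ C.map k
  nat_fac {e e' : Fibre κ b} (k : e ⟶ e') :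
    J (D.map k) ◁ ((fac e').hom ≫ μ e') ≫ (D.nat k).hom =
      ((α_ _ _ _).inv ≫ ((JComp _ _).inv ≫ J₂ (nat k).hom ≫ (JComp _ _).hom) ▷ (c e').hom ≫
        (α_ _ _ _).hom ≫ J (app e) ◁ (C.nat k).hom ≫ (α_ _ _ _).inv) ≫
        ((fac e).hom ≫ μ e) ▷ J k
  nat_map₂ {e e' : Fibre κ b} {k l : e ⟶ e'} (θ : k ⟶ l) :
    D.map₂ θ ▷ app e' ≫ (nat l).hom = (nat k).hom ≫ app e ◁ C.map₂ θ
  nat_id (e : Fibre κ b) : (nat (𝟙 e)).hom ≫ app e ◁ (C.mapId e).hom =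
    (D.mapId e).hom ▷ app e ≫ (λ_ _).hom ≫ (ρ_ _).inv
  nat_comp {e e' e'' : Fibre κ b} (k : e ⟶ e') (l : e' ⟶ e'') :
    (nat (k ≫ l)).hom ≫ app e ◁ (C.mapComp k l).hom =
      (D.mapComp k l).hom ▷ app e'' ≫ (α_ _ _ _).hom ≫ D.map k ◁ (nat l).hom ≫
        (α_ _ _ _).inv ≫ (nat k).hom ▷ C.map l ≫ (α_ _ _ _).hom

/-- Factoring object by object gives the components, and `exists_trans` supplies the naturality. The
lemma serves three times: for `σ^*`, with chosen cartesian 2-cells as `μ`, and for `χ` and `ι`, with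
identities as `μ`. -/
theorem Factorisation.nonempty_of_cartesian [hP : Fact (IsFibration P)] {u v : a ⟶ b}
    {objC objD : Fibre κ b → Fibre κ a}
    {c : ∀ e, Disp (objC e) e u} (C : PreCone c) {d : ∀ e, Disp (objD e) e v} (D : PreCone d)
    (hc : ∀ e, IsCartesian₁ P (c e).hom)
    (m : ∀ e, Disp (objD e) e u) (μ : ∀ e, (m e).hom ⟶ (d e).hom) {σ : u ⟶ v}
    (hμ : ∀ e, (m e).Over (d e) (μ e) σ) (cμ : ∀ e, IsCartesian₂ P (μ e)) :
    Nonempty (Factorisation C D m μ) := by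
  choose t fac hfac using fun e => (hc e).exists_lift_hom (m e) (λ_ u)
  obtain ⟨n, h₁, h₂, h₃, h₄⟩ := C.exists_trans D hc (σ := σ) t
    (fun e => (fac e).hom ≫ μ e) (fun e => (hfac e).comp (hμ e))
    (fun e => (IsCartesian₂.of_isIso (fac e).hom).comp (cμ e))
  exact ⟨⟨t, fac, hfac, n, h₁, h₂, h₃, h₄⟩⟩

namespace Cleavage

variable (κ₁ : Cleavage κ)

/-- The chosen cartesian 1-cells. -/
def disp (u : a ⟶ b) (e : Fibre κ b) : Disp (κ₁ u e).dom e u :=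
  Disp.ofEq (κ₁ u e).hom (κ₁ u e).map_eq

theorem disp_cart (u : a ⟶ b) (e : Fibre κ b) : IsCartesian₁ P (κ₁.disp u e).hom := (κ₁ u e).cart

/-- Factorisations through the chosen cartesian 1-cells. -/
def cone (u : a ⟶ b) : PreCone (κ₁.disp u) :=
  (PreCone.nonempty_of_cartesian _ (κ₁.disp_cart u)).some

variable [hP : Fact (IsFibration P)]

/-- The factorisation of the domain of the chosen cartesian 2-cell over `σ`. -/
def fac₂ {u v : a ⟶ b} (σ : u ⟶ v) :
    Factorisation (κ₁.cone u) (κ₁.cone v) (fun e => (κ₁.disp v e).pull σ)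
      (fun e => (κ₁.disp v e).pullHom σ) :=
  (Factorisation.nonempty_of_cartesian _ _ (κ₁.disp_cart u) _ _
    (fun e => (κ₁.disp v e).pullHom_over σ)
    (fun e => ((κ₁.disp v e).lift σ).isCartesian₂)).some

/-- The factorisation of composites of chosen cartesian 1-cells. -/
def facComp (f : a ⟶ b) (g : b ⟶ b') :
    Factorisation (κ₁.cone (f ≫ g))
      ((κ₁.cone f).comp (κ₁.cone g) (κ₁.disp_cart f) (κ₁.disp_cart g))
      (fun e => (κ₁.disp f (κ₁ g e).dom).comp (κ₁.disp g e)) (fun _ => 𝟙 _) :=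
  (Factorisation.nonempty_of_cartesian _ _ (κ₁.disp_cart (f ≫ g))
    (fun e => (κ₁.disp f (κ₁ g e).dom).comp (κ₁.disp g e)) (fun _ => 𝟙 _)
    (fun _ => Disp.Over.id _) (fun _ => .of_isIso _)).some

/-- The factorisation of identities. -/
def facId (a : B) :
    Factorisation (κ₁.cone (𝟙 a)) (PreCone.id κ a) (fun e => Disp.id e) (fun _ => 𝟙 _) :=
  (Factorisation.nonempty_of_cartesian _ _ (κ₁.disp_cart (𝟙 a)) (fun e => Disp.id e) (fun _ => 𝟙 _)
    (fun _ => Disp.Over.id _) (fun _ => .of_isIso _)).some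

/-- The operations and comparison transformations given by the factorisations. -/
def core : TrihomCore B (Fibre κ) where
  map u := (κ₁.cone u).toPseudofunctor (κ₁.disp_cart u)
  map₂ σ :=
    { app := (κ₁.fac₂ σ).app
      naturality := (κ₁.fac₂ σ).nat
      naturality_naturality := (κ₁.fac₂ σ).nat_map₂
      naturality_id := (κ₁.fac₂ σ).nat_id
      naturality_comp := (κ₁.fac₂ σ).nat_comp }
  χ f g :=
    { app := (κ₁.facComp f g).app
      naturality := (κ₁.facComp f g).nat
      naturality_naturality := (κ₁.facComp f g).nat_map₂
      naturality_id := (κ₁.facComp f g).nat_id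
      naturality_comp := (κ₁.facComp f g).nat_comp }
  ι a :=
    { app := (κ₁.facId a).app
      naturality := (κ₁.facId a).nat
      naturality_naturality := (κ₁.facId a).nat_map₂
      naturality_id := (κ₁.facId a).nat_id
      naturality_comp := (κ₁.facId a).nat_comp }

end Cleavage

end

/-! ### Existence of the structural modifications. -/

section

variable {E : Type u₂} [Bicategory.{w₂, v₂} E] {B : Type u₁} [Bicategory.{w₁, v₁} B]
  {P : E ⥤ᵖ B} {κ : LocalCleavage P} (κ₁ : Cleavage κ) [hP : Fact (IsFibration P)]
  {a b d d' : B}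

open Fibre Disp

-- The form `(λ_ u).hom ≫ σ` of the base 2-cell is stable under composing factorisations in a fibre.
-- Pastings along longer composites are therefore treated by iterating this lemma.
omit hP in
theorem Disp.Over.comp_factor {e e' e'' : Fibre κ a} {y : Fibre κ b} {u v w : a ⟶ b} {k : e ⟶ e'}
    {l : e' ⟶ e''} {c : Disp e'' y u} {m : Disp e' y v} {n : Disp e y w} {σ : u ⟶ v} {τ : v ⟶ w}
    {θ : J l ≫ c.hom ⟶ m.hom} {ζ : J k ≫ m.hom ⟶ n.hom}
    (hθ : ((JDisp l).comp c).Over m θ ((λ_ u).hom ≫ σ))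
    (hζ : ((JDisp k).comp m).Over n ζ ((λ_ v).hom ≫ τ)) :
    ((JDisp (k ≫ l)).comp c).Over n
      ((JComp k l).hom ▷ c.hom ≫ (α_ (J k) (J l) c.hom).hom ≫ J k ◁ θ ≫ ζ)
      ((λ_ u).hom ≫ σ ≫ τ) :=
  ((Over.whiskerRight (JComp_over k l) c).comp ((Over.associator (JDisp k) (JDisp l) c).comp
    ((Over.whiskerLeft (JDisp k) hθ).comp hζ))).congr (by simp)

namespace Cleavage

/-- The action on 2-cells at an object. -/
def t {u v : a ⟶ b} (σ : u ⟶ v) (e : Fibre κ b) : (κ₁ v e).dom ⟶ (κ₁ u e).dom :=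
  (κ₁.fac₂ σ).app e

/-- The 2-cell over `σ` from the action of `σ` followed by a chosen cartesian 1-cell. -/
def s {u v : a ⟶ b} (σ : u ⟶ v) (e : Fibre κ b) :
    J (κ₁.t σ e) ≫ (κ₁.disp u e).hom ⟶ (κ₁.disp v e).hom :=
  ((κ₁.fac₂ σ).fac e).hom ≫ (κ₁.disp v e).pullHom σ

theorem s_over {u v : a ⟶ b} (σ : u ⟶ v) (e : Fibre κ b) :
    ((JDisp (κ₁.t σ e)).comp (κ₁.disp u e)).Over (κ₁.disp v e) (κ₁.s σ e) ((λ_ u).hom ≫ σ) :=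
  ((κ₁.fac₂ σ).fac_over e).comp ((κ₁.disp v e).pullHom_over σ)

instance cartesianCell_s {u v : a ⟶ b} (σ : u ⟶ v) (e : Fibre κ b) :
    CartesianCell P (κ₁.s σ e) :=
  ⟨(IsCartesian₂.of_isIso ((κ₁.fac₂ σ).fac e).hom).comp ((κ₁.disp v e).lift σ).isCartesian₂⟩

/-- The comparison for composites of 1-cells at an object. -/
def χ (f : a ⟶ b) (g : b ⟶ d) (e : Fibre κ d) : (κ₁ f (κ₁ g e).dom).dom ⟶ (κ₁ (f ≫ g) e).dom :=
  (κ₁.facComp f g).app e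

/-- The factorisation of composites through the comparison. -/
def x (f : a ⟶ b) (g : b ⟶ d) (e : Fibre κ d) : J (κ₁.χ f g e) ≫ (κ₁.disp (f ≫ g) e).hom ≅
    (κ₁.disp f (κ₁ g e).dom).hom ≫ (κ₁.disp g e).hom :=
  (κ₁.facComp f g).fac e

/-- The trailing identity gives the base 2-cell the form expected by `Disp.Over.comp_factor`. -/
theorem x_over (f : a ⟶ b) (g : b ⟶ d) (e : Fibre κ d) :
    ((JDisp (κ₁.χ f g e)).comp (κ₁.disp (f ≫ g) e)).Over
      ((κ₁.disp f (κ₁ g e).dom).comp (κ₁.disp g e)) (κ₁.x f g e).hom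
      ((λ_ (f ≫ g)).hom ≫ 𝟙 _) :=
  ((κ₁.facComp f g).fac_over e).congr (Category.comp_id _).symm

/-- The comparison for identities at an object. -/
def ι (a : B) (e : Fibre κ a) : e ⟶ (κ₁ (𝟙 a) e).dom := (κ₁.facId a).app e

/-- The factorisation of identities through the comparison. -/
def i (a : B) (e : Fibre κ a) : J (κ₁.ι a e) ≫ (κ₁.disp (𝟙 a) e).hom ≅ 𝟙 e.obj :=
  (κ₁.facId a).fac e

theorem i_over (a : B) (e : Fibre κ a) :
    ((JDisp (κ₁.ι a e)).comp (κ₁.disp (𝟙 a) e)).Over (Disp.id e) (κ₁.i a e).hom (λ_ (𝟙 a)).hom :=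
  (κ₁.facId a).fac_over e

/-- The action on 1-cells of the fibres. -/
def pb (u : a ⟶ b) {e e' : Fibre κ b} (k : e ⟶ e') : (κ₁ u e).dom ⟶ (κ₁ u e').dom :=
  (κ₁.cone u).map k

/-- The naturality of the chosen cartesian 1-cells. -/
def n (u : a ⟶ b) {e e' : Fibre κ b} (k : e ⟶ e') :
    J (κ₁.pb u k) ≫ (κ₁.disp u e').hom ≅ (κ₁.disp u e).hom ≫ J k :=
  (κ₁.cone u).nat k

omit hP in
theorem n_over (u : a ⟶ b) {e e' : Fibre κ b} (k : e ⟶ e') :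
    ((JDisp (κ₁.pb u k)).comp (κ₁.disp u e')).Over ((κ₁.disp u e).comp (JDisp k)) (κ₁.n u k).hom
      ((λ_ u).hom ≫ (ρ_ u).inv) :=
  (κ₁.cone u).nat_over k

/-- The pasting of `s σ` with `s τ` and the cell `s (σ ≫ τ)` are both cartesian over the same
2-cell, so the 1-cells through which they factor are isomorphic. The other existence statements
follow the same scheme, once the two pastings are seen to lie over the same 2-cell of `B`. -/
theorem exists_map₂Comp {u v w : a ⟶ b} (σ : u ⟶ v) (τ : v ⟶ w) (e : Fibre κ b) :
    ∃ θ : κ₁.t (σ ≫ τ) e ≅ κ₁.t τ e ≫ κ₁.t σ e,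
      J₂ θ.hom ▷ (κ₁.disp u e).hom ≫ (JComp _ _).hom ▷ (κ₁.disp u e).hom ≫ (α_ _ _ _).hom ≫
        J (κ₁.t τ e) ◁ κ₁.s σ e ≫ κ₁.s τ e = κ₁.s (σ ≫ τ) e :=
  (κ₁.disp_cart u e).exists_lift_iso (n := κ₁.disp w e)
    (Over.comp_factor (κ₁.s_over σ e) (κ₁.s_over τ e)) (κ₁.s_over (σ ≫ τ) e)
    CartesianCell.cart CartesianCell.cart

theorem exists_map₂Id (u : a ⟶ b) (e : Fibre κ b) :
    ∃ θ : κ₁.t (𝟙 u) e ≅ 𝟙 (κ₁ u e).dom,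
      J₂ θ.hom ▷ (κ₁.disp u e).hom ≫ (JId _).hom ▷ (κ₁.disp u e).hom ≫ (λ_ _).hom =
        κ₁.s (𝟙 u) e :=
  (κ₁.disp_cart u e).exists_lift_iso (n := κ₁.disp u e)
    ((Over.whiskerRight (JId_over _) (κ₁.disp u e)).comp (Over.leftUnitor (κ₁.disp u e)))
    ((κ₁.s_over (𝟙 u) e).congr (by simp)) CartesianCell.cart CartesianCell.cart

/-- The factorisation of `pb f k` followed by two cartesian 1-cells. -/
def n₂ (f : a ⟶ b) (g : b ⟶ d) {e : Fibre κ b} {e' : Fibre κ d} (k : e ⟶ (κ₁ g e').dom) :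
    J (κ₁.pb f k) ≫ (κ₁.disp f (κ₁ g e').dom).hom ≫ (κ₁.disp g e').hom ≅
      (κ₁.disp f e).hom ≫ J k ≫ (κ₁.disp g e').hom :=
  (α_ _ _ _).symm ≪≫ whiskerRightIso (κ₁.n f k) (κ₁.disp g e').hom ≪≫ α_ _ _ _

omit hP in
theorem n₂_over (f : a ⟶ b) (g : b ⟶ d) {e : Fibre κ b} {e' : Fibre κ d}
    (k : e ⟶ (κ₁ g e').dom) :
    ((JDisp (κ₁.pb f k)).comp ((κ₁.disp f (κ₁ g e').dom).comp (κ₁.disp g e'))).Over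
      ((κ₁.disp f e).comp ((JDisp k).comp (κ₁.disp g e'))) (κ₁.n₂ f g k).hom
      ((λ_ (f ≫ g)).hom ≫ f ◁ (λ_ g).inv) :=
  ((Over.associator_inv (JDisp (κ₁.pb f k)) (κ₁.disp f (κ₁ g e').dom) (κ₁.disp g e')).comp
    ((Over.whiskerRight (κ₁.n_over f k) (κ₁.disp g e')).comp
    (Over.associator (κ₁.disp f e) (JDisp k) (κ₁.disp g e')))).congr (by simp)

theorem exists_χ₂ {f f' : a ⟶ b} {g g' : b ⟶ d} (α : f ⟶ f') (β : g ⟶ g') (e : Fibre κ d) :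
    ∃ θ : κ₁.t α (κ₁ g' e).dom ≫ κ₁.pb f (κ₁.t β e) ≫ κ₁.χ f g e ≅ κ₁.χ f' g' e ≫ κ₁.t (hc α β) e,
      J₂ θ.hom ▷ (κ₁.disp (f ≫ g) e).hom ≫ (JComp _ _).hom ▷ (κ₁.disp (f ≫ g) e).hom ≫
        (α_ _ _ _).hom ≫ J (κ₁.χ f' g' e) ◁ κ₁.s (hc α β) e ≫ (κ₁.x f' g' e).hom =
      (JComp _ _).hom ▷ (κ₁.disp (f ≫ g) e).hom ≫ (α_ _ _ _).hom ≫
        J (κ₁.t α (κ₁ g' e).dom) ◁ ((JComp _ _).hom ▷ (κ₁.disp (f ≫ g) e).hom ≫ (α_ _ _ _).hom ≫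
          J (κ₁.pb f (κ₁.t β e)) ◁ (κ₁.x f g e).hom ≫ (κ₁.n₂ f g (κ₁.t β e)).hom) ≫ (α_ _ _ _).inv ≫
        κ₁.s α (κ₁ g' e).dom ▷ (J (κ₁.t β e) ≫ (κ₁.disp g e).hom) ≫
        (κ₁.disp f' (κ₁ g' e).dom).hom ◁ κ₁.s β e :=
  (κ₁.disp_cart (f ≫ g) e).exists_lift_iso
    (n := (κ₁.disp f' (κ₁ g' e).dom).comp (κ₁.disp g' e))
    (Over.comp_factor (κ₁.s_over (hc α β) e) (κ₁.x_over f' g' e))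
    ((Over.comp_factor (m := (κ₁.disp f (κ₁ g' e).dom).comp ((JDisp (κ₁.t β e)).comp (κ₁.disp g e)))
      (Over.comp_factor (κ₁.x_over f g e) (κ₁.n₂_over f g (κ₁.t β e)))
      (((Over.associator_inv (JDisp (κ₁.t α (κ₁ g' e).dom)) (κ₁.disp f (κ₁ g' e).dom)
        ((JDisp (κ₁.t β e)).comp (κ₁.disp g e))).comp
      ((Over.whiskerRight (κ₁.s_over α (κ₁ g' e).dom) ((JDisp (κ₁.t β e)).comp (κ₁.disp g e))).comp
      (Over.whiskerLeft (κ₁.disp f' (κ₁ g' e).dom) (κ₁.s_over β e)))).congr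
      (τ := (λ_ _).hom ≫ α ▷ (𝟙 b ≫ g) ≫ f' ◁ ((λ_ g).hom ≫ β))
        (by simp))).congr (by
        simp only [Category.comp_id, Category.id_comp, hc]
        rw [whisker_exchange_assoc, ← whiskerLeft_comp, Iso.inv_hom_id_assoc]))
    -- The codomain is given as an explicit composite in `E`, so that instance search need not look
    -- through `Disp.comp`.
    (CartesianCell.cart (g := (κ₁.disp f' (κ₁ g' e).dom).hom ≫ (κ₁.disp g' e).hom))
    (CartesianCell.cart (g := (κ₁.disp f' (κ₁ g' e).dom).hom ≫ (κ₁.disp g' e).hom))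

theorem exists_ω (f : a ⟶ b) (g : b ⟶ d) (h : d ⟶ d') (e : Fibre κ d') :
    ∃ θ : κ₁.pb f (κ₁.χ g h e) ≫ κ₁.χ f (g ≫ h) e ≫ κ₁.t (α_ f g h).hom e ≅
        κ₁.χ f g (κ₁ h e).dom ≫ κ₁.χ (f ≫ g) h e,
      J₂ θ.hom ▷ (κ₁.disp ((f ≫ g) ≫ h) e).hom ≫ (JComp _ _).hom ▷ _ ≫ (α_ _ _ _).hom ≫
        J (κ₁.χ f g (κ₁ h e).dom) ◁ (κ₁.x (f ≫ g) h e).hom ≫ (α_ _ _ _).inv ≫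
        (κ₁.x f g (κ₁ h e).dom).hom ▷ (κ₁.disp h e).hom =
      (JComp _ _).hom ▷ (κ₁.disp ((f ≫ g) ≫ h) e).hom ≫ (α_ _ _ _).hom ≫
        J (κ₁.pb f (κ₁.χ g h e)) ◁ ((JComp _ _).hom ▷ _ ≫ (α_ _ _ _).hom ≫
          J (κ₁.χ f (g ≫ h) e) ◁ κ₁.s (α_ f g h).hom e ≫ (κ₁.x f (g ≫ h) e).hom) ≫
        (κ₁.n₂ f (g ≫ h) (κ₁.χ g h e)).hom ≫
        (κ₁.disp f (κ₁ g (κ₁ h e).dom).dom).hom ◁ (κ₁.x g h e).hom ≫ (α_ _ _ _).inv :=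
  (κ₁.disp_cart ((f ≫ g) ≫ h) e).exists_lift_iso
    (n := ((κ₁.disp f (κ₁ g (κ₁ h e).dom).dom).comp (κ₁.disp g (κ₁ h e).dom)).comp (κ₁.disp h e))
    (Over.comp_factor (m := (κ₁.disp (f ≫ g) (κ₁ h e).dom).comp (κ₁.disp h e)) (τ := 𝟙 _)
      (κ₁.x_over (f ≫ g) h e)
      (((Over.associator_inv (JDisp (κ₁.χ f g (κ₁ h e).dom)) (κ₁.disp (f ≫ g) (κ₁ h e).dom)
        (κ₁.disp h e)).comp
        (Over.whiskerRight (κ₁.x_over f g (κ₁ h e).dom) (κ₁.disp h e))).congr (by simp)))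
    ((Over.comp_factor (m := (κ₁.disp f (κ₁ (g ≫ h) e).dom).comp (κ₁.disp (g ≫ h) e))
      -- The final reassociation of three cartesian 1-cells lies over the inverse associator, which
      -- cancels the associator underlying the cell `s`.
      (τ := (α_ _ _ _).inv)
      (Over.comp_factor (κ₁.s_over (α_ f g h).hom e) (κ₁.x_over f (g ≫ h) e))
      (((κ₁.n₂_over f (g ≫ h) (κ₁.χ g h e)).comp
      ((Over.whiskerLeft (κ₁.disp f (κ₁ g (κ₁ h e).dom).dom) (κ₁.x_over g h e)).comp
      (Over.associator_inv (κ₁.disp f (κ₁ g (κ₁ h e).dom).dom) (κ₁.disp g (κ₁ h e).dom)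
        (κ₁.disp h e)))).congr (by simp))).congr (by simp))
    (CartesianCell.cart (g := ((κ₁.disp f (κ₁ g (κ₁ h e).dom).dom).hom ≫
      (κ₁.disp g (κ₁ h e).dom).hom) ≫ (κ₁.disp h e).hom))
    (CartesianCell.cart (g := ((κ₁.disp f (κ₁ g (κ₁ h e).dom).dom).hom ≫
      (κ₁.disp g (κ₁ h e).dom).hom) ≫ (κ₁.disp h e).hom))

theorem exists_γ (f : a ⟶ b) (e : Fibre κ b) :
    ∃ θ : κ₁.pb f (κ₁.ι b e) ≫ κ₁.χ f (𝟙 b) e ≫ κ₁.t (ρ_ f).inv e ≅ 𝟙 (κ₁ f e).dom,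
      J₂ θ.hom ▷ (κ₁.disp f e).hom ≫ (JId _).hom ▷ (κ₁.disp f e).hom ≫ (λ_ _).hom =
      (JComp _ _).hom ▷ (κ₁.disp f e).hom ≫ (α_ _ _ _).hom ≫
        J (κ₁.pb f (κ₁.ι b e)) ◁ ((JComp _ _).hom ▷ _ ≫ (α_ _ _ _).hom ≫
          J (κ₁.χ f (𝟙 b) e) ◁ κ₁.s (ρ_ f).inv e ≫ (κ₁.x f (𝟙 b) e).hom) ≫
        (κ₁.n₂ f (𝟙 b) (κ₁.ι b e)).hom ≫ (κ₁.disp f e).hom ◁ (κ₁.i b e).hom ≫ (ρ_ _).hom :=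
  (κ₁.disp_cart f e).exists_lift_iso (n := κ₁.disp f e)
    ((Over.whiskerRight (JId_over _) (κ₁.disp f e)).comp (Over.leftUnitor (κ₁.disp f e)))
    ((Over.comp_factor (m := (κ₁.disp f (κ₁ (𝟙 b) e).dom).comp (κ₁.disp (𝟙 b) e))
      (τ := (ρ_ f).hom)
      (Over.comp_factor (κ₁.s_over (ρ_ f).inv e) (κ₁.x_over f (𝟙 b) e))
      (((κ₁.n₂_over f (𝟙 b) (κ₁.ι b e)).comp
      ((Over.whiskerLeft (κ₁.disp f e) (κ₁.i_over b e)).comp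
      (Over.rightUnitor (κ₁.disp f e)))).congr (by simp))).congr (by simp))
    CartesianCell.cart CartesianCell.cart

theorem exists_δ (f : a ⟶ b) (e : Fibre κ b) :
    ∃ θ : κ₁.t (λ_ f).hom e ≅ κ₁.ι a (κ₁ f e).dom ≫ κ₁.χ (𝟙 a) f e,
      J₂ θ.hom ▷ (κ₁.disp (𝟙 a ≫ f) e).hom ≫ (JComp _ _).hom ▷ _ ≫ (α_ _ _ _).hom ≫
        J (κ₁.ι a (κ₁ f e).dom) ◁ (κ₁.x (𝟙 a) f e).hom ≫ (α_ _ _ _).inv ≫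
        (κ₁.i a (κ₁ f e).dom).hom ▷ (κ₁.disp f e).hom ≫ (λ_ _).hom = κ₁.s (λ_ f).hom e :=
  (κ₁.disp_cart (𝟙 a ≫ f) e).exists_lift_iso (n := κ₁.disp f e)
    (Over.comp_factor (m := (κ₁.disp (𝟙 a) (κ₁ f e).dom).comp (κ₁.disp f e)) (τ := (λ_ f).hom)
      (κ₁.x_over (𝟙 a) f e)
      (((Over.associator_inv (JDisp (κ₁.ι a (κ₁ f e).dom)) (κ₁.disp (𝟙 a) (κ₁ f e).dom)
        (κ₁.disp f e)).comp
        ((Over.whiskerRight (κ₁.i_over a (κ₁ f e).dom) (κ₁.disp f e)).comp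
        (Over.leftUnitor (κ₁.disp f e)))).congr (by simp)))
    ((κ₁.s_over (λ_ f).hom e).congr (by simp))
    CartesianCell.cart CartesianCell.cart

end Cleavage

end

/-! ### The associated data and its coherence. -/

section

variable {E : Type u₂} [Bicategory.{w₂, v₂} E] {B : Type u₁} [Bicategory.{w₁, v₁} B]
  {P : E ⥤ᵖ B} {κ : LocalCleavage P} (κ₁ : Cleavage κ) [hP : Fact (IsFibration P)]
  {a b d d' : B}

open Fibre Disp

namespace Cleavage

/-- The equation characterising the chosen isomorphism, brought to the form demanded of an
associated trihomomorphism. The two forms differ by `JComp₃`, which is cancelled, and by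
reassociations; `ω` and `γ` are treated in the same way. -/
theorem χ₂_eq_of {f f' : a ⟶ b} {g g' : b ⟶ d} (α : f ⟶ f') (β : g ⟶ g') (e : Fibre κ d) :
    ((JComp₃ _ _ _).inv ≫ J₂ (κ₁.exists_χ₂ α β e).choose.hom ≫ (JComp _ _).hom) ▷
          (κ₁.disp (f ≫ g) e).hom ⊗≫
        J (κ₁.χ f' g' e) ◁ κ₁.s (hc α β) e ≫ (κ₁.x f' g' e).hom =
      𝟙 _ ⊗≫ J (κ₁.t α (κ₁ g' e).dom) ◁ J (κ₁.pb f (κ₁.t β e)) ◁ (κ₁.x f g e).hom ⊗≫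
        J (κ₁.t α (κ₁ g' e).dom) ◁ (κ₁.n f (κ₁.t β e)).hom ▷ (κ₁.disp g e).hom ⊗≫
        κ₁.s α (κ₁ g' e).dom ▷ (J (κ₁.t β e) ≫ (κ₁.disp g e).hom) ≫
        (κ₁.disp f' (κ₁ g' e).dom).hom ◁ κ₁.s β e := by
  have h := (κ₁.exists_χ₂ α β e).choose_spec
  rw [← cancel_epi ((JComp₃ _ _ _).hom ▷ (κ₁.disp (f ≫ g) e).hom)]
  simp [bicategoricalComp, JComp₃, n₂] at h ⊢
  simp [h]

theorem ω_eq_of (f : a ⟶ b) (g : b ⟶ d) (h : d ⟶ d') (e : Fibre κ d') :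
    ((JComp₃ _ _ _).inv ≫ J₂ (κ₁.exists_ω f g h e).choose.hom ≫ (JComp _ _).hom) ▷
          (κ₁.disp ((f ≫ g) ≫ h) e).hom ⊗≫
        J (κ₁.χ f g (κ₁ h e).dom) ◁ (κ₁.x (f ≫ g) h e).hom ⊗≫
        (κ₁.x f g (κ₁ h e).dom).hom ▷ (κ₁.disp h e).hom ⊗≫ 𝟙 _ =
      𝟙 _ ⊗≫ J (κ₁.pb f (κ₁.χ g h e)) ◁ J (κ₁.χ f (g ≫ h) e) ◁ κ₁.s (α_ f g h).hom e ⊗≫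
        J (κ₁.pb f (κ₁.χ g h e)) ◁ (κ₁.x f (g ≫ h) e).hom ⊗≫
        (κ₁.n f (κ₁.χ g h e)).hom ▷ (κ₁.disp (g ≫ h) e).hom ⊗≫
        (κ₁.disp f (κ₁ g (κ₁ h e).dom).dom).hom ◁ (κ₁.x g h e).hom := by
  have h := (κ₁.exists_ω f g h e).choose_spec
  rw [← cancel_epi ((JComp₃ _ _ _).hom ▷ _)]
  simp [bicategoricalComp, JComp₃, n₂] at h ⊢
  simp [reassoc_of% h]

theorem γ_eq_of (f : a ⟶ b) (e : Fibre κ b) :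
    ((JComp₃ _ _ _).inv ≫ J₂ (κ₁.exists_γ f e).choose.hom ≫ (JId _).hom) ▷ (κ₁.disp f e).hom ≫
        (λ_ _).hom =
      𝟙 _ ⊗≫ J (κ₁.pb f (κ₁.ι b e)) ◁ J (κ₁.χ f (𝟙 b) e) ◁ κ₁.s (ρ_ f).inv e ≫
        J (κ₁.pb f (κ₁.ι b e)) ◁ (κ₁.x f (𝟙 b) e).hom ⊗≫
        (κ₁.n f (κ₁.ι b e)).hom ▷ (κ₁.disp (𝟙 b) e).hom ⊗≫
        (κ₁.disp f e).hom ◁ (κ₁.i b e).hom ≫ (ρ_ _).hom := by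
  have h := (κ₁.exists_γ f e).choose_spec
  rw [← cancel_epi ((JComp₃ _ _ _).hom ▷ _)]
  simp [bicategoricalComp, JComp₃, n₂] at h ⊢
  simp [h]

theorem δ_eq_of (f : a ⟶ b) (e : Fibre κ b) :
    (J₂ (κ₁.exists_δ f e).choose.hom ≫ (JComp _ _).hom) ▷ (κ₁.disp (𝟙 a ≫ f) e).hom ⊗≫
        J (κ₁.ι a (κ₁ f e).dom) ◁ (κ₁.x (𝟙 a) f e).hom ⊗≫
        (κ₁.i a (κ₁ f e).dom).hom ▷ (κ₁.disp f e).hom ≫ (λ_ _).hom =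
      κ₁.s (λ_ f).hom e := by
  have h := (κ₁.exists_δ f e).choose_spec
  simp [bicategoricalComp] at h ⊢
  simp [h]

/-- The factorisations as the data of a trihomomorphism. -/
def trihomData : TrihomData B (Fibre κ) where
  toTrihomCore := κ₁.core
  map₂Comp σ τ e := (κ₁.exists_map₂Comp σ τ e).choose
  map₂Id u e := (κ₁.exists_map₂Id u e).choose
  χ₂ α β e := (κ₁.exists_χ₂ α β e).choose
  ω f g h e := (κ₁.exists_ω f g h e).choose
  γ f e := (κ₁.exists_γ f e).choose
  δ f e := (κ₁.exists_δ f e).choose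

/-- The data of the associated trihomomorphism. -/
def associatedData : AssociatedData κ κ₁ where
  F := κ₁.trihomData
  c u := (κ₁.cone u).toStrongTrans (κ₁.disp_cart u)
  map_eq u e := (κ₁ u e).map_eq
  cart u e := (κ₁ u e).cart
  chosen _ _ := rfl
  fac σ e := (κ₁.fac₂ σ).fac e
  x f g e := κ₁.x f g e
  i a e := κ₁.i a e

instance : κ₁.associatedData.IsCoherent where
  cNat_base u _ _ k := κ₁.n_over u k
  fac_base σ e := (κ₁.fac₂ σ).fac_over e
  x_base f g e := (κ₁.facComp f g).fac_over e
  i_base a e := (κ₁.facId a).fac_over e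
  s_mod σ _ _ k := (κ₁.fac₂ σ).nat_fac k
  x_mod f g _ _ k := by
    have h := (κ₁.facComp f g).nat_fac k
    -- The cell `μ` is an identity in this factorisation, so `nat_fac` contains a redundant
    -- composition.
    have h' : ∀ e, ((κ₁.facComp f g).fac e).hom ≫ 𝟙 _ = ((κ₁.facComp f g).fac e).hom :=
      fun e => Category.comp_id _
    rw [h', h'] at h
    exact h
  i_mod a _ _ k := by
    have h := (κ₁.facId a).nat_fac k
    have h' : ∀ e, ((κ₁.facId a).fac e).hom ≫ 𝟙 _ = ((κ₁.facId a).fac e).hom :=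
      fun e => Category.comp_id _
    rw [h', h'] at h
    exact h
  s_comp σ τ e := by
    have h := (κ₁.exists_map₂Comp σ τ e).choose_spec
    rw [← comp_whiskerRight_assoc] at h
    exact h.symm
  s_id u e := by
    have h := (κ₁.exists_map₂Id u e).choose_spec
    rw [← comp_whiskerRight_assoc] at h
    exact h.symm
  χ₂_eq α β e := κ₁.χ₂_eq_of α β e
  ω_eq f g h e := κ₁.ω_eq_of f g h e
  γ_eq f e := κ₁.γ_eq_of f e
  δ_eq f e := κ₁.δ_eq_of f e

end Cleavage

end

/-! ### The comparisons `χ` and `ι` are equivalences. -/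

section

variable {E : Type u₂} [Bicategory.{w₂, v₂} E] {B : Type u₁} [Bicategory.{w₁, v₁} B]
  {P : E ⥤ᵖ B} {κ : LocalCleavage P} {κ₁ : Cleavage κ} {a b d : B}

open Fibre Disp

section

variable {e : Fibre κ a} {x : Fibre κ b} {y : Fibre κ d} {u : b ⟶ d} {c : Disp x y u}

/-- In contrast to `exists_lift_hom₂`, the 1-cells lie over an arbitrary `f` and belong to no single
fibre, so the conclusion has to record that `θ` lies over an identity. -/
theorem IsCartesian₁.exists_lift_disp_hom (hc : IsCartesian₁ P c.hom)
    {f : a ⟶ b} {v : a ⟶ d} {k l : Disp e x f} {n : Disp e y v} {R : l.hom ≫ c.hom ⟶ n.hom}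
    {W : k.hom ≫ c.hom ⟶ n.hom} {σ : f ≫ u ⟶ v} (hR : (l.comp c).Over n R σ)
    (hW : (k.comp c).Over n W σ) (cR : IsCartesian₂ P R) :
    ∃ θ : k.hom ⟶ l.hom, θ ▷ c.hom ≫ R = W ∧ k.Over l θ (𝟙 f) := by
  obtain ⟨θ, ⟨h₁, h₂⟩, -⟩ := hc.existsUnique_fac cR W _ (hR.map₂_eq hW)
  exact ⟨θ, h₁, by simp [Disp.Over, h₂]⟩

/-- Isomorphic composites with a cartesian 1-cell come from isomorphic 1-cells. -/
theorem IsCartesian₁.exists_lift_disp_iso (hc : IsCartesian₁ P c.hom)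
    {f : a ⟶ b} {k l : Disp e x f} {R : k.hom ≫ c.hom ≅ l.hom ≫ c.hom}
    (hR : (k.comp c).Over (l.comp c) R.hom (𝟙 _)) :
    ∃ θ : k.hom ≅ l.hom, k.Over l θ.hom (𝟙 f) := by
  have hR' : (l.comp c).Over (k.comp c) R.inv (𝟙 _) :=
    Over.inv (f := k.comp c) (g := l.comp c) (θ := R) (σ := Iso.refl _) hR
  obtain ⟨θ, h₁, h₂⟩ := hc.exists_lift_disp_hom (n := l.comp c) (R := 𝟙 (l.hom ≫ c.hom))
    (Over.id (l.comp c)) hR (.of_isIso (𝟙 (l.hom ≫ c.hom)))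
  obtain ⟨ζ, h₃, h₄⟩ := hc.exists_lift_disp_hom (n := k.comp c) (R := 𝟙 (k.hom ≫ c.hom))
    (Over.id (k.comp c)) hR' (.of_isIso (𝟙 (k.hom ≫ c.hom)))
  have h₁' : θ ▷ c.hom = R.hom := (Category.comp_id _).symm.trans h₁
  have h₃' : ζ ▷ c.hom = R.inv := (Category.comp_id _).symm.trans h₃
  -- Equality of 2-cells of `E` must also be checked in `B`. An endomorphism of `k` over an identity
  -- has an identity as its image.
  have aux {k : Disp e x f} {ξ : k.hom ⟶ k.hom} (h : k.Over k ξ (𝟙 f)) : P.map₂ ξ = 𝟙 _ := by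
    rw [← cancel_mono k.iso.hom, h]
    simp
  refine ⟨⟨θ, ζ, hc.hom_ext (.of_isIso (𝟙 (k.hom ≫ c.hom))) ?_ ?_,
    hc.hom_ext (.of_isIso (𝟙 (l.hom ≫ c.hom))) ?_ ?_⟩, h₂⟩
  · rw [aux ((h₂.comp h₄).congr (Category.comp_id _)), P.map₂_id]
  · simp [h₁', h₃']
  · rw [aux ((h₄.comp h₂).congr (Category.comp_id _)), P.map₂_id]
  · simp [h₁', h₃']

end

theorem Disp.Over.nonempty_iso {e x : Fibre κ a} {k l : e ⟶ x} {θ : J k ≅ J l}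
    (h : (JDisp k).Over (JDisp l) θ.hom (𝟙 _)) : Nonempty (k ≅ l) :=
  ⟨isoMk θ h rfl⟩

section

variable {x : Fibre κ a} {y : Fibre κ b} {u : a ⟶ b}

/-- 1-cells over `u` through which 1-cells over `u` factor essentially uniquely by 1-cells of the
fibre. -/
structure Disp.IsTerminal (c : Disp x y u) : Prop where
  exists_hom {e : Fibre κ a} (m : Disp e y u) : ∃ (k : e ⟶ x) (φ : J k ≫ c.hom ≅ m.hom),
    ((JDisp k).comp c).Over m φ.hom (λ_ u).hom
  nonempty_iso {e : Fibre κ a} {k l : e ⟶ x} (R : J k ≫ c.hom ≅ J l ≫ c.hom)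
    (hR : ((JDisp k).comp c).Over ((JDisp l).comp c) R.hom (𝟙 _)) : Nonempty (k ≅ l)

theorem IsCartesian₁.isTerminal {c : Disp x y u} (hc : IsCartesian₁ P c.hom) : c.IsTerminal where
  exists_hom m := hc.exists_lift_hom m (λ_ u)
  nonempty_iso {e k l} R hR := by
    obtain ⟨θ, h⟩ := hc.exists_lift_disp_iso (k := JDisp k) (l := JDisp l) (R := R) hR
    exact h.nonempty_iso

/-- A 1-cell over the composite is factored through `c'` and then through `c`, and isomorphisms
descend in the same order. This property tests only 1-cells over one fixed 1-cell of `B`, and it is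
all that the comparison `χ` requires of a composite. -/
theorem IsCartesian₁.comp_isTerminal {z : Fibre κ d} {v : b ⟶ d} {c : Disp x y u} {c' : Disp y z v}
    (hc : IsCartesian₁ P c.hom) (hc' : IsCartesian₁ P c'.hom) : (c.comp c').IsTerminal where
  exists_hom m := by
    obtain ⟨l, ψ, hψ⟩ := hc'.exists_lift_disp m (Iso.refl _)
    obtain ⟨k, φ, hφ⟩ := hc.exists_lift_hom l (λ_ u)
    exact ⟨k, (α_ _ _ _).symm ≪≫ whiskerRightIso φ c'.hom ≪≫ ψ,
      ((Over.associator_inv (JDisp k) c c').comp ((Over.whiskerRight hφ c').comp hψ)).congr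
        (by simp)⟩
  nonempty_iso {e k l} R hR := by
    obtain ⟨θ, h⟩ := hc'.exists_lift_disp_iso (k := (JDisp k).comp c) (l := (JDisp l).comp c)
      (R := α_ (J k) c.hom c'.hom ≪≫ R ≪≫ (α_ (J l) c.hom c'.hom).symm)
      (((Over.associator (JDisp k) c c').comp (hR.comp (Over.associator_inv (JDisp l) c c'))).congr
        (by simp))
    obtain ⟨ζ, h'⟩ := hc.exists_lift_disp_iso (R := θ) h
    exact h'.nonempty_iso

/-- A 1-cell over the identity up to isomorphism is isomorphic to one strictly over it, and the
latter is its factorisation. -/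
theorem Disp.id_isTerminal (e : Fibre κ a) : (Disp.id e).IsTerminal where
  exists_hom {e'} m := by
    let l : e' ⟶ e := ⟨(m.pull (𝟙 _)).hom, (m.lift (𝟙 _)).domain_eq⟩
    have hl : (JDisp l).Over m (m.pullIso (Iso.refl _)).hom (𝟙 _) := m.pullIso_over (Iso.refl _)
    exact ⟨l, ρ_ _ ≪≫ m.pullIso (Iso.refl _),
      ((Over.rightUnitor (JDisp l)).comp hl).congr (by simp [unitors_equal])⟩
  nonempty_iso {e k l} R hR := by
    refine Over.nonempty_iso (θ := (ρ_ (J k)).symm ≪≫ R ≪≫ ρ_ (J l)) ?_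
    exact ((Over.rightUnitor_inv (JDisp k)).comp (hR.comp (Over.rightUnitor (JDisp l)))).congr
      (by simp)

/-- The uniqueness of terminal objects, up to equivalence: factoring `c` through `c'` gives a
quasi-inverse of `k`, because the composites and the identities are factorisations of the same
1-cells. -/
theorem Disp.IsTerminal.isEquiv₁ {x' : Fibre κ a} {c : Disp x y u} {c' : Disp x' y u}
    (hc : c.IsTerminal) (hc' : c'.IsTerminal) (k : x' ⟶ x) (φ : J k ≫ c.hom ≅ c'.hom)
    (hφ : ((JDisp k).comp c).Over c' φ.hom (λ_ u).hom) : IsEquiv₁ k := by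
  obtain ⟨l, ψ, hψ⟩ := hc'.exists_hom c
  have aux {x x' : Fibre κ a} {c : Disp x y u} {c' : Disp x' y u} (hc : c.IsTerminal) {k : x' ⟶ x}
      {l : x ⟶ x'} (φ : J k ≫ c.hom ≅ c'.hom) (hφ : ((JDisp k).comp c).Over c' φ.hom (λ_ u).hom)
      (ψ : J l ≫ c'.hom ≅ c.hom) (hψ : ((JDisp l).comp c').Over c ψ.hom (λ_ u).hom) :
      Nonempty (l ≫ k ≅ 𝟙 x) := by
    refine hc.nonempty_iso (whiskerRightIso (JComp l k) c.hom ≪≫ α_ (J l) (J k) c.hom ≪≫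
      whiskerLeftIso (J l) φ ≪≫ ψ ≪≫ (λ_ c.hom).symm ≪≫ whiskerRightIso (JId x).symm c.hom) ?_
    refine (((JComp_over l k).whiskerRight c).comp ((Over.associator (JDisp l) (JDisp k) c).comp
      ((Over.whiskerLeft (JDisp l) hφ).comp (hψ.comp ((Over.leftUnitor_inv c).comp
      (Over.whiskerRight (Over.inv (f := JDisp (𝟙 x)) (g := Disp.id x) (σ := Iso.refl _)
        (JId_over x)) c)))))).congr (by simp)
  obtain ⟨ν⟩ := aux hc φ hφ ψ hψ
  obtain ⟨η⟩ := aux hc' ψ hψ φ hφ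
  -- Nothing relates `η` to `ν`. The counit is adjusted so that the triangle identity holds, while
  -- `k` itself is unchanged.
  exact ⟨Equivalence.mkOfAdjointifyCounit η.symm ν, rfl⟩

end

namespace AssociatedData

variable (T : AssociatedData κ κ₁) [hT : T.IsCoherent]

namespace IsCoherent

/-- The cartesian 1-cell over `f ≫ g` and the composite of those over `f` and `g` are both terminal,
and `χ` factors the second through the first. -/
theorem χ_equiv (f : a ⟶ b) (g : b ⟶ d) (e : Fibre κ d) : IsEquiv₁ (T.F.χApp f g e) :=
  IsTerminal.isEquiv₁ (c := T.cDisp (f ≫ g) e)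
    (c' := (T.cDisp f ((T.F.map g).obj e)).comp (T.cDisp g e))
    (T.cart _ _).isTerminal ((T.cart _ _).comp_isTerminal (T.cart _ _)) _ (T.x f g e)
    (hT.x_base f g e)

theorem ι_equiv (a : B) (e : Fibre κ a) : IsEquiv₁ (T.F.ιApp a e) :=
  IsTerminal.isEquiv₁ (c := T.cDisp (𝟙 a) e) (c' := Disp.id e) (T.cart _ _).isTerminal
    (Disp.id_isTerminal e) _ (T.i a e) (hT.i_base a e)

end IsCoherent

end AssociatedData

end

/-! ### Every fibration has an associated trihomomorphism. -/

section

variable {E : Type u₂} [Bicategory.{w₂, v₂} E] {B : Type u₁} [Bicategory.{w₁, v₁} B]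
  {P : E ⥤ᵖ B} {κ : LocalCleavage P} {κ₁ : Cleavage κ}

/-- The axioms of a trihomomorphism follow from the compatibility with cartesian cells. -/
theorem AssociatedData.IsCoherent.isTrihom [Fact (IsFibration P)] (T : AssociatedData κ κ₁)
    [hT : T.IsCoherent] : T.F.IsTrihom where
  map₂Comp_mod := map₂Comp_mod
  map₂Id_mod := map₂Id_mod
  map₂_assoc := map₂_assoc
  map₂_id_comp := map₂_id_comp
  map₂_comp_id := map₂_comp_id
  χ_equiv := χ_equiv T
  ι_equiv := ι_equiv T
  χ₂_mod := χ₂_mod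
  χ₂_id := χ₂_id
  χ₂_comp := χ₂_comp
  ω_mod := ω_mod
  ω_nat := ω_nat
  γ_mod := γ_mod
  γ_nat := γ_nat
  δ_mod := δ_mod
  δ_nat := δ_nat
  assoc := assoc
  unit := unit

theorem IsFibration.nonempty_associatedTrihom (hP : IsFibration P) (κ₁ : Cleavage κ) :
    Nonempty (AssociatedTrihom κ κ₁) := by
  have : Fact (IsFibration P) := ⟨hP⟩
  have hT : κ₁.associatedData.IsCoherent := inferInstance
  exact ⟨{ hT with toAssociatedData := κ₁.associatedData, isTrihom := hT.isTrihom }⟩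

end

/-! ### The operations of the Grothendieck construction, interpreted in `E`. -/

section

variable {E : Type u₂} [Bicategory.{w₂, v₂} E] {B : Type u₁} [Bicategory.{w₁, v₁} B]
  {P : E ⥤ᵖ B} {κ : LocalCleavage P} {κ₁ : Cleavage κ}

open Fibre

namespace AssociatedData

variable (T : AssociatedData κ κ₁) {z : E} {a b d d' : B} {u v w : a ⟶ b} {e : Fibre κ b}
  {y : Fibre κ a} (m : z ⟶ y.obj)

/-- The 2-cell of `E` given by a 2-cell of the Grothendieck construction, acting by
postcomposition. -/
def cellA {k : y ⟶ (T.F.map u).obj e} {l : y ⟶ (T.F.map v).obj e} {σ : u ⟶ v}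
    (η : k ⟶ l ≫ T.F.app₂ σ e) : (m ≫ J k) ≫ T.cApp u e ⟶ (m ≫ J l) ≫ T.cApp v e :=
  fact m η ▷ T.cApp u e ≫ (jc m _ _).hom ▷ T.cApp u e ≫ T.sA (m ≫ J l) σ

/-- The isomorphism between the actions of a composite and of its factors. -/
def compA {f : a ⟶ b} {g : b ⟶ d} {e' : Fibre κ d} (k : y ⟶ (T.F.map f).obj e)
    (l : e ⟶ (T.F.map g).obj e') :
    (m ≫ J (k ≫ (T.F.map f).map l ≫ T.F.χApp f g e')) ≫ T.cApp (f ≫ g) e' ≅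
      (((m ≫ J k) ≫ T.cApp f e) ≫ J l) ≫ T.cApp g e' :=
  whiskerRightIso (jc m k _ ≪≫ jc (m ≫ J k) _ _) (T.cApp (f ≫ g) e') ≪≫ T.xA _ ≪≫
    whiskerRightIso (T.cA (m ≫ J k) l) (T.cApp g e')

variable [hT : T.IsCoherent]
include hT

/-- This and the following statements say that `cellA` turns each operation of the Grothendieck
construction into the corresponding one of `E`, up to `compA` and `iA`. They hold because the
structural cells of `F` were defined by factoring precisely these pastings. -/
theorem cellA_id (k : y ⟶ (T.F.map u).obj e) :
    T.cellA m ((ρ_ k).inv ≫ k ◁ (T.F.map₂Id u e).inv) = 𝟙 _ := by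
  simp [cellA]

theorem cellA_comp {k : y ⟶ (T.F.map u).obj e} {l : y ⟶ (T.F.map v).obj e} {n : y ⟶ (T.F.map w).obj e}
    {σ : u ⟶ v} {τ : v ⟶ w} (η : k ⟶ l ≫ T.F.app₂ σ e) (ξ : l ⟶ n ≫ T.F.app₂ τ e) :
    T.cellA m (η ≫ ξ ▷ T.F.app₂ σ e ≫ (α_ _ _ _).hom ≫ n ◁ (T.F.map₂Comp σ τ e).inv) =
      T.cellA m η ≫ T.cellA m ξ := by
  simp [cellA]

variable {p q r s : El T.F}

theorem cellA_hcomp {f f' : El.Hom p q} {g g' : El.Hom q r} (m : z ⟶ p.fib.obj)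
    (θ : El.Hom₂ f f') (ζ : El.Hom₂ g g') :
    T.cellA m (El.hcompFib θ ζ) ≫ (T.compA m f'.fib g'.fib).hom =
      (T.compA m f.fib g.fib).hom ≫ T.cellA m θ.fib ▷ J g.fib ▷ T.cApp g.base r.fib ≫
        T.cellA ((m ≫ J f'.fib) ≫ T.cApp f'.base q.fib) ζ.fib := by
  simp [cellA, compA, El.hcompFib, bicategoricalComp]

theorem cellA_assoc (m : z ⟶ p.fib.obj) (f : El.Hom p q) (g : El.Hom q r) (h : El.Hom r s) :
    T.cellA m (El.assocFib f g h) ≫ (T.compA m f.fib (g.fib ≫ (T.F.map g.base).map h.fib ≫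
        T.F.χApp g.base h.base s.fib)).hom ≫
        (T.compA ((m ≫ J f.fib) ≫ T.cApp f.base q.fib) g.fib h.fib).hom =
      (T.compA m (f.fib ≫ (T.F.map f.base).map g.fib ≫ T.F.χApp f.base g.base r.fib) h.fib).hom ≫
        (T.compA m f.fib g.fib).hom ▷ J h.fib ▷ T.cApp h.base s.fib := by
  simp [cellA, compA, El.assocFib, bicategoricalComp]

theorem cellA_leftUnitor (m : z ⟶ p.fib.obj) (f : El.Hom p q) :
    T.cellA m (El.leftUnitorFib f) = (T.compA m (T.F.ιApp p.base p.fib) f.fib).hom ≫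
      (T.iA m).hom ▷ J f.fib ▷ T.cApp f.base q.fib := by
  simp [cellA, compA, El.leftUnitorFib, bicategoricalComp]

theorem cellA_rightUnitorInv (m : z ⟶ p.fib.obj) (f : El.Hom p q) :
    T.cellA m (El.rightUnitorInvFib f) ≫ (T.compA m f.fib (T.F.ιApp q.base q.fib)).hom ≫
      (T.iA ((m ≫ J f.fib) ≫ T.cApp f.base q.fib)).hom = 𝟙 _ := by
  simp [cellA, compA, El.rightUnitorInvFib, bicategoricalComp]

end AssociatedData

end

/-! ### The interpretation is bijective on 2-cells. -/

section

variable {E : Type u₂} [Bicategory.{w₂, v₂} E] {B : Type u₁} [Bicategory.{w₁, v₁} B]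
  {P : E ⥤ᵖ B} {κ : LocalCleavage P} {κ₁ : Cleavage κ} {a b : B}

open Fibre Disp

section

variable {e : Fibre κ a} {e' : Fibre κ b} {u v : a ⟶ b}

theorem base₂_injective {σ τ : u ⟶ v} (h : base₂ e e' σ = base₂ e e' τ) : σ = τ := by
  obtain ⟨e, rfl⟩ := e; obtain ⟨e', rfl⟩ := e'
  exact h

theorem base₂_surjective (δ : base₁ e e' u ⟶ base₁ e e' v) : ∃ σ, base₂ e e' σ = δ := by
  obtain ⟨e, rfl⟩ := e; obtain ⟨e', rfl⟩ := e'
  exact ⟨δ, rfl⟩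

/-- Together with `Disp.exists_over` this assigns to each 2-cell of `E` a well-defined 2-cell of
`B`, which recovers the base component of a 2-cell of the Grothendieck construction. -/
theorem Disp.Over.unique {f : Disp e e' u} {g : Disp e e' v} {θ : f.hom ⟶ g.hom} {σ τ : u ⟶ v}
    (h : f.Over g θ σ) (h' : f.Over g θ τ) : σ = τ :=
  base₂_injective (e := e) (e' := e') ((cancel_epi f.iso.hom).1 (h.symm.trans h'))

theorem Disp.exists_over (f : Disp e e' u) (g : Disp e e' v) (θ : f.hom ⟶ g.hom) :
    ∃ σ, f.Over g θ σ := by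
  obtain ⟨σ, h⟩ := base₂_surjective (f.iso.inv ≫ P.map₂ θ ≫ g.iso.hom)
  exact ⟨σ, by simp [Disp.Over, h]⟩

end

namespace AssociatedData

variable (T : AssociatedData κ κ₁)

/-- The 2-cell of `E` given by a 2-cell of the Grothendieck construction. -/
def cell {u v : a ⟶ b} {e : Fibre κ b} {y : Fibre κ a}
    {k : y ⟶ (T.F.map u).obj e} {l : y ⟶ (T.F.map v).obj e} {σ : u ⟶ v}
    (η : k ⟶ l ≫ T.F.app₂ σ e) : J k ≫ T.cApp u e ⟶ J l ≫ T.cApp v e :=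
  (J₂ η ≫ (JComp _ _).hom) ▷ T.cApp u e ≫ (α_ _ _ _).hom ≫ J l ◁ T.s σ e

theorem cellA_eq {z : E} {u v : a ⟶ b} {e : Fibre κ b} {y : Fibre κ a} (m : z ⟶ y.obj)
    {k : y ⟶ (T.F.map u).obj e} {l : y ⟶ (T.F.map v).obj e} {σ : u ⟶ v}
    (η : k ⟶ l ≫ T.F.app₂ σ e) :
    T.cellA m η = (α_ _ _ _).hom ≫ m ◁ T.cell η ≫ (α_ _ _ _).inv := by
  simp [cell, cellA, fact, act₁₁, jc, act₁₂, sA, act₂₁]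

variable {T} {p q : El T.F}

variable [hT : T.IsCoherent]

theorem IsCoherent.s_over {u v : a ⟶ b} (σ : u ⟶ v) (e : Fibre κ b) :
    ((JDisp (T.F.app₂ σ e)).comp (T.cDisp u e)).Over (T.cDisp v e) (T.s σ e)
      ((λ_ u).hom ≫ σ) :=
  (hT.fac_base σ e).comp ((T.cDisp v e).pullHom_over σ)

/-- The cell in question is a cartesian lift of `σ`, up to unitors, at `l` followed by the cartesian
1-cell over `v`, with its domain already factored through the one over `u`. Factoring through it
turns 2-cells of `E` into 2-cells of the fibre into `l` followed by `σ^*`, that is, into fibre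
components. -/
theorem IsCoherent.reduction_over {u v : a ⟶ b} (σ : u ⟶ v) {e : Fibre κ b} {y : Fibre κ a}
    (l : y ⟶ (T.F.map v).obj e) :
    ((JDisp (l ≫ T.F.app₂ σ e)).comp (T.cDisp u e)).Over ((JDisp l).comp (T.cDisp v e))
      ((JComp _ _).hom ▷ T.cApp u e ≫ (α_ _ _ _).hom ≫ J l ◁ T.s σ e) (𝟙 a ◁ σ) :=
  ((Over.whiskerRight (JComp_over l (T.F.app₂ σ e)) (T.cDisp u e)).comp
    ((Over.associator (JDisp l) (JDisp (T.F.app₂ σ e)) (T.cDisp u e)).comp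
    (Over.whiskerLeft (JDisp l) (hT.s_over σ e)))).congr (by simp)

theorem IsCoherent.cell_over {u v : a ⟶ b} {e : Fibre κ b} {y : Fibre κ a}
    {k : y ⟶ (T.F.map u).obj e} {l : y ⟶ (T.F.map v).obj e} {σ : u ⟶ v}
    (η : k ⟶ l ≫ T.F.app₂ σ e) :
    ((JDisp k).comp (T.cDisp u e)).Over ((JDisp l).comp (T.cDisp v e)) (T.cell η) (𝟙 a ◁ σ) := by
  have := ((Over.whiskerRight (J₂_over η) (T.cDisp u e)).comp (hT.reduction_over σ l)).congr
    (τ := 𝟙 a ◁ σ) (by simp)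
  have h : T.cell η = J₂ η ▷ T.cApp u e ≫ (JComp _ _).hom ▷ T.cApp u e ≫ (α_ _ _ _).hom ≫
    J l ◁ T.s σ e := by simp [cell]
  rw [h]
  exact this

theorem whiskerLeft_id_injective {u v : a ⟶ b} {σ τ : u ⟶ v} (h : 𝟙 a ◁ σ = 𝟙 a ◁ τ) : σ = τ := by
  simpa using h

variable [hP : Fact (IsFibration P)]

omit hT in
theorem reduction_cart {u v : a ⟶ b} (σ : u ⟶ v) {e : Fibre κ b} {y : Fibre κ a}
    (l : y ⟶ (T.F.map v).obj e) :
    IsCartesian₂ P ((JComp l (T.F.app₂ σ e)).hom ▷ T.cApp u e ≫ (α_ _ _ _).hom ≫ J l ◁ T.s σ e) :=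
  have : CartesianCell P (T.s σ e) :=
    ⟨(IsCartesian₂.of_isIso (T.fac σ e).hom).comp ((T.cDisp v e).lift σ).isCartesian₂⟩
  CartesianCell.cart

/-- The 2-cells of the Grothendieck construction are determined by the 2-cells of `E`. -/
theorem IsCoherent.cell_injective {f g : El.Hom p q} {θ ζ : El.Hom₂ f g}
    (h : T.cell θ.fib = T.cell ζ.fib) : θ = ζ := by
  have h₁ := hT.cell_over θ.fib
  rw [h] at h₁
  -- The base component is read off first, since the interpretation lies over its whiskering by an
  -- identity. The fibre components are then parallel and can be compared.
  have h₂ := whiskerLeft_id_injective (h₁.unique (hT.cell_over ζ.fib))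
  obtain ⟨σ, θ⟩ := θ
  obtain ⟨τ, ζ⟩ := ζ
  subst h₂
  congr 1
  refine (T.isCartesian_cApp _ _).hom₂_ext (reduction_cart σ g.fib) ?_
  simpa [cell] using h

/-- Every 2-cell of `E` between the composites that interpret 1-cells of the Grothendieck
construction comes from a 2-cell. -/
theorem IsCoherent.cell_surjective {f g : El.Hom p q}
    (W : J f.fib ≫ T.cApp f.base q.fib ⟶ J g.fib ≫ T.cApp g.base q.fib) :
    ∃ θ : El.Hom₂ f g, T.cell θ.fib = W := by
  obtain ⟨σ, h⟩ := Disp.exists_over ((JDisp f.fib).comp (T.cDisp f.base q.fib))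
    ((JDisp g.fib).comp (T.cDisp g.base q.fib)) W
  -- Conjugation by unitors arranges that `𝟙 _ ◁ τ` is `σ`.
  let τ : f.base ⟶ g.base := (λ_ _).inv ≫ σ ≫ (λ_ _).hom
  obtain ⟨θ, hθ⟩ := (T.cart f.base q.fib).exists_lift_hom₂ (c := T.cDisp f.base q.fib)
    (n := (JDisp g.fib).comp (T.cDisp g.base q.fib)) (hT.reduction_over τ g.fib)
    (h.congr (by simp [τ])) (reduction_cart τ g.fib)
  refine ⟨⟨τ, θ⟩, ?_⟩
  have h' : J₂ θ ▷ T.cApp f.base q.fib ≫ (JComp _ _).hom ▷ T.cApp f.base q.fib ≫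
    (α_ _ _ _).hom ≫ J g.fib ◁ T.s τ q.fib = W := hθ
  simp [cell, ← h']

end AssociatedData

end

/-! ### Postcomposition with cells of the Grothendieck construction. -/

section

variable {E : Type u₂} [Bicategory.{w₂, v₂} E] {B : Type u₁} [Bicategory.{w₁, v₁} B]
  {P : E ⥤ᵖ B} {κ : LocalCleavage P} {κ₁ : Cleavage κ} {a b : B}

open Fibre Disp

namespace AssociatedData

variable (T : AssociatedData κ κ₁) {z : E} {p q r s t : El T.F} (m : z ⟶ p.fib.obj)

/-- Postcomposition with the interpretation of a 1-cell of the Grothendieck construction. -/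
def post (f : El.Hom p q) : z ⟶ q.fib.obj := (m ≫ J f.fib) ≫ T.cApp f.base q.fib

/-- Postcomposition on 2-cells. -/
def postMap {m m' : z ⟶ p.fib.obj} (μ : m ⟶ m') (f : El.Hom p q) : T.post m f ⟶ T.post m' f :=
  μ ▷ J f.fib ▷ T.cApp f.base q.fib

/-- Postcomposition with the interpretation of a 2-cell of the Grothendieck construction. -/
def postCell {f g : El.Hom p q} (θ : El.Hom₂ f g) : T.post m f ⟶ T.post m g := T.cellA m θ.fib

/-- Postcomposition with a composite. -/
def postComp (f : El.Hom p q) (g : El.Hom q r) :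
    T.post m (f.comp g) ≅ T.post (T.post m f) g := T.compA m f.fib g.fib

/-- Postcomposition with an identity. -/
def postId : T.post m (El.Hom.id p) ≅ m := T.iA m

variable {T} [hT : T.IsCoherent]
include hT

namespace IsCoherent

theorem postCell_id (f : El.Hom p q) : T.postCell m (El.Hom₂.id f) = 𝟙 _ :=
  T.cellA_id m f.fib

theorem postCell_comp {f g h : El.Hom p q} (θ : El.Hom₂ f g) (ζ : El.Hom₂ g h) :
    T.postCell m (El.Hom₂.comp θ ζ) = T.postCell m θ ≫ T.postCell m ζ :=
  T.cellA_comp m θ.fib ζ.fib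

theorem postCell_hcomp {f f' : El.Hom p q} {g g' : El.Hom q r} (θ : El.Hom₂ f f')
    (ζ : El.Hom₂ g g') : T.postCell m (El.Hom₂.hcomp θ ζ) ≫ (T.postComp m f' g').hom =
      (T.postComp m f g).hom ≫ T.postMap (T.postCell m θ) g ≫ T.postCell (T.post m f') ζ :=
  T.cellA_hcomp m θ ζ

theorem postCell_assoc (f : El.Hom p q) (g : El.Hom q r) (h : El.Hom r s) :
    T.postCell m (El.Hom₂.assoc f g h) ≫ (T.postComp m f (g.comp h)).hom ≫
      (T.postComp (T.post m f) g h).hom = (T.postComp m (f.comp g) h).hom ≫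
        T.postMap (T.postComp m f g).hom h :=
  T.cellA_assoc m f g h

theorem postCell_leftUnitor (f : El.Hom p q) :
    T.postCell m (El.Hom₂.leftUnitor f) = (T.postComp m (El.Hom.id p) f).hom ≫
      T.postMap (T.postId m).hom f :=
  T.cellA_leftUnitor m f

theorem postCell_rightUnitorInv (f : El.Hom p q) :
    T.postCell m (El.Hom₂.rightUnitorInv f) ≫ (T.postComp m f (El.Hom.id q)).hom ≫
      (T.postId (T.post m f)).hom = 𝟙 _ :=
  T.cellA_rightUnitorInv m f

end IsCoherent

end AssociatedData

end

/-! ### The comparison respects all operations. -/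

section

variable {E : Type u₂} [Bicategory.{w₂, v₂} E] {B : Type u₁} [Bicategory.{w₁, v₁} B]
  {P : E ⥤ᵖ B} {κ : LocalCleavage P} {κ₁ : Cleavage κ}

open Fibre

namespace AssociatedTrihom

variable (T : AssociatedTrihom κ κ₁) {z : E} {p q r s : El T.F} (m : z ⟶ p.fib.obj)

/-- Postcomposition with a 1-cell of the Grothendieck construction is composition with its image
under the comparison. -/
def postIso (f : El.Hom p q) : T.post m f ≅ m ≫ T.compMap f :=
  α_ m (J f.fib) (T.cApp f.base q.fib) ≪≫ whiskerLeftIso m (T.r f).symm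

/-- `post` uses the composite of the fibre component with a cartesian 1-cell, the comparison uses
its strict replacement `compMap`. Conjugation by `postIso` passes from one to the other, here and in
the next three statements. -/
theorem postMap_eq {m m' : z ⟶ p.fib.obj} (μ : m ⟶ m') (f : El.Hom p q) : T.postMap μ f =
    (T.postIso m f).hom ≫ μ ▷ T.compMap f ≫ (T.postIso m' f).inv := by
  change μ ▷ J f.fib ▷ T.cApp f.base q.fib =
    ((α_ m (J f.fib) (T.cApp f.base q.fib)).hom ≫ m ◁ (T.r f).inv) ≫ μ ▷ T.compMap f ≫
      m' ◁ (T.r f).hom ≫ (α_ m' (J f.fib) (T.cApp f.base q.fib)).inv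
  rw [Category.assoc, whisker_exchange_assoc]
  simp

theorem postCell_eq {f g : El.Hom p q} (θ : El.Hom₂ f g) : T.postCell m θ =
    (T.postIso m f).hom ≫ m ◁ T.compMap₂ θ ≫ (T.postIso m g).inv := by
  have h : T.compMap₂ θ = (T.r f).hom ≫ T.cell θ.fib ≫ (T.r g).inv := by
    simp [compMap₂, AssociatedData.cell]
  rw [h]
  refine (T.cellA_eq m θ.fib).trans ?_
  change _ = ((α_ m (J f.fib) (T.cApp f.base q.fib)).hom ≫ m ◁ (T.r f).inv) ≫
    m ◁ ((T.r f).hom ≫ T.cell θ.fib ≫ (T.r g).inv) ≫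
      m ◁ (T.r g).hom ≫ (α_ m (J g.fib) (T.cApp g.base q.fib)).inv
  simp

theorem postComp_eq (f : El.Hom p q) (g : El.Hom q r) : (T.postComp m f g).hom =
    (T.postIso m (f.comp g)).hom ≫ m ◁ (T.compMapComp f g).hom ≫
      (α_ m (T.compMap f) (T.compMap g)).inv ≫ (T.postIso m f).inv ▷ T.compMap g ≫
      (T.postIso (T.post m f) g).inv := by
  -- The isomorphism `r` at the composite matters only through its type, with the fibre component of
  -- the composite spelled out. Proving the identity for an arbitrary `R` of that type achieves
  -- this, and `R` cancels.
  have aux (R : T.compMap (f.comp g) ≅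
      J (f.fib ≫ (T.F.map f.base).map g.fib ≫ T.F.χApp f.base g.base r.fib) ≫
        T.cApp (f.base ≫ g.base) r.fib) :
      (jc m f.fib _ ≪≫ jc (m ≫ J f.fib) _ _).hom ▷ T.cApp (f.base ≫ g.base) r.fib ≫
        (T.xA ((m ≫ J f.fib) ≫ J ((T.F.map f.base).map g.fib))).hom ≫
        (T.cA (m ≫ J f.fib) g.fib).hom ▷ (T.cApp g.base r.fib) =
      ((α_ m (J (f.fib ≫ (T.F.map f.base).map g.fib ≫ T.F.χApp f.base g.base r.fib))
        (T.cApp (f.base ≫ g.base) r.fib)).hom ≫ m ◁ R.inv) ≫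
      m ◁ (R ≪≫ whiskerRightIso (JComp₃ f.fib ((T.F.map f.base).map g.fib)
          (T.F.χApp f.base g.base r.fib)) (T.cApp (f.base ≫ g.base) r.fib) ≪⊗≫
        whiskerLeftIso (J f.fib) (whiskerLeftIso (J ((T.F.map f.base).map g.fib))
          (T.x f.base g.base r.fib)) ≪⊗≫
        whiskerLeftIso (J f.fib) (whiskerRightIso (T.cNat f.base g.fib) (T.cApp g.base r.fib)) ≪⊗≫
        whiskerRightIso (T.r f).symm (J g.fib ≫ T.cApp g.base r.fib) ≪≫
        whiskerLeftIso (T.compMap f) (T.r g).symm).hom ≫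
      (α_ m (T.compMap f) (T.compMap g)).inv ≫ (m ◁ (T.r f).hom ≫
        (α_ m (J f.fib) (T.cApp f.base q.fib)).inv) ▷ T.compMap g ≫
      ((m ≫ J f.fib) ≫ T.cApp f.base q.fib) ◁ (T.r g).hom ≫
        (α_ ((m ≫ J f.fib) ≫ T.cApp f.base q.fib) (J g.fib) (T.cApp g.base r.fib)).inv := by
    have e : T.compMap f ◁ (T.r g).inv ≫ (T.r f).hom ▷ T.compMap g =
      (T.r f).hom ▷ _ ≫ (J f.fib ≫ T.cApp f.base q.fib) ◁ (T.r g).inv := whisker_exchange _ _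
    have e' := congrArg (fun x => m ◁ x) e
    simp only [whiskerLeft_comp] at e'
    simp [JComp₃, bicategoricalIsoComp, jc, act₁₂, AssociatedData.xA, AssociatedData.cA, act₂₂,
      reassoc_of% e']
    bicategory
  exact aux (T.r (f.comp g))

theorem postId_eq : (T.postId m).hom =
    (T.postIso m (El.Hom.id p)).hom ≫ m ◁ (T.compMapId p).hom ≫ (ρ_ m).hom := by
  have aux (R : T.compMap (El.Hom.id p) ≅ J (T.F.ιApp p.base p.fib) ≫ T.cApp (𝟙 p.base) p.fib) :
      (T.iA m).hom = ((α_ m (J (T.F.ιApp p.base p.fib)) (T.cApp (𝟙 p.base) p.fib)).hom ≫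
        m ◁ R.inv) ≫ m ◁ (R.hom ≫ (T.i p.base p.fib).hom) ≫ (ρ_ m).hom := by
    simp [AssociatedData.iA, act₂₀]
  exact aux (T.r (El.Hom.id p))

theorem whiskerLeft_id_injective {x y : E} {f g : x ⟶ y} {θ ζ : f ⟶ g} (h : 𝟙 x ◁ θ = 𝟙 x ◁ ζ) :
    θ = ζ := by
  simpa using h

/-- Here and below, the statement about postcomposition is specialised to an identity 1-cell, and
the isomorphisms `postIso` are cancelled. -/
theorem compMap₂_id (f : El.Hom p q) : T.compMap₂ (El.Hom₂.id f) = 𝟙 _ := by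
  have h := T.isCoherent.postCell_id (𝟙 _) f
  rw [postCell_eq, ← Iso.eq_inv_comp, Category.comp_id, ← cancel_mono (T.postIso _ f).hom] at h
  exact whiskerLeft_id_injective (by simpa using h)

theorem compMap₂_comp {f g h : El.Hom p q} (θ : El.Hom₂ f g) (ζ : El.Hom₂ g h) :
    T.compMap₂ (El.Hom₂.comp θ ζ) = T.compMap₂ θ ≫ T.compMap₂ ζ := by
  have h := T.isCoherent.postCell_comp (𝟙 _) θ ζ
  simp only [postCell_eq, Category.assoc, Iso.inv_hom_id_assoc, cancel_epi] at h
  simp only [← Category.assoc, cancel_mono] at h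
  exact whiskerLeft_id_injective (by rw [h, whiskerLeft_comp])

theorem compMap₂_hcomp {f f' : El.Hom p q} {g g' : El.Hom q r} (θ : El.Hom₂ f f')
    (ζ : El.Hom₂ g g') : T.compMap₂ (El.Hom₂.hcomp θ ζ) = (T.compMapComp f g).hom ≫
      T.compMap₂ θ ▷ T.compMap g ≫ T.compMap f' ◁ T.compMap₂ ζ ≫ (T.compMapComp f' g').inv := by
  have h := T.isCoherent.postCell_hcomp (𝟙 _) θ ζ
  -- Exchange moves `postIso` behind the whiskered 2-cell, where it cancels against the same factor
  -- on the other side.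
  have e : (T.postIso (𝟙 _) f').inv ▷ T.compMap g ≫ T.post (𝟙 p.fib.obj) f' ◁ T.compMap₂ ζ =
    (𝟙 _ ≫ T.compMap f') ◁ T.compMap₂ ζ ≫ _ := (whisker_exchange _ _).symm
  simp only [postCell_eq, postComp_eq, postMap_eq] at h
  rw [← cancel_mono ((T.compMapComp f' g').hom ≫ (λ_ _).inv ≫ (α_ _ _ _).inv ≫
    (T.postIso (𝟙 p.fib.obj) f').inv ▷ T.compMap g' ≫
      (T.postIso (T.post (𝟙 p.fib.obj) f') g').inv)]
  simpa [reassoc_of% e] using h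

theorem compMap₂_assoc (f : El.Hom p q) (g : El.Hom q r) (h : El.Hom r s) :
    T.compMap₂ (El.Hom₂.assoc f g h) = (T.compMapComp (f.comp g) h).hom ≫
      (T.compMapComp f g).hom ▷ T.compMap h ≫
      (α_ (T.compMap f) (T.compMap g) (T.compMap h)).hom ≫ T.compMap f ◁ (T.compMapComp g h).inv ≫
      (T.compMapComp f (g.comp h)).inv := by
  have h' := T.isCoherent.postCell_assoc (𝟙 _) f g h
  have e : (T.postIso (𝟙 _) f).inv ▷ T.compMap (g.comp h) ≫
      T.post (𝟙 p.fib.obj) f ◁ (T.compMapComp g h).hom =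
    (𝟙 _ ≫ T.compMap f) ◁ (T.compMapComp g h).hom ≫ _ := (whisker_exchange _ _).symm
  simp only [postCell_eq, postComp_eq, postMap_eq] at h'
  have c : (α_ (T.compMap f) (T.compMap g) (T.compMap h)).hom ≫ (λ_ _).inv ≫
    (α_ _ _ _).inv ≫ (α_ (𝟙 p.fib.obj ≫ T.compMap f) (T.compMap g) (T.compMap h)).inv =
      (λ_ _).inv ≫ (α_ (𝟙 p.fib.obj) (T.compMap f ≫ T.compMap g) (T.compMap h)).inv ≫
        (α_ (𝟙 p.fib.obj) (T.compMap f) (T.compMap g)).inv ▷ T.compMap h := by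
    bicategory
  rw [← cancel_mono ((T.compMapComp f (g.comp h)).hom ≫ T.compMap f ◁ (T.compMapComp g h).hom ≫
    (λ_ _).inv ≫ (α_ _ _ _).inv ≫ (α_ _ _ _).inv ≫
      (T.postIso (𝟙 p.fib.obj) f).inv ▷ T.compMap g ▷ T.compMap h ≫
      (T.postIso (T.post (𝟙 p.fib.obj) f) g).inv ▷ T.compMap h ≫
      (T.postIso (T.post (T.post (𝟙 p.fib.obj) f) g) h).inv)]
  simpa [reassoc_of% e, reassoc_of% c] using h'

theorem compMap₂_leftUnitor (f : El.Hom p q) : T.compMap₂ (El.Hom₂.leftUnitor f) =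
    (T.compMapComp (El.Hom.id p) f).hom ≫ (T.compMapId p).hom ▷ T.compMap f ≫
      (λ_ (T.compMap f)).hom := by
  have h := T.isCoherent.postCell_leftUnitor (𝟙 _) f
  simp only [postCell_eq, postComp_eq, postMap_eq, postId_eq] at h
  rw [← cancel_mono (λ_ _).inv]
  simpa using h

theorem compMap₂_rightUnitorInv (f : El.Hom p q) : T.compMap₂ (El.Hom₂.rightUnitorInv f) ≫
    (T.compMapComp f (El.Hom.id q)).hom ≫ T.compMap f ◁ (T.compMapId q).hom ≫
      (ρ_ (T.compMap f)).hom = 𝟙 _ := by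
  have h := T.isCoherent.postCell_rightUnitorInv (𝟙 _) f
  have e : (T.postIso (𝟙 _) f).inv ▷ T.compMap (El.Hom.id q) ≫
      T.post (𝟙 p.fib.obj) f ◁ (T.compMapId q).hom =
    (𝟙 _ ≫ T.compMap f) ◁ (T.compMapId q).hom ≫ _ := (whisker_exchange _ _).symm
  have c : (λ_ (T.compMap f ≫ 𝟙 q.fib.obj)).inv ≫ (α_ _ _ _).inv ≫ (ρ_ _).hom =
    (ρ_ (T.compMap f)).hom ≫ (λ_ _).inv := by
    bicategory
  simp only [postCell_eq, postComp_eq, postId_eq] at h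
  rw [← cancel_epi ((T.postIso (𝟙 p.fib.obj) f).hom ≫ (λ_ _).hom),
    ← cancel_mono ((λ_ _).inv ≫ (T.postIso (𝟙 p.fib.obj) f).inv)]
  simpa [reassoc_of% e, reassoc_of% c] using h

end AssociatedTrihom

end

/-! ### Axioms reflected along a locally fully faithful interpretation. -/

section

/-- An interpretation of the cells and operations of a raw bicategory in a bicategory. -/
structure RawBicategory.Interpretation {C : Type u₁} (R : RawBicategory.{w₁, v₁} C) (E : Type u₂)
    [Bicategory.{w₂, v₂} E] where
  obj : C → E
  map {x y : C} : R.Hom x y → (obj x ⟶ obj y)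
  map₂ {x y : C} {f g : R.Hom x y} : R.Hom₂ f g → (map f ⟶ map g)
  mapId (x : C) : map (R.id x) ≅ 𝟙 (obj x)
  mapComp {x y z : C} (f : R.Hom x y) (g : R.Hom y z) : map (R.comp f g) ≅ map f ≫ map g
  map₂_id₂ {x y : C} (f : R.Hom x y) : map₂ (R.id₂ f) = 𝟙 _
  map₂_comp₂ {x y : C} {f g h : R.Hom x y} (θ : R.Hom₂ f g) (ζ : R.Hom₂ g h) :
    map₂ (R.comp₂ θ ζ) = map₂ θ ≫ map₂ ζ
  map₂_hcomp {x y z : C} {f f' : R.Hom x y} {g g' : R.Hom y z} (θ : R.Hom₂ f f')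
    (ζ : R.Hom₂ g g') : map₂ (R.hcomp θ ζ) = (mapComp f g).hom ≫ map₂ θ ▷ map g ≫
      map f' ◁ map₂ ζ ≫ (mapComp f' g').inv
  map₂_assoc {x y z t : C} (f : R.Hom x y) (g : R.Hom y z) (h : R.Hom z t) :
    map₂ (R.assoc f g h) = (mapComp (R.comp f g) h).hom ≫ (mapComp f g).hom ▷ map h ≫
      (α_ (map f) (map g) (map h)).hom ≫ map f ◁ (mapComp g h).inv ≫
      (mapComp f (R.comp g h)).inv
  map₂_leftUnitor {x y : C} (f : R.Hom x y) : map₂ (R.leftUnitor f) =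
    (mapComp (R.id x) f).hom ≫ (mapId x).hom ▷ map f ≫ (λ_ (map f)).hom
  map₂_rightUnitorInv {x y : C} (f : R.Hom x y) : map₂ (R.rightUnitorInv f) =
    (ρ_ (map f)).inv ≫ map f ◁ (mapId y).inv ≫ (mapComp f (R.id y)).inv
  map₂_injective {x y : C} {f g : R.Hom x y} {θ ζ : R.Hom₂ f g} : map₂ θ = map₂ ζ → θ = ζ
  map₂_surjective {x y : C} {f g : R.Hom x y} (W : map f ⟶ map g) : ∃ θ : R.Hom₂ f g, map₂ θ = W

namespace RawBicategory.Interpretation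

variable {C : Type u₁} {R : RawBicategory.{w₁, v₁} C} {E : Type u₂} [Bicategory.{w₂, v₂} E]
  (I : R.Interpretation E)

/-- Surjectivity of `map₂` provides a preimage of the inverse, and injectivity reflects the two
equations. -/
theorem isInvertible {x y : C} {f g : R.Hom x y} (θ : R.Hom₂ f g) (φ : I.map f ≅ I.map g)
    (h : I.map₂ θ = φ.hom) : R.IsInvertible θ := by
  obtain ⟨ζ, hζ⟩ := I.map₂_surjective φ.inv
  exact ⟨ζ, I.map₂_injective (by simp [map₂_comp₂, map₂_id₂, h, hζ]),
    I.map₂_injective (by simp [map₂_comp₂, map₂_id₂, h, hζ])⟩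

include I

/-- A raw bicategory with a locally fully faithful interpretation satisfies the axioms. -/
theorem isLawful : R.IsLawful where
  id₂_comp₂ θ := I.map₂_injective (by simp [map₂_comp₂, map₂_id₂])
  comp₂_id₂ θ := I.map₂_injective (by simp [map₂_comp₂, map₂_id₂])
  comp₂_assoc θ ζ ξ := I.map₂_injective (by simp [map₂_comp₂])
  hcomp_id₂ f g := I.map₂_injective (by simp [map₂_hcomp, map₂_id₂])
  interchange θ θ' ζ ζ' := I.map₂_injective (by
    simp [map₂_hcomp, map₂_comp₂, whisker_exchange_assoc])
  assoc_nat θ ζ ξ := I.map₂_injective (by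
    simp [map₂_hcomp, map₂_comp₂, map₂_assoc, whisker_exchange_assoc])
  leftUnitor_nat θ := I.map₂_injective (by
    simp [map₂_hcomp, map₂_comp₂, map₂_leftUnitor, map₂_id₂, whisker_exchange_assoc])
  rightUnitorInv_nat θ := I.map₂_injective (by
    simp [map₂_hcomp, map₂_comp₂, map₂_rightUnitorInv, map₂_id₂, whisker_exchange_assoc])
  assoc_inv f g h := I.isInvertible _ (I.mapComp _ h ≪≫ whiskerRightIso (I.mapComp f g) _ ≪≫
    α_ _ _ _ ≪≫ whiskerLeftIso _ (I.mapComp g h).symm ≪≫ (I.mapComp f _).symm)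
    (by simp [map₂_assoc])
  leftUnitor_inv f := I.isInvertible _ (I.mapComp _ f ≪≫ whiskerRightIso (I.mapId _) _ ≪≫ λ_ _)
    (by simp [map₂_leftUnitor])
  rightUnitorInv_inv f := I.isInvertible _ ((ρ_ _).symm ≪≫ whiskerLeftIso _ (I.mapId _).symm ≪≫
    (I.mapComp f _).symm) (by simp [map₂_rightUnitorInv])
  pentagon f g h k := I.map₂_injective (by
    simp [map₂_hcomp, map₂_comp₂, map₂_assoc, map₂_id₂, whisker_exchange_assoc])
  triangle f g := I.map₂_injective (by
    simp [map₂_hcomp, map₂_comp₂, map₂_assoc, map₂_id₂, map₂_leftUnitor, map₂_rightUnitorInv])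

end RawBicategory.Interpretation

variable {E : Type u₂} [Bicategory.{w₂, v₂} E] {B : Type u₁} [Bicategory.{w₁, v₁} B]
  {P : E ⥤ᵖ B} {κ : LocalCleavage P} {κ₁ : Cleavage κ}

open Fibre

namespace AssociatedTrihom

variable (T : AssociatedTrihom κ κ₁) {p q r : El T.F}

theorem compMap₂_eq {f g : El.Hom p q} (θ : El.Hom₂ f g) :
    T.compMap₂ θ = (T.r f).hom ≫ T.cell θ.fib ≫ (T.r g).inv := by
  simp [compMap₂, AssociatedData.cell]

theorem compMap₂_whiskerLeft (f : El.Hom p q) {g g' : El.Hom q r} (θ : El.Hom₂ g g') :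
    T.compMap₂ (El.Hom₂.hcomp (El.Hom₂.id f) θ) = (T.compMapComp f g).hom ≫
      T.compMap f ◁ T.compMap₂ θ ≫ (T.compMapComp f g').inv := by
  simp [compMap₂_hcomp, compMap₂_id]

theorem compMap₂_whiskerRight {f f' : El.Hom p q} (θ : El.Hom₂ f f') (g : El.Hom q r) :
    T.compMap₂ (El.Hom₂.hcomp θ (El.Hom₂.id g)) = (T.compMapComp f g).hom ≫
      T.compMap₂ θ ▷ T.compMap g ≫ (T.compMapComp f' g).inv := by
  simp [compMap₂_hcomp, compMap₂_id]

/-- The raw structure contains only the inverse of the right unitor, and the bicategory built from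
it uses some chosen inverse of that. Its image under the comparison is nevertheless forced. -/
theorem compMap₂_rightUnitor {f : El.Hom p q} {θ : El.Hom₂ (f.comp (El.Hom.id q)) f}
    (h : El.Hom₂.comp θ (El.Hom₂.rightUnitorInv f) = El.Hom₂.id _) : T.compMap₂ θ =
      (T.compMapComp f (El.Hom.id q)).hom ≫ T.compMap f ◁ (T.compMapId q).hom ≫
        (ρ_ (T.compMap f)).hom := by
  have h' := congrArg T.compMap₂ h
  rw [compMap₂_comp, compMap₂_id] at h'
  rw [← Category.comp_id (T.compMap₂ θ), ← T.compMap₂_rightUnitorInv f, reassoc_of% h']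

variable [hP : Fact (IsFibration P)]

theorem compMap₂_injective {f g : El.Hom p q} {θ ζ : El.Hom₂ f g}
    (h : T.compMap₂ θ = T.compMap₂ ζ) : θ = ζ := by
  rw [compMap₂_eq, compMap₂_eq, cancel_epi, cancel_mono] at h
  exact T.isCoherent.cell_injective h

theorem compMap₂_surjective {f g : El.Hom p q} (W : T.compMap f ⟶ T.compMap g) :
    ∃ θ : El.Hom₂ f g, T.compMap₂ θ = W := by
  obtain ⟨θ, h⟩ := T.isCoherent.cell_surjective ((T.r f).inv ≫ W ≫ (T.r g).hom)
  exact ⟨θ, by rw [compMap₂_eq, h]; simp⟩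

/-- The interpretation of the Grothendieck construction in `E`. -/
def interpretation : (El.raw T.F).Interpretation E where
  obj p := p.fib.obj
  map f := T.compMap f
  map₂ θ := T.compMap₂ θ
  mapId p := T.compMapId p
  mapComp f g := T.compMapComp f g
  map₂_id₂ f := T.compMap₂_id f
  map₂_comp₂ θ ζ := T.compMap₂_comp θ ζ
  map₂_hcomp θ ζ := T.compMap₂_hcomp θ ζ
  map₂_assoc f g h := T.compMap₂_assoc f g h
  map₂_leftUnitor f := T.compMap₂_leftUnitor f
  map₂_rightUnitorInv {p q} f := by
    have h := T.compMap₂_rightUnitorInv f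
    let t : T.compMap (El.Hom.comp f (El.Hom.id q)) ≅ T.compMap f :=
      T.compMapComp f (El.Hom.id q) ≪≫ whiskerLeftIso (T.compMap f) (T.compMapId q) ≪≫ ρ_ _
    have ht : T.compMap₂ (El.Hom₂.rightUnitorInv f) = t.inv := by
      rw [← cancel_mono t.hom, Iso.inv_hom_id]
      exact h
    refine ht.trans ?_
    simp [t]
    rfl
  map₂_injective {p q f g θ ζ} h := T.compMap₂_injective h
  map₂_surjective W := T.compMap₂_surjective W

theorem raw_isLawful : (El.raw T.F).IsLawful := T.interpretation.isLawful

omit hP in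
theorem comparison_isLawful (h : (El.raw T.F).IsLawful) : (T.comparison h).IsLawful where
  map₂_id f := T.compMap₂_id f
  map₂_comp θ ζ := T.compMap₂_comp θ ζ
  map₂_whisker_left f _ _ θ := T.compMap₂_whiskerLeft f θ
  map₂_whisker_right θ g := T.compMap₂_whiskerRight θ g
  map₂_associator f g k := T.compMap₂_assoc f g k
  map₂_left_unitor f := T.compMap₂_leftUnitor f
  map₂_right_unitor f := T.compMap₂_rightUnitor (ρ_ f).hom_inv_id

end AssociatedTrihom

end

/-! ### Strict equality of `PH` with the projection. -/

section

section Equality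

variable {D : Type u₃} [Bicategory.{w₃, v₃} D] {B : Type u₁} [Bicategory.{w₁, v₁} B]

/-- Homomorphisms are equal when they agree on cells and their coherence isomorphisms agree, along
equalities of objects and of 1-cells. -/
theorem pseudofunctor_ext {F G : D ⥤ᵖ B} (h₀ : ∀ x, F.obj x = G.obj x)
    (h₁ : ∀ {x y : D} (f : x ⟶ y), F.map f = castHom (h₀ x) (h₀ y) (G.map f))
    (h₂ : ∀ {x y : D} {f g : x ⟶ y} (θ : f ⟶ g), F.map₂ θ ≫ eqToHom (h₁ g) =
      eqToHom (h₁ f) ≫ castHom₂ (h₀ x) (h₀ y) (G.map₂ θ))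
    (hI : ∀ x : D, (castId (h₀ x) (F.mapId x)).hom =
      eqToHom (h₁ (𝟙 x)) ≫ castHom₂ (h₀ x) (h₀ x) (G.mapId x).hom)
    (hC : ∀ {x y z : D} (f : x ⟶ y) (g : y ⟶ z), (castComp (h₀ x) (h₀ y) (h₀ z)
      (F.mapComp f g ≪≫ whiskerRightIso (eqToIso (h₁ f)) _ ≪≫
        whiskerLeftIso _ (eqToIso (h₁ g)))).hom =
      eqToHom (h₁ (f ≫ g)) ≫ castHom₂ (h₀ x) (h₀ z) (G.mapComp f g).hom) : F = G := by
  -- With both homomorphisms taken apart, the equalities on objects and then on 1-cells can be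
  -- substituted, after which the casts in the remaining hypotheses become trivial.
  obtain ⟨⟨⟨⟨obj, map⟩, map₂⟩, _, _⟩, mapId, mapComp, _, _, _, _, _⟩ := F
  obtain ⟨⟨⟨⟨obj', map'⟩, map₂'⟩, _, _⟩, mapId', mapComp', _, _, _, _, _⟩ := G
  dsimp only at *
  obtain rfl : obj = obj' := funext h₀
  obtain rfl : @map = @map' := by funext x y f; exact h₁ f
  obtain rfl : @map₂ = @map₂' := by
    funext x y f g θ
    have h : map₂ θ ≫ eqToHom rfl = eqToHom rfl ≫ map₂' θ := h₂ θ
    simpa using h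
  obtain rfl : mapId = mapId' := by
    funext x
    ext
    have h : (mapId x).hom = eqToHom rfl ≫ (mapId' x).hom := hI x
    simpa using h
  obtain rfl : @mapComp = @mapComp' := by
    funext x y z f g
    ext
    have h : (mapComp f g ≪≫ whiskerRightIso (Iso.refl _) _ ≪≫
      whiskerLeftIso _ (Iso.refl _)).hom = eqToHom rfl ≫ (mapComp' f g).hom := hC f g
    simpa using h
  rfl

variable {x y z b d e : B}

/-- The cast concerns only the target, so isomorphisms composed in front can be taken out. With
`castComp_trans` this matches the constraints of a composite homomorphism with the isomorphisms in
`Disp.id` and `Disp.comp`. -/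
theorem castId_trans (hx : x = b) {f g : x ⟶ x} (α : f ≅ g) (φ : g ≅ 𝟙 x) :
    castId hx (α ≪≫ φ) = α ≪≫ castId hx φ := by
  subst hx; rfl

theorem castComp_trans (hx : x = b) (hy : y = d) (hz : z = e) {u : b ⟶ d}
    {v : d ⟶ e} {f g h : x ⟶ z} (α : f ≅ g) (β : g ≅ h)
    (φ : h ≅ castHom hx hy u ≫ castHom hy hz v) :
    castComp hx hy hz ((α ≪≫ β) ≪≫ φ) = α ≪≫ castComp hx hy hz (β ≪≫ φ) := by
  subst hx; subst hy; subst hz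
  exact Iso.trans_assoc _ _ _

end Equality

variable {E : Type u₂} [Bicategory.{w₂, v₂} E] {B : Type u₁} [Bicategory.{w₁, v₁} B]
  {P : E ⥤ᵖ B} {κ : LocalCleavage P} {κ₁ : Cleavage κ}

open Fibre Disp

namespace AssociatedTrihom

variable (T : AssociatedTrihom κ κ₁) {p q r : El T.F}

/-- The image of a 1-cell under the comparison, strictly over the base component. -/
def mapDisp (f : El.Hom p q) : Disp p.fib q.fib f.base := (T.compDisp f).pull (λ_ f.base).inv

theorem r_over (f : El.Hom p q) :
    (T.mapDisp f).Over (T.compDisp f) (T.r f).hom (λ_ f.base).inv :=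
  (T.compDisp f).pullIso_over (λ_ f.base).symm

theorem r_inv_over (f : El.Hom p q) :
    (T.compDisp f).Over (T.mapDisp f) (T.r f).inv (λ_ f.base).hom :=
  Disp.Over.inv (σ := (λ_ f.base).symm) (T.r_over f)

theorem compMap₂_over {f g : El.Hom p q} (θ : El.Hom₂ f g) :
    (T.mapDisp f).Over (T.mapDisp g) (T.compMap₂ θ) θ.base := by
  rw [compMap₂_eq]
  exact ((T.r_over f).comp ((T.isCoherent.cell_over θ.fib).comp (T.r_inv_over g))).congr (by simp)

theorem compMapId_over (p : El T.F) :
    (T.mapDisp (El.Hom.id p)).Over (Disp.id p.fib) (T.compMapId p).hom (𝟙 _) :=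
  ((T.r_over (El.Hom.id p)).comp (T.i_base p.base p.fib)).congr (Iso.inv_hom_id _)

/-- Every constituent of `compMapComp` lies over a canonical isomorphism of `B`. The whole lies over
their composite, which coherence identifies with an identity. -/
theorem compMapComp_over (f : El.Hom p q) (g : El.Hom q r) :
    (T.mapDisp (f.comp g)).Over ((T.mapDisp f).comp (T.mapDisp g)) (T.compMapComp f g).hom
      (𝟙 _) := by
  let jf := JDisp f.fib
  let jg := JDisp ((T.F.map f.base).map g.fib)
  let jx := JDisp (T.F.χApp f.base g.base r.fib)
  let c := T.cDisp (f.base ≫ g.base) r.fib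
  have h₀ := T.r_over (f.comp g)
  have h₁ := ((JComp_over f.fib ((T.F.map f.base).map g.fib ≫ T.F.χApp f.base g.base r.fib)).comp
    ((JComp_over ((T.F.map f.base).map g.fib) (T.F.χApp f.base g.base r.fib)).whiskerLeft
      (JDisp f.fib))).whiskerRight c
  have h₂ := (Over.associator jf (jg.comp jx) c).comp ((Over.associator jg jx c).whiskerLeft jf)
  have h₃ := ((T.x_base f.base g.base r.fib).whiskerLeft jg).whiskerLeft jf
  have h₄ := (Over.associator_inv jg (T.cDisp f.base ((T.F.map g.base).obj r.fib))
    (T.cDisp g.base r.fib)).whiskerLeft jf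
  have h₅ := ((T.cNat_base f.base g.fib).whiskerRight (T.cDisp g.base r.fib)).whiskerLeft jf
  have h₆ := ((Over.associator (T.cDisp f.base q.fib) (JDisp g.fib)
    (T.cDisp g.base r.fib)).whiskerLeft jf).comp
    (Over.associator_inv jf (T.cDisp f.base q.fib) ((JDisp g.fib).comp (T.cDisp g.base r.fib)))
  have h₇ := (T.r_inv_over f).whiskerRight ((JDisp g.fib).comp (T.cDisp g.base r.fib))
  have h₈ := (T.r_inv_over g).whiskerLeft (T.mapDisp f)
  have h := h₀.comp (h₁.comp (h₂.comp (h₃.comp (h₄.comp (h₅.comp (h₆.comp (h₇.comp h₈)))))))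
  have aux (R : T.compMap (f.comp g) ≅
      J (f.fib ≫ (T.F.map f.base).map g.fib ≫ T.F.χApp f.base g.base r.fib) ≫
        T.cApp (f.base ≫ g.base) r.fib) :
      (R ≪≫ whiskerRightIso (JComp₃ f.fib ((T.F.map f.base).map g.fib)
          (T.F.χApp f.base g.base r.fib)) (T.cApp (f.base ≫ g.base) r.fib) ≪⊗≫
        whiskerLeftIso (J f.fib) (whiskerLeftIso (J ((T.F.map f.base).map g.fib))
          (T.x f.base g.base r.fib)) ≪⊗≫
        whiskerLeftIso (J f.fib) (whiskerRightIso (T.cNat f.base g.fib) (T.cApp g.base r.fib)) ≪⊗≫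
        whiskerRightIso (T.r f).symm (J g.fib ≫ T.cApp g.base r.fib) ≪≫
        whiskerLeftIso (T.compMap f) (T.r g).symm).hom =
      R.hom ≫ ((JComp _ _).hom ≫ J f.fib ◁ (JComp _ _).hom) ▷ T.cApp (f.base ≫ g.base) r.fib ≫
        ((α_ _ _ _).hom ≫ J f.fib ◁ (α_ _ _ _).hom) ≫
        J f.fib ◁ J ((T.F.map f.base).map g.fib) ◁ (T.x f.base g.base r.fib).hom ≫
        J f.fib ◁ (α_ _ _ _).inv ≫ J f.fib ◁ (T.cNat f.base g.fib).hom ▷ T.cApp g.base r.fib ≫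
        (J f.fib ◁ (α_ _ _ _).hom ≫ (α_ _ _ _).inv) ≫
        (T.r f).inv ▷ (J g.fib ≫ T.cApp g.base r.fib) ≫ T.compMap f ◁ (T.r g).inv := by
    simp [JComp₃, bicategoricalIsoComp]
  have e := aux (T.r (f.comp g))
  have h' : (T.mapDisp (f.comp g)).Over ((T.mapDisp f).comp (T.mapDisp g))
    (T.compMapComp f g).hom _ := e ▸ h
  have coh {a b d : B} (u : a ⟶ b) (v : b ⟶ d) : (λ_ (u ≫ v)).inv ≫
      ((λ_ (𝟙 a)).inv ≫ 𝟙 a ◁ (λ_ (𝟙 a)).inv) ▷ (u ≫ v) ≫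
        ((α_ (𝟙 a) (𝟙 a ≫ 𝟙 a) (u ≫ v)).hom ≫ 𝟙 a ◁ (α_ (𝟙 a) (𝟙 a) (u ≫ v)).hom) ≫
        𝟙 a ◁ 𝟙 a ◁ (λ_ (u ≫ v)).hom ≫ 𝟙 a ◁ (α_ (𝟙 a) u v).inv ≫
        𝟙 a ◁ ((λ_ u).hom ≫ (ρ_ u).inv) ▷ v ≫
        (𝟙 a ◁ (α_ u (𝟙 b) v).hom ≫ (α_ (𝟙 a) u (𝟙 b ≫ v)).inv) ≫
        (λ_ u).hom ▷ (𝟙 b ≫ v) ≫ u ◁ (λ_ v).hom = 𝟙 _ := by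
    bicategory
  exact h'.congr (coh f.base g.base)

/-- `compMap f` is the domain of a chosen lift and therefore lies strictly over `f.base`; the
unstraightened composite would do so only up to a unitor. The 2-cells and constraints agree because
they lie over the required 2-cells. -/
theorem comparison_comp (h : (El.raw T.F).IsLawful) (hH : (T.comparison h).IsLawful) :
    hH.toPseudofunctor.comp P = El.proj h := by
  refine pseudofunctor_ext (fun p => (El.fib p).proj_eq)
    (fun f => ((T.compDisp f).lift (λ_ (El.Hom.base f)).inv).domain_eq)
    (fun θ => T.compMap₂_over θ) (fun p => ?_) (fun f g => ?_)
  · exact (congrArg Iso.hom (castId_trans (El.fib p).proj_eq (P.map₂Iso (T.compMapId p))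
      (P.mapId _))).trans (T.compMapId_over p)
  · exact (congrArg Iso.hom (castComp_trans _ _ _ (P.map₂Iso (T.compMapComp f g))
      (P.mapComp (T.compMap f) (T.compMap g)) (whiskerRightIso (T.mapDisp f).iso _ ≪≫
        whiskerLeftIso _ (T.mapDisp g).iso))).trans (T.compMapComp_over f g)

end AssociatedTrihom

end

/-! ### Transport of cartesian cells and fibrations along `H`. -/

section

variable {E : Type u₂} [Bicategory.{w₂, v₂} E] {B : Type u₁} [Bicategory.{w₁, v₁} B]
  {D : Type u₃} [Bicategory.{w₃, v₃} D] {P : E ⥤ᵖ B} {H : D ⥤ᵖ E}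

/-- 2-cells between composites with `c` that lie over whiskerings are uniquely whiskered. -/
def UniquelyWhiskered (P : E ⥤ᵖ B) {x y z : E} (c : x ⟶ y) (k l : z ⟶ x) : Prop :=
  ∀ (θ : k ≫ c ⟶ l ≫ c) (δ : P.map k ⟶ P.map l),
    P.map₂ θ = (P.mapComp k c).hom ≫ δ ▷ P.map c ≫ (P.mapComp l c).inv →
    ∃! d : k ⟶ l, d ▷ c = θ ∧ P.map₂ d = δ

/-- Conjugation by the isomorphisms `fac` and `base` of the two lifts reduces the second clause of
the definition to tautological lifts. It becomes a condition on pairs of parallel 1-cells, which is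
easier to transport. -/
theorem isCartesian₁_iff {x y : E} {c : x ⟶ y} : IsCartesian₁ P c ↔
    (∀ {z : E} (g : z ⟶ y) (h : P.obj z ⟶ P.obj x) (α : h ≫ P.map c ≅ P.map g),
      Nonempty (Lift₁ P c g h α)) ∧ ∀ {z : E} (k l : z ⟶ x), UniquelyWhiskered P c k l := by
  refine ⟨fun hc => ⟨hc.exists_lift, fun k l θ δ => hc.existsUnique_whiskerRight θ δ⟩,
    fun ⟨h₁, h₂⟩ => ⟨h₁, ?_⟩⟩
  intro z g g' σ h h' α α' L L' δ hδ
  have e (d : L.hom ⟶ L'.hom) : (d ▷ c ≫ L'.fac.hom = L.fac.hom ≫ σ ∧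
      L.base.hom ≫ δ = P.map₂ d ≫ L'.base.hom) ↔
      (d ▷ c = L.fac.hom ≫ σ ≫ L'.fac.inv ∧ P.map₂ d = L.base.hom ≫ δ ≫ L'.base.inv) := by
    rw [← Category.assoc, ← Category.assoc, Iso.eq_comp_inv, Iso.eq_comp_inv,
      eq_comm (a := L.base.hom ≫ δ)]
  simp only [e]
  refine h₂ _ _ _ _ ?_
  have e₁ := L.comm
  have e₂ := L'.comm
  have e₃ : L'.base.inv ▷ P.map c ≫ (P.mapComp L'.hom c).inv = α'.hom ≫ P.map₂ L'.fac.inv := by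
    rw [← cancel_mono (P.map₂ L'.fac.hom), Category.assoc, ← e₂]
    simp
  rw [comp_whiskerRight, comp_whiskerRight, Category.assoc, Category.assoc, e₃, reassoc_of% hδ,
    reassoc_of% e₁]
  simp

/-- A homomorphism that is bijective on 2-cells, and surjective on 1-cells and objects, up to
isomorphism over the base in the case of 1-cells. -/
structure IsStrictBiequivalence (P : E ⥤ᵖ B) (H : D ⥤ᵖ E) : Prop where
  exists_obj : ∀ e : E, ∃ x : D, H.obj x = e
  exists_hom : ∀ {x y : D} (m : H.obj x ⟶ H.obj y), ∃ (k : x ⟶ y) (φ : H.map k ≅ m)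
    (h : P.map (H.map k) = P.map m), P.map₂ φ.hom = eqToHom h
  map₂_injective : ∀ {x y : D} {f g : x ⟶ y} {θ ζ : f ⟶ g}, H.map₂ θ = H.map₂ ζ → θ = ζ
  map₂_surjective : ∀ {x y : D} {f g : x ⟶ y} (W : H.map f ⟶ H.map g),
    ∃ θ : f ⟶ g, H.map₂ θ = W

namespace IsStrictBiequivalence

variable (hH : IsStrictBiequivalence P H) {x y z : D}
include hH

theorem exists_iso {f g : x ⟶ y} (W : H.map f ≅ H.map g) : ∃ θ : f ≅ g, H.map₂Iso θ = W := by
  obtain ⟨θ, h⟩ := hH.map₂_surjective W.hom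
  obtain ⟨ζ, h'⟩ := hH.map₂_surjective W.inv
  exact ⟨⟨θ, ζ, hH.map₂_injective (by simp [h, h']), hH.map₂_injective (by simp [h, h'])⟩,
    Iso.ext h⟩

omit hH in
theorem uniquelyWhiskered_iff_aux {f : x ⟶ y} {c : H.obj x ⟶ H.obj y} (φ : H.map f ≅ c)
    {k' l' : z ⟶ x} {k l : H.obj z ⟶ H.obj x} (ψ : H.map k' ≅ k) (ψ' : H.map l' ≅ l)
    (δ : P.map k ⟶ P.map l) :
    (P.map₂ ψ.hom ≫ δ ≫ P.map₂ ψ'.inv) ▷ P.map (H.map f) =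
      (P.mapComp _ _).inv ≫ P.map₂ (ψ.hom ▷ H.map f ≫ k ◁ φ.hom) ≫ (P.mapComp k c).hom ≫
        δ ▷ P.map c ≫ (P.mapComp l c).inv ≫ P.map₂ (l ◁ φ.inv ≫ ψ'.inv ▷ H.map f) ≫
        (P.mapComp _ _).hom := by
  have e := congrArg (fun t => P.map (H.map l') ◁ t) (PrelaxFunctor.map₂_hom_inv P.toPrelaxFunctor φ)
  simp only [whiskerLeft_comp, whiskerLeft_id] at e
  simp [whisker_exchange_assoc, e]

/-- Conjugation by `ψ`, `ψ'` and `φ`, with the bijectivity of `H` on 2-cells, matches the 2-cells on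
the two sides. The equivalences `h₁`, `h₂` and `h₃` say that the three equations in the definition
correspond. -/
theorem uniquelyWhiskered_iff {f : x ⟶ y} {c : H.obj x ⟶ H.obj y} (φ : H.map f ≅ c)
    {k' l' : z ⟶ x} {k l : H.obj z ⟶ H.obj x} (ψ : H.map k' ≅ k) (ψ' : H.map l' ≅ l) :
    UniquelyWhiskered (H.comp P) f k' l' ↔ UniquelyWhiskered P c k l := by
  let s {k' : z ⟶ x} {k : H.obj z ⟶ H.obj x} (ψ : H.map k' ≅ k) : H.map (k' ≫ f) ≅ k ≫ c :=
    H.mapComp k' f ≪≫ whiskerRightIso ψ (H.map f) ≪≫ whiskerLeftIso k φ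
  have h₁ {d' : k' ⟶ l'} {d : k ⟶ l} {θ' : k' ≫ f ⟶ l' ≫ f} {θ : k ≫ c ⟶ l ≫ c}
      (hd : H.map₂ d' = ψ.hom ≫ d ≫ ψ'.inv)
      (hθ : H.map₂ θ' = (s ψ).hom ≫ θ ≫ (s ψ').inv) : d' ▷ f = θ' ↔ d ▷ c = θ := by
    have e : H.map₂ (d' ▷ f) = (s ψ).hom ≫ d ▷ c ≫ (s ψ').inv := by
      rw [H.map₂_whisker_right, hd]
      simp [s, whisker_exchange_assoc]
    refine ⟨fun h => ?_, fun h => hH.map₂_injective (by rw [e, hθ, h])⟩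
    have := e.symm.trans ((congrArg (fun t => H.map₂ t) h).trans hθ)
    simpa using this
  have h₂ {d' : k' ⟶ l'} {d : k ⟶ l} {δ : P.map k ⟶ P.map l}
      (hd : H.map₂ d' = ψ.hom ≫ d ≫ ψ'.inv) :
      (H.comp P).map₂ d' = P.map₂ ψ.hom ≫ δ ≫ P.map₂ ψ'.inv ↔ P.map₂ d = δ := by
    change P.map₂ (H.map₂ d') = _ ↔ _
    rw [hd, P.map₂_comp, P.map₂_comp, cancel_epi, cancel_mono]
  have h₃ {θ' : k' ≫ f ⟶ l' ≫ f} {θ : k ≫ c ⟶ l ≫ c} {δ : P.map k ⟶ P.map l}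
      (hθ : H.map₂ θ' = (s ψ).hom ≫ θ ≫ (s ψ').inv) :
      (H.comp P).map₂ θ' = ((H.comp P).mapComp k' f).hom ≫
        (P.map₂ ψ.hom ≫ δ ≫ P.map₂ ψ'.inv) ▷ (H.comp P).map f ≫ ((H.comp P).mapComp l' f).inv ↔
      P.map₂ θ = (P.mapComp k c).hom ≫ δ ▷ P.map c ≫ (P.mapComp l c).inv := by
    change P.map₂ (H.map₂ θ') = (P.map₂ (H.mapComp k' f).hom ≫ (P.mapComp _ _).hom) ≫
      (P.map₂ ψ.hom ≫ δ ≫ P.map₂ ψ'.inv) ▷ P.map (H.map f) ≫ (P.mapComp _ _).inv ≫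
        P.map₂ (H.mapComp l' f).inv ↔ _
    rw [uniquelyWhiskered_iff_aux φ ψ ψ' δ, hθ]
    have e : (P.map₂ (H.mapComp k' f).hom ≫ (P.mapComp _ _).hom) ≫
      ((P.mapComp _ _).inv ≫ P.map₂ (ψ.hom ▷ H.map f ≫ k ◁ φ.hom) ≫ (P.mapComp k c).hom ≫
        δ ▷ P.map c ≫ (P.mapComp l c).inv ≫ P.map₂ (l ◁ φ.inv ≫ ψ'.inv ▷ H.map f) ≫
        (P.mapComp _ _).hom) ≫ (P.mapComp _ _).inv ≫
        P.map₂ (H.mapComp l' f).inv = P.map₂ (s ψ).hom ≫ ((P.mapComp k c).hom ≫ δ ▷ P.map c ≫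
          (P.mapComp l c).inv) ≫ P.map₂ (s ψ').inv := by
      simp [s, -Pseudofunctor.map₂_whisker_left, -Pseudofunctor.map₂_whisker_right]
    rw [e, P.map₂_comp, P.map₂_comp, cancel_epi, cancel_mono]
  constructor
  · intro h θ δ hδ
    obtain ⟨θ', hθ⟩ := hH.map₂_surjective ((s ψ).hom ≫ θ ≫ (s ψ').inv)
    obtain ⟨d', ⟨e₁, e₂⟩, u⟩ := h θ' (P.map₂ ψ.hom ≫ δ ≫ P.map₂ ψ'.inv) ((h₃ hθ).2 hδ)
    have hd : H.map₂ d' = ψ.hom ≫ (ψ.inv ≫ H.map₂ d' ≫ ψ'.hom) ≫ ψ'.inv := by simp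
    refine ⟨_, ⟨(h₁ hd hθ).1 e₁, (h₂ hd).1 e₂⟩, ?_⟩
    rintro d ⟨e₃, e₄⟩
    obtain ⟨d'', hd'⟩ := hH.map₂_surjective (ψ.hom ≫ d ≫ ψ'.inv)
    rw [← u d'' ⟨(h₁ hd' hθ).2 e₃, (h₂ hd').2 e₄⟩, hd']
    simp
  · intro h θ' δ' hδ
    have hθ : H.map₂ θ' = (s ψ).hom ≫ ((s ψ).inv ≫ H.map₂ θ' ≫ (s ψ').hom) ≫ (s ψ').inv := by simp
    have h₄ (t : P.map (H.map k') ⟶ P.map (H.map l')) :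
        ∃ δ, t = P.map₂ ψ.hom ≫ δ ≫ P.map₂ ψ'.inv :=
      ⟨P.map₂ ψ.inv ≫ t ≫ P.map₂ ψ'.hom, by simp [PrelaxFunctor.map₂_hom_inv_assoc]⟩
    obtain ⟨δ, rfl⟩ := h₄ δ'
    obtain ⟨d, ⟨e₁, e₂⟩, u⟩ := h _ δ ((h₃ hθ).1 hδ)
    obtain ⟨d', hd⟩ := hH.map₂_surjective (ψ.hom ≫ d ≫ ψ'.inv)
    refine ⟨d', ⟨(h₁ hd hθ).2 e₁, (h₂ hd).2 e₂⟩, ?_⟩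
    rintro d'' ⟨e₃, e₄⟩
    have hd' : H.map₂ d'' = ψ.hom ≫ (ψ.inv ≫ H.map₂ d'' ≫ ψ'.hom) ≫ ψ'.inv := by simp
    refine hH.map₂_injective ?_
    rw [hd', hd, u _ ⟨(h₁ hd' hθ).1 e₃, (h₂ hd').1 e₄⟩]

/-- A lift along `f` is carried by `H` to a lift along `c`, corrected by `φ` and `γ`. Conversely,
the 1-cell of a lift along `c` is replaced by an isomorphic one in the image of `H`, and its
factorisation isomorphism then comes from the source of `H`. -/
theorem nonempty_lift₁_iff {f : x ⟶ y} {c : H.obj x ⟶ H.obj y} (φ : H.map f ≅ c) {g : z ⟶ y}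
    {n : H.obj z ⟶ H.obj y} (γ : H.map g ≅ n) {h : P.obj (H.obj z) ⟶ P.obj (H.obj x)}
    {α : h ≫ P.map (H.map f) ≅ P.map (H.map g)} {α' : h ≫ P.map c ≅ P.map n}
    (hα : α.hom ≫ P.map₂ γ.hom = h ◁ P.map₂ φ.hom ≫ α'.hom) :
    Nonempty (Lift₁ (H.comp P) f g h α) ↔ Nonempty (Lift₁ P c n h α') := by
  constructor
  · rintro ⟨⟨k, ξ, β, e⟩⟩
    let β' : P.map (H.map k) ≅ h := β
    replace e : β'.hom ▷ P.map (H.map f) ≫ α.hom = ((P.mapComp _ _).inv ≫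
      P.map₂ (H.mapComp k f).inv) ≫ P.map₂ (H.map₂ ξ.hom) := e
    refine ⟨⟨H.map k, whiskerLeftIso _ φ.symm ≪≫ (H.mapComp k f).symm ≪≫
      H.map₂Iso ξ ≪≫ γ, β', ?_⟩⟩
    have e' : α'.hom = h ◁ P.map₂ φ.inv ≫ α.hom ≫ P.map₂ γ.hom := by
      rw [hα, ← whiskerLeft_comp_assoc]
      simp
    rw [e', ← whisker_exchange_assoc, reassoc_of% e]
    simp
  · rintro ⟨L⟩
    obtain ⟨k, ψ, -, -⟩ := hH.exists_hom L.hom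
    obtain ⟨ξ, hξ⟩ := hH.exists_iso (H.mapComp k f ≪≫ whiskerRightIso ψ _ ≪≫
      whiskerLeftIso _ φ ≪≫ L.fac ≪≫ γ.symm)
    refine ⟨⟨k, ξ, P.map₂Iso ψ ≪≫ L.base, ?_⟩⟩
    have e := L.comm
    change (P.map₂ ψ.hom ≫ L.base.hom) ▷ P.map (H.map f) ≫ α.hom = ((P.mapComp _ _).inv ≫
      P.map₂ (H.mapComp k f).inv) ≫ P.map₂ (H.map₂Iso ξ).hom
    have e' : α.hom = h ◁ P.map₂ φ.hom ≫ α'.hom ≫ P.map₂ γ.inv := by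
      rw [← Category.assoc, ← hα]
      simp
    rw [hξ, e', ← whisker_exchange_assoc, comp_whiskerRight, Category.assoc,
      reassoc_of% e, whisker_exchange_assoc]
    simp [PrelaxFunctor.map₂_inv_hom_assoc]

/-- Cartesian 1-cells correspond under `H`. -/
theorem isCartesian₁_iff {f : x ⟶ y} {c : H.obj x ⟶ H.obj y} (φ : H.map f ≅ c) :
    IsCartesian₁ (H.comp P) f ↔ IsCartesian₁ P c := by
  rw [FibredBicat.isCartesian₁_iff, FibredBicat.isCartesian₁_iff]
  constructor
  · rintro ⟨h₁, h₂⟩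
    refine ⟨fun {e} n h α' => ?_, fun {e} k l => ?_⟩
    · obtain ⟨z, rfl⟩ := hH.exists_obj e
      obtain ⟨g, γ, -, -⟩ := hH.exists_hom n
      let α : h ≫ P.map (H.map f) ≅ P.map (H.map g) :=
        whiskerLeftIso h (P.map₂Iso φ) ≪≫ α' ≪≫ P.map₂Iso γ.symm
      have hα : α.hom ≫ P.map₂ γ.hom = h ◁ P.map₂ φ.hom ≫ α'.hom := by
        have e : α.hom = h ◁ P.map₂ φ.hom ≫ α'.hom ≫ P.map₂ γ.inv := rfl
        simp [e]
      exact (hH.nonempty_lift₁_iff φ γ hα).1 (h₁ g h α)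
    · obtain ⟨z, rfl⟩ := hH.exists_obj e
      obtain ⟨k', ψ, -, -⟩ := hH.exists_hom k
      obtain ⟨l', ψ', -, -⟩ := hH.exists_hom l
      exact (hH.uniquelyWhiskered_iff φ ψ ψ').1 (h₂ k' l')
  · rintro ⟨h₁, h₂⟩
    refine ⟨fun g h α => ?_, fun k l => ?_⟩
    · have aux {z : D} (g : z ⟶ y) (h : P.obj (H.obj z) ⟶ P.obj (H.obj x))
          (α : h ≫ P.map (H.map f) ≅ P.map (H.map g)) :
          Nonempty (Lift₁ (H.comp P) f g h α) := by
        let α' : h ≫ P.map c ≅ P.map (H.map g) := whiskerLeftIso h (P.map₂Iso φ.symm) ≪≫ α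
        have hα : α.hom ≫ P.map₂ (𝟙 (H.map g)) = h ◁ P.map₂ φ.hom ≫ α'.hom := by
          have e : α'.hom = h ◁ P.map₂ φ.inv ≫ α.hom := rfl
          rw [e, ← whiskerLeft_comp_assoc]
          simp
        exact (hH.nonempty_lift₁_iff φ (Iso.refl _) hα).2 (h₁ _ h α')
      exact aux g h α
    · exact (hH.uniquelyWhiskered_iff φ (Iso.refl _) (Iso.refl _)).2 (h₂ _ _)

/-- Cartesian 2-cells correspond under `H`. -/
theorem isCartesian₂_iff {f g : x ⟶ y} {α : f ⟶ g} :
    IsCartesian₂ (H.comp P) α ↔ IsCartesian₂ P (H.map₂ α) := by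
  rw [FibredBicat.isCartesian₂_iff, FibredBicat.isCartesian₂_iff]
  constructor
  · intro h m φ τ e
    obtain ⟨k, ψ, -, -⟩ := hH.exists_hom m
    obtain ⟨φ', hφ⟩ := hH.map₂_surjective (ψ.hom ≫ φ)
    obtain ⟨χ, ⟨h₁, h₂⟩, u⟩ := h φ' (P.map₂ ψ.hom ≫ τ) (by
      change P.map₂ (H.map₂ φ') = (P.map₂ ψ.hom ≫ τ) ≫ P.map₂ (H.map₂ α)
      rw [hφ, P.map₂_comp, e, Category.assoc])
    replace h₁ : P.map₂ (H.map₂ χ) = P.map₂ ψ.hom ≫ τ := h₁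
    refine ⟨ψ.inv ≫ H.map₂ χ, ⟨by rw [P.map₂_comp, h₁, PrelaxFunctor.map₂_inv_hom_assoc], by simp [← H.map₂_comp, h₂, hφ]⟩, ?_⟩
    rintro ξ ⟨h₃, h₄⟩
    obtain ⟨ξ', hξ⟩ := hH.map₂_surjective (ψ.hom ≫ ξ)
    rw [← u ξ' ⟨?_, hH.map₂_injective (by simp [hξ, h₄, hφ])⟩, hξ, Iso.inv_hom_id_assoc]
    change P.map₂ (H.map₂ ξ') = P.map₂ ψ.hom ≫ τ
    rw [hξ, P.map₂_comp, h₃]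
  · intro h k φ τ e
    obtain ⟨χ, ⟨h₁, h₂⟩, u⟩ := h (H.map₂ φ) τ e
    obtain ⟨χ', rfl⟩ := hH.map₂_surjective χ
    exact ⟨χ', ⟨h₁, hH.map₂_injective (by simp [h₂])⟩, fun ξ hξ => hH.map₂_injective
      (u _ ⟨hξ.1, by rw [← hξ.2, H.map₂_comp]⟩)⟩

/-- Lifts are found in `E` and replaced by isomorphic cells in the image of `H`. They stay strictly
over the given cells of `B`, because the isomorphisms provided by `exists_hom` lie over identities.
-/
theorem isFibration (hP : IsFibration P) : IsFibration (H.comp P) where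
  exists_cartesian x b f := by
    obtain ⟨e, he, m, h₁, h₂⟩ := hP.exists_cartesian (H.obj x) f
    obtain ⟨a, rfl⟩ := hH.exists_obj e
    obtain ⟨k, φ, h₃, -⟩ := hH.exists_hom m
    exact ⟨a, he, k, h₃.trans h₁, (hH.isCartesian₁_iff φ).2 h₂⟩
  locally_fibred x y := by
    have := hP.locally_fibred (H.obj x) (H.obj y)
    obtain ⟨κ⟩ := hP.nonempty_localCleavage
    have aux (g : x ⟶ y) {w : P.obj (H.obj x) ⟶ P.obj (H.obj y)} (σ : w ⟶ P.map (H.map g)) :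
        ∃ (k : x ⟶ y) (h : P.map (H.map k) = w) (θ : k ⟶ g), IsCartesian₂ (H.comp P) θ ∧
          P.map₂ (H.map₂ θ) = eqToHom h ≫ σ := by
      let L := κ.lift (H.map g) σ
      obtain ⟨k, φ, h₃, h₄⟩ := hH.exists_hom L.dom
      obtain ⟨θ, hθ⟩ := hH.map₂_surjective (φ.hom ≫ L.hom)
      refine ⟨k, h₃.trans L.domain_eq, θ, hH.isCartesian₂_iff.2
        (hθ ▸ (IsCartesian₂.of_isIso φ.hom).comp L.isCartesian₂), ?_⟩
      rw [hθ, P.map₂_comp, h₄, L.map₂_eq, eqToHom_trans_assoc]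
    refine Functor.IsFibered.of_exists_isStronglyCartesian fun g w σ => ?_
    obtain ⟨k, rfl, θ, h, e⟩ := aux g σ
    obtain rfl : P.map₂ (H.map₂ θ) = σ := e.trans (Category.id_comp _)
    exact ⟨k, θ, h⟩
  hcomp_cartesian {x y z f f' g g'} α β hα hβ := by
    rw [hH.isCartesian₂_iff] at *
    have e : H.map₂ (α ▷ g ≫ f' ◁ β) = (H.mapComp f g).hom ≫
      (H.map₂ α ▷ H.map g ≫ H.map f' ◁ H.map₂ β) ≫ (H.mapComp f' g').inv := by
      simp
    rw [e]
    exact (IsCartesian₂.of_isIso _).comp ((hP.hcomp_cartesian _ _ hα hβ).comp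
      (IsCartesian₂.of_isIso _))

theorem isBiequivalence : IsBiequivalence H where
  surj d := by
    obtain ⟨x, rfl⟩ := hH.exists_obj d
    exact ⟨x, ⟨Equivalence.id _⟩⟩
  local_equiv x y := {
    faithful := ⟨fun h => hH.map₂_injective h⟩
    full := ⟨fun W => hH.map₂_surjective W⟩
    essSurj := ⟨fun m => by
      obtain ⟨k, φ, -, -⟩ := hH.exists_hom m
      exact ⟨k, ⟨φ⟩⟩⟩ }

end IsStrictBiequivalence

end

/-! ### The comparison is a biequivalence over `B`, and the projection is a fibration. -/

section

variable {E : Type u₂} [Bicategory.{w₂, v₂} E] {B : Type u₁} [Bicategory.{w₁, v₁} B]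
  {P : E ⥤ᵖ B} {κ : LocalCleavage P} {κ₁ : Cleavage κ}

open Fibre Disp

theorem base₁_surjective {a b : B} (e : Fibre κ a) (e' : Fibre κ b)
    (m : P.obj e.obj ⟶ P.obj e'.obj) : ∃ u : a ⟶ b, m = base₁ e e' u := by
  obtain ⟨e, rfl⟩ := e
  obtain ⟨e', rfl⟩ := e'
  exact ⟨m, rfl⟩

namespace AssociatedTrihom

variable (T : AssociatedTrihom κ κ₁) {p q : El T.F}

/-- Every 1-cell of `E` is isomorphic over the base to the image of a 1-cell of the Grothendieck
construction. -/
theorem exists_compMap_iso (m : p.fib.obj ⟶ q.fib.obj) : ∃ (f : El.Hom p q) (φ : T.compMap f ≅ m)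
    (h : P.map (T.compMap f) = P.map m), P.map₂ φ.hom = eqToHom h := by
  obtain ⟨u, hu⟩ := base₁_surjective p.fib q.fib (P.map m)
  -- Since `m` lies strictly over `u`, it factors through the chosen cartesian 1-cell over `u`. The
  -- factorisation is the fibre component of the required 1-cell, and the two unitors of `B` cancel.
  obtain ⟨k, ξ, hξ⟩ := (T.cart u q.fib).exists_lift_hom (c := T.cDisp u q.fib)
    (Disp.ofEq m hu) (λ_ u)
  let f : El.Hom p q := ⟨u, k⟩
  have h := ((T.r_over f).comp hξ).congr (Iso.inv_hom_id _)
  have h₁ : P.map (T.compMap f) = base₁ p.fib q.fib u :=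
    ((T.compDisp f).lift (λ_ f.base).inv).domain_eq
  refine ⟨f, T.r f ≪≫ ξ, h₁.trans hu.symm, ?_⟩
  have h₂ : P.map₂ (T.r f ≪≫ ξ).hom ≫ eqToHom hu = eqToHom h₁ ≫ base₂ p.fib q.fib (𝟙 u) := h
  rw [base₂_id, Category.comp_id] at h₂
  exact (cancel_mono (eqToHom hu)).1 (h₂.trans (eqToHom_trans _ _).symm)

variable [hP : Fact (IsFibration P)]

theorem isStrictBiequivalence (h : (El.raw T.F).IsLawful) (hH : (T.comparison h).IsLawful) :
    IsStrictBiequivalence P hH.toPseudofunctor where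
  exists_obj e := ⟨⟨P.obj e, ⟨e, rfl⟩⟩, rfl⟩
  exists_hom m := T.exists_compMap_iso m
  map₂_injective e := T.compMap₂_injective e
  map₂_surjective W := T.compMap₂_surjective W

/-- The projection equals `PH`, so the property is transported from `P` along `H`, not verified
directly. -/
theorem proj_isFibration (h : (El.raw T.F).IsLawful) : IsFibration (El.proj h) :=
  T.comparison_comp h (T.comparison_isLawful h) ▸
    (T.isStrictBiequivalence h (T.comparison_isLawful h)).isFibration hP.out

theorem comparison_isCartesianHom (h : (El.raw T.F).IsLawful) (hH : (T.comparison h).IsLawful) :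
    IsCartesianHom (El.proj h) P hH.toPseudofunctor where
  comp_eq := T.comparison_comp h hH
  map_cartesian _ hf :=
    ((T.isStrictBiequivalence h hH).isCartesian₁_iff (Iso.refl _)).1
      ((T.comparison_comp h hH).symm ▸ hf)
  map₂_cartesian _ hα :=
    (T.isStrictBiequivalence h hH).isCartesian₂_iff.1 ((T.comparison_comp h hH).symm ▸ hα)

end AssociatedTrihom

end

end

end FibredBicat

theorem mainTheorem2 {E : Type u₂} [Bicategory.{w₂, v₂} E] {B : Type u₁} [Bicategory.{w₁, v₁} B]
    (P : E ⥤ᵖ B) (hP : FibredBicat.IsFibration P) :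
    Nonempty (FibredBicat.LocalCleavage P) ∧
    ∀ κ : FibredBicat.LocalCleavage P, Nonempty (FibredBicat.Cleavage κ) ∧
    ∀ κ₁ : FibredBicat.Cleavage κ, Nonempty (FibredBicat.AssociatedTrihom κ κ₁) ∧
    ∀ T : FibredBicat.AssociatedTrihom κ κ₁,
      ∃ h : (FibredBicat.El.raw T.F).IsLawful,
        FibredBicat.IsFibration (FibredBicat.El.proj h) ∧
        ∃ hH : (T.comparison h).IsLawful,
          FibredBicat.IsCartesianHom (FibredBicat.El.proj h) P hH.toPseudofunctor ∧
          FibredBicat.IsBiequivalence hH.toPseudofunctor := by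
  have : Fact (FibredBicat.IsFibration P) := ⟨hP⟩
  refine ⟨hP.nonempty_localCleavage, fun κ => ⟨hP.nonempty_cleavage κ, fun κ₁ =>
    ⟨hP.nonempty_associatedTrihom κ₁, fun T => ?_⟩⟩⟩
  exact ⟨T.raw_isLawful, T.proj_isFibration _, T.comparison_isLawful _,
    T.comparison_isCartesianHom _ _, (T.isStrictBiequivalence _ _).isBiequivalence⟩
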